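/- **Setting.** Let $a,b\in\mathbb N_0$ and let $K,L_1,L_3,L_4\subset\mathbb N_0$ be finite and pairwise disjoint, of cardinalities $p,q_1,q_3,q_4$. Put $L=L_1\cup L_3\cup L_4$, $L_{34}=L_3\cup L_4$, $\gamma=p+q_3+q_4$, $\alpha=a+p+2q_4$, $\beta=b+p+2q_3$, $j^*=-j-a-b-1$, $S^*=\{s^*: s\in S\}$, $\mathfrak u(j)=\max\{j,j^*\}$. Let $\pi_n(x;a,b)$ be the monic Jacobi polynomials, $$\nu(z;a,b)=2^{1+a+b+2z}\frac{\Gamma(z+1)\Gamma(a+b+z+1)\Gamma(a+z+1)\Gamma(b+z+1)}{\Gamma(a+b+2z+1)\Gamma(a+b+2z+2)},$$ $\tilde\nu_\ell=\nu(\ell;a,b)$, and $\rho_{ij}(x)=\int_{-1}^x\pi_i(s;a,b)\pi_j(s;a,b)(1-s)^a(1+s)^b\,ds$. The parameters are real numbers $t=(t_\ell)_{\ell\in L_1}$ with $t_\ell\notin\{0,-\tilde\nu_\ell\}$; put $t_\ell=0$ for $\ell\in L_3$ and $t_\ell=-\tilde\nu_\ell$ for $\ell\in L_4$. **First stage.**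 Let $\mathcal R=(t_\ell\delta_{\ell m}+\rho_{\ell m})_{\ell,m\in L}$, and let $\mathcal A(n)$ be $\mathcal R$ bordered by an extra row and column with corner entry $\pi_n$, first row $(\pi_m)_{m\in L}$ and first column $(\rho_{\ell n})_{\ell\in L}$. With $\hat\chi(z)=\prod_{\ell\in L_{34}}\frac{z-\ell^*}{z-\ell}$ and $\hat n_i=\mathfrak u(i+q_3+q_4)$ set $$\hat\tau=(1-x)^{-q_4(q_4+a)}(1+x)^{-q_3(q_3+b)}\det\mathcal R,\qquad \hat\pi_i=(x-1)^{-q_4}(1+x)^{-q_3}\,\hat\chi(\hat n_i)\,\frac{\det\mathcal A(\hat n_i)}{\det\mathcal R}.$$ **Second stage.** Let $k_1,\dots,k_p$ be an enumeration of $K$ and write $\operatorname{Wr}[\hat\pi(K),\dots]$ for the Wronskian of $\hat\pi_{k_1-q_3-q_4},\dots,\hat\pi_{k_p-q_3-q_4},\dots$. With $n_i=\mathfrak u(i+\gamma)$ set $$\tau_t=\hat\tau\operatorname{Wr}[\hat\pi(K)],\qquad \pi_i(x;t)=\Bigl(\prod_{k\in K}\frac1{n_i-k}\Bigr)\frac{\operatorname{Wr}[\hat\pi(K),\hat\pi_{i+p}]}{\operatorname{Wr}[\hat\pi(K)]}.$$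 **Index sets.** Let $\check I_{2-}=\{0,\dots,\min(a,b)-1\}$, $\check I_{2+}=\{\max(a,b),\dots,a+b-1\}$, $\check I_{3-}=\{n\in\mathbb N_0:2n-a+b<0\}$, $\check I_{3+}=\{\max(a-b,0),\dots,a-1\}$, $\check I_{4-}=\{n\in\mathbb N_0:2n+a-b<0\}$, $\check I_{4+}=\{\max(b-a,0),\dots,b-1\}$, and $$I_{1+}=(\mathbb N_0\setminus(K\cup L))-\gamma,\quad I_{1-}=L_1^*-\gamma,$$ $$I_{2+}=(\check I_{2+}+\gamma)\cup(K+a+b+\gamma),\quad I_{2-}=(\check I_{2-}+\gamma)\cup(K^*+a+b+\gamma),$$ $$I_{3+}=(\check I_{3+}+q_4-q_3)\cup(K+a+q_4-q_3),\quad I_{3-}=(\check I_{3-}+q_4-q_3)\cup(L_4^*+a+q_4-q_3),$$ $$I_{4+}=(\check I_{4+}+q_3-q_4)\cup(K+b+q_3-q_4),\quad I_{4-}=(\check I_{4-}+q_3-q_4)\cup(L_3^*+b+q_3-q_4),$$ $I_\imath=I_{\imath+}\cup I_{\imath-}$. Let $\lambda_1(k)=k(k+\alpha+\beta+1)$, $\lambda_2(k)=(k-\alpha-\beta)(k+1)$,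 $\lambda_3(k)=(k-\alpha)(k+\beta+1)$, $\lambda_4(k)=(k-\beta)(k+\alpha+1)$. **Operators.** Put $\eta=\frac{\alpha+1}{x-1}+\frac{\beta+1}{x+1}$ and $$T_{\rm ng}(\tau;\alpha,\beta)=(x^2-1)\Bigl(D^2-2\tfrac{\tau'}{\tau}D+\tfrac{\tau''}{\tau}+\eta\bigl(D-\tfrac{\tau'}{\tau}\bigr)\Bigr)+2x\tfrac{\tau'}{\tau},\qquad T_{\rm rg}(\tau;\alpha,\beta)=\tau^{-1}\circ T_{\rm ng}(\tau;\alpha,\beta)\circ\tau.$$ $T_{\rm ng}$ is exceptional if it has eigenpolynomials of all but finitely many degrees. A quasi-polynomial eigenfunction of $T=T_{\rm rg}(\tau;\alpha,\beta)$ is a rational eigenfunction without zeros or poles at $\pm1$; its eigenvalue is a quasi-polynomial eigenvalue. The degree of a rational function is that of its numerator minus that of its denominator, and it is monic if numerator and denominator have equal leading coefficients. A quasi-rational eigenfunction is a solution $\phi$ of $T\phi=\lambda\phi$ with $w=\phi'/\phi\in\mathbb R(x)$; its degree is $\lim_{x\to\infty}xw(x)$; its type is 1, 2, 3, 4 if $w$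 has, respectively, no pole at $\pm1$, poles at both, a pole at $1$ only, a pole at $-1$ only; its index is its degree plus $0$, $\alpha+\beta$, $\alpha$, $\beta$, respectively. The extended spectral diagram of $T$ assigns to each $\lambda$ that has a quasi-rational eigenfunction a label: $\bigcirc$ or $\triangledown$ if the quasi-rational eigenfunction is unique up to scale, of type 1, and of degree $\ge-\frac{\alpha+\beta+1}2$ or $<-\frac{\alpha+\beta+1}2$; $+$ or $-$ if it is unique up to scale and of type 3 or 4; $\bullet$ if there are infinitely many up to scale, with 2, 3, 4 as the set of types. The norms $\nu_i$ of $\pi_i$, $i\in I_1$, are the constants such that for all $i,j\in I_1$ the function $\bigl(\pi_i\pi_j-\delta_{ij}\nu_i/\nu(0;\alpha,\beta)\bigr)(1-x)^\alpha(1+x)^\beta$ has a primitive $(1-x)^{\alpha+1}(1+x)^{\beta+1}\rho$ with $\rho$ rational and regular at $\pm1$. **Proposition.** 1. For all parameters $t$, $\tau_t$ is a polynomial with $\tau_t(\pm1)\ne0$ and $$\deg\tau_t=\sum_{k\in K}k+2\sum_{\ell\in L}\ell-\binom p2-p(q_3+q_4)+q_1-q_3(q_3-1)-q_4(q_4-1)+a(q_1+q_3)+b(q_1+q_4).$$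 2. The operators $T_t=T_{\rm rg}(\tau_t;\alpha,\beta)$ are exceptional. For each type $\imath$, the set of indices of the type $\imath$ quasi-rational eigenfunctions of $T_t$ is $I_\imath=I_{\imath+}\sqcup I_{\imath-}$, and $I_1$ is the set of degrees of the quasi-polynomial eigenfunctions. The set of eigenvalues with a quasi-rational eigenfunction is $\lambda_1(\mathbb Z)$, and the extended spectral diagram of $T_t$ is $\Lambda_{\rm D}(K,L_1,L_3,L_4,a,b)$: the labels $\bigcirc,\triangledown,\bullet,+,-$ are carried precisely by $\lambda_1(I_{1+})$, $\lambda_1(I_{1-})$, $\lambda_2(I_{2+})=\lambda_2(I_{2-})=\lambda_3(I_{3+})=\lambda_4(I_{4+})$, $\lambda_3(I_{3-})$, $\lambda_4(I_{4-})$, and these five sets partition $\lambda_1(\mathbb Z)$. 3. For $i\in I_1$, $\pi_i(x;t)$ is a quasi-polynomial eigenfunction of $T_t$ of degree $i$ with eigenvalue $\lambda_1(i)$. It is asymptotically monic: $\pi_i(-1;t)$ does not depend on $t$, and as all $|t_\ell|\to\infty$, $\pi_i(x;t)$ converges, for all but finitely many real $x$, to a monic rational function of degree $n_i-\gamma$.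 4. The norms are $\nu_i=\kappa(n_i;t)\,\nu(n_i;a,b)$, $i\in I_1$, where $$\kappa(z;t)=\prod_{\ell\in L_1}\Bigl(1-\delta_{z,\ell}\frac{\tilde\nu_\ell}{t_\ell+\tilde\nu_\ell}\Bigr)\kappa_0(z),\qquad \kappa_0(z)=\prod_{k\in K}\frac{z-k^*}{z-k}\prod_{\ell\in L_{34}}\Bigl(\frac{z-\ell^*}{z-\ell}\Bigr)^2.$$ 5. The $T_t$ form a $q_1$-parameter isospectral deformation with support $I_{1-}$: all $T_t$ have the same quasi-polynomial spectrum; $\nu_i$ is independent of $t$ for $i\in I_{1+}$; and $t\mapsto(\nu_i)_{i\in I_{1-}}$ is a bijection from the set of parameters onto the set of all $(y_i)_{i\in I_{1-}}$ of real numbers with $y_i\ne0$ and $y_i\ne\kappa_0(n_i)\nu(n_i;a,b)$ (the undeformed value, which corresponds to $t_\ell=\infty$). -/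

import Mathlib

open Polynomial Filter Topology

namespace ExcJacobi

noncomputable section

/-! ### Rational functions of one real variable -/

/-- The field `ℝ(x)` of rational functions. -/
abbrev RF := RatFunc ℝ

/-- The inclusion of the polynomials into the rational functions. -/
def ofPoly (P : ℝ[X]) : RF := algebraMap ℝ[X] (RatFunc ℝ) P

/-- The constant rational function. -/
def const (c : ℝ) : RF := RatFunc.C c

/-- The variable `x`. -/
def x : RF := RatFunc.X

/-- The derivative `d/dx` on `ℝ(x)`, by the quotient rule. -/
def D (f : RF) : RF :=
  ofPoly (derivative f.num * f.denom - f.num * derivative f.denom) / ofPoly f.denom ^ 2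

theorem ofPoly_ne_zero {P : ℝ[X]} (h : P ≠ 0) : ofPoly P ≠ 0 := by
  simpa [ofPoly] using h

theorem num_div_denom' (f : RF) : ofPoly f.num / ofPoly f.denom = f :=
  RatFunc.num_div_denom f

/-- The quotient rule holds for every representation as a quotient of polynomials. -/
theorem D_div (n q : ℝ[X]) (hq : q ≠ 0) :
    D (ofPoly n / ofPoly q) =
      ofPoly (derivative n * q - n * derivative q) / ofPoly q ^ 2 := by
  set f : RF := ofPoly n / ofPoly q with hf
  have hd : f.denom ≠ 0 := RatFunc.denom_ne_zero f
  have hq' := ofPoly_ne_zero hq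
  have hd' := ofPoly_ne_zero hd
  have h1 : ofPoly f.num * ofPoly q = ofPoly n * ofPoly f.denom := by
    have := num_div_denom' f
    rw [hf] at this
    rwa [← hf, div_eq_div_iff hd' hq'] at this
  have h2 : f.num * q = n * f.denom := by
    apply IsFractionRing.injective ℝ[X] (RatFunc ℝ)
    simpa [ofPoly] using h1
  have h3 : derivative f.num * q + f.num * derivative q
      = derivative n * f.denom + n * derivative f.denom := by
    simpa using congrArg derivative h2
  have h4 : (derivative f.num * f.denom - f.num * derivative f.denom) * q ^ 2
      = (derivative n * q - n * derivative q) * f.denom ^ 2 := by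
    linear_combination (f.denom * q) * h3 - (q * derivative f.denom + f.denom * derivative q) * h2
  unfold D
  rw [div_eq_div_iff (pow_ne_zero 2 hd') (pow_ne_zero 2 hq')]
  have := congrArg ofPoly h4
  simpa [ofPoly] using this

theorem exists_div (f : RF) : ∃ n q : ℝ[X], q ≠ 0 ∧ f = ofPoly n / ofPoly q :=
  ⟨f.num, f.denom, RatFunc.denom_ne_zero f, (num_div_denom' f).symm⟩

theorem D_add (f g : RF) : D (f + g) = D f + D g := by
  obtain ⟨n, q, hq, rfl⟩ := exists_div f
  obtain ⟨m, r, hr, rfl⟩ := exists_div g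
  have hq' := ofPoly_ne_zero hq
  have hr' := ofPoly_ne_zero hr
  have e : ofPoly n / ofPoly q + ofPoly m / ofPoly r
      = ofPoly (n * r + m * q) / ofPoly (q * r) := by
    simp only [ofPoly, map_add, map_mul] at *
    field_simp
  rw [e, D_div _ _ (mul_ne_zero hq hr), D_div _ _ hq, D_div _ _ hr]
  simp only [ofPoly, map_add, map_mul, map_sub, derivative_mul] at *
  field_simp
  ring

theorem D_mul (f g : RF) : D (f * g) = D f * g + f * D g := by
  obtain ⟨n, q, hq, rfl⟩ := exists_div f
  obtain ⟨m, r, hr, rfl⟩ := exists_div g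
  have hq' := ofPoly_ne_zero hq
  have hr' := ofPoly_ne_zero hr
  have e : ofPoly n / ofPoly q * (ofPoly m / ofPoly r)
      = ofPoly (n * m) / ofPoly (q * r) := by
    simp only [ofPoly, map_mul] at *
    field_simp
  rw [e, D_div _ _ (mul_ne_zero hq hr), D_div _ _ hq, D_div _ _ hr]
  simp only [ofPoly, map_add, map_mul, map_sub, derivative_mul] at *
  field_simp
  ring

/-- The value of a rational function at a real point (used only away from poles). -/
def evalAt (c : ℝ) (f : RF) : ℝ := RatFunc.eval (RingHom.id ℝ) c f

/-- `f` has no pole at `c`. -/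
def RegularAt (f : RF) (c : ℝ) : Prop := f.denom.eval c ≠ 0

/-- `f` has neither a zero nor a pole at `c`. -/
def UnitAt (f : RF) (c : ℝ) : Prop := f.num.eval c ≠ 0 ∧ f.denom.eval c ≠ 0

/-- A rational function is monic if its numerator and denominator have the same leading
coefficient (the denominator of a `RatFunc` is normalized to be monic). -/
def IsMonic (f : RF) : Prop := f.num.leadingCoeff = f.denom.leadingCoeff

/-- The Wronskian determinant of a finite list of rational functions. -/
def wr {n : ℕ} (f : Fin n → RF) : RF :=
  Matrix.det (Matrix.of fun i j : Fin n => D^[(i : ℕ)] (f j))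

/-! ### Second order operators -/

/-- The differential expression `p D² + q D + r` with rational coefficients. -/
structure Diff2 where
  p : RF
  q : RF
  r : RF

/-- The action on rational functions. -/
def Diff2.apply (T : Diff2) (y : RF) : RF := T.p * D (D y) + T.q * D y + T.r * y

/-- The coefficients of the gauge-transformed operator `M(f)⁻¹ ∘ T ∘ M(f)`. -/
def Diff2.gauge (T : Diff2) (f : RF) : Diff2 where
  p := T.p
  q := T.q + 2 * T.p * (D f / f)
  r := T.r + T.q * (D f / f) + T.p * (D (D f) / f)

theorem Diff2.gauge_apply (T : Diff2) (f y : RF) (hf : f ≠ 0) :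
    (T.gauge f).apply y = f⁻¹ * T.apply (f * y) := by
  simp only [Diff2.gauge, Diff2.apply, D_mul, D_add]
  field_simp
  ring

/-- `η(x; α, β) = (α+1)/(x-1) + (β+1)/(x+1)`. -/
def eta (α β : ℝ) : RF := const (α + 1) / (x - 1) + const (β + 1) / (x + 1)

/-- The operator in the natural gauge:
`(x²-1)(D² - 2 (τ'/τ) D + τ''/τ + η (D - τ'/τ)) + 2 x τ'/τ`. -/
def Tng (τ : RF) (α β : ℝ) : Diff2 where
  p := x ^ 2 - 1
  q := (x ^ 2 - 1) * (eta α β - 2 * (D τ / τ))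
  r := (x ^ 2 - 1) * (D (D τ) / τ - eta α β * (D τ / τ)) + 2 * x * (D τ / τ)

/-- The operator in the rational gauge, `M(τ)⁻¹ ∘ Tng(τ; α, β) ∘ M(τ)`. -/
def Trg (τ : RF) (α β : ℝ) : Diff2 := (Tng τ α β).gauge τ

/-- An exceptional Jacobi operator: leading coefficient `x² - 1`, and eigenpolynomials of all
but finitely many degrees. -/
def IsExceptionalJacobi (T : Diff2) : Prop :=
  T.p = x ^ 2 - 1 ∧
  {n : ℕ | ¬ ∃ (P : ℝ[X]) (lam : ℝ), P ≠ 0 ∧ P.natDegree = n ∧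
    T.apply (ofPoly P) = const lam * ofPoly P}.Finite

/-- Quasi-polynomial eigenfunctions: rational solutions of `T π = λ π` with neither zeros nor
poles at `x = ±1`. -/
def IsQuasiPoly (T : Diff2) (lam : ℝ) (π : RF) : Prop :=
  T.apply π = const lam * π ∧ UnitAt π 1 ∧ UnitAt π (-1)

/-- The quasi-polynomial spectrum. -/
def qpSpectrum (T : Diff2) : Set ℝ := {lam | ∃ π, IsQuasiPoly T lam π}

/-- The degrees of the quasi-polynomial eigenfunctions. -/
def qpIndexSet (T : Diff2) : Set ℤ := {k | ∃ lam π, IsQuasiPoly T lam π ∧ π.intDegree = k}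

/-! ### Quasi-rational eigenfunctions

A quasi-rational eigenfunction `φ` is encoded, up to a constant factor, by its logarithmic
derivative `w = φ'/φ`, a rational function. -/

/-- Rational solutions of the Riccati equation `p (w' + w²) + q w + r = λ`; these are the
log-derivatives of the quasi-rational eigenfunctions with eigenvalue `λ`. -/
def Ric (T : Diff2) (lam : ℝ) : Set RF :=
  {w | T.p * (D w + w ^ 2) + T.q * w + T.r = const lam}

/-- The quasi-rational spectrum. -/
def qrSpectrum (T : Diff2) : Set ℝ := {lam | (Ric T lam).Nonempty}

/-- The four asymptotic types. -/
inductive AType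
  | one
  | two
  | three
  | four

/-- `w` has the given asymptotic type: type 1 if regular at `±1`, type 2 if it has poles at both,
type 3 if it has a pole at `+1` only, type 4 if it has a pole at `-1` only. -/
def HasType (w : RF) : AType → Prop
  | .one => RegularAt w 1 ∧ RegularAt w (-1)
  | .two => ¬ RegularAt w 1 ∧ ¬ RegularAt w (-1)
  | .three => ¬ RegularAt w 1 ∧ RegularAt w (-1)
  | .four => RegularAt w 1 ∧ ¬ RegularAt w (-1)

/-- The quasi-rational function with log-derivative `w` has degree `m`: `x w → m` at infinity,
that is, `x w - m` vanishes at infinity. -/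
def HasDeg (w : RF) (m : ℝ) : Prop :=
  x * w - const m = 0 ∨ (x * w - const m).intDegree < 0

/-- The degree of the prefactors `1`, `(1-x)^{-α}(1+x)^{-β}`, `(1-x)^{-α}`, `(1+x)^{-β}`. -/
def degMu (α β : ℝ) : AType → ℝ
  | .one => 0
  | .two => -α - β
  | .three => -α
  | .four => -β

/-- The index set of the quasi-rational eigenfunctions of a given type of an operator with
parameters `α, β`; the index is the degree of `φ` minus the degree of the prefactor. -/
def indexSet (T : Diff2) (α β : ℝ) (s : AType) : Set ℝ :=
  {k | ∃ lam w m, w ∈ Ric T lam ∧ HasType w s ∧ HasDeg w m ∧ k = m - degMu α β s}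

/-- The eigenvalue of a quasi-rational eigenfunction in terms of its type and index. -/
def lamOf (α β : ℝ) (s : AType) (k : ℝ) : ℝ :=
  match s with
  | .one => k * (k + α + β + 1)
  | .two => (k - α - β) * (k + 1)
  | .three => (k - α) * (k + β + 1)
  | .four => (k - β) * (k + α + 1)

/-- The extended label set of class D. -/
inductive Label
  | circle
  | triangle
  | bullet
  | plus
  | minus

/-- The extended label of the eigenvalue `λ` of a class D operator. The labels `circle`,
`triangle`, `plus`, `minus` mean that there is exactly one quasi-rational eigenfunction up to
scale, of type 1, 1, 3, 4, respectively; type 1 is labelled by `circle` or `triangle` according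
to whether its degree lies on the upper or the lower side of the vertex `-(α+β+1)/2`. The label
`bullet` means that there are infinitely many, and that their types are exactly 2, 3, 4. -/
def HasLabel (T : Diff2) (α β : ℝ) (lam : ℝ) : Label → Prop
  | .circle => ∃ w m, Ric T lam = {w} ∧ HasType w .one ∧ HasDeg w m ∧ -(α + β + 1) / 2 ≤ m
  | .triangle => ∃ w m, Ric T lam = {w} ∧ HasType w .one ∧ HasDeg w m ∧ m < -(α + β + 1) / 2
  | .plus => ∃ w, Ric T lam = {w} ∧ HasType w .three
  | .minus => ∃ w, Ric T lam = {w} ∧ HasType w .four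
  | .bullet => (Ric T lam).Infinite ∧
      ∀ s : AType, (∃ w ∈ Ric T lam, HasType w s) ↔ s ≠ .one

/-- The extended spectral diagram of a class D operator, as the graph of an assignment of labels
to the quasi-rational eigenvalues. -/
def extDiagram (T : Diff2) (α β : ℝ) : Set (ℝ × Label) := {z | HasLabel T α β z.1 z.2}

/-! ### Norms -/

/-- The norms `ν(z; a, b)` of the monic classical Jacobi polynomials. -/
def nuCl (z a b : ℝ) : ℝ :=
  2 ^ (1 + a + b + 2 * z) *
    (Real.Gamma (z + 1) * Real.Gamma (a + b + z + 1) * Real.Gamma (a + z + 1) *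
      Real.Gamma (b + z + 1)) /
    (Real.Gamma (a + b + 2 * z + 1) * Real.Gamma (a + b + 2 * z + 2))

/-- `(1-x)^m (1+x)^n`. -/
def weight (m n : ℕ) : RF := (1 - x) ^ m * (1 + x) ^ n

open Classical in
/-- The numbers `ν i`, `i ∈ I`, are the (generalized) norms of the functions `π i`:
`∫ (π_i π_j - δ_ij ν_i / ν(α,β)) (1-x)^α (1+x)^β` has a primitive of the form
`(1-x)^{α+1} (1+x)^{β+1} ρ`, with `ρ` rational and regular at `±1`. Here
`ν(α,β) = ∫_{-1}^1 (1-x)^α (1+x)^β`. -/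
def IsNormFamily (α β : ℕ) (I : Set ℤ) (π : ℤ → RF) (ν : ℤ → ℝ) : Prop :=
  ∀ i ∈ I, ∀ j ∈ I, ∃ ρ : RF, RegularAt ρ 1 ∧ RegularAt ρ (-1) ∧
    D (weight (α + 1) (β + 1) * ρ) =
      (π i * π j - const (if i = j then ν i / nuCl 0 α β else 0)) * weight α β

/-- An isospectral deformation, with parameter space `Θ` and support `S`. The operators
`Trg(τ_θ; α, β)` are exceptional with the same quasi-polynomial spectrum, the `π_θ i`, `i ∈ I`,
are quasi-polynomial eigenfunctions of degree `i` whose normalization `π_θ i (-1)` is independent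
of `θ`, and the `ν_θ i` are their norms. The norms outside of the finite set `S` are constant, and
`θ` corresponds bijectively to the norms at `S`, which take, independently, all non-zero real
values other than the undeformed values `c i`. -/
structure IsIsospectralDeformation {Θ : Type} (τ : Θ → RF) (α β : ℕ) (I S : Set ℤ)
    (π : Θ → ℤ → RF) (ν : Θ → ℤ → ℝ) (c : ℤ → ℝ) : Prop where
  exceptional : ∀ s, IsExceptionalJacobi (Tng (τ s) α β)
  isospectral : ∀ s s', qpSpectrum (Trg (τ s) α β) = qpSpectrum (Trg (τ s') α β)
  index : ∀ s, qpIndexSet (Trg (τ s) α β) = I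
  eigen : ∀ s, ∀ i ∈ I, IsQuasiPoly (Trg (τ s) α β) (lamOf α β .one i) (π s i) ∧
    (π s i).intDegree = i
  normalization : ∀ i ∈ I, ∀ s s', evalAt (-1) (π s i) = evalAt (-1) (π s' i)
  norm : ∀ s, IsNormFamily α β I (π s) (ν s)
  support_subset : S ⊆ I
  support_finite : S.Finite
  constant : ∀ i ∈ I \ S, ∀ s s', ν s i = ν s' i
  bijective : Set.BijOn (fun (s : Θ) (i : S) => ν s i) Set.univ
    {y | ∀ i : S, y i ≠ 0 ∧ y i ≠ c i}

/-! ### Classical Jacobi polynomials with parameters in `ℕ` -/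

/-- The classical Jacobi polynomial `P_n(x; a, b)`. -/
def jacobiP (n a b : ℕ) : ℝ[X] :=
  C ((2 : ℝ)⁻¹ ^ n) * ∑ k ∈ Finset.range (n + 1),
    C (((n + a).choose (n - k) : ℝ) * ((n + b).choose k : ℝ)) * (X - 1) ^ k * (X + 1) ^ (n - k)

/-- The monic form `π_n(x; a, b) = (2^n n! / (n+a+b+1)_n) P_n(x; a, b)`. -/
def jacobiMonic (n a b : ℕ) : ℝ[X] :=
  C ((2 : ℝ) ^ n * (n.factorial : ℝ) / (ascPochhammer ℝ n).eval ((n : ℝ) + a + b + 1)) *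
    jacobiP n a b

/-- The primitive of a polynomial that vanishes at `-1`. -/
def primitive (P : ℝ[X]) : ℝ[X] :=
  (P.sum fun n c => C (c / ((n : ℝ) + 1)) * X ^ (n + 1)) -
    C (P.sum fun n c => c / ((n : ℝ) + 1) * (-1) ^ (n + 1))

/-- `ρ_ij(x; a, b) = ∫_{-1}^x π_i π_j (1-x)^a (1+x)^b`. -/
def rho (i j a b : ℕ) : ℝ[X] :=
  primitive (jacobiMonic i a b * jacobiMonic j a b * ((1 - X) ^ a * (1 + X) ^ b))

/-! ### The two-stage construction -/

/-- The discrete data: `a, b ∈ ℕ`, finite sets `K, L₁, L₃, L₄ ⊂ ℕ`, and an enumeration of `K`. -/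
structure Data where
  a : ℕ
  b : ℕ
  K : Finset ℕ
  L₁ : Finset ℕ
  L₃ : Finset ℕ
  L₄ : Finset ℕ
  enum : Fin K.card ≃ K

namespace Data

variable (d : Data)

/-- `L₁ ∪ L₃ ∪ L₄`. -/
def L : Finset ℕ := d.L₁ ∪ d.L₃ ∪ d.L₄

def p : ℕ := d.K.card
def q₁ : ℕ := d.L₁.card
def q₃ : ℕ := d.L₃.card
def q₄ : ℕ := d.L₄.card

/-- `α = a + p + 2 q₄`. -/
def α : ℕ := d.a + d.p + 2 * d.q₄

/-- `β = b + p + 2 q₃`. -/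
def β : ℕ := d.b + d.p + 2 * d.q₃

/-- The shift `γ = p + q₃ + q₄`. -/
def γ : ℤ := d.p + d.q₃ + d.q₄

/-- `j* = -j - a - b - 1`. -/
def star (j : ℤ) : ℤ := -j - d.a - d.b - 1

/-- `max(j, j*)`; this is a natural number for all indices `j` that occur below. -/
def u (j : ℤ) : ℕ := (max j (d.star j)).toNat

/-- `ν(ℓ; a, b)`. -/
def nu (l : ℕ) : ℝ := nuCl l d.a d.b

/-- The deformation parameters: real numbers `t_ℓ`, `ℓ ∈ L₁`, with `t_ℓ ≠ 0, -ν(ℓ; a, b)`. -/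
def Param : Type := {t : d.L₁ → ℝ // ∀ l : d.L₁, t l ≠ 0 ∧ t l ≠ -d.nu l}

/-- `t_ℓ` for `ℓ ∈ L₁ ∪ L₃ ∪ L₄`, with `t_ℓ = 0` on `L₃` and `t_ℓ = -ν(ℓ; a, b)` on `L₄`. -/
def tExt (t : d.L₁ → ℝ) (l : ℕ) : ℝ :=
  if h : l ∈ d.L₁ then t ⟨l, h⟩ else if l ∈ d.L₄ then -d.nu l else 0

/-- The matrix `t_ℓ δ_{ℓℓ'} + ρ_{ℓℓ'}`, indexed by `L₁ ∪ L₃ ∪ L₄`. -/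
def matR (t : d.L₁ → ℝ) : Matrix d.L d.L RF :=
  Matrix.of fun i j =>
    (if i = j then const (d.tExt t i) else 0) + ofPoly (rho i j d.a d.b)

/-- The bordered matrix; the extra row and column have the index `none`. -/
def matA (t : d.L₁ → ℝ) (n : ℕ) : Matrix (Option d.L) (Option d.L) RF :=
  Matrix.of fun i j =>
    match i, j with
    | none, none => ofPoly (jacobiMonic n d.a d.b)
    | none, some j => ofPoly (jacobiMonic j d.a d.b)
    | some i, none => ofPoly (rho i n d.a d.b)
    | some i, some j => d.matR t i j

/-- First stage: `τ̂`. -/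
def tauHat (t : d.L₁ → ℝ) : RF :=
  (d.matR t).det / weight (d.q₄ * (d.q₄ + d.a)) (d.q₃ * (d.q₃ + d.b))

/-- First stage: the normalization factor. -/
def chiHat (z : ℕ) : ℝ := ∏ l ∈ d.L₃ ∪ d.L₄, ((z : ℝ) - (d.star l : ℝ)) / ((z : ℝ) - l)

/-- First stage: the eigenfunction `π̂_i`. -/
def piHat (t : d.L₁ → ℝ) (i : ℤ) : RF :=
  const (d.chiHat (d.u (i + d.q₃ + d.q₄))) *
    ((d.matA t (d.u (i + d.q₃ + d.q₄))).det / (d.matR t).det) /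
    ((x - 1) ^ d.q₄ * (1 + x) ^ d.q₃)

/-- The list `π̂_{k - q₃ - q₄}`, `k ∈ K`. -/
def seeds (t : d.L₁ → ℝ) : Fin d.K.card → RF :=
  fun m => d.piHat t (((d.enum m : ℕ) : ℤ) - d.q₃ - d.q₄)

/-- Second stage: `τ`. -/
def tau (t : d.L₁ → ℝ) : RF := d.tauHat t * wr (d.seeds t)

/-- `n_i = max(j, j*)`, `j = i + p + q₃ + q₄`. -/
def nIdx (i : ℤ) : ℕ := d.u (i + d.γ)

/-- Second stage: the normalization factor. -/
def chi (z : ℕ) : ℝ := ∏ k ∈ d.K, 1 / ((z : ℝ) - k)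

/-- Second stage: the eigenfunction `π_i`. -/
def pi (t : d.L₁ → ℝ) (i : ℤ) : RF :=
  const (d.chi (d.nIdx i)) *
    (wr (Fin.snoc (α := fun _ => RF) (d.seeds t) (d.piHat t (i + d.p))) / wr (d.seeds t))

/-- The part of the norm factor that does not depend on the parameters. -/
def kappa₀ (z : ℕ) : ℝ :=
  (∏ k ∈ d.K, ((z : ℝ) - (d.star k : ℝ)) / ((z : ℝ) - k)) *
    ∏ l ∈ d.L₃ ∪ d.L₄, (((z : ℝ) - (d.star l : ℝ)) / ((z : ℝ) - l)) ^ 2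

/-- The norm factor `κ(z; t)`. -/
def kappa (t : d.L₁ → ℝ) (z : ℕ) : ℝ :=
  (∏ l : d.L₁, (1 - if z = (l : ℕ) then d.nu l / (t l + d.nu l) else 0)) * d.kappa₀ z

/-- The norms `ν_i = κ(n_i; t) ν(n_i; a, b)`. -/
def norm (t : d.L₁ → ℝ) (i : ℤ) : ℝ := d.kappa t (d.nIdx i) * d.nu (d.nIdx i)

/-- The undeformed norms. -/
def norm₀ (i : ℤ) : ℝ := d.kappa₀ (d.nIdx i) * d.nu (d.nIdx i)

/-! #### Index sets -/

/-- The translate `S + c` of a set of integers. -/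
def shift (S : Set ℤ) (c : ℤ) : Set ℤ := (fun n => n + c) '' S

/-- A finite set of natural numbers as a set of integers. -/
def toZ (S : Finset ℕ) : Set ℤ := (fun n : ℕ => (n : ℤ)) '' (S : Set ℕ)

/-- The reflected set `S* = {s* : s ∈ S}`. -/
def starSet (S : Finset ℕ) : Set ℤ := d.star '' toZ S

def I₁p : Set ℤ := shift {n | 0 ≤ n ∧ n ∉ toZ (d.K ∪ d.L)} (-d.γ)
def I₁m : Set ℤ := shift (d.starSet d.L₁) (-d.γ)

/-- Index sets of the classical operator `T(a, b)`. -/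
def cI₂m : Set ℤ := Set.Ico 0 (min (d.a : ℤ) d.b)
def cI₂p : Set ℤ := Set.Ico (max (d.a : ℤ) d.b) (d.a + d.b)
def cI₃m : Set ℤ := {n | 0 ≤ n ∧ 2 * n - d.a + d.b < 0}
def cI₃p : Set ℤ := Set.Ico (max ((d.a : ℤ) - d.b) 0) d.a
def cI₄m : Set ℤ := {n | 0 ≤ n ∧ 2 * n + d.a - d.b < 0}
def cI₄p : Set ℤ := Set.Ico (max ((d.b : ℤ) - d.a) 0) d.b

def I₂p : Set ℤ := d.cI₂p.image (· + d.γ) ∪ shift (toZ d.K) (d.a + d.b + d.γ)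
def I₂m : Set ℤ := d.cI₂m.image (· + d.γ) ∪ shift (d.starSet d.K) (d.a + d.b + d.γ)
def I₃p : Set ℤ := shift d.cI₃p (d.q₄ - d.q₃) ∪ shift (toZ d.K) (d.a + d.q₄ - d.q₃)
def I₃m : Set ℤ := shift d.cI₃m (d.q₄ - d.q₃) ∪ shift (d.starSet d.L₄) (d.a + d.q₄ - d.q₃)
def I₄p : Set ℤ := shift d.cI₄p (d.q₃ - d.q₄) ∪ shift (toZ d.K) (d.b + d.q₃ - d.q₄)
def I₄m : Set ℤ := shift d.cI₄m (d.q₃ - d.q₄) ∪ shift (d.starSet d.L₃) (d.b + d.q₃ - d.q₄)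

/-- `I₁ = I₁₊ ∪ I₁₋`, and similarly for the other types. -/
def I : AType → Set ℤ
  | .one => d.I₁p ∪ d.I₁m
  | .two => d.I₂p ∪ d.I₂m
  | .three => d.I₃p ∪ d.I₃m
  | .four => d.I₄p ∪ d.I₄m

/-- `λ_s(S; α, β)`, the set of eigenvalues of type `s` with index in `S`. -/
def spec (s : AType) (S : Set ℤ) : Set ℝ := (fun k : ℤ => lamOf d.α d.β s k) '' S

/-- The set of eigenvalues that carry a given label in `Λ_D(K, L₁, L₃, L₄, a, b)`. -/
def labelled : Label → Set ℝ
  | .circle => d.spec .one d.I₁p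
  | .triangle => d.spec .one d.I₁m
  | .bullet => d.spec .two d.I₂p
  | .plus => d.spec .three d.I₃m
  | .minus => d.spec .four d.I₄m

/-- The diagram `Λ_D(K, L₁, L₃, L₄, a, b)`, as a graph. -/
def LambdaD : Set (ℝ × Label) := {z | z.1 ∈ d.labelled z.2}

/-- The degree of `τ`. -/
def degTau : ℤ :=
  (∑ k ∈ d.K, (k : ℤ)) + 2 * (∑ l ∈ d.L, (l : ℤ)) - (d.p.choose 2 : ℤ) - d.p * (d.q₃ + d.q₄)
    + d.q₁ - d.q₃ * (d.q₃ - 1) - d.q₄ * (d.q₄ - 1)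
    + d.a * (d.q₁ + d.q₃) + d.b * (d.q₁ + d.q₄)

end Data

end

end ExcJacobi

namespace ExcJacobi
noncomputable section

/-! ### Differential algebra in `ℝ(x)` -/

theorem ofPoly_C (c : ℝ) : ofPoly (C c) = const c := RatFunc.algebraMap_C c
theorem ofPoly_X : ofPoly X = x := RatFunc.algebraMap_X
theorem ofPoly_add (P Q : ℝ[X]) : ofPoly (P + Q) = ofPoly P + ofPoly Q := map_add _ _ _
theorem ofPoly_sub (P Q : ℝ[X]) : ofPoly (P - Q) = ofPoly P - ofPoly Q := map_sub _ _ _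
theorem ofPoly_neg (P : ℝ[X]) : ofPoly (-P) = -ofPoly P := map_neg _ _
theorem ofPoly_mul (P Q : ℝ[X]) : ofPoly (P * Q) = ofPoly P * ofPoly Q := map_mul _ _ _
theorem ofPoly_pow (P : ℝ[X]) (n : ℕ) : ofPoly (P ^ n) = ofPoly P ^ n := map_pow _ _ _
theorem ofPoly_one : ofPoly 1 = 1 := map_one _
theorem ofPoly_zero : ofPoly 0 = 0 := map_zero _
theorem ofPoly_sum {ι : Type*} (s : Finset ι) (f : ι → ℝ[X]) :
    ofPoly (∑ i ∈ s, f i) = ∑ i ∈ s, ofPoly (f i) := map_sum _ _ _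
theorem ofPoly_injective : Function.Injective ofPoly := IsFractionRing.injective ℝ[X] (RatFunc ℝ)

theorem const_add (a b : ℝ) : const (a + b) = const a + const b := map_add _ _ _
theorem const_sub (a b : ℝ) : const (a - b) = const a - const b := map_sub _ _ _
theorem const_mul (a b : ℝ) : const (a * b) = const a * const b := map_mul _ _ _
theorem const_neg (a : ℝ) : const (-a) = -const a := map_neg _ _
theorem const_div (a b : ℝ) : const (a / b) = const a / const b := map_div₀ RatFunc.C _ _
theorem const_inv (a : ℝ) : const a⁻¹ = (const a)⁻¹ := map_inv₀ RatFunc.C _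
theorem const_pow (a : ℝ) (n : ℕ) : const (a ^ n) = const a ^ n := map_pow _ _ _
theorem const_zero : const 0 = 0 := map_zero _
theorem const_one : const 1 = 1 := map_one _
theorem const_natCast (n : ℕ) : const n = n := map_natCast _ _
theorem const_intCast (n : ℤ) : const n = n := map_intCast _ _
theorem const_ofNat (n : ℕ) [n.AtLeastTwo] : const (OfNat.ofNat n) = OfNat.ofNat n :=
  map_ofNat RatFunc.C n
theorem const_injective : Function.Injective const :=
  fun _ _ h => (RatFunc.C (K := ℝ)).injective h
theorem const_ne_zero {a : ℝ} (h : a ≠ 0) : const a ≠ 0 := by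
  rw [← const_zero]; exact fun e => h (const_injective e)

theorem D_ofPoly (P : ℝ[X]) : D (ofPoly P) = ofPoly (derivative P) := by
  have := D_div P 1 one_ne_zero
  simpa [ofPoly] using this

theorem D_const (c : ℝ) : D (const c) = 0 := by
  rw [← ofPoly_C, D_ofPoly, derivative_C, ofPoly_zero]
theorem D_zero : D 0 = 0 := by simpa only [const_zero] using D_const 0
theorem D_one : D 1 = 0 := by simpa only [const_one] using D_const 1
theorem D_x : D x = 1 := by rw [← ofPoly_X, D_ofPoly, derivative_X, ofPoly_one]
theorem D_natCast (n : ℕ) : D (n : RF) = 0 := by rw [← const_natCast, D_const]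
theorem D_neg (f : RF) : D (-f) = -D f := by
  have h := D_add f (-f)
  rw [add_neg_cancel, D_zero] at h
  linear_combination -h
theorem D_sub (f g : RF) : D (f - g) = D f - D g := by
  rw [sub_eq_add_neg, D_add, D_neg, sub_eq_add_neg]
theorem D_inv (f : RF) : D f⁻¹ = -D f / f ^ 2 := by
  by_cases hf : f = 0
  · simp [hf, D_zero]
  · have h := D_mul f f⁻¹
    rw [mul_inv_cancel₀ hf, D_one] at h
    field_simp at h ⊢
    linear_combination -h
theorem D_quot (f g : RF) (hg : g ≠ 0) : D (f / g) = (D f * g - f * D g) / g ^ 2 := by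
  rw [div_eq_mul_inv, D_mul, D_inv]
  field_simp
  ring
theorem D_const_mul (c : ℝ) (f : RF) : D (const c * f) = const c * D f := by
  rw [D_mul, D_const, zero_mul, zero_add]
theorem D_sum {ι : Type*} (s : Finset ι) (f : ι → RF) : D (∑ i ∈ s, f i) = ∑ i ∈ s, D (f i) := by
  classical
  induction s using Finset.induction_on with
  | empty => simp [D_zero]
  | insert a s ha ih => rw [Finset.sum_insert ha, Finset.sum_insert ha, D_add, ih]
theorem D_pow (f : RF) (n : ℕ) : D (f ^ n) = n * f ^ (n - 1) * D f := by
  induction n with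
  | zero => simp [D_one]
  | succ n ih =>
    rw [pow_succ, D_mul, ih]
    rcases n with _ | n
    · simp
    · simp only [Nat.add_sub_cancel]; push_cast; ring
theorem D_zpow (f : RF) (hf : f ≠ 0) (n : ℤ) : D (f ^ n) = n * f ^ (n - 1) * D f := by
  obtain ⟨m, rfl | rfl⟩ := n.eq_nat_or_neg
  · rw [zpow_natCast, D_pow]
    rcases m with _ | m
    · simp
    · congr 2
      rw [← zpow_natCast]; congr 1; push_cast; ring
  · rw [zpow_neg, zpow_natCast, D_inv, D_pow, zpow_sub₀ hf, zpow_neg, zpow_natCast, zpow_one]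
    rcases m with _ | m
    · simp
    · simp only [Nat.add_sub_cancel]; push_cast; field_simp; ring

theorem D_eq_zero {f : RF} (h : D f = 0) : ∃ c : ℝ, f = const c := by
  have hd := RatFunc.denom_ne_zero f
  have h0 : derivative f.num * f.denom - f.num * derivative f.denom = 0 := by
    have h1 := h
    unfold D at h1
    rw [div_eq_zero_iff] at h1
    rcases h1 with h1 | h1
    · exact ofPoly_injective (h1.trans ofPoly_zero.symm)
    · exact absurd h1 (pow_ne_zero _ (ofPoly_ne_zero hd))
  have hdvd : f.denom ∣ derivative f.denom :=
    (RatFunc.isCoprime_num_denom f).symm.dvd_of_dvd_mul_left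
      ⟨derivative f.num, by linear_combination -h0⟩
  have hz : derivative f.denom = 0 := by
    by_contra hne
    have := Polynomial.degree_le_of_dvd hdvd hne
    exact absurd (Polynomial.degree_derivative_lt hd) (not_lt.mpr this)
  have hn : derivative f.num = 0 := by
    rw [hz, mul_zero, sub_zero] at h0
    exact (mul_eq_zero.mp h0).resolve_right hd
  obtain ⟨a, ha⟩ : ∃ a, f.num = C a := ⟨_, Polynomial.eq_C_of_derivative_eq_zero hn⟩
  obtain ⟨b, hb⟩ : ∃ b, f.denom = C b := ⟨_, Polynomial.eq_C_of_derivative_eq_zero hz⟩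
  refine ⟨a / b, ?_⟩
  rw [const_div, ← ofPoly_C, ← ofPoly_C, ← ha, ← hb, num_div_denom']

/-- Functions with equal log-derivatives are proportional. -/
theorem eq_const_mul_of_logDeriv {f g : RF} (hf : f ≠ 0) (hg : g ≠ 0) (h : D f / f = D g / g) :
    ∃ c : ℝ, c ≠ 0 ∧ f = const c * g := by
  have h1 : D (f / g) = 0 := by
    rw [D_quot _ _ hg]
    field_simp at h ⊢
    rw [h]; ring
  obtain ⟨c, hc⟩ := D_eq_zero h1
  have hfg : f = const c * g := by rw [← hc]; field_simp
  refine ⟨c, ?_, hfg⟩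
  rintro rfl
  rw [const_zero, zero_mul] at hfg
  exact hf hfg

theorem logDeriv_mul {f g : RF} (hf : f ≠ 0) (hg : g ≠ 0) :
    D (f * g) / (f * g) = D f / f + D g / g := by
  rw [D_mul]; field_simp
theorem logDeriv_inv {f : RF} (hf : f ≠ 0) : D f⁻¹ / f⁻¹ = -(D f / f) := by
  rw [D_inv]; field_simp
theorem logDeriv_div {f g : RF} (hf : f ≠ 0) (hg : g ≠ 0) :
    D (f / g) / (f / g) = D f / f - D g / g := by
  rw [D_quot _ _ hg]; field_simp
theorem logDeriv_pow {f : RF} (hf : f ≠ 0) (n : ℕ) : D (f ^ n) / f ^ n = n * (D f / f) := by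
  rcases n with _ | n
  · simp [D_one]
  · rw [D_pow, Nat.add_sub_cancel, pow_succ]; field_simp

/-! ### Darboux transformations of second order operators -/

/-- `y` solves `T y = λ y`. -/
def Sol (T : Diff2) (lam : ℝ) (y : RF) : Prop := T.apply y = const lam * y

theorem Sol.add {T : Diff2} {lam : ℝ} {y z : RF} (hy : Sol T lam y) (hz : Sol T lam z) :
    Sol T lam (y + z) := by
  unfold Sol Diff2.apply at *
  simp only [D_add]; linear_combination hy + hz
theorem Sol.const_mul {T : Diff2} {lam : ℝ} {y : RF} (c : ℝ) (hy : Sol T lam y) :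
    Sol T lam (const c * y) := by
  unfold Sol Diff2.apply at *
  simp only [D_const_mul]; linear_combination const c * hy

theorem mem_Ric_of_sol {T : Diff2} {lam : ℝ} {y : RF} (h0 : y ≠ 0) (hy : Sol T lam y) :
    D y / y ∈ Ric T lam := by
  unfold Sol Diff2.apply at hy
  change T.p * (D (D y / y) + (D y / y) ^ 2) + T.q * (D y / y) + T.r = const lam
  rw [D_quot _ _ h0]
  field_simp
  linear_combination y * hy

theorem sol_of_mem_Ric {T : Diff2} {lam : ℝ} {y : RF} (h0 : y ≠ 0) (hy : D y / y ∈ Ric T lam) :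
    Sol T lam y := by
  change T.p * (D (D y / y) + (D y / y) ^ 2) + T.q * (D y / y) + T.r = const lam at hy
  unfold Sol Diff2.apply
  rw [D_quot _ _ h0] at hy
  field_simp at hy
  apply mul_left_cancel₀ h0
  linear_combination hy

/-- The Darboux transform of `T` by a seed with log-derivative `w`. -/
def Diff2.step (T : Diff2) (w : RF) : Diff2 where
  p := T.p
  q := T.q + D T.p
  r := T.r + D T.q + 2 * T.p * D w + D T.p * w

/-- The first order operator `y ↦ y' - w y`. -/
def dar (w y : RF) : RF := D y - w * y

/-- The adjoint factor `y ↦ p y' + (p w + q) y`. -/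
def Diff2.adj (T : Diff2) (w y : RF) : RF := T.p * D y + (T.p * w + T.q) * y

theorem adj_dar {T : Diff2} {mu : ℝ} {w : RF} (hw : w ∈ Ric T mu) (y : RF) :
    T.adj w (dar w y) = T.apply y - const mu * y := by
  change T.p * (D w + w ^ 2) + T.q * w + T.r = const mu at hw
  unfold Diff2.adj dar Diff2.apply
  simp only [D_sub, D_mul]
  linear_combination (-y) * hw

theorem dar_adj {T : Diff2} {mu : ℝ} {w : RF} (hw : w ∈ Ric T mu) (y : RF) :
    dar w (T.adj w y) = (T.step w).apply y - const mu * y := by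
  change T.p * (D w + w ^ 2) + T.q * w + T.r = const mu at hw
  unfold Diff2.adj dar Diff2.apply Diff2.step
  simp only [D_add, D_mul]
  linear_combination (-y) * hw

theorem dar_const_mul (w : RF) (c : ℝ) (y : RF) : dar w (const c * y) = const c * dar w y := by
  unfold dar; rw [D_const_mul]; ring

theorem sol_step {T : Diff2} {lam mu : ℝ} {w y : RF} (hw : w ∈ Ric T mu) (hy : Sol T lam y) :
    Sol (T.step w) lam (dar w y) := by
  have h1 := dar_adj hw (dar w y)
  rw [adj_dar hw y, hy, ← sub_mul, ← const_sub, dar_const_mul, const_sub] at h1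
  unfold Sol
  linear_combination -h1

theorem adj_dar_sol {T : Diff2} {lam mu : ℝ} {w y : RF} (hw : w ∈ Ric T mu) (hy : Sol T lam y) :
    T.adj w (dar w y) = const (lam - mu) * y := by
  rw [adj_dar hw y, hy, const_sub]; ring

theorem dar_ne_zero {T : Diff2} {lam mu : ℝ} {w y : RF} (hw : w ∈ Ric T mu) (hy : Sol T lam y)
    (h0 : y ≠ 0) (hne : lam ≠ mu) : dar w y ≠ 0 := by
  intro h
  have h1 := adj_dar_sol hw hy
  rw [h] at h1
  simp only [Diff2.adj, D_zero, mul_zero, add_zero] at h1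
  exact mul_ne_zero (const_ne_zero (sub_ne_zero.mpr hne)) h0 h1.symm

/-- `1 / (y² p W)` changes by an exact term under a Darboux transformation. -/
theorem class_step {T : Diff2} {lam mu : ℝ} {w y W : RF} (hw : w ∈ Ric T mu) (hy : Sol T lam y)
    (h0 : y ≠ 0) (hne : lam ≠ mu) (hp : T.p ≠ 0) (hW0 : W ≠ 0) (hW : D (T.p * W) = T.q * W) :
    1 / (y ^ 2 * (T.p * W)) + D (1 / (y * (T.p * W) * dar w y)) =
      const (mu - lam) / (dar w y ^ 2 * (T.p * (T.p * W))) := by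
  have hF := dar_ne_zero hw hy h0 hne
  have h1 := adj_dar_sol hw hy
  have h2 : dar w y = D y - w * y := rfl
  unfold Diff2.adj at h1
  generalize dar w y = F at *
  have hpW := mul_ne_zero hp hW0
  rw [D_quot _ _ (mul_ne_zero (mul_ne_zero h0 hpW) hF), D_one, D_mul (y * (T.p * W)), D_mul y, hW]
  rw [const_sub] at h1 ⊢
  field_simp
  have h3 : D y = F + w * y := by linear_combination -h2
  rw [h3]
  linear_combination (-y) * h1

/-- A solution of the Riccati equation of the transformed operator gives one of the original
operator, away from the eigenvalue of the seed. -/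
theorem ric_of_ric_step {T : Diff2} {lam mu : ℝ} {w v : RF} (hw : w ∈ Ric T mu)
    (hv : v ∈ Ric (T.step w) lam) (hne : lam ≠ mu) : (Ric T lam).Nonempty := by
  change T.p * (D v + v ^ 2) + (T.q + D T.p) * v +
    (T.r + D T.q + 2 * T.p * D w + D T.p * w) = const lam at hv
  change T.p * (D w + w ^ 2) + T.q * w + T.r = const mu at hw
  set g := T.p * (v + w) + T.q with hg
  have hDg : D g = const (lam - mu) - (v - w) * g := by
    rw [hg, const_sub]
    simp only [D_add, D_mul]
    linear_combination hv - hw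
  have hg0 : g ≠ 0 := by
    intro h
    rw [h, D_zero, mul_zero, sub_zero] at hDg
    exact const_ne_zero (sub_ne_zero.mpr hne) hDg.symm
  refine ⟨w + const (lam - mu) / g, ?_⟩
  change T.p * (D (w + const (lam - mu) / g) + (w + const (lam - mu) / g) ^ 2) +
    T.q * (w + const (lam - mu) / g) + T.r = const lam
  rw [D_add, D_quot _ _ hg0, D_const, hDg]
  have e : const lam = const mu + const (lam - mu) := by rw [const_sub]; ring
  rw [e, ← hw]
  generalize const (lam - mu) = k at *
  field_simp
  rw [hg]
  ring

/-- The solutions of the transformed operator at the eigenvalue of the seed. -/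
theorem sol_step_seed {T : Diff2} {mu : ℝ} {f W R : RF} {c : ℝ} (hf : Sol T mu f) (h0 : f ≠ 0)
    (hp : T.p ≠ 0) (hW0 : W ≠ 0) (hW : D (T.p * W) = T.q * W) (hR : D R = const c * (f ^ 2 * W)) :
    Sol (T.step (D f / f)) mu (R / (T.p * W * f)) := by
  have hw := mem_Ric_of_sol h0 hf
  have h1 := dar_adj hw (R / (T.p * W * f))
  have hpW := mul_ne_zero hp hW0
  have h2 : T.adj (D f / f) (R / (T.p * W * f)) = const c * f := by
    unfold Diff2.adj
    rw [D_quot _ _ (mul_ne_zero hpW h0), D_mul, hW, hR]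
    field_simp
    ring
  have h3 : dar (D f / f) f = 0 := by unfold dar; field_simp; ring
  rw [h2, dar_const_mul, h3, mul_zero] at h1
  unfold Sol
  linear_combination -h1

theorem mem_Ric_gauge {T : Diff2} {lam : ℝ} {m w : RF} (hm : m ≠ 0) :
    w ∈ Ric (T.gauge m) lam ↔ w + D m / m ∈ Ric T lam := by
  change T.p * (D w + w ^ 2) + (T.q + 2 * T.p * (D m / m)) * w +
    (T.r + T.q * (D m / m) + T.p * (D (D m) / m)) = const lam ↔
    T.p * (D (w + D m / m) + (w + D m / m) ^ 2) + T.q * (w + D m / m) + T.r = const lam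
  rw [D_add, D_quot _ _ hm]
  have e : T.p * (D w + (D (D m) * m - D m * D m) / m ^ 2 + (w + D m / m) ^ 2) +
      T.q * (w + D m / m) + T.r = T.p * (D w + w ^ 2) + (T.q + 2 * T.p * (D m / m)) * w +
      (T.r + T.q * (D m / m) + T.p * (D (D m) / m)) := by
    field_simp; ring
  rw [e]

theorem sol_gauge {T : Diff2} {lam : ℝ} {m y : RF} (hm : m ≠ 0) :
    Sol (T.gauge m) lam y ↔ Sol T lam (m * y) := by
  unfold Sol
  rw [T.gauge_apply m y hm]
  constructor
  · intro h
    field_simp at h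
    linear_combination h
  · intro h
    rw [h]; field_simp

/-- If `T y = λ y` has a non-zero solution, then the solutions of the Riccati equation are
log-derivatives; two independent solutions exist iff `1 / (y² p W)` has a primitive. -/
theorem ric_iff_of_sol {T : Diff2} {lam : ℝ} {y W : RF} (hy : Sol T lam y) (h0 : y ≠ 0)
    (hp : T.p ≠ 0) (hW0 : W ≠ 0) (hW : D (T.p * W) = T.q * W) (w : RF) (hw : w ∈ Ric T lam) :
    w = D y / y ∨ ∃ h, D h = 1 / (y ^ 2 * (T.p * W)) ∧ w = D (y * h) / (y * h) ∧ h ≠ 0 := by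
  by_cases hwy : w = D y / y
  · exact Or.inl hwy
  right
  have h1 := mem_Ric_of_sol h0 hy
  change T.p * (D (D y / y) + (D y / y) ^ 2) + T.q * (D y / y) + T.r = const lam at h1
  change T.p * (D w + w ^ 2) + T.q * w + T.r = const lam at hw
  set v := w - D y / y with hv
  have hv0 : v ≠ 0 := sub_ne_zero.mpr hwy
  have hpW := mul_ne_zero hp hW0
  have hDv : T.p * (D v + v ^ 2 + 2 * (D y / y) * v) + T.q * v = 0 := by
    rw [hv, D_sub]; linear_combination hw - h1
  refine ⟨1 / (y ^ 2 * (T.p * W) * v), ?_, ?_, ?_⟩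
  · rw [D_quot _ _ (mul_ne_zero (mul_ne_zero (pow_ne_zero _ h0) hpW) hv0), D_one, D_mul, D_mul, hW,
      pow_two, D_mul]
    field_simp at hDv ⊢
    linear_combination -hDv
  · have e : D (y * (1 / (y ^ 2 * (T.p * W) * v))) / (y * (1 / (y ^ 2 * (T.p * W) * v))) =
        D (1 / (y * (T.p * W) * v)) / (1 / (y * (T.p * W) * v)) := by
      congr 2 <;> field_simp
    rw [e, D_quot _ _ (mul_ne_zero (mul_ne_zero h0 hpW) hv0), D_one, D_mul, D_mul, hW]
    have : w = v + D y / y := by rw [hv]; ring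
    rw [this]
    field_simp at hDv ⊢
    linear_combination hDv
  · exact div_ne_zero one_ne_zero (mul_ne_zero (mul_ne_zero (pow_ne_zero _ h0) hpW) hv0)

theorem sol_second {T : Diff2} {lam : ℝ} {y W h : RF} (hy : Sol T lam y) (h0 : y ≠ 0)
    (hp : T.p ≠ 0) (hW0 : W ≠ 0) (hW : D (T.p * W) = T.q * W)
    (hh : D h = 1 / (y ^ 2 * (T.p * W))) : Sol T lam (y * h) := by
  unfold Sol Diff2.apply at *
  have hpW := mul_ne_zero hp hW0
  have h2 : T.p * (D (D h) + 2 * (D y / y) * D h) + T.q * D h = 0 := by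
    rw [hh, D_quot _ _ (mul_ne_zero (pow_ne_zero _ h0) hpW), D_one, D_mul, hW, pow_two, D_mul]
    field_simp
    ring
  simp only [D_mul, D_add]
  field_simp at h2
  linear_combination h * hy + h2

end
end ExcJacobi

namespace ExcJacobi
noncomputable section

/-! ### Leading terms at the points of the projective line -/

/-- A point of the projective line, with the coordinate `t` (`t = x - c` at a finite point `c`,
`t = x` at infinity), and the relation `f → v`; the parameter `t ^ eps` vanishes at the point. -/
structure Place where
  t : RF
  eps : ℤ
  Lim : RF → ℝ → Prop
  eps_eq : eps = 1 ∨ eps = -1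
  t_ne : t ≠ 0
  D_t : D t = 1
  lim_t : Lim (t ^ eps) 0
  lim_const : ∀ c, Lim (const c) c
  lim_add : ∀ {f g a b}, Lim f a → Lim g b → Lim (f + g) (a + b)
  lim_mul : ∀ {f g a b}, Lim f a → Lim g b → Lim (f * g) (a * b)
  lim_inv : ∀ {f a}, Lim f a → a ≠ 0 → Lim f⁻¹ a⁻¹
  lim_unique : ∀ {f a b}, Lim f a → Lim f b → a = b
  lim_D : ∀ {f a}, Lim f a → Lim (t * D f) 0
  exists_order : ∀ f, f ≠ 0 → ∃ (m : ℤ) (v : ℝ), v ≠ 0 ∧ Lim (f * t ^ (-m)) v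

theorem ne_zero_of_eval {P : ℝ[X]} {c : ℝ} (h : P.eval c ≠ 0) : P ≠ 0 := by
  rintro rfl; simp at h

theorem x_sub_const_ne (c : ℝ) : x - const c ≠ 0 := by
  rw [← ofPoly_X, ← ofPoly_C, ← ofPoly_sub]; exact ofPoly_ne_zero (X_sub_C_ne_zero c)

/-- The finite point `c`. -/
def finPlace (c : ℝ) : Place where
  t := x - const c
  eps := 1
  Lim f v := ∃ n d : ℝ[X], d.eval c ≠ 0 ∧ n.eval c = v * d.eval c ∧ f = ofPoly n / ofPoly d
  eps_eq := Or.inl rfl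
  t_ne := x_sub_const_ne c
  D_t := by rw [D_sub, D_x, D_const, sub_zero]
  lim_t := ⟨X - C c, 1, by simp, by simp, by
    rw [ofPoly_sub, ofPoly_X, ofPoly_C, ofPoly_one, zpow_one, div_one]⟩
  lim_const a := ⟨C a, 1, by simp, by simp, by rw [ofPoly_C, ofPoly_one, div_one]⟩
  lim_add := by
    rintro f g a b ⟨n, d, hd, hn, rfl⟩ ⟨m, e, he, hm, rfl⟩
    refine ⟨n * e + m * d, d * e, by simp [hd, he], by simp [hn, hm]; ring, ?_⟩
    have := ofPoly_ne_zero (ne_zero_of_eval hd)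
    have := ofPoly_ne_zero (ne_zero_of_eval he)
    rw [ofPoly_add, ofPoly_mul, ofPoly_mul, ofPoly_mul]; field_simp
  lim_mul := by
    rintro f g a b ⟨n, d, hd, hn, rfl⟩ ⟨m, e, he, hm, rfl⟩
    refine ⟨n * m, d * e, by simp [hd, he], by simp [hn, hm]; ring, ?_⟩
    rw [ofPoly_mul, ofPoly_mul, div_mul_div_comm]
  lim_inv := by
    rintro f a ⟨n, d, hd, hn, rfl⟩ ha
    exact ⟨d, n, by rw [hn]; exact mul_ne_zero ha hd, by rw [hn]; field_simp, by rw [inv_div]⟩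
  lim_unique := by
    rintro f a b ⟨n, d, hd, hn, rfl⟩ ⟨m, e, he, hm, h⟩
    rw [div_eq_div_iff (ofPoly_ne_zero (ne_zero_of_eval hd))
      (ofPoly_ne_zero (ne_zero_of_eval he)), ← ofPoly_mul, ← ofPoly_mul] at h
    have h1 := congrArg (eval c) (ofPoly_injective h)
    rw [eval_mul, eval_mul, hn, hm] at h1
    have : d.eval c * e.eval c ≠ 0 := mul_ne_zero hd he
    apply mul_right_cancel₀ this
    linear_combination h1
  lim_D := by
    rintro f a ⟨n, d, hd, hn, rfl⟩
    refine ⟨(X - C c) * (derivative n * d - n * derivative d), d ^ 2, by simp [hd], by simp, ?_⟩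
    rw [D_div _ _ (ne_zero_of_eval hd), ofPoly_mul, ofPoly_pow, ofPoly_sub X, ofPoly_X, ofPoly_C,
      mul_div_assoc]
  exists_order f hf := by
    obtain ⟨n, d, hd, rfl⟩ := exists_div f
    have hn : n ≠ 0 := by
      rintro rfl; rw [ofPoly_zero, zero_div] at hf; exact hf rfl
    obtain ⟨n', hn', hn1⟩ := exists_eq_pow_rootMultiplicity_mul_and_not_dvd n hn c
    obtain ⟨d', hd', hd1⟩ := exists_eq_pow_rootMultiplicity_mul_and_not_dvd d hd c
    rw [dvd_iff_isRoot, IsRoot] at hn1 hd1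
    have h0 := ofPoly_ne_zero (ne_zero_of_eval hd1)
    refine ⟨(n.rootMultiplicity c : ℤ) - d.rootMultiplicity c, n'.eval c / d'.eval c,
      div_ne_zero hn1 hd1, n', d', hd1, by field_simp, ?_⟩
    generalize n.rootMultiplicity c = i at *
    generalize d.rootMultiplicity c = j at *
    have ht := x_sub_const_ne c
    rw [hn', hd', ofPoly_mul, ofPoly_mul, ofPoly_pow, ofPoly_pow, ofPoly_sub, ofPoly_X, ofPoly_C,
      neg_sub, zpow_sub₀ ht, zpow_natCast, zpow_natCast]
    field_simp

theorem ne_zero_of_coeff {P : ℝ[X]} {n : ℕ} (h : P.coeff n ≠ 0) : P ≠ 0 := by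
  rintro rfl; simp at h

theorem x_ne : x ≠ 0 := by
  rw [← ofPoly_X]; exact ofPoly_ne_zero X_ne_zero

/-- The point at infinity. -/
def infPlace : Place where
  t := x
  eps := -1
  Lim f v := ∃ (N : ℕ) (n d : ℝ[X]), n.natDegree ≤ N ∧ d.natDegree ≤ N ∧ d.coeff N ≠ 0 ∧
    n.coeff N = v * d.coeff N ∧ f = ofPoly n / ofPoly d
  eps_eq := Or.inr rfl
  t_ne := x_ne
  D_t := D_x
  lim_t := ⟨1, 1, X, by simp, by simp, by simp, by simp [coeff_one], by
    rw [ofPoly_X, ofPoly_one, zpow_neg, zpow_one, one_div]⟩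
  lim_const a := ⟨0, C a, 1, by simp, by simp, by simp, by simp, by
    rw [ofPoly_C, ofPoly_one, div_one]⟩
  lim_add := by
    rintro f g a b ⟨N, n, d, hN, hN', hd, hn, rfl⟩ ⟨M, m, e, hM, hM', he, hm, rfl⟩
    refine ⟨N + M, n * e + d * m, d * e, ?_, natDegree_mul_le_of_le hN' hM', ?_, ?_, ?_⟩
    · exact natDegree_add_le_of_degree_le (natDegree_mul_le_of_le hN hM')
        (natDegree_mul_le_of_le hN' hM)
    · rw [coeff_mul_add_eq_of_natDegree_le hN' hM']; exact mul_ne_zero hd he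
    · rw [coeff_add, coeff_mul_add_eq_of_natDegree_le hN' hM', coeff_mul_add_eq_of_natDegree_le hN hM',
        coeff_mul_add_eq_of_natDegree_le hN' hM, hn, hm]; ring
    have := ofPoly_ne_zero (ne_zero_of_coeff hd)
    have := ofPoly_ne_zero (ne_zero_of_coeff he)
    rw [ofPoly_add, ofPoly_mul, ofPoly_mul, ofPoly_mul]; field_simp
  lim_mul := by
    rintro f g a b ⟨N, n, d, hN, hN', hd, hn, rfl⟩ ⟨M, m, e, hM, hM', he, hm, rfl⟩
    refine ⟨N + M, n * m, d * e, natDegree_mul_le_of_le hN hM, natDegree_mul_le_of_le hN' hM',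
      ?_, ?_, ?_⟩
    · rw [coeff_mul_add_eq_of_natDegree_le hN' hM']; exact mul_ne_zero hd he
    · rw [coeff_mul_add_eq_of_natDegree_le hN' hM', coeff_mul_add_eq_of_natDegree_le hN hM, hn, hm]; ring
    rw [ofPoly_mul, ofPoly_mul, div_mul_div_comm]
  lim_inv := by
    rintro f a ⟨N, n, d, hN, hN', hd, hn, rfl⟩ ha
    exact ⟨N, d, n, hN', hN, by rw [hn]; exact mul_ne_zero ha hd, by rw [hn]; field_simp,
      by rw [inv_div]⟩
  lim_unique := by
    rintro f a b ⟨N, n, d, hN, hN', hd, hn, rfl⟩ ⟨M, m, e, hM, hM', he, hm, h⟩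
    rw [div_eq_div_iff (ofPoly_ne_zero (ne_zero_of_coeff hd))
      (ofPoly_ne_zero (ne_zero_of_coeff he)), ← ofPoly_mul, ← ofPoly_mul] at h
    have h1 := congrArg (fun P => coeff P (N + M)) (ofPoly_injective h)
    beta_reduce at h1
    rw [coeff_mul_add_eq_of_natDegree_le hN hM', add_comm N M, coeff_mul_add_eq_of_natDegree_le hM hN',
      hn, hm] at h1
    have : d.coeff N * e.coeff M ≠ 0 := mul_ne_zero hd he
    apply mul_right_cancel₀ this
    linear_combination h1
  lim_D := by
    rintro f a ⟨N, n, d, hN, hN', hd, hn, rfl⟩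
    have hX : ∀ P : ℝ[X], P.natDegree ≤ N → (X * derivative P).natDegree ≤ N ∧
        (X * derivative P).coeff N = N * P.coeff N := by
      intro P hP
      constructor
      · rcases Nat.eq_zero_or_pos P.natDegree with h | h
        · rw [eq_C_of_natDegree_eq_zero h]; simp
        · have h1 := natDegree_derivative_lt h.ne'
          refine natDegree_mul_le.trans ?_
          rw [natDegree_X]; omega
      · rcases N with _ | N
        · simp
        · rw [coeff_X_mul, coeff_derivative]; push_cast; ring
    refine ⟨N + N, (X * derivative n) * d - n * (X * derivative d), d * d, ?_,
      natDegree_mul_le_of_le hN' hN', ?_, ?_, ?_⟩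
    · exact (natDegree_sub_le_of_le (natDegree_mul_le_of_le (hX n hN).1 hN')
        (natDegree_mul_le_of_le hN (hX d hN').1)).trans (max_self _).le
    · rw [coeff_mul_add_eq_of_natDegree_le hN' hN']; exact mul_ne_zero hd hd
    · rw [coeff_sub, coeff_mul_add_eq_of_natDegree_le (hX n hN).1 hN',
        coeff_mul_add_eq_of_natDegree_le hN (hX d hN').1, (hX n hN).2, (hX d hN').2]
      ring
    · rw [D_div _ _ (ne_zero_of_coeff hd)]
      simp only [ofPoly_mul, ofPoly_sub, ofPoly_X]
      ring
  exists_order f hf := by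
    obtain ⟨n, d, hd, rfl⟩ := exists_div f
    have hn : n ≠ 0 := by
      rintro rfl; rw [ofPoly_zero, zero_div] at hf; exact hf rfl
    have hn1 : n.leadingCoeff ≠ 0 := leadingCoeff_ne_zero.mpr hn
    have hd1 : d.leadingCoeff ≠ 0 := leadingCoeff_ne_zero.mpr hd
    refine ⟨(n.natDegree : ℤ) - d.natDegree, n.leadingCoeff / d.leadingCoeff, div_ne_zero hn1 hd1,
      n.natDegree + d.natDegree, n * X ^ d.natDegree, d * X ^ n.natDegree, ?_, ?_, ?_, ?_, ?_⟩
    · rw [natDegree_mul_X_pow _ hn]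
    · rw [natDegree_mul_X_pow _ hd, add_comm]
    · rw [add_comm, coeff_mul_X_pow]; exact hd1
    · rw [coeff_mul_X_pow, add_comm, coeff_mul_X_pow]
      change n.leadingCoeff = _ * d.leadingCoeff
      field_simp
    · have := ofPoly_ne_zero hd
      have := x_ne
      rw [ofPoly_mul, ofPoly_mul, ofPoly_pow, ofPoly_pow, ofPoly_X, neg_sub, zpow_sub₀ x_ne,
        zpow_natCast, zpow_natCast]
      field_simp

namespace Place

variable (P : Place)

/-- `y = v t^m + ⋯`, where `v` may be zero. -/
def Asym (y : RF) (m : ℤ) (v : ℝ) : Prop := P.Lim (y * P.t ^ (-m)) v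

variable {P}

theorem lim_zero : P.Lim 0 0 := by simpa only [const_zero] using P.lim_const 0
theorem lim_one : P.Lim 1 1 := by simpa only [const_one] using P.lim_const 1
theorem Asym.congr {y : RF} {m m' : ℤ} {v v' : ℝ} (h : P.Asym y m v) (hm : m = m') (hv : v = v') :
    P.Asym y m' v' := by subst hm hv; exact h
theorem asym_zero_iff {y : RF} {v : ℝ} : P.Asym y 0 v ↔ P.Lim y v := by
  unfold Asym; rw [neg_zero, zpow_zero, mul_one]
theorem asym_const (c : ℝ) : P.Asym (const c) 0 c := asym_zero_iff.mpr (P.lim_const c)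
theorem asym_zero (m : ℤ) : P.Asym 0 m 0 := by unfold Asym; rw [zero_mul]; exact lim_zero
theorem asym_t_zpow (m : ℤ) : P.Asym (P.t ^ m) m 1 := by
  unfold Asym
  rw [← zpow_add₀ P.t_ne, add_neg_cancel, zpow_zero]; exact lim_one
theorem asym_t : P.Asym P.t 1 1 := by simpa using P.asym_t_zpow 1
theorem Asym.add {y z : RF} {m : ℤ} {v w : ℝ} (hy : P.Asym y m v) (hz : P.Asym z m w) :
    P.Asym (y + z) m (v + w) := by
  unfold Asym; rw [add_mul]; exact P.lim_add hy hz
theorem Asym.mul {y z : RF} {m n : ℤ} {v w : ℝ} (hy : P.Asym y m v) (hz : P.Asym z n w) :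
    P.Asym (y * z) (m + n) (v * w) := by
  have := P.lim_mul hy hz
  unfold Asym
  rwa [neg_add, zpow_add₀ P.t_ne, mul_mul_mul_comm]
theorem Asym.const_mul {y : RF} {m : ℤ} {v : ℝ} (c : ℝ) (hy : P.Asym y m v) :
    P.Asym (const c * y) m (c * v) := ((asym_const c).mul hy).congr (zero_add _) rfl
theorem Asym.neg {y : RF} {m : ℤ} {v : ℝ} (hy : P.Asym y m v) : P.Asym (-y) m (-v) := by
  have := hy.const_mul (-1)
  rwa [const_neg, const_one, neg_one_mul, neg_one_mul] at this
theorem Asym.sub {y z : RF} {m : ℤ} {v w : ℝ} (hy : P.Asym y m v) (hz : P.Asym z m w) :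
    P.Asym (y - z) m (v - w) := by
  rw [sub_eq_add_neg, sub_eq_add_neg]; exact hy.add hz.neg
theorem Asym.inv {y : RF} {m : ℤ} {v : ℝ} (hy : P.Asym y m v) (hv : v ≠ 0) :
    P.Asym y⁻¹ (-m) v⁻¹ := by
  have := P.lim_inv hy hv
  unfold Asym
  rwa [mul_inv, ← zpow_neg] at this
theorem Asym.div {y z : RF} {m n : ℤ} {v w : ℝ} (hy : P.Asym y m v) (hz : P.Asym z n w)
    (hw : w ≠ 0) : P.Asym (y / z) (m - n) (v / w) := by
  rw [div_eq_mul_inv, div_eq_mul_inv, sub_eq_add_neg]; exact hy.mul (hz.inv hw)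
theorem Asym.pow {y : RF} {m : ℤ} {v : ℝ} (hy : P.Asym y m v) (n : ℕ) :
    P.Asym (y ^ n) (n * m) (v ^ n) := by
  induction n with
  | zero => simpa [const_one] using P.asym_const 1
  | succ n ih => rw [pow_succ, pow_succ]; exact (ih.mul hy).congr (by push_cast; ring) rfl
theorem Asym.unique {y : RF} {m : ℤ} {v w : ℝ} (h : P.Asym y m v) (h' : P.Asym y m w) : v = w :=
  P.lim_unique h h'
theorem Asym.D {y : RF} {m : ℤ} {v : ℝ} (hy : P.Asym y m v) : P.Asym (D y) (m - 1) (m * v) := by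
  have h1 := P.lim_D hy
  have h2 := P.lim_add h1 (P.lim_mul (P.lim_const m) hy)
  unfold Asym
  rw [zero_add] at h2
  convert h2 using 1
  have ht := P.t_ne
  rw [D_mul, D_zpow _ P.t_ne, P.D_t, zpow_sub₀ ht, neg_sub, zpow_sub₀ ht, zpow_neg, const_intCast]
  push_cast
  field_simp
  ring

theorem exists_asym {y : RF} (h : y ≠ 0) : ∃ (m : ℤ) (v : ℝ), v ≠ 0 ∧ P.Asym y m v :=
  P.exists_order y h

theorem lim_t_pow {k : ℤ} (hk : 0 < k) : P.Lim (P.t ^ (P.eps * k)) 0 := by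
  lift k to ℕ using hk.le
  have h : P.Asym (P.t ^ P.eps) 0 0 := asym_zero_iff.mpr P.lim_t
  have h1 := h.pow k
  rw [mul_zero, zero_pow (by omega), asym_zero_iff] at h1
  rwa [zpow_mul, zpow_natCast]

theorem Asym.shift {y : RF} {m : ℤ} {v : ℝ} (hy : P.Asym y m v) {k : ℤ} (hk : 0 < k) :
    P.Asym y (m - P.eps * k) 0 := by
  have h := P.lim_mul hy (P.lim_t_pow hk)
  unfold Asym
  rw [mul_zero, mul_assoc, ← zpow_add₀ P.t_ne] at h
  convert h using 3
  ring

theorem Asym.ne_zero {y : RF} {m : ℤ} {v : ℝ} (hy : P.Asym y m v) (hv : v ≠ 0) : y ≠ 0 := by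
  rintro rfl
  exact hv (hy.unique (asym_zero m))

theorem Asym.order_unique {y : RF} {m n : ℤ} {v w : ℝ} (h : P.Asym y m v) (hv : v ≠ 0)
    (h' : P.Asym y n w) (hw : w ≠ 0) : m = n := by
  have key : ∀ {m n : ℤ} {v w : ℝ}, P.Asym y m v → v ≠ 0 → P.Asym y n w → w ≠ 0 →
      ¬ 0 < P.eps * (m - n) := by
    intro m n v w h hv h' hw hpos
    have h2 := h.shift hpos
    rw [← mul_assoc] at h2
    have he : P.eps * P.eps = 1 := by rcases P.eps_eq with e | e <;> rw [e] <;> rfl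
    rw [he, one_mul, sub_sub_cancel] at h2
    exact hw (h'.unique h2)
  have h1 := key h hv h' hw
  have h2 := key h' hw h hv
  rcases P.eps_eq with e | e <;> rw [e] at h1 h2 <;> omega

/-- The leading term of a primitive. -/
theorem asym_primitive {h : RF} {m : ℤ} {v : ℝ} (hD : P.Asym (D h) m v) (hm : 0 < m + 1)
    (hl : P.eps = 1 → P.Lim h 0) : P.Asym h (m + 1) (v / (m + 1)) := by
  have hm1 : (m : ℝ) + 1 ≠ 0 := by
    intro e
    have : m + 1 = 0 := by exact_mod_cast e
    omega
  by_cases h0 : h = 0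
  · subst h0
    rw [D_zero] at hD
    rw [hD.unique (asym_zero m), zero_div]; exact asym_zero _
  obtain ⟨s, c, hc, hs⟩ := P.exists_asym h0
  have hDs := hs.D
  have hdv : ∀ k : ℤ, 0 < k → s - 1 = m + P.eps * k → P.Asym h (m + 1) (v / (m + 1)) := by
    intro k hk e
    have h1 := hDs.shift hk
    rw [e, add_sub_cancel_right] at h1
    rw [hD.unique h1, zero_div]
    have h2 := hs.shift hk
    exact h2.congr (by linarith) rfl
  by_cases hsm : s = m + 1
  · subst hsm
    have := hDs.congr (by ring : m + 1 - 1 = m) rfl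
    have e := hD.unique this
    push_cast at e
    rw [e, mul_div_cancel_left₀ _ hm1]; exact hs
  by_cases hlt : 0 < P.eps * (s - 1 - m)
  · refine hdv _ hlt ?_
    rcases P.eps_eq with e | e <;> rw [e] <;> ring
  exfalso
  have hk : 0 < P.eps * (m - (s - 1)) := by
    rcases P.eps_eq with e | e <;> rw [e] at hlt ⊢ <;> omega
  have h1 := hD.shift hk
  have e : m - P.eps * (P.eps * (m - (s - 1))) = s - 1 := by
    rcases P.eps_eq with e | e <;> rw [e] <;> ring
  rw [e] at h1
  have h2 := hDs.unique h1
  have hs0 : s = 0 := by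
    rcases mul_eq_zero.mp h2 with h3 | h3
    · exact_mod_cast h3
    · exact absurd h3 hc
  subst hs0
  rcases P.eps_eq with e1 | e1
  · exact hc (P.lim_unique (asym_zero_iff.mp hs) (hl e1))
  · rw [e1] at hk; omega

end Place

open Place

/-! ### Values, poles, and degrees -/

/-- `f` has no pole at `c`. -/
def Reg (c : ℝ) (f : RF) : Prop := ∃ v, (finPlace c).Lim f v

theorem lim_fin_iff {c v : ℝ} {f : RF} :
    (finPlace c).Lim f v ↔ RegularAt f c ∧ evalAt c f = v := by
  constructor
  · rintro ⟨n, d, hd, hn, h⟩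
    have hd0 := ne_zero_of_eval hd
    have h1 : f.num * d = n * f.denom := by
      apply ofPoly_injective
      rw [ofPoly_mul, ofPoly_mul]
      have h2 := num_div_denom' f
      rw [h, div_eq_div_iff (by rw [← h]; exact ofPoly_ne_zero (RatFunc.denom_ne_zero f))
        (ofPoly_ne_zero hd0)] at h2
      rwa [← h] at h2
    have hdvd : f.denom ∣ d :=
      (RatFunc.isCoprime_num_denom f).symm.dvd_of_dvd_mul_left ⟨n, by rw [h1]; ring⟩
    have hreg : f.denom.eval c ≠ 0 := by
      intro h0
      obtain ⟨e, rfl⟩ := hdvd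
      rw [eval_mul, h0, zero_mul] at hd
      exact hd rfl
    refine ⟨hreg, ?_⟩
    have h3 := congrArg (eval c) h1
    rw [eval_mul, eval_mul, hn] at h3
    change eval₂ _ c f.num / eval₂ _ c f.denom = v
    rw [eval₂_id, eval₂_id, div_eq_iff hreg]
    apply mul_right_cancel₀ hd
    linear_combination h3
  · rintro ⟨h, rfl⟩
    refine ⟨f.num, f.denom, h, ?_, (num_div_denom' f).symm⟩
    change _ = eval₂ _ c f.num / eval₂ _ c f.denom * _
    rw [eval₂_id, eval₂_id, div_mul_cancel₀ _ h]

theorem reg_iff {c : ℝ} {f : RF} : Reg c f ↔ RegularAt f c :=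
  ⟨fun ⟨_, h⟩ => (lim_fin_iff.mp h).1, fun h => ⟨_, lim_fin_iff.mpr ⟨h, rfl⟩⟩⟩

theorem unitAt_iff {c : ℝ} {f : RF} : UnitAt f c ↔ ∃ v, v ≠ 0 ∧ (finPlace c).Lim f v := by
  have key : RegularAt f c → (evalAt c f ≠ 0 ↔ f.num.eval c ≠ 0) := by
    intro h
    change eval₂ _ c f.num / eval₂ _ c f.denom ≠ 0 ↔ _
    rw [eval₂_id, eval₂_id, ne_eq, div_eq_zero_iff]
    exact ⟨fun h1 h2 => h1 (Or.inl h2), fun h1 h2 => h2.elim h1 h⟩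
  constructor
  · rintro ⟨h1, h2⟩
    exact ⟨_, (key h2).mpr h1, lim_fin_iff.mpr ⟨h2, rfl⟩⟩
  · rintro ⟨v, hv, h⟩
    obtain ⟨h1, rfl⟩ := lim_fin_iff.mp h
    exact ⟨(key h1).mp hv, h1⟩

theorem asym_inf_self {f : RF} (hf : f ≠ 0) :
    infPlace.Asym f f.intDegree f.num.leadingCoeff := by
  have hn := RatFunc.num_ne_zero hf
  have hd := RatFunc.denom_ne_zero f
  have hx := x_ne
  have h0 := ofPoly_ne_zero hd
  refine ⟨f.num.natDegree + f.denom.natDegree, f.num * X ^ f.denom.natDegree,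
    f.denom * X ^ f.num.natDegree, ?_, ?_, ?_, ?_, ?_⟩
  · rw [natDegree_mul_X_pow _ hn]
  · rw [natDegree_mul_X_pow _ hd, add_comm]
  · rw [add_comm, coeff_mul_X_pow]; exact leadingCoeff_ne_zero.mpr hd
  · rw [coeff_mul_X_pow, add_comm, coeff_mul_X_pow]
    change f.num.leadingCoeff = _ * f.denom.leadingCoeff
    rw [(RatFunc.monic_denom f).leadingCoeff, mul_one]
  · rw [ofPoly_mul, ofPoly_mul, ofPoly_pow, ofPoly_pow, ofPoly_X, RatFunc.intDegree, neg_sub]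
    change f * x ^ _ = _
    rw [zpow_sub₀ x_ne, zpow_natCast, zpow_natCast]
    nth_rewrite 1 [← num_div_denom' f]
    field_simp

theorem intDegree_eq {f : RF} {m : ℤ} {v : ℝ} (h : infPlace.Asym f m v) (hv : v ≠ 0) :
    f.intDegree = m := by
  have hf := h.ne_zero hv
  exact (asym_inf_self hf).order_unique (leadingCoeff_ne_zero.mpr (RatFunc.num_ne_zero hf)) h hv

theorem isMonic_of_asym {f : RF} {m : ℤ} (h : infPlace.Asym f m 1) : IsMonic f := by
  have h1 := intDegree_eq h one_ne_zero
  have h2 := asym_inf_self (h.ne_zero one_ne_zero)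
  rw [h1] at h2
  unfold IsMonic
  rw [h2.unique h, (RatFunc.monic_denom f).leadingCoeff]

theorem lim_inf_zero_iff {f : RF} : infPlace.Lim f 0 ↔ f = 0 ∨ f.intDegree < 0 := by
  constructor
  · intro h
    by_cases hf : f = 0
    · exact Or.inl hf
    right
    by_contra hlt
    push Not at hlt
    have h1 := asym_inf_self hf
    have hl := leadingCoeff_ne_zero.mpr (RatFunc.num_ne_zero hf)
    have h2 : infPlace.Asym f 0 0 := asym_zero_iff.mpr h
    rcases hlt.eq_or_lt with h3 | h3
    · rw [← h3] at h1; exact hl (h1.unique h2)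
    · have h4 := h2.shift (P := infPlace) h3
      rw [show (0 : ℤ) - infPlace.eps * f.intDegree = f.intDegree from by
        change 0 - (-1) * _ = _; ring] at h4
      exact hl (h1.unique h4)
  · rintro (rfl | h)
    · exact lim_zero
    · have hf : f ≠ 0 := by rintro rfl; simp at h
      have h1 := (asym_inf_self hf).shift (k := -f.intDegree) (by omega)
      rw [show f.intDegree - infPlace.eps * -f.intDegree = 0 from by
        change _ - (-1) * _ = _; ring] at h1
      exact asym_zero_iff.mp h1

theorem hasDeg_iff {w : RF} {m : ℝ} : HasDeg w m ↔ infPlace.Lim (x * w) m := by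
  unfold HasDeg
  rw [← lim_inf_zero_iff]
  constructor
  · intro h
    have := infPlace.lim_add h (infPlace.lim_const m)
    rwa [sub_add_cancel, zero_add] at this
  · intro h
    have := infPlace.lim_add h (infPlace.lim_const (-m))
    rwa [const_neg, ← sub_eq_add_neg, add_neg_cancel] at this

theorem Place.Asym.logDeriv {P : Place} {y : RF} {m : ℤ} {v : ℝ} (h : P.Asym y m v) (hv : v ≠ 0) :
    P.Asym (ExcJacobi.D y / y) (-1) m :=
  (h.D.div h hv).congr (by ring) (by field_simp)

theorem hasDeg_logDeriv {y : RF} {m : ℤ} {v : ℝ} (h : infPlace.Asym y m v) (hv : v ≠ 0) :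
    HasDeg (D y / y) m := by
  rw [hasDeg_iff]
  have h1 := (asym_t (P := infPlace)).mul (h.logDeriv hv)
  rw [one_mul] at h1
  exact asym_zero_iff.mp h1

theorem HasDeg.unique {w : RF} {m m' : ℝ} (h : HasDeg w m) (h' : HasDeg w m') : m = m' :=
  infPlace.lim_unique (hasDeg_iff.mp h) (hasDeg_iff.mp h')

theorem Reg.D {c : ℝ} {f : RF} (h : Reg c f) : Reg c (ExcJacobi.D f) := by
  obtain ⟨v, n, d, hd, _, rfl⟩ := h
  rw [D_div _ _ (ne_zero_of_eval hd), ← ofPoly_pow]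
  exact ⟨_, _, d ^ 2, by simp [hd], (div_mul_cancel₀ _ (by simp [hd])).symm, rfl⟩

theorem Reg.add {c : ℝ} {f g : RF} (hf : Reg c f) (hg : Reg c g) : Reg c (f + g) :=
  ⟨_, (finPlace c).lim_add hf.choose_spec hg.choose_spec⟩
theorem Reg.mul {c : ℝ} {f g : RF} (hf : Reg c f) (hg : Reg c g) : Reg c (f * g) :=
  ⟨_, (finPlace c).lim_mul hf.choose_spec hg.choose_spec⟩
theorem reg_const (c a : ℝ) : Reg c (const a) := ⟨_, (finPlace c).lim_const a⟩
theorem Reg.sub {c : ℝ} {f g : RF} (hf : Reg c f) (hg : Reg c g) : Reg c (f - g) := by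
  have := hf.add ((reg_const c (-1)).mul hg)
  rwa [const_neg, const_one, neg_one_mul, ← sub_eq_add_neg] at this
theorem lim_ofPoly (c : ℝ) (P : ℝ[X]) : (finPlace c).Lim (ofPoly P) (P.eval c) :=
  ⟨P, 1, by simp, by simp, by rw [ofPoly_one, div_one]⟩
theorem reg_ofPoly (c : ℝ) (P : ℝ[X]) : Reg c (ofPoly P) := ⟨_, lim_ofPoly c P⟩

theorem reg_iff_asym {c : ℝ} {f : RF} : Reg c f ↔ ∃ v, (finPlace c).Asym f 0 v :=
  exists_congr fun _ => asym_zero_iff.symm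

theorem reg_of_asym {c : ℝ} {f : RF} {m : ℤ} {v : ℝ} (h : (finPlace c).Asym f m v) (hm : 0 ≤ m) :
    Reg c f := by
  rw [reg_iff_asym]
  rcases hm.eq_or_lt with rfl | h1
  · exact ⟨_, h⟩
  · have := h.shift h1
    rw [show m - (finPlace c).eps * m = 0 from by change m - 1 * m = 0; ring] at this
    exact ⟨_, this⟩

theorem not_reg_of_asym {c : ℝ} {f : RF} {m : ℤ} {v : ℝ} (h : (finPlace c).Asym f m v)
    (hv : v ≠ 0) (hm : m < 0) : ¬ Reg c f := by
  rw [reg_iff_asym]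
  rintro ⟨w, hw⟩
  have h1 := hw.shift (k := -m) (by omega)
  rw [show (0 : ℤ) - (finPlace c).eps * -m = m from by change 0 - 1 * -m = m; ring] at h1
  exact hv (h.unique h1)

theorem reg_logDeriv_iff {c : ℝ} {y : RF} {m : ℤ} {v : ℝ} (h : (finPlace c).Asym y m v)
    (hv : v ≠ 0) : Reg c (D y / y) ↔ m = 0 := by
  constructor
  · intro h1
    by_contra hm
    exact not_reg_of_asym (h.logDeriv hv) (by exact_mod_cast hm) (by norm_num) h1
  · rintro rfl
    have h1 := asym_zero_iff.mp h
    obtain ⟨v', hv'⟩ := (show Reg c y from ⟨v, h1⟩).D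
    have := (asym_zero_iff.mpr hv').div h hv
    exact reg_of_asym this (by norm_num)

end
end ExcJacobi

namespace ExcJacobi
noncomputable section

open Place

/-! ### Confluent double Darboux transformations -/

/-- The operator obtained from `T` by replacing `u` by `u + v`, where the potential of `T` is
`2 p u' + p' u` up to a constant. -/
def Diff2.double (T : Diff2) (v : RF) : Diff2 where
  p := T.p
  q := T.q
  r := T.r + 2 * T.p * D v + D T.p * v

theorem Diff2.ext' {S T : Diff2} (hp : S.p = T.p) (hq : S.q = T.q) (hr : S.r = T.r) : S = T := by
  cases S; cases T; simp_all

theorem double_eq (T : Diff2) (hp : T.p ≠ 0) (w v : RF) :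
    ((T.step w).step (v - w - T.q / T.p)).gauge T.p⁻¹ = T.double v := by
  apply Diff2.ext'
  · rfl
  · change T.q + D T.p + D T.p + 2 * T.p * (D T.p⁻¹ / T.p⁻¹) = T.q
    rw [D_inv]; field_simp; ring
  · change T.r + D T.q + 2 * T.p * D w + D T.p * w + D (T.q + D T.p) +
      2 * T.p * D (v - w - T.q / T.p) + D T.p * (v - w - T.q / T.p) +
      (T.q + D T.p + D T.p) * (D T.p⁻¹ / T.p⁻¹) + T.p * (D (D T.p⁻¹) / T.p⁻¹) =
      T.r + 2 * T.p * D v + D T.p * v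
    rw [D_inv, D_quot _ _ (pow_ne_zero 2 hp), D_neg, D_sub, D_sub, D_quot _ _ hp, D_add, pow_two,
      D_mul]
    field_simp
    ring

/-- The confluent double Darboux transformation with seed `f`, `r' = f² W`. -/
def gmap (T : Diff2) (W f r : RF) (k : ℝ) (y : RF) : RF :=
  y - f * (T.p * W * (D f * y - f * D y)) / (const k * r)

section Double

variable {T : Diff2} {lam mu : ℝ} {W f r y : RF}

theorem logDeriv_seed (hp : T.p ≠ 0) (hW0 : W ≠ 0) (hW : D (T.p * W) = T.q * W) (f0 : f ≠ 0)
    (hr0 : r ≠ 0) : D (r / (T.p * W * f)) / (r / (T.p * W * f)) =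
      D r / r - D f / f - T.q / T.p := by
  have hpW := mul_ne_zero hp hW0
  rw [logDeriv_div hr0 (mul_ne_zero hpW f0), logDeriv_mul hpW f0, hW]
  field_simp
  ring

theorem hW_step (hW : D (T.p * W) = T.q * W) (w : RF) :
    D ((T.step w).p * (T.p * W)) = (T.step w).q * (T.p * W) := by
  change D (T.p * (T.p * W)) = (T.q + D T.p) * (T.p * W)
  rw [D_mul, hW]; ring

theorem gmap_eq (hp : T.p ≠ 0)
    (hf : Sol T mu f) (f0 : f ≠ 0) (hr0 : r ≠ 0) (hr : D r = f ^ 2 * W)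
    (hy : Sol T lam y) (hne : lam ≠ mu) :
    T.p * dar (D r / r - D f / f - T.q / T.p) (dar (D f / f) y) =
      const (lam - mu) * gmap T W f r (mu - lam) y := by
  have h1 := adj_dar_sol (mem_Ric_of_sol f0 hf) hy
  have hk : const (lam - mu) ≠ 0 := const_ne_zero (sub_ne_zero.mpr hne)
  have e : const (mu - lam) = -const (lam - mu) := by rw [← const_neg]; congr 1; ring
  unfold gmap
  rw [e]
  generalize const (lam - mu) = k at *
  unfold Diff2.adj at h1
  have h2 : dar (D f / f) y = D y - D f / f * y := rfl
  have h3 : dar (D r / r - D f / f - T.q / T.p) (dar (D f / f) y) =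
    D (dar (D f / f) y) - (D r / r - D f / f - T.q / T.p) * dar (D f / f) y := rfl
  rw [h3]
  have h4 : T.p * (D (dar (D f / f) y) - (D r / r - D f / f - T.q / T.p) * dar (D f / f) y)
      = (T.p * D (dar (D f / f) y) + (T.p * (D f / f) + T.q) * dar (D f / f) y)
        - T.p * (D r / r) * dar (D f / f) y := by
    field_simp; ring
  rw [h4, h1, h2, hr]
  field_simp
  ring

theorem mem_Ric_seed (hp : T.p ≠ 0) (hW0 : W ≠ 0) (hW : D (T.p * W) = T.q * W)
    (hf : Sol T mu f) (f0 : f ≠ 0) (hr0 : r ≠ 0) (hr : D r = f ^ 2 * W) :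
    D r / r - D f / f - T.q / T.p ∈ Ric (T.step (D f / f)) mu := by
  rw [← logDeriv_seed hp hW0 hW f0 hr0]
  exact mem_Ric_of_sol (div_ne_zero hr0 (mul_ne_zero (mul_ne_zero hp hW0) f0))
    (sol_step_seed (c := 1) hf f0 hp hW0 hW (by rw [const_one, one_mul, hr]))

theorem sol_double (hp : T.p ≠ 0) (hW0 : W ≠ 0) (hW : D (T.p * W) = T.q * W)
    (hf : Sol T mu f) (f0 : f ≠ 0) (hr0 : r ≠ 0) (hr : D r = f ^ 2 * W)
    (hy : Sol T lam y) (y0 : y ≠ 0) (hne : lam ≠ mu) :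
    Sol (T.double (D r / r)) lam (gmap T W f r (mu - lam) y) ∧ gmap T W f r (mu - lam) y ≠ 0 ∧
    ∃ h, 1 / (y ^ 2 * (T.p * W)) =
      1 / (gmap T W f r (mu - lam) y ^ 2 * (T.p * W)) + D h := by
  have hk : const (lam - mu) ≠ 0 := const_ne_zero (sub_ne_zero.mpr hne)
  have hw := mem_Ric_of_sol f0 hf
  have hs := mem_Ric_seed hp hW0 hW hf f0 hr0 hr
  have e := gmap_eq hp hf f0 hr0 hr hy hne
  have hy1 := sol_step hw hy
  have y1 := dar_ne_zero hw hy y0 hne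
  have hy2 := sol_step hs hy1
  have y2 := dar_ne_zero hs hy1 y1 hne
  have c1 := class_step hw hy y0 hne hp hW0 hW
  have c2 := class_step hs hy1 y1 hne hp (mul_ne_zero hp hW0) (hW_step hW _)
  set z := dar (D r / r - D f / f - T.q / T.p) (dar (D f / f) y) with hz
  have hG : gmap T W f r (mu - lam) y = const (lam - mu)⁻¹ * (T.p * z) := by
    rw [e, const_inv]; field_simp
  refine ⟨?_, ?_, ?_⟩
  · rw [← double_eq T hp (D f / f) (D r / r), sol_gauge (inv_ne_zero hp), hG]
    have : T.p⁻¹ * (const (lam - mu)⁻¹ * (T.p * z)) = const (lam - mu)⁻¹ * z := by field_simp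
    rw [this]
    exact hy2.const_mul _
  · rw [hG]
    exact mul_ne_zero (const_ne_zero (inv_ne_zero (sub_ne_zero.mpr hne))) (mul_ne_zero hp y2)
  · change 1 / (dar (D f / f) y ^ 2 * (T.p * (T.p * W))) + _ =
      const (mu - lam) / (z ^ 2 * (T.p * (T.p * (T.p * W)))) at c2
    have e2 : const (mu - lam) = -const (lam - mu) := by rw [← const_neg]; congr 1; ring
    obtain ⟨h1, hh1⟩ : ∃ h, D (1 / (y * (T.p * W) * dar (D f / f) y)) = D h := ⟨_, rfl⟩
    obtain ⟨h2, hh2⟩ : ∃ h, D (1 / (dar (D f / f) y * ((T.step (D f / f)).p * (T.p * W)) * z)) =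
      D h := ⟨_, rfl⟩
    rw [hh1] at c1
    rw [hh2] at c2
    refine ⟨const (mu - lam) * (-h2) - h1, ?_⟩
    have e3 : 1 / (gmap T W f r (mu - lam) y ^ 2 * (T.p * W)) =
        const (mu - lam) * (const (mu - lam) / (z ^ 2 * (T.p * (T.p * (T.p * W))))) := by
      rw [hG, e2, const_inv]; field_simp
    rw [e3, ← c2, D_sub, D_const_mul, D_neg]
    have e4 : const (mu - lam) / (dar (D f / f) y ^ 2 * (T.p * (T.p * W))) =
      const (mu - lam) * (1 / (dar (D f / f) y ^ 2 * (T.p * (T.p * W)))) := by ring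
    rw [e4] at c1
    linear_combination c1

theorem ric_of_ric_double (hp : T.p ≠ 0) (hW0 : W ≠ 0) (hW : D (T.p * W) = T.q * W)
    (hf : Sol T mu f) (f0 : f ≠ 0) (hr0 : r ≠ 0) (hr : D r = f ^ 2 * W) (hne : lam ≠ mu)
    (h : (Ric (T.double (D r / r)) lam).Nonempty) : (Ric T lam).Nonempty := by
  obtain ⟨v, hv⟩ := h
  rw [← double_eq T hp (D f / f) (D r / r), mem_Ric_gauge (inv_ne_zero hp)] at hv
  obtain ⟨v1, hv1⟩ := ric_of_ric_step (mem_Ric_seed hp hW0 hW hf f0 hr0 hr) hv hne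
  exact ric_of_ric_step (mem_Ric_of_sol f0 hf) hv1 hne

theorem sol_double_seed (hp : T.p ≠ 0) (hW0 : W ≠ 0) (hW : D (T.p * W) = T.q * W)
    (hf : Sol T mu f) (f0 : f ≠ 0) (hr0 : r ≠ 0) (hr : D r = f ^ 2 * W) :
    Sol (T.double (D r / r)) mu (f / r) := by
  have hpW := mul_ne_zero hp hW0
  have s0 : r / (T.p * W * f) ≠ 0 := div_ne_zero hr0 (mul_ne_zero hpW f0)
  have hs : Sol (T.step (D f / f)) mu (r / (T.p * W * f)) :=
    sol_step_seed (c := 1) hf f0 hp hW0 hW (by rw [const_one, one_mul, hr])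
  have h2 := sol_step_seed (c := 0) (R := 1) hs s0 hp hpW (hW_step hW _)
    (by rw [D_one, const_zero, zero_mul])
  rw [logDeriv_seed hp hW0 hW f0 hr0] at h2
  rw [← double_eq T hp (D f / f) (D r / r), sol_gauge (inv_ne_zero hp)]
  convert h2 using 1
  change T.p⁻¹ * (f / r) = 1 / (T.p * (T.p * W) * (r / (T.p * W * f)))
  field_simp

end Double

/-! ### Operators of Jacobi type -/

/-- The operator `Trg(τ; α, β)` in terms of `u = τ'/τ`, shifted by a constant such that Darboux
transformations preserve the eigenvalues. -/
def opN (u : RF) (α β γ : ℕ) : Diff2 where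
  p := x ^ 2 - 1
  q := (x ^ 2 - 1) * eta α β
  r := 2 * (x ^ 2 - 1) * D u + 2 * x * u + const (γ * (α + β + 1 - γ))

theorem const_two : const 2 = 2 := const_ofNat 2
theorem x_sub_one_ne : x - 1 ≠ 0 := by simpa only [const_one] using x_sub_const_ne 1
theorem x_add_one_ne : x + 1 ≠ 0 := by
  have := x_sub_const_ne (-1)
  rwa [const_neg, const_one, sub_neg_eq_add] at this
theorem one_sub_x_ne : 1 - x ≠ 0 := by
  rw [← neg_sub]; exact neg_ne_zero.mpr x_sub_one_ne
theorem one_add_x_ne : 1 + x ≠ 0 := by rw [add_comm]; exact x_add_one_ne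
theorem p_eq : x ^ 2 - 1 = (x - 1) * (x + 1) := by ring
theorem p_ne : x ^ 2 - 1 ≠ 0 := by
  rw [p_eq]; exact mul_ne_zero x_sub_one_ne x_add_one_ne
theorem weight_ne (m n : ℕ) : weight m n ≠ 0 :=
  mul_ne_zero (pow_ne_zero _ one_sub_x_ne) (pow_ne_zero _ one_add_x_ne)
theorem q_eq (α β : ℝ) : (x ^ 2 - 1) * eta α β =
    const (α + 1) * (x + 1) + const (β + 1) * (x - 1) := by
  have := x_sub_one_ne
  have := x_add_one_ne
  unfold eta
  rw [p_eq]
  field_simp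
theorem D_p : D (x ^ 2 - 1) = 2 * x := by
  rw [D_sub, D_one, pow_two, D_mul, D_x]; ring
theorem D_q (α β : ℝ) : D ((x ^ 2 - 1) * eta α β) = const (α + β + 2) := by
  rw [q_eq, D_add, D_const_mul, D_const_mul, D_add, D_sub, D_one, D_x, add_zero, sub_zero, mul_one,
    mul_one, ← const_add]
  congr 1; ring

theorem D_weight_succ (m n : ℕ) : D (weight (m + 1) (n + 1)) =
    (const (n + 1) * (1 - x) - const (m + 1) * (1 + x)) * weight m n := by
  unfold weight
  rw [D_mul, D_pow, D_pow, D_sub, D_add, D_one, D_x, const_add, const_add, const_natCast,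
    const_natCast, const_one]
  simp only [Nat.add_sub_cancel]
  push_cast
  ring

theorem p_mul_weight (m n : ℕ) : (x ^ 2 - 1) * weight m n = -weight (m + 1) (n + 1) := by
  unfold weight; ring

theorem hW_opN (u : RF) (α β γ : ℕ) :
    D ((opN u α β γ).p * weight α β) = (opN u α β γ).q * weight α β := by
  change D ((x ^ 2 - 1) * weight α β) = (x ^ 2 - 1) * eta α β * weight α β
  rw [p_mul_weight, D_neg, D_weight_succ, q_eq]; ring

theorem Trg_eq {τ : RF} (h : τ ≠ 0) (α β : ℝ) : Trg τ α β =
    ⟨x ^ 2 - 1, (x ^ 2 - 1) * eta α β,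
      2 * (x ^ 2 - 1) * D (D τ / τ) + 2 * x * (D τ / τ)⟩ := by
  apply Diff2.ext'
  · rfl
  · change (x ^ 2 - 1) * (eta α β - 2 * (D τ / τ)) + 2 * (x ^ 2 - 1) * (D τ / τ) = _
    ring
  · change (x ^ 2 - 1) * (D (D τ) / τ - eta α β * (D τ / τ)) + 2 * x * (D τ / τ) +
      (x ^ 2 - 1) * (eta α β - 2 * (D τ / τ)) * (D τ / τ) + (x ^ 2 - 1) * (D (D τ) / τ) = _
    change _ = 2 * (x ^ 2 - 1) * D (D τ / τ) + 2 * x * (D τ / τ)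
    rw [D_quot _ _ h]
    field_simp
    ring

theorem mem_Ric_Trg {τ : RF} (h : τ ≠ 0) (α β γ : ℕ) {lam : ℝ} {w : RF} :
    w ∈ Ric (Trg τ α β) lam ↔ w ∈ Ric (opN (D τ / τ) α β γ) (lam + γ * (α + β + 1 - γ)) := by
  rw [Trg_eq h]
  change _ = _ ↔ _ = _
  simp only [opN]
  rw [const_add]
  constructor
  · intro h; linear_combination h
  · intro h; linear_combination h

theorem sol_Trg {τ : RF} (h : τ ≠ 0) (α β γ : ℕ) {lam : ℝ} {y : RF} :
    Sol (Trg τ α β) lam y ↔ Sol (opN (D τ / τ) α β γ) (lam + γ * (α + β + 1 - γ)) y := by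
  rw [Trg_eq h]
  simp only [opN, Sol, Diff2.apply]
  rw [const_add]
  constructor
  · intro h; linear_combination h
  · intro h; linear_combination h

theorem opN_step (u w : RF) (α β γ : ℕ) :
    (opN u α β γ).step w = opN (u + w) (α + 1) (β + 1) (γ + 1) := by
  apply Diff2.ext'
  · rfl
  · change (x ^ 2 - 1) * eta α β + D (x ^ 2 - 1) = (x ^ 2 - 1) * eta ((α + 1 : ℕ) : ℝ) ((β + 1 : ℕ) : ℝ)
    rw [D_p, q_eq, q_eq]
    push_cast
    simp only [const_add, const_one]
    ring
  · change 2 * (x ^ 2 - 1) * D u + 2 * x * u + const (γ * (α + β + 1 - γ)) +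
      D ((x ^ 2 - 1) * eta α β) + 2 * (x ^ 2 - 1) * D w + D (x ^ 2 - 1) * w =
      2 * (x ^ 2 - 1) * D (u + w) + 2 * x * (u + w) +
        const (((γ + 1 : ℕ) : ℝ) * (((α + 1 : ℕ) : ℝ) + ((β + 1 : ℕ) : ℝ) + 1 - ((γ + 1 : ℕ) : ℝ)))
    rw [D_q, D_p, D_add]
    have : (((γ + 1 : ℕ) : ℝ) * (((α + 1 : ℕ) : ℝ) + ((β + 1 : ℕ) : ℝ) + 1 - ((γ + 1 : ℕ) : ℝ))) =
      γ * (α + β + 1 - γ) + (α + β + 2) := by push_cast; ring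
    rw [this, const_add _ ((α : ℝ) + β + 2)]
    ring

theorem opN_double (u v : RF) (α β γ : ℕ) :
    (opN u α β γ).double v = opN (u + v) α β γ := by
  apply Diff2.ext'
  · rfl
  · rfl
  · change 2 * (x ^ 2 - 1) * D u + 2 * x * u + const (γ * (α + β + 1 - γ)) +
      2 * (x ^ 2 - 1) * D v + D (x ^ 2 - 1) * v =
      2 * (x ^ 2 - 1) * D (u + v) + 2 * x * (u + v) + const (γ * (α + β + 1 - γ))
    rw [D_p, D_add]; ring

theorem opN_gauge_neg_one (u : RF) (α β γ : ℕ) :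
    (opN u α β γ).gauge (x + 1) = opN (u - const (β + 1) / (x + 1)) α (β + 2) (γ + 1) := by
  have h1 := x_add_one_ne
  have hD : D (x + 1) = 1 := by rw [D_add, D_x, D_one, add_zero]
  apply Diff2.ext'
  · rfl
  · change (x ^ 2 - 1) * eta α β + 2 * (x ^ 2 - 1) * (D (x + 1) / (x + 1)) =
      (x ^ 2 - 1) * eta α ((β + 2 : ℕ) : ℝ)
    rw [q_eq, q_eq, hD, p_eq]
    push_cast
    simp only [const_add, const_one, const_two]
    field_simp
    ring
  · change 2 * (x ^ 2 - 1) * D u + 2 * x * u + const (γ * (α + β + 1 - γ)) +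
      (x ^ 2 - 1) * eta α β * (D (x + 1) / (x + 1)) + (x ^ 2 - 1) * (D (D (x + 1)) / (x + 1)) =
      2 * (x ^ 2 - 1) * D (u - const (β + 1) / (x + 1)) + 2 * x * (u - const (β + 1) / (x + 1)) +
        const (((γ + 1 : ℕ) : ℝ) * ((α : ℝ) + ((β + 2 : ℕ) : ℝ) + 1 - ((γ + 1 : ℕ) : ℝ)))
    rw [D_sub u, D_quot _ _ h1, hD, D_one, D_const, q_eq, p_eq]
    push_cast
    simp only [const_add, const_sub, const_mul, const_one, const_two]
    field_simp
    ring

theorem opN_gauge_one (u : RF) (α β γ : ℕ) :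
    (opN u α β γ).gauge (x - 1) = opN (u - const (α + 1) / (x - 1)) (α + 2) β (γ + 1) := by
  have h1 := x_sub_one_ne
  have hD : D (x - 1) = 1 := by rw [D_sub, D_x, D_one, sub_zero]
  apply Diff2.ext'
  · rfl
  · change (x ^ 2 - 1) * eta α β + 2 * (x ^ 2 - 1) * (D (x - 1) / (x - 1)) =
      (x ^ 2 - 1) * eta ((α + 2 : ℕ) : ℝ) β
    rw [q_eq, q_eq, hD, p_eq]
    push_cast
    simp only [const_add, const_one, const_two]
    field_simp
    ring
  · change 2 * (x ^ 2 - 1) * D u + 2 * x * u + const (γ * (α + β + 1 - γ)) +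
      (x ^ 2 - 1) * eta α β * (D (x - 1) / (x - 1)) + (x ^ 2 - 1) * (D (D (x - 1)) / (x - 1)) =
      2 * (x ^ 2 - 1) * D (u - const (α + 1) / (x - 1)) + 2 * x * (u - const (α + 1) / (x - 1)) +
        const (((γ + 1 : ℕ) : ℝ) * (((α + 2 : ℕ) : ℝ) + β + 1 - ((γ + 1 : ℕ) : ℝ)))
    rw [D_sub u, D_quot _ _ h1, hD, D_one, D_const, q_eq, p_eq]
    push_cast
    simp only [const_add, const_sub, const_mul, const_one, const_two]
    field_simp
    ring

/-! ### Leading terms of the coefficients, and exponents -/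

/-- The parameter attached to the end point `c = ±1`. -/
def expo (c : ℝ) (α β : ℕ) : ℕ := if c = 1 then α else β

theorem expo_one (α β : ℕ) : expo 1 α β = α := if_pos rfl
theorem expo_neg_one (α β : ℕ) : expo (-1) α β = β := if_neg (by norm_num)

theorem asym_x_sub (c : ℝ) : (finPlace c).Asym (x - const c) 1 1 := (finPlace c).asym_t

theorem asym_x_sub' {c c' : ℝ} : (finPlace c).Asym (x - const c') 0 (c - c') := by
  have := lim_ofPoly c (X - C c')
  rw [eval_sub, eval_X, eval_C, ofPoly_sub, ofPoly_X, ofPoly_C] at this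
  exact asym_zero_iff.mpr this

theorem lim_x (c : ℝ) : (finPlace c).Lim x c := by
  have := lim_ofPoly c X
  rwa [eval_X, ofPoly_X] at this

theorem asym_p {c : ℝ} (hc : c = 1 ∨ c = -1) : (finPlace c).Asym (x ^ 2 - 1) 1 (2 * c) := by
  have h := (asym_x_sub c).mul (asym_x_sub' (c := c) (c' := -c))
  have e : (x - const c) * (x - const (-c)) = x ^ 2 - 1 := by
    rcases hc with rfl | rfl <;> simp only [const_neg, const_one] <;> ring
  rw [e] at h
  exact h.congr (add_zero _) (by ring)

theorem asym_q {c : ℝ} (hc : c = 1 ∨ c = -1) (α β : ℕ) :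
    (finPlace c).Asym ((x ^ 2 - 1) * eta α β) 0 (2 * c * (expo c α β + 1)) := by
  rw [q_eq]
  have h1 := (asym_x_sub' (c := c) (c' := -1)).const_mul ((α : ℝ) + 1)
  have h2 := (asym_x_sub' (c := c) (c' := 1)).const_mul ((β : ℝ) + 1)
  have h := h1.add h2
  rw [const_neg, const_one, sub_neg_eq_add] at h
  refine h.congr rfl ?_
  rcases hc with rfl | rfl
  · rw [expo_one]; ring
  · rw [expo_neg_one]; ring

theorem asym_weight {c : ℝ} (hc : c = 1 ∨ c = -1) (α β : ℕ) :
    ∃ v, v ≠ 0 ∧ (finPlace c).Asym (weight α β) (expo c α β) v := by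
  have e1 : 1 - x = -(x - const 1) := by rw [const_one]; ring
  have e2 : 1 + x = x - const (-1) := by rw [const_neg, const_one]; ring
  unfold weight
  rw [e1, e2]
  rcases hc with rfl | rfl
  · refine ⟨_, ?_, (((asym_x_sub 1).neg.pow α).mul ((asym_x_sub' (c' := -1)).pow β)).congr
      (by rw [expo_one]; ring) rfl⟩
    exact mul_ne_zero (pow_ne_zero _ (by norm_num)) (pow_ne_zero _ (by norm_num))
  · refine ⟨_, ?_, (((asym_x_sub' (c' := 1)).neg.pow α).mul ((asym_x_sub (-1)).pow β)).congr
      (by rw [expo_neg_one]; ring) rfl⟩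
    exact mul_ne_zero (pow_ne_zero _ (by norm_num)) (pow_ne_zero _ (by norm_num))

theorem asym_pW {c : ℝ} (hc : c = 1 ∨ c = -1) (α β : ℕ) :
    ∃ v, v ≠ 0 ∧ (finPlace c).Asym ((x ^ 2 - 1) * weight α β) (expo c α β + 1) v := by
  obtain ⟨v, hv, h⟩ := asym_weight hc α β
  refine ⟨_, mul_ne_zero ?_ hv, ((asym_p hc).mul h).congr (add_comm _ _) rfl⟩
  rcases hc with rfl | rfl <;> norm_num

theorem asym_inf_x_add (c : ℝ) : infPlace.Asym (x + const c) 1 1 := by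
  have h1 : infPlace.Asym x 1 1 := infPlace.asym_t
  have h2 := (infPlace.asym_const c).shift (k := 1) one_pos
  have h3 : infPlace.Asym (const c) 1 0 := h2.congr (by change 0 - (-1) * 1 = 1; rfl) rfl
  exact (h1.add h3).congr rfl (add_zero _)

theorem asym_inf_p : infPlace.Asym (x ^ 2 - 1) 2 1 := by
  have h := (asym_inf_x_add 1).mul (asym_inf_x_add (-1))
  have e : (x + const 1) * (x + const (-1)) = x ^ 2 - 1 := by
    simp only [const_neg, const_one]; ring
  rw [e] at h
  exact h.congr rfl (by ring)

theorem asym_inf_q (α β : ℝ) :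
    infPlace.Asym ((x ^ 2 - 1) * eta α β) 1 (α + β + 2) := by
  rw [q_eq]
  have h := ((asym_inf_x_add 1).const_mul (α + 1)).add ((asym_inf_x_add (-1)).const_mul (β + 1))
  rw [const_neg, const_one, ← sub_eq_add_neg] at h
  exact h.congr rfl (by ring)

theorem asym_inf_weight (α β : ℕ) : infPlace.Asym (weight α β) (α + β) ((-1) ^ α) := by
  have e1 : 1 - x = -(x + const (-1)) := by rw [const_neg, const_one]; ring
  have e2 : 1 + x = x + const 1 := by rw [const_one]; ring
  unfold weight
  rw [e1, e2]
  exact (((asym_inf_x_add (-1)).neg.pow α).mul ((asym_inf_x_add 1).pow β)).congr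
    (by ring) (by simp)

/-- The exponents at `±1`. -/
theorem exponent_fin {c : ℝ} (hc : c = 1 ∨ c = -1) {u y : RF} {α β γ : ℕ} {lam : ℝ}
    (hu : Reg c u) (hy : Sol (opN u α β γ) lam y) {s : ℤ} {v : ℝ} (hv : v ≠ 0)
    (h : (finPlace c).Asym y s v) : s = 0 ∨ s = -(expo c α β : ℤ) := by
  have hV : Reg c (opN u α β γ).r := by
    change Reg c (2 * (x ^ 2 - 1) * D u + 2 * x * u + const (γ * (α + β + 1 - γ)))
    rw [← const_two]
    exact (((((reg_const c 2).mul ⟨_, asym_zero_iff.mp ((asym_p hc).shift (k := 1) one_pos)⟩).mul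
      hu.D).add (((reg_const c 2).mul ⟨_, lim_x c⟩).mul hu)).add (reg_const c _))
  obtain ⟨V0, hV0⟩ := reg_iff_asym.mp hV
  have h1 := ((asym_p hc).mul h.D.D).congr (by ring : (1 : ℤ) + (s - 1 - 1) = s - 1) rfl
  have h2 := ((asym_q hc α β).mul h.D).congr (by ring : (0 : ℤ) + (s - 1) = s - 1) rfl
  have h3 := ((hV0.mul h).shift (k := 1) one_pos).congr
    (show 0 + s - (finPlace c).eps * 1 = s - 1 from by change 0 + s - 1 * 1 = _; ring) rfl
  have h4 := ((h.const_mul lam).shift (k := 1) one_pos).congr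
    (show s - (finPlace c).eps * 1 = s - 1 from rfl) rfl
  have h5 := (h1.add h2).add h3
  rw [← show (opN u α β γ).apply y = _ from hy] at h4
  have h6 := h5.unique h4
  have h7 : (s : ℝ) * (s + expo c α β) = 0 := by
    have hc0 : 2 * c * v ≠ 0 := mul_ne_zero (by rcases hc with rfl | rfl <;> norm_num) hv
    apply mul_left_cancel₀ hc0
    push_cast at h6
    linear_combination h6
  rcases mul_eq_zero.mp h7 with h8 | h8
  · left; exact_mod_cast h8
  · right; have : s + (expo c α β : ℤ) = 0 := by exact_mod_cast h8
    omega

theorem reg_weight (c : ℝ) (α β : ℕ) : Reg c (weight α β) := by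
  have : weight α β = ofPoly ((1 - X) ^ α * (1 + X) ^ β) := by
    simp only [ofPoly_mul, ofPoly_pow, ofPoly_sub, ofPoly_add, ofPoly_one, ofPoly_X]; rfl
  rw [this]; exact reg_ofPoly _ _

/-- The exponents at infinity. -/
theorem exponent_inf {u y : RF} {α β γ : ℕ} {lam δ : ℝ} (hu : infPlace.Asym u (-1) δ)
    (hy : Sol (opN u α β γ) lam y) {s : ℤ} {v : ℝ} (hv : v ≠ 0) (h : infPlace.Asym y s v) :
    lam = (s + γ) * (s + α + β + 1 - γ) := by
  have hx : infPlace.Asym x 1 1 := infPlace.asym_t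
  have h2c : infPlace.Asym (2 : RF) 0 2 := by
    have := infPlace.asym_const 2
    rwa [const_ofNat] at this
  have hV : infPlace.Asym (opN u α β γ).r 0 (γ * (α + β + 1 - γ)) := by
    have h1 := (h2c.mul asym_inf_p).mul hu.D
    have h2 := (h2c.mul hx).mul hu
    have h3 := infPlace.asym_const ((γ : ℝ) * (α + β + 1 - γ))
    exact ((h1.add h2).add h3).congr rfl (by push_cast; ring)
  have h1 := (asym_inf_p.mul h.D.D).congr (by ring : (2 : ℤ) + (s - 1 - 1) = s) rfl
  have h2 := ((asym_inf_q α β).mul h.D).congr (by ring : (1 : ℤ) + (s - 1) = s) rfl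
  have h3 := (hV.mul h).congr (by ring : (0 : ℤ) + s = s) rfl
  have h4 := h.const_mul lam
  rw [← show (opN u α β γ).apply y = _ from hy] at h4
  have h5 := ((h1.add h2).add h3).unique h4
  apply mul_right_cancel₀ hv
  push_cast at h5
  linear_combination -h5

/-- A solution without a pole at `c = ±1` does not vanish there. -/
theorem unit_of_reg {c : ℝ} (hc : c = 1 ∨ c = -1) {u y : RF} {α β γ : ℕ} {lam : ℝ}
    (hu : Reg c u) (hy : Sol (opN u α β γ) lam y) (y0 : y ≠ 0) (h : Reg c y) :
    ∃ v, v ≠ 0 ∧ (finPlace c).Lim y v := by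
  obtain ⟨s, v, hv, hs⟩ := (finPlace c).exists_asym y0
  have h1 : 0 ≤ s := by
    by_contra hlt
    exact not_reg_of_asym hs hv (by omega) h
  have : s = 0 := by
    rcases exponent_fin hc hu hy hv hs with h2 | h2 <;> omega
  subst this
  exact ⟨v, hv, asym_zero_iff.mp hs⟩

theorem pole_of_not_reg {c : ℝ} (hc : c = 1 ∨ c = -1) {u y : RF} {α β γ : ℕ} {lam : ℝ}
    (hu : Reg c u) (hy : Sol (opN u α β γ) lam y) (y0 : y ≠ 0) (h : ¬ Reg c y) :
    0 < expo c α β ∧ ∃ v, v ≠ 0 ∧ (finPlace c).Asym y (-(expo c α β : ℤ)) v := by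
  obtain ⟨s, v, hv, hs⟩ := (finPlace c).exists_asym y0
  have h1 : s < 0 := by
    by_contra hlt
    exact h (reg_of_asym hs (by omega))
  rcases exponent_fin hc hu hy hv hs with h2 | h2
  · omega
  · subst h2; exact ⟨by omega, v, hv, hs⟩

end
end ExcJacobi

namespace ExcJacobi
noncomputable section

open Place

/-! ### Spectral diagrams of transformed operators -/

/-- The eigenvalue with the index `j`. -/
def Lam (N : ℕ) (j : ℤ) : ℝ := j * (j + N + 1)

theorem Lam_sub (N : ℕ) (i j : ℤ) : Lam N i - Lam N j = (i - j) * (i + j + N + 1) := by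
  unfold Lam; ring

theorem Lam_eq_iff (N : ℕ) (i j : ℤ) : Lam N i = Lam N j ↔ i = j ∨ i = -j - N - 1 := by
  rw [← sub_eq_zero, Lam_sub, mul_eq_zero, sub_eq_zero, Int.cast_inj]
  refine or_congr Iff.rfl ?_
  rw [show (i : ℝ) + j + N + 1 = ((i + j + N + 1 : ℤ) : ℝ) from by push_cast; ring]
  rw [Int.cast_eq_zero]
  omega

theorem Lam_inj {N : ℕ} {i j : ℤ} (hi : -(N + 1 : ℤ) ≤ 2 * i) (hj : -(N + 1 : ℤ) ≤ 2 * j)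
    (h : Lam N i = Lam N j) : i = j := by
  rcases (Lam_eq_iff N i j).mp h with h | h <;> omega

/-- The rational function `y` has the degree `m`. -/
def Deg (y : RF) (m : ℤ) : Prop := ∃ v, v ≠ 0 ∧ infPlace.Asym y m v

/-- `g` has a primitive. -/
def Exact (g : RF) : Prop := ∃ h, D h = g

/-- `g` has a primitive near `c`. -/
def LExact (c : ℝ) (g : RF) : Prop := ∃ h, Reg c (g - D h)

/-- A non-zero solution of `T y = λ y` with prescribed behaviour at `±1` and prescribed degree; if
`uniq` holds then it is the only rational solution up to scale. -/
def HasSol (T : Diff2) (W : RF) (lam : ℝ) (r₁ r₂ : Prop) (m : ℤ) (uniq : Prop) : Prop :=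
  ∃ y, y ≠ 0 ∧ Sol T lam y ∧ (Reg 1 y ↔ r₁) ∧ (Reg (-1) y ↔ r₂) ∧ Deg y m ∧
    (uniq → ¬ Exact (1 / (y ^ 2 * (T.p * W))))

/-- The solutions of `T y = λ y` that correspond to a label, where `m` and `m'` are the upper and
the lower exponent at infinity. -/
def Diag (T : Diff2) (W : RF) (lam : ℝ) (m m' : ℤ) : Label → Prop
  | .circle => HasSol T W lam True True m True
  | .triangle => HasSol T W lam True True m' True
  | .plus => HasSol T W lam False True m' True
  | .minus => HasSol T W lam True False m' True
  | .bullet => HasSol T W lam False True m False ∧ HasSol T W lam True False m False ∧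
      HasSol T W lam False False m' False

/-- A map from the solutions of `T y = λ y` to those of `T' y = λ y` that preserves the behaviour
at `±1` and lowers degrees by `s`. -/
def Transfers (T T' : Diff2) (W W' : RF) (lam : ℝ) (s : ℤ) (Φ : RF → RF) : Prop :=
  ∀ y, y ≠ 0 → Sol T lam y → Φ y ≠ 0 ∧ Sol T' lam (Φ y) ∧ (Reg 1 (Φ y) ↔ Reg 1 y) ∧
    (Reg (-1) (Φ y) ↔ Reg (-1) y) ∧ (∀ m, Deg y m → Deg (Φ y) (m - s)) ∧
    ∃ (k : ℝ) (h : RF), 1 / (y ^ 2 * (T.p * W)) = const k * (1 / (Φ y ^ 2 * (T'.p * W'))) + D h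

theorem HasSol.transfer {T T' : Diff2} {W W' : RF} {lam : ℝ} {s : ℤ} {Φ : RF → RF}
    (hΦ : Transfers T T' W W' lam s Φ) {r₁ r₂ : Prop} {m : ℤ} {uniq : Prop}
    (h : HasSol T W lam r₁ r₂ m uniq) : HasSol T' W' lam r₁ r₂ (m - s) uniq := by
  obtain ⟨y, y0, hy, h1, h2, hm, hu⟩ := h
  obtain ⟨z0, hz, g1, g2, gm, k, h, hk⟩ := hΦ y y0 hy
  refine ⟨Φ y, z0, hz, g1.trans h1, g2.trans h2, gm m hm, fun u => ?_⟩
  rintro ⟨h', hh'⟩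
  exact hu u ⟨const k * h' + h, by rw [D_add, D_const_mul, hh', hk]⟩

theorem Diag.transfer {T T' : Diff2} {W W' : RF} {lam : ℝ} {s : ℤ} {Φ : RF → RF}
    (hΦ : Transfers T T' W W' lam s Φ) {m m' : ℤ} {l : Label} (h : Diag T W lam m m' l) :
    Diag T' W' lam (m - s) (m' - s) l := by
  cases l
  · exact HasSol.transfer hΦ h
  · exact HasSol.transfer hΦ h
  · exact ⟨h.1.transfer hΦ, h.2.1.transfer hΦ, h.2.2.transfer hΦ⟩
  · exact HasSol.transfer hΦ h
  · exact HasSol.transfer hΦ h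

theorem Transfers.not_lExact {T T' : Diff2} {W W' : RF} {lam : ℝ} {s : ℤ} {Φ : RF → RF}
    (hΦ : Transfers T T' W W' lam s Φ) {y : RF} (y0 : y ≠ 0) (hy : Sol T lam y) {c : ℝ}
    (h : ¬ LExact c (1 / (y ^ 2 * (T.p * W)))) : ¬ LExact c (1 / (Φ y ^ 2 * (T'.p * W'))) := by
  obtain ⟨-, -, -, -, -, k, g, hk⟩ := hΦ y y0 hy
  rintro ⟨h', hh'⟩
  refine h ⟨const k * h' + g, ?_⟩
  rw [hk, D_add, D_const_mul]
  have := (reg_const c k).mul hh'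
  convert this using 1
  ring

/-- The indices that carry a quasi-polynomial eigenfunction. -/
def Fam (lab : ℤ → Label) (i : ℕ) : Prop := lab i = .circle ∨ lab i = .triangle

/-- The invariants of the operators obtained from the classical one by Darboux transformations:
the spectral diagram, the quasi-polynomial eigenfunctions `f i`, primitives `ρ i j` of
`f i * f j * W`, the norms `ν`, the leading coefficients `lc`, and the values `vm` at `-1`. -/
structure State (N : ℕ) (lab : ℤ → Label) (α β γ : ℕ) (u : RF) (δ : ℤ) (f : ℕ → RF)
    (ρ : ℕ → ℕ → RF) (ν lc vm : ℕ → ℝ) : Prop where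
  sum : α + β = N + 2 * γ
  reg_u : ∀ c : ℝ, c = 1 ∨ c = -1 → Reg c u
  asym_u : infPlace.Asym u (-1) δ
  sol : ∀ i : ℕ, Fam lab i → Sol (opN u α β γ) (Lam N i) (f i)
  lim_one : ∀ i : ℕ, Fam lab i → ∃ v, v ≠ 0 ∧ (finPlace 1).Lim (f i) v
  lim_neg : ∀ i : ℕ, Fam lab i → vm i ≠ 0 ∧ (finPlace (-1)).Lim (f i) (vm i)
  asym_f : ∀ i : ℕ, lab i = .circle → lc i ≠ 0 ∧ infPlace.Asym (f i) (i - γ) (lc i)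
  not_lExact : ∀ i : ℕ, lab i = .circle → ∀ c : ℝ, c = 1 ∨ c = -1 →
    ¬ LExact c (1 / (f i ^ 2 * ((x ^ 2 - 1) * weight α β)))
  D_rho : ∀ i j : ℕ, Fam lab i → Fam lab j → D (ρ i j) = f i * f j * weight α β
  rho_neg : ∀ i j : ℕ, Fam lab i → Fam lab j → (finPlace (-1)).Lim (ρ i j) 0
  rho_one : ∀ i j : ℕ, Fam lab i → Fam lab j →
    (finPlace 1).Lim (ρ i j) (if i = j then ν i else 0)
  nu_ne : ∀ i : ℕ, Fam lab i → ν i ≠ 0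
  diag : ∀ j : ℤ, -(N + 1 : ℤ) ≤ 2 * j →
    Diag (opN u α β γ) (weight α β) (Lam N j) (j - γ) (-j - N - 1 - γ) (lab j)
  ric : ∀ lam, (Ric (opN u α β γ) lam).Nonempty → ∃ j : ℤ, lam = Lam N j

/-- The bilinear relations of the primitives `ρ`. -/
def Comm (N : ℕ) (lab : ℤ → Label) (α β : ℕ) (f : ℕ → RF) (ρ : ℕ → ℕ → RF) : Prop :=
  ∀ i j : ℕ, Fam lab i → Fam lab j → const (Lam N i - Lam N j) * ρ i j =
    (x ^ 2 - 1) * weight α β * (D (f i) * f j - f i * D (f j))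

section

variable {N : ℕ} {lab : ℤ → Label} {α β γ : ℕ} {u : RF} {δ : ℤ} {f : ℕ → RF}
  {ρ : ℕ → ℕ → RF} {ν lc vm : ℕ → ℝ}

theorem State.f_ne (S : State N lab α β γ u δ f ρ ν lc vm) {i : ℕ} (hi : Fam lab i) : f i ≠ 0 := by
  obtain ⟨v, hv, h⟩ := S.lim_one i hi
  exact (asym_zero_iff.mpr h).ne_zero hv

theorem State.lim_f (S : State N lab α β γ u δ f ρ ν lc vm) {i : ℕ} (hi : Fam lab i) {c : ℝ}
    (hc : c = 1 ∨ c = -1) : ∃ v, v ≠ 0 ∧ (finPlace c).Lim (f i) v := by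
  rcases hc with rfl | rfl
  · exact S.lim_one i hi
  · exact ⟨_, S.lim_neg i hi⟩

theorem Lam_exponent {α β γ N : ℕ} (h : α + β = N + 2 * γ) (m : ℤ) :
    ((m : ℝ) + γ) * (m + α + β + 1 - γ) = Lam N (m + γ) := by
  have : (α : ℝ) + β = N + 2 * γ := by exact_mod_cast h
  unfold Lam
  push_cast
  linear_combination ((m : ℝ) + γ) * this

theorem State.deg_cases (S : State N lab α β γ u δ f ρ ν lc vm) {y : RF} {j m : ℤ}
    (hy : Sol (opN u α β γ) (Lam N j) y) (hm : Deg y m) : m = j - γ ∨ m = -j - N - 1 - γ := by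
  obtain ⟨v, hv, h⟩ := hm
  have h1 := exponent_inf S.asym_u hy hv h
  rw [Lam_exponent S.sum, Lam_eq_iff] at h1
  omega

/-! ### The Darboux step with a polynomial seed -/

/-- The value at an end point of the Darboux transform of an eigenfunction. -/
theorem dar_lim {c : ℝ} (hc : c = 1 ∨ c = -1) (hu : Reg c u) {lam mu : ℝ} {f y : RF}
    (hf : Sol (opN u α β γ) mu f) (hy : Sol (opN u α β γ) lam y) {a b : ℝ} (ha : a ≠ 0)
    (hfa : (finPlace c).Lim f a) (hyb : (finPlace c).Lim y b) :
    (finPlace c).Lim (dar (D f / f) y) (b * (lam - mu) / (2 * c * (expo c α β + 1))) := by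
  have hc0 : 2 * c * ((expo c α β : ℝ) + 1) ≠ 0 := by
    apply mul_ne_zero
    · rcases hc with rfl | rfl <;> norm_num
    · positivity
  have hV : Reg c (opN u α β γ).r := by
    change Reg c (2 * (x ^ 2 - 1) * D u + 2 * x * u + const (γ * (α + β + 1 - γ)))
    rw [← const_two]
    exact (((((reg_const c 2).mul ⟨_, asym_zero_iff.mp ((asym_p hc).shift (k := 1) one_pos)⟩).mul
      hu.D).add (((reg_const c 2).mul ⟨_, lim_x c⟩).mul hu)).add (reg_const c _))
  obtain ⟨V, hV⟩ := hV
  have hp : (finPlace c).Lim (x ^ 2 - 1) 0 := asym_zero_iff.mp ((asym_p hc).shift (k := 1) one_pos)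
  have key : ∀ {z : RF} {l b : ℝ}, Sol (opN u α β γ) l z → (finPlace c).Lim z b →
      ∃ d, (finPlace c).Lim (D z) d ∧ 2 * c * ((expo c α β : ℝ) + 1) * d = (l - V) * b := by
    intro z l b hz hb
    obtain ⟨d, hd⟩ := (show Reg c z from ⟨b, hb⟩).D
    obtain ⟨e, he⟩ := (show Reg c (D z) from ⟨d, hd⟩).D
    refine ⟨d, hd, ?_⟩
    have h1 := (finPlace c).lim_add ((finPlace c).lim_add ((finPlace c).lim_mul hp he)
      ((finPlace c).lim_mul (asym_zero_iff.mp (asym_q hc α β)) hd)) ((finPlace c).lim_mul hV hb)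
    have h2 := (finPlace c).lim_mul ((finPlace c).lim_const l) hb
    rw [← show (opN u α β γ).apply z = const l * z from hz] at h2
    have := (finPlace c).lim_unique h1 h2
    linear_combination this
  obtain ⟨d, hd, ed⟩ := key hf hfa
  obtain ⟨e, he, ee⟩ := key hy hyb
  have h1 := ((asym_zero_iff.mpr he).sub (((asym_zero_iff.mpr hd).div (asym_zero_iff.mpr hfa)
    ha).mul (asym_zero_iff.mpr hyb)))
  refine asym_zero_iff.mp (h1.congr rfl ?_)
  generalize 2 * c * ((expo c α β : ℝ) + 1) = k at *
  field_simp
  linear_combination a * ee - b * ed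

theorem neg_p_weight : (x ^ 2 - 1) * weight α β = -weight (α + 1) (β + 1) := p_mul_weight α β

theorem State.deg_dar (S : State N lab α β γ u δ f ρ ν lc vm) {y g : RF} {j m k : ℤ} {a v : ℝ}
    (hy : Sol (opN u α β γ) (Lam N j) y) (hne : Lam N j ≠ Lam N (k + γ)) (ha : a ≠ 0)
    (hg : infPlace.Asym g k a) (hv : v ≠ 0) (hm : infPlace.Asym y m v) :
    (m : ℝ) - k ≠ 0 ∧ infPlace.Asym (dar (D g / g) y) (m - 1) ((m - k) * v) := by
  constructor
  · intro h
    have h1 : m = k := by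
      have : ((m - k : ℤ) : ℝ) = 0 := by push_cast; exact h
      have := Int.cast_eq_zero.mp this
      omega
    subst h1
    have h1 := exponent_inf S.asym_u hy hv hm
    rw [Lam_exponent S.sum] at h1
    exact hne h1
  · exact (hm.D.sub (((hg.logDeriv ha).mul hm).congr (by ring) rfl)).congr rfl (by ring)

theorem State.transfers_dar (S : State N lab α β γ u δ f ρ ν lc vm) {k : ℕ}
    (hk : lab k = .circle) {j : ℤ} (hne : Lam N j ≠ Lam N k) :
    Transfers (opN u α β γ) (opN (u + D (f k) / f k) (α + 1) (β + 1) (γ + 1)) (weight α β)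
      (weight (α + 1) (β + 1)) (Lam N j) 1 (dar (D (f k) / f k)) := by
  intro y y0 hy
  have hfk := S.sol k (Or.inl hk)
  have fk0 := S.f_ne (Or.inl hk)
  have hw := mem_Ric_of_sol fk0 hfk
  have hreg : ∀ c : ℝ, c = 1 ∨ c = -1 → (Reg c (dar (D (f k) / f k) y) ↔ Reg c y) := by
    intro c hc
    obtain ⟨a, ha, hfa⟩ := S.lim_f (Or.inl hk) hc
    obtain ⟨d, hd⟩ := (show Reg c (f k) from ⟨a, hfa⟩).D
    have hwl := (asym_zero_iff.mpr hd).div (asym_zero_iff.mpr hfa) ha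
    constructor
    · intro h
      by_contra hn
      obtain ⟨he, v, hv, h1⟩ := pole_of_not_reg hc (S.reg_u c hc) hy y0 hn
      have h2 := ((hwl.mul h1).shift (k := 1) one_pos).congr
        (show 0 - 0 + -(expo c α β : ℤ) - (finPlace c).eps * 1 = -(expo c α β : ℤ) - 1 from by
          change 0 - 0 + -(expo c α β : ℤ) - 1 * 1 = _; ring) rfl
      have h3 := h1.D.sub h2
      refine not_reg_of_asym h3 ?_ (by omega) h
      rw [sub_zero]
      refine mul_ne_zero ?_ hv
      have : (expo c α β : ℝ) ≠ 0 := by exact_mod_cast he.ne'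
      push_cast
      exact neg_ne_zero.mpr this
    · intro h
      exact h.D.sub (Reg.mul (reg_of_asym hwl (by omega)) h)
  refine ⟨dar_ne_zero hw hy y0 hne, ?_, hreg 1 (Or.inl rfl), hreg (-1) (Or.inr rfl), ?_, ?_⟩
  · rw [← opN_step]; exact sol_step hw hy
  · rintro m ⟨v, hv, hm⟩
    obtain ⟨hl, hlc⟩ := S.asym_f k hk
    obtain ⟨h1, h2⟩ := S.deg_dar hy (by rwa [sub_add_cancel]) hl hlc hv hm
    exact ⟨_, mul_ne_zero h1 hv, h2⟩
  · have h1 := class_step hw hy y0 hne p_ne (weight_ne α β) (hW_opN u α β γ)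
    refine ⟨-(Lam N k - Lam N j), -(1 / (y * ((x ^ 2 - 1) * weight α β) *
      dar (D (f k) / f k) y)), ?_⟩
    have h2 : (opN u α β γ).p = x ^ 2 - 1 := rfl
    have h3 : (opN (u + D (f k) / f k) (α + 1) (β + 1) (γ + 1)).p = x ^ 2 - 1 := rfl
    rw [h2] at h1 ⊢
    rw [h3, D_neg, const_neg]
    have h4 : weight (α + 1) (β + 1) = -((x ^ 2 - 1) * weight α β) := by
      rw [neg_p_weight, neg_neg]
    rw [h4]
    have h5 : const (Lam N k - Lam N j) / (dar (D (f k) / f k) y ^ 2 * ((x ^ 2 - 1) *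
        ((x ^ 2 - 1) * weight α β))) = -const (Lam N k - Lam N j) *
        (1 / (dar (D (f k) / f k) y ^ 2 * ((x ^ 2 - 1) * -((x ^ 2 - 1) * weight α β)))) := by
      have := p_ne
      have := weight_ne α β
      have := dar_ne_zero hw hy y0 hne
      field_simp
    rw [h5] at h1
    linear_combination h1

theorem Fam.of_update {k : ℕ} {l : Label} (hl : l ≠ .circle ∧ l ≠ .triangle) {i : ℕ}
    (h : Fam (Function.update lab k l) i) : i ≠ k ∧ Fam lab i := by
  by_cases e : i = k
  · subst e
    simp [Fam] at h
    exact absurd h (by rintro (h | h); exacts [hl.1 h, hl.2 h])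
  · have : (i : ℤ) ≠ k := by exact_mod_cast e
    simp only [Fam, Function.update_of_ne this] at h
    exact ⟨e, h⟩

theorem circle_of_update {k : ℕ} {l : Label} (hl : l ≠ .circle) {i : ℕ}
    (h : Function.update lab k l i = .circle) : i ≠ k ∧ lab i = .circle := by
  by_cases e : i = k
  · subst e
    rw [Function.update_self] at h
    exact absurd h hl
  · have : (i : ℤ) ≠ k := by exact_mod_cast e
    rw [Function.update_of_ne this] at h
    exact ⟨e, h⟩

theorem Lam_ne_of_ne {i k : ℕ} (h : i ≠ k) : Lam N i ≠ Lam N k := by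
  intro e
  have := Lam_inj (N := N) (i := (i : ℤ)) (j := (k : ℤ)) (by omega) (by omega) e
  omega

theorem Lam_ne_of_ne' {j : ℤ} {k : ℕ} (hj : -(N + 1 : ℤ) ≤ 2 * j) (h : j ≠ k) :
    Lam N j ≠ Lam N k := fun e => h (Lam_inj hj (by omega) e)

theorem State.rho_asym (S : State N lab α β γ u δ f ρ ν lc vm) {k : ℕ} (hk : lab k = .circle)
    (t : ℝ) : ∃ v, v ≠ 0 ∧
    infPlace.Asym (const t + ρ k k) (2 * (k - γ) + α + β + 1) v ∧
    v * ((2 * (k - γ) + α + β + 1 : ℤ) : ℝ) = lc k ^ 2 * (-1) ^ α := by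
  obtain ⟨hl, h⟩ := S.asym_f k hk
  have hD : infPlace.Asym (D (const t + ρ k k)) (2 * (k - γ) + α + β) (lc k ^ 2 * (-1) ^ α) := by
    rw [D_add, D_const, zero_add, S.D_rho k k (Or.inl hk) (Or.inl hk)]
    exact ((h.mul h).mul (asym_inf_weight α β)).congr (by ring) (by ring)
  have hs := S.sum
  have hpos : (0 : ℤ) < 2 * (k - γ) + α + β + 1 := by omega
  have h1 := asym_primitive hD hpos (fun h => by change (-1 : ℤ) = 1 at h; omega)
  have hne : ((2 * (k - γ) + α + β + 1 : ℤ) : ℝ) ≠ 0 := by exact_mod_cast hpos.ne'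
  refine ⟨_, ?_, h1, ?_⟩
  · refine div_ne_zero (mul_ne_zero (pow_ne_zero _ hl) (pow_ne_zero _ (by norm_num))) ?_
    push_cast at hne ⊢
    exact hne
  · push_cast at hne ⊢
    field_simp

/-- The Darboux step with the quasi-polynomial seed `f k`. -/
theorem State.darboux (S : State N lab α β γ u δ f ρ ν lc vm) {k : ℕ} (hk : lab k = .circle) :
    State N (Function.update lab k .bullet) (α + 1) (β + 1) (γ + 1) (u + D (f k) / f k)
      (δ + (k - γ)) (fun i => dar (D (f k) / f k) (f i))
      (fun i j => const (Lam N j - Lam N k) * ρ i j -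
        (x ^ 2 - 1) * weight α β * f i * dar (D (f k) / f k) (f j))
      (fun i => (Lam N i - Lam N k) * ν i) (fun i => ((i : ℝ) - k) * lc i)
      (fun i => vm i * (Lam N k - Lam N i) / (2 * (β + 1))) := by
  have hK : Fam lab k := Or.inl hk
  have hfk := S.sol k hK
  have fk0 := S.f_ne hK
  have hw := mem_Ric_of_sol fk0 hfk
  have hb : Label.bullet ≠ .circle ∧ Label.bullet ≠ .triangle := ⟨by simp, by simp⟩
  obtain ⟨hl, hlc⟩ := S.asym_f k hk
  have hs := S.sum
  have hlimdar : ∀ c : ℝ, c = 1 ∨ c = -1 → ∀ i, i ≠ k → Fam lab i →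
      ∃ v, v ≠ 0 ∧ (finPlace c).Lim (dar (D (f k) / f k) (f i)) v := by
    intro c hc i hik hi
    obtain ⟨a, ha, hfa⟩ := S.lim_f hK hc
    obtain ⟨b, hb, hfb⟩ := S.lim_f hi hc
    refine ⟨_, ?_, dar_lim hc (S.reg_u c hc) hfk (S.sol i hi) ha hfa hfb⟩
    refine div_ne_zero (mul_ne_zero hb (sub_ne_zero.mpr (Lam_ne_of_ne hik))) (mul_ne_zero ?_ ?_)
    · rcases hc with rfl | rfl <;> norm_num
    · positivity
  have hpW0 : ∀ c : ℝ, c = 1 ∨ c = -1 → ∀ i j, i ≠ k → j ≠ k → Fam lab i → Fam lab j →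
      (finPlace c).Lim ((x ^ 2 - 1) * weight α β * f i * dar (D (f k) / f k) (f j)) 0 := by
    intro c hc i j hik hjk hi hj
    obtain ⟨a, ha, hfa⟩ := S.lim_f hi hc
    obtain ⟨b, hb, hfb⟩ := hlimdar c hc j hjk hj
    have hp : (finPlace c).Lim (x ^ 2 - 1) 0 :=
      asym_zero_iff.mp ((asym_p hc).shift (k := 1) one_pos)
    obtain ⟨w, hw⟩ := reg_weight c α β
    have := (finPlace c).lim_mul ((finPlace c).lim_mul ((finPlace c).lim_mul hp hw) hfa) hfb
    simpa using this
  refine ⟨by omega, ?_, ?_, ?_, ?_, ?_, ?_, ?_, ?_, ?_, ?_, ?_, ?_, ?_⟩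
  · intro c hc
    obtain ⟨a, ha, hfa⟩ := S.lim_f hK hc
    exact (S.reg_u c hc).add ((reg_logDeriv_iff (asym_zero_iff.mpr hfa) ha).mpr rfl)
  · exact (S.asym_u.add (hlc.logDeriv hl)).congr rfl (by push_cast; ring)
  · intro i hi
    obtain ⟨hik, hi⟩ := hi.of_update hb
    rw [← opN_step]; exact sol_step hw (S.sol i hi)
  · intro i hi
    obtain ⟨hik, hi⟩ := hi.of_update hb
    exact hlimdar 1 (Or.inl rfl) i hik hi
  · intro i hi
    obtain ⟨hik, hi⟩ := hi.of_update hb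
    obtain ⟨ha, hfa⟩ := S.lim_neg k hK
    obtain ⟨hb, hfb⟩ := S.lim_neg i hi
    have hL := sub_ne_zero.mpr (Lam_ne_of_ne (N := N) hik).symm
    refine ⟨div_ne_zero (mul_ne_zero hb hL) (by positivity), ?_⟩
    have := dar_lim (Or.inr rfl) (S.reg_u _ (Or.inr rfl)) hfk (S.sol i hi) ha hfa hfb
    rw [expo_neg_one] at this
    convert this using 1
    rw [div_eq_div_iff (by positivity) (by
      apply mul_ne_zero (by norm_num); positivity)]
    ring
  · intro i hi
    obtain ⟨hik, hi⟩ := circle_of_update hb.1 hi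
    obtain ⟨hl', hlc'⟩ := S.asym_f i hi
    have hn := Lam_ne_of_ne (N := N) hik
    obtain ⟨h1, h2⟩ := S.deg_dar (S.sol i (Or.inl hi)) (by rwa [sub_add_cancel]) hl hlc hl' hlc'
    refine ⟨mul_ne_zero (sub_ne_zero.mpr (by exact_mod_cast hik)) hl', h2.congr ?_ ?_⟩
    · push_cast; ring
    · push_cast; ring
  · intro i hi c hc
    obtain ⟨hik, hi⟩ := circle_of_update hb.1 hi
    exact (S.transfers_dar hk (Lam_ne_of_ne hik)).not_lExact (S.f_ne (Or.inl hi))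
      (S.sol i (Or.inl hi)) (S.not_lExact i hi c hc)
  · intro i j hi hj
    obtain ⟨hik, hi⟩ := hi.of_update hb
    obtain ⟨hjk, hj⟩ := hj.of_update hb
    have h1 := adj_dar_sol hw (S.sol j hj)
    unfold Diff2.adj at h1
    have hW := hW_opN u α β γ
    rw [D_sub, D_const_mul, S.D_rho i j hi hj, D_mul, D_mul]
    have h2 : dar (D (f k) / f k) (f i) = D (f i) - D (f k) / f k * f i := rfl
    have h3 : (opN u α β γ).p = x ^ 2 - 1 := rfl
    have h4 : weight (α + 1) (β + 1) = -((x ^ 2 - 1) * weight α β) := by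
      rw [neg_p_weight, neg_neg]
    rw [h3] at hW h1
    rw [h2, h4, hW]
    linear_combination (-f i * weight α β) * h1
  · intro i j hi hj
    obtain ⟨hik, hi⟩ := hi.of_update hb
    obtain ⟨hjk, hj⟩ := hj.of_update hb
    have h1 := (finPlace (-1)).lim_mul ((finPlace (-1)).lim_const (Lam N j - Lam N k))
      (S.rho_neg i j hi hj)
    have h2 := hpW0 (-1) (Or.inr rfl) i j hik hjk hi hj
    have := (asym_zero_iff.mpr h1).sub (asym_zero_iff.mpr h2)
    exact asym_zero_iff.mp (this.congr rfl (by ring))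
  · intro i j hi hj
    obtain ⟨hik, hi⟩ := hi.of_update hb
    obtain ⟨hjk, hj⟩ := hj.of_update hb
    have h1 := (finPlace 1).lim_mul ((finPlace 1).lim_const (Lam N j - Lam N k))
      (S.rho_one i j hi hj)
    have h2 := hpW0 1 (Or.inl rfl) i j hik hjk hi hj
    have := (asym_zero_iff.mpr h1).sub (asym_zero_iff.mpr h2)
    refine asym_zero_iff.mp (this.congr rfl ?_)
    split_ifs with e
    · rw [e]; ring
    · ring
  · intro i hi
    obtain ⟨hik, hi⟩ := hi.of_update hb
    exact mul_ne_zero (sub_ne_zero.mpr (Lam_ne_of_ne hik)) (S.nu_ne i hi)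
  · intro j hj
    by_cases hjk : j = k
    · subst hjk
      rw [Function.update_self]
      have hp := p_ne
      have hW0 := weight_ne α β
      have hpW := mul_ne_zero hp hW0
      have hg : ∀ R : RF, (∃ c, D R = const c * (f k ^ 2 * weight α β)) →
          Sol (opN (u + D (f k) / f k) (α + 1) (β + 1) (γ + 1)) (Lam N k)
            (R / ((x ^ 2 - 1) * weight α β * f k)) := by
        rintro R ⟨c, hR⟩
        rw [← opN_step]
        exact sol_step_seed hfk fk0 hp hW0 (hW_opN u α β γ) hR
      have hDρ := S.D_rho k k hK hK
      have hend : ∀ c : ℝ, c = 1 ∨ c = -1 → ∃ v, v ≠ 0 ∧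
          (finPlace c).Asym ((x ^ 2 - 1) * weight α β * f k) (expo c α β + 1) v := by
        intro c hc
        obtain ⟨v, hv, h1⟩ := asym_pW hc α β
        obtain ⟨a, ha, h2⟩ := S.lim_f hK hc
        exact ⟨_, mul_ne_zero hv ha, (h1.mul (asym_zero_iff.mpr h2)).congr (add_zero _) rfl⟩
      have hpole : ∀ c : ℝ, c = 1 ∨ c = -1 → ∀ R : RF, ∀ a : ℝ, a ≠ 0 → (finPlace c).Lim R a →
          ¬ Reg c (R / ((x ^ 2 - 1) * weight α β * f k)) := by
        intro c hc R a ha hR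
        obtain ⟨v, hv, h1⟩ := hend c hc
        exact not_reg_of_asym ((asym_zero_iff.mpr hR).div h1 hv) (div_ne_zero ha hv) (by omega)
      have hreg : ∀ c : ℝ, c = 1 ∨ c = -1 → ∀ R : RF, (finPlace c).Lim R 0 →
          D R = f k * f k * weight α β → Reg c (R / ((x ^ 2 - 1) * weight α β * f k)) := by
        intro c hc R hR hDR
        obtain ⟨v, hv, h1⟩ := hend c hc
        obtain ⟨w, hw, h2⟩ := asym_weight hc α β
        obtain ⟨a, ha, h3⟩ := S.lim_f hK hc
        have h3 := asym_zero_iff.mpr h3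
        have h4 := (h3.mul h3).mul h2
        rw [← hDR] at h4
        have h5 := asym_primitive h4 (by omega) (fun _ => hR)
        exact reg_of_asym (h5.div h1 hv) (by omega)
      have hdeg : infPlace.Asym ((x ^ 2 - 1) * weight α β * f k) (k + N + γ + 2)
          (1 * (-1) ^ α * lc k) :=
        ((asym_inf_p.mul (asym_inf_weight α β)).mul hlc).congr (by
          have : (α : ℤ) + β = N + 2 * γ := by exact_mod_cast hs
          linear_combination this) rfl
      have hd0 : (1 : ℝ) * (-1) ^ α * lc k ≠ 0 :=
        mul_ne_zero (mul_ne_zero one_ne_zero (pow_ne_zero _ (by norm_num))) hl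
      have hdegρ : ∀ t : ℝ, Deg ((const t + ρ k k) / ((x ^ 2 - 1) * weight α β * f k))
          ((k : ℤ) - (γ + 1 : ℕ)) := by
        intro t
        obtain ⟨v, hv, h1, -⟩ := S.rho_asym hk t
        refine ⟨_, div_ne_zero hv hd0, (h1.div hdeg hd0).congr ?_ rfl⟩
        have : (α : ℤ) + β = N + 2 * γ := by exact_mod_cast hs
        push_cast
        linear_combination this
      have hne : ∀ t : ℝ, (const t + ρ k k) / ((x ^ 2 - 1) * weight α β * f k) ≠ 0 := by
        intro t
        obtain ⟨v, hv, h1⟩ := hdegρ t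
        exact h1.ne_zero hv
      have hDt : ∀ t : ℝ, D (const t + ρ k k) = f k * f k * weight α β := by
        intro t; rw [D_add, D_const, zero_add, hDρ]
      have hsolt : ∀ t : ℝ, Sol (opN (u + D (f k) / f k) (α + 1) (β + 1) (γ + 1)) (Lam N k)
            ((const t + ρ k k) / ((x ^ 2 - 1) * weight α β * f k)) :=
        fun t => hg _ ⟨1, by rw [hDt, const_one]; ring⟩
      have hl1 : ∀ t : ℝ, (finPlace 1).Lim (const t + ρ k k) (t + ν k) := by
        intro t
        have := (finPlace 1).lim_add ((finPlace 1).lim_const t) (S.rho_one k k hK hK)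
        rwa [if_pos rfl] at this
      have hl2 : ∀ t : ℝ, (finPlace (-1)).Lim (const t + ρ k k) t := by
        intro t
        have := (finPlace (-1)).lim_add ((finPlace (-1)).lim_const t) (S.rho_neg k k hK hK)
        rwa [add_zero] at this
      have hν := S.nu_ne k hK
      refine ⟨⟨_, hne 0, hsolt 0, ?_, ?_, hdegρ 0, fun h => h.elim⟩,
        ⟨_, hne (-ν k), hsolt (-ν k), ?_, ?_, hdegρ (-ν k), fun h => h.elim⟩,
        ⟨1 / ((x ^ 2 - 1) * weight α β * f k), div_ne_zero one_ne_zero (mul_ne_zero hpW fk0),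
          hg 1 ⟨0, by rw [D_one, const_zero, zero_mul]⟩, ?_, ?_, ?_, fun h => h.elim⟩⟩
      · exact iff_false_intro (hpole 1 (Or.inl rfl) _ _ (by rwa [zero_add]) (hl1 0))
      · exact iff_true_intro (hreg (-1) (Or.inr rfl) _ (hl2 0) (hDt 0))
      · exact iff_true_intro (hreg 1 (Or.inl rfl) _
          (by have := hl1 (-ν k); rwa [neg_add_cancel] at this) (hDt _))
      · exact iff_false_intro (hpole (-1) (Or.inr rfl) _ _ (neg_ne_zero.mpr hν) (hl2 _))
      · exact iff_false_intro (hpole 1 (Or.inl rfl) _ _ one_ne_zero Place.lim_one)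
      · exact iff_false_intro (hpole (-1) (Or.inr rfl) _ _ one_ne_zero Place.lim_one)
      · refine ⟨_, div_ne_zero one_ne_zero hd0,
          ((asym_zero_iff.mpr Place.lim_one).div hdeg hd0).congr ?_ rfl⟩
        push_cast; ring
    · rw [Function.update_of_ne hjk]
      have := (S.diag j hj).transfer (S.transfers_dar hk (Lam_ne_of_ne' hj hjk))
      convert this using 1 <;> push_cast <;> ring
  · intro lam h
    by_cases e : lam = Lam N k
    · exact ⟨k, e⟩
    · obtain ⟨v, hv⟩ := h
      rw [← opN_step] at hv
      exact S.ric lam (ric_of_ric_step hw hv e)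

end

end
end ExcJacobi

namespace ExcJacobi
noncomputable section

open Place

/-! ### The confluent steps -/

/-- The eigenfunctions after a confluent step. -/
def confF (f : ℕ → RF) (ρ : ℕ → ℕ → RF) (l : ℕ) (t : ℝ) (i : ℕ) : RF :=
  f i - f l * ρ l i / (const t + ρ l l)

/-- The primitives after a confluent step. -/
def confRho (ρ : ℕ → ℕ → RF) (l : ℕ) (t : ℝ) (i j : ℕ) : RF :=
  ρ i j - ρ l i * ρ l j / (const t + ρ l l)

section

variable {N : ℕ} {lab : ℤ → Label} {α β γ : ℕ} {u : RF} {δ : ℤ} {f : ℕ → RF}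
  {ρ : ℕ → ℕ → RF} {ν lc vm : ℕ → ℝ}

theorem State.r_ne (S : State N lab α β γ u δ f ρ ν lc vm) {l : ℕ} (hl : lab l = .circle) (t : ℝ) :
    const t + ρ l l ≠ 0 := by
  obtain ⟨v, hv, h, -⟩ := S.rho_asym hl t
  exact h.ne_zero hv

theorem State.D_r (S : State N lab α β γ u δ f ρ ν lc vm) {l : ℕ} (hl : lab l = .circle) (t : ℝ) :
    D (const t + ρ l l) = f l ^ 2 * weight α β := by
  rw [D_add, D_const, zero_add, S.D_rho l l (Or.inl hl) (Or.inl hl)]; ring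

theorem State.confF_eq (S : State N lab α β γ u δ f ρ ν lc vm) (C : Comm N lab α β f ρ) {l i : ℕ}
    (hl : lab l = .circle) (hi : Fam lab i) (hil : i ≠ l) (t : ℝ) :
    confF f ρ l t i = gmap (opN u α β γ) (weight α β) (f l) (const t + ρ l l)
      (Lam N l - Lam N i) (f i) := by
  have h1 := C l i (Or.inl hl) hi
  have hk := const_ne_zero (sub_ne_zero.mpr (Lam_ne_of_ne (N := N) hil).symm)
  have hr := S.r_ne hl t
  unfold confF gmap
  change _ = f i - f l * ((x ^ 2 - 1) * weight α β * (D (f l) * f i - f l * D (f i))) / _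
  rw [← h1]
  field_simp

theorem State.confF_self (S : State N lab α β γ u δ f ρ ν lc vm) {l : ℕ}
    (hl : lab l = .circle) (t : ℝ) :
    confF f ρ l t l = const t * (f l / (const t + ρ l l)) := by
  have hr := S.r_ne hl t
  unfold confF
  field_simp
  ring

theorem State.D_confRho (S : State N lab α β γ u δ f ρ ν lc vm) {l i j : ℕ}
    (hl : lab l = .circle) (hi : Fam lab i) (hj : Fam lab j) (t : ℝ) :
    D (confRho ρ l t i j) = confF f ρ l t i * confF f ρ l t j * weight α β := by
  have hr := S.r_ne hl t
  unfold confRho confF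
  rw [D_sub, D_quot _ _ hr, D_mul, S.D_r hl, S.D_rho i j hi hj, S.D_rho l i (Or.inl hl) hi,
    S.D_rho l j (Or.inl hl) hj]
  field_simp
  ring

theorem State.comm_conf (S : State N lab α β γ u δ f ρ ν lc vm) (C : Comm N lab α β f ρ)
    {l i j : ℕ} (hl : lab l = .circle) (hi : Fam lab i) (hj : Fam lab j) (t : ℝ) :
    const (Lam N i - Lam N j) * confRho ρ l t i j = (x ^ 2 - 1) * weight α β *
      (D (confF f ρ l t i) * confF f ρ l t j - confF f ρ l t i * D (confF f ρ l t j)) := by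
  have hr := S.r_ne hl t
  have h1 := C i j hi hj
  have h2 := C l i (Or.inl hl) hi
  have h3 := C l j (Or.inl hl) hj
  unfold confRho confF
  rw [D_sub, D_sub, D_quot _ _ hr, D_quot _ _ hr, D_mul, D_mul, S.D_r hl,
    S.D_rho l i (Or.inl hl) hi, S.D_rho l j (Or.inl hl) hj]
  simp only [const_sub] at h1 h2 h3 ⊢
  generalize const t + ρ l l = r at *
  field_simp
  linear_combination r ^ 3 * h1 + r ^ 2 * ρ l j * h2 - r ^ 2 * ρ l i * h3

theorem State.transfers_reg (S : State N lab α β γ u δ f ρ ν lc vm) {l : ℕ}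
    (hl : lab l = .circle) {t : ℝ} {c : ℝ} (hc : c = 1 ∨ c = -1) {a : ℝ} (ha : a ≠ 0)
    (hr : (finPlace c).Lim (const t + ρ l l) a) {j : ℤ} (hne : Lam N j ≠ Lam N l) {y : RF}
    (y0 : y ≠ 0) (hy : Sol (opN u α β γ) (Lam N j) y) :
    Reg c (gmap (opN u α β γ) (weight α β) (f l) (const t + ρ l l) (Lam N l - Lam N j) y) ↔
      Reg c y := by
  obtain ⟨s, v, hv, h⟩ := (finPlace c).exists_asym y0
  obtain ⟨b, hb, hfb⟩ := S.lim_f (Or.inl hl) hc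
  obtain ⟨d, hd⟩ := (show Reg c (f l) from ⟨b, hfb⟩).D
  obtain ⟨w, hw, hpw⟩ := asym_pW hc α β
  have hfb := asym_zero_iff.mpr hfb
  have hk := sub_ne_zero.mpr hne.symm
  have h1 := (((asym_zero_iff.mpr hd).mul h).shift (k := 1) one_pos).congr
    (show 0 + s - (finPlace c).eps * 1 = s - 1 from by change 0 + s - 1 * 1 = _; ring) rfl
  have h2 := (hfb.mul h.D).congr (zero_add (s - 1)) rfl
  have h3 := ((hfb.mul (hpw.mul (h1.sub h2))).div ((asym_zero_iff.mpr hr).const_mul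
    (Lam N l - Lam N j)) (mul_ne_zero hk ha))
  have hs : 0 ≤ (expo c α β : ℤ) + s := by
    rcases exponent_fin hc (S.reg_u c hc) hy hv h with e | e <;> omega
  have h4 : Reg c _ := reg_of_asym h3 (by omega)
  constructor
  · intro h5
    have := h5.add h4
    change Reg c (y - f l * ((x ^ 2 - 1) * weight α β * (D (f l) * y - f l * D y)) / _ + _) at this
    rwa [sub_add_cancel] at this
  · intro h5
    exact h5.sub h4

/-- The order of the transform at an end point where `r` vanishes. -/
theorem State.transfers_pole (S : State N lab α β γ u δ f ρ ν lc vm) {l : ℕ}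
    (hl : lab l = .circle) {t : ℝ} {c : ℝ} (hc : c = 1 ∨ c = -1)
    (hr : (finPlace c).Lim (const t + ρ l l) 0) {j : ℤ} (hne : Lam N j ≠ Lam N l) {y : RF}
    (y0 : y ≠ 0) (hy : Sol (opN u α β γ) (Lam N j) y) :
    (Reg c y → Reg c (gmap (opN u α β γ) (weight α β) (f l) (const t + ρ l l)
      (Lam N l - Lam N j) y)) ∧
    (¬ Reg c y → ∃ v, v ≠ 0 ∧ (finPlace c).Asym (gmap (opN u α β γ) (weight α β) (f l)
      (const t + ρ l l) (Lam N l - Lam N j) y) (-(expo c α β : ℤ) - 1) v) := by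
  obtain ⟨b, hb, hfb⟩ := S.lim_f (Or.inl hl) hc
  obtain ⟨d, hd⟩ := (show Reg c (f l) from ⟨b, hfb⟩).D
  obtain ⟨w, hw, hpw⟩ := asym_pW hc α β
  obtain ⟨w', hw', hW⟩ := asym_weight hc α β
  have hfb := asym_zero_iff.mpr hfb
  have hk := sub_ne_zero.mpr hne.symm
  have hDr := (hfb.pow 2).mul hW
  rw [← S.D_r hl t] at hDr
  have hr1 := (asym_primitive hDr (by omega) (fun _ => hr)).congr
    (show _ = (expo c α β : ℤ) + 1 from by ring) rfl
  have hr0 : b ^ 2 * w' / ((((2 : ℕ) : ℤ) * 0 + (expo c α β : ℤ) : ℤ) + 1 : ℝ) ≠ 0 := by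
    refine div_ne_zero (mul_ne_zero (pow_ne_zero _ hb) hw') ?_
    push_cast
    positivity
  constructor
  · rintro ⟨v, hv⟩
    obtain ⟨v', hv'⟩ := (show Reg c y from ⟨v, hv⟩).D
    have h1 := ((asym_zero_iff.mpr hd).mul (asym_zero_iff.mpr hv)).sub
      (hfb.mul (asym_zero_iff.mpr hv'))
    have h2 := (hfb.mul (hpw.mul h1)).div (hr1.const_mul (Lam N l - Lam N j)) (mul_ne_zero hk hr0)
    exact Reg.sub ⟨v, hv⟩ (reg_of_asym h2 (by omega))
  · intro hn
    obtain ⟨he, v, hv, h⟩ := pole_of_not_reg hc (S.reg_u c hc) hy y0 hn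
    have h1 := (((asym_zero_iff.mpr hd).mul h).shift (k := 1) one_pos).congr
      (show 0 + -(expo c α β : ℤ) - (finPlace c).eps * 1 = -(expo c α β : ℤ) - 1 from by
        change 0 + -(expo c α β : ℤ) - 1 * 1 = _; ring) rfl
    have h2 := (hfb.mul h.D).congr (zero_add (-(expo c α β : ℤ) - 1)) rfl
    have h3 := ((hfb.mul (hpw.mul (h1.sub h2))).div (hr1.const_mul
      (Lam N l - Lam N j)) (mul_ne_zero hk hr0)).congr
      (show _ = -(expo c α β : ℤ) - 1 from by ring) rfl
    have h4 := (h.shift (k := 1) one_pos).congr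
      (show -(expo c α β : ℤ) - (finPlace c).eps * 1 = -(expo c α β : ℤ) - 1 from by
        change -(expo c α β : ℤ) - 1 * 1 = _; ring) rfl
    refine ⟨_, ?_, h4.sub h3⟩
    rw [zero_sub, neg_ne_zero]
    refine div_ne_zero (mul_ne_zero hb (mul_ne_zero hw ?_)) (mul_ne_zero hk hr0)
    rw [zero_sub, neg_ne_zero]
    have : (expo c α β : ℝ) ≠ 0 := by exact_mod_cast he.ne'
    refine mul_ne_zero hb (mul_ne_zero ?_ hv)
    push_cast
    exact neg_ne_zero.mpr this

theorem State.gmap_asym (S : State N lab α β γ u δ f ρ ν lc vm) {l : ℕ}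
    (hl : lab l = .circle) {t : ℝ} {j : ℤ} (hne : Lam N j ≠ Lam N l) {y : RF}
    (hy : Sol (opN u α β γ) (Lam N j) y) {m : ℤ} {v : ℝ} (hv : v ≠ 0)
    (hm : infPlace.Asym y m v) :
    (m : ℝ) + γ - l ≠ 0 ∧ (m : ℝ) + γ + l + N + 1 ≠ 0 ∧
    infPlace.Asym (gmap (opN u α β γ) (weight α β) (f l) (const t + ρ l l)
      (Lam N l - Lam N j) y) m (v * ((m + γ - l) / (m + γ + l + N + 1))) := by
  obtain ⟨hlc, hf⟩ := S.asym_f l hl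
  obtain ⟨w, hw, hr, hwe⟩ := S.rho_asym hl t
  have hL : Lam N j = Lam N (m + γ) := by
    rw [exponent_inf S.asym_u hy hv hm, Lam_exponent S.sum]
  have hprod : Lam N l - Lam N j = (l - (m + γ)) * (m + γ + l + N + 1) := by
    rw [hL, Lam_sub]; push_cast; ring
  have hk := sub_ne_zero.mpr hne.symm
  have h0 := hk
  rw [hprod] at h0
  have hd := right_ne_zero_of_mul h0
  have hn := left_ne_zero_of_mul h0
  refine ⟨fun h => hn (by linear_combination -h), hd, ?_⟩
  have h1 := (hf.D.mul hm).congr (show _ = (l : ℤ) - γ + m - 1 from by ring) rfl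
  have h2 := (hf.mul hm.D).congr (show _ = (l : ℤ) - γ + m - 1 from by ring) rfl
  have h3 := (hf.mul ((asym_inf_p.mul (asym_inf_weight α β)).mul (h1.sub h2))).div
    (hr.const_mul (Lam N l - Lam N j)) (mul_ne_zero hk hw)
  have h4 := h3.congr (show _ = m from by ring) rfl
  refine (hm.sub h4).congr rfl ?_
  have hs : (α : ℝ) + β = N + 2 * γ := by exact_mod_cast S.sum
  have hwe' : w * (2 * l + N + 1) = lc l ^ 2 * (-1) ^ α := by
    rw [← hwe]; push_cast; linear_combination (-w) * hs
  have hq : (2 * (l : ℝ) + N + 1) ≠ 0 := by positivity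
  rw [hprod]
  push_cast
  have hww : w = lc l ^ 2 * (-1) ^ α / (2 * l + N + 1) := by
    rw [← hwe']; field_simp
  rw [hww]
  have h5 : ((-1 : ℝ)) ^ α ≠ 0 := pow_ne_zero _ (by norm_num)
  field_simp
  ring

theorem State.transfers_double (S : State N lab α β γ u δ f ρ ν lc vm) {l : ℕ}
    (hl : lab l = .circle) {t : ℝ} (h1 : t ≠ 0) (h2 : t + ν l ≠ 0) {j : ℤ}
    (hne : Lam N j ≠ Lam N l) :
    Transfers (opN u α β γ)
      (opN (u + D (const t + ρ l l) / (const t + ρ l l)) α β γ) (weight α β) (weight α β)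
      (Lam N j) 0 (gmap (opN u α β γ) (weight α β) (f l) (const t + ρ l l)
        (Lam N l - Lam N j)) := by
  intro y y0 hy
  have hL : Fam lab l := Or.inl hl
  obtain ⟨g1, g2, h, hh⟩ := sol_double (T := opN u α β γ) p_ne (weight_ne α β) (hW_opN u α β γ)
    (S.sol l hL) (S.f_ne hL) (S.r_ne hl t) (S.D_r hl t) hy y0 hne
  rw [opN_double] at g1
  have l1 := (finPlace 1).lim_add ((finPlace 1).lim_const t) (S.rho_one l l hL hL)
  have l2 := (finPlace (-1)).lim_add ((finPlace (-1)).lim_const t) (S.rho_neg l l hL hL)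
  rw [if_pos rfl] at l1
  rw [add_zero] at l2
  refine ⟨g2, g1, S.transfers_reg hl (Or.inl rfl) h2 l1 hne y0 hy,
    S.transfers_reg hl (Or.inr rfl) h1 l2 hne y0 hy, ?_, 1, h, ?_⟩
  · rintro m ⟨v, hv, hm⟩
    obtain ⟨e1, e2, e3⟩ := S.gmap_asym (t := t) hl hne hy hv hm
    rw [sub_zero]
    exact ⟨_, mul_ne_zero hv (div_ne_zero e1 e2), e3⟩
  · rw [const_one, one_mul]; exact hh

/-- The new eigenfunction at the eigenvalue of the seed is unique up to scale. -/
theorem State.not_exact_seed (S : State N lab α β γ u δ f ρ ν lc vm) {l : ℕ}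
    (hl : lab l = .circle) {t : ℝ} {c : ℝ} (hc : c = 1 ∨ c = -1) {a : ℝ} (ha : a ≠ 0)
    (hr : (finPlace c).Lim (const t + ρ l l) a) :
    ¬ Exact (1 / ((f l / (const t + ρ l l)) ^ 2 * ((x ^ 2 - 1) * weight α β))) := by
  rintro ⟨h, hh⟩
  have hr0 := S.r_ne hl t
  have hf0 := S.f_ne (i := l) (Or.inl hl)
  obtain ⟨b, hb, hfb⟩ := S.lim_f (Or.inl hl) hc
  have hfb := asym_zero_iff.mpr hfb
  obtain ⟨w, hw, hpw⟩ := asym_pW hc α β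
  obtain ⟨w', hw', hW⟩ := asym_weight hc α β
  refine S.not_lExact l hl c hc ⟨const (a ^ 2)⁻¹ * h, ?_⟩
  set r := const t + ρ l l with hrdef
  have hDr := (hfb.pow 2).mul hW
  rw [← S.D_r hl t, ← hrdef] at hDr
  have hDr' : (finPlace c).Asym (D (r - const a)) (expo c α β) (b ^ 2 * w') := by
    rw [D_sub, D_const, sub_zero]
    exact hDr.congr (by ring) rfl
  have hr1 := asym_primitive hDr' (by omega) (fun _ => by
    have := (asym_zero_iff.mpr hr).sub ((finPlace c).asym_const a)
    exact asym_zero_iff.mp (this.congr rfl (sub_self a)))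
  have hr2 := ((asym_zero_iff.mpr hr).add ((finPlace c).asym_const a))
  have h5 := (((hr2.mul hr1).div ((hfb.pow 2).mul hpw)
    (mul_ne_zero (pow_ne_zero _ hb) hw)).const_mul (-(a ^ 2)⁻¹))
  have h6 : Reg c _ := reg_of_asym h5 (by simp)
  convert h6 using 1
  rw [D_const_mul, hh, const_neg, const_inv, const_pow]
  have ha' := const_ne_zero ha
  have hp := p_ne
  have hw0 := weight_ne α β
  field_simp
  ring

theorem State.asym_u_double (S : State N lab α β γ u δ f ρ ν lc vm) {l : ℕ}
    (hl : lab l = .circle) (t : ℝ) :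
    infPlace.Asym (u + D (const t + ρ l l) / (const t + ρ l l)) (-1)
      ((δ + (2 * l + N + 1) : ℤ) : ℝ) := by
  obtain ⟨v, hv, h, -⟩ := S.rho_asym hl t
  refine (S.asym_u.add (h.logDeriv hv)).congr rfl ?_
  have : (α : ℝ) + β = N + 2 * γ := by exact_mod_cast S.sum
  push_cast
  linear_combination this

theorem Fam.of_update_triangle {k : ℕ} (hk : lab k = .circle) {i : ℕ}
    (h : Fam (Function.update lab k .triangle) i) : Fam lab i := by
  by_cases e : i = k
  · subst e; exact Or.inl hk
  · have : (i : ℤ) ≠ k := by exact_mod_cast e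
    simpa only [Fam, Function.update_of_ne this] using h

/-- The confluent step that preserves the parameters. -/
theorem State.confluent (S : State N lab α β γ u δ f ρ ν lc vm) (C : Comm N lab α β f ρ) {l : ℕ}
    (hl : lab l = .circle) {t : ℝ} (h1 : t ≠ 0) (h2 : t + ν l ≠ 0) :
    State N (Function.update lab l .triangle) α β γ
      (u + D (const t + ρ l l) / (const t + ρ l l)) (δ + (2 * l + N + 1))
      (confF f ρ l t) (confRho ρ l t) (fun i => if i = l then t * ν l / (t + ν l) else ν i)
      (fun i => ((i : ℝ) - l) / (i + l + N + 1) * lc i) vm ∧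
    Comm N (Function.update lab l .triangle) α β (confF f ρ l t) (confRho ρ l t) := by
  have hL : Fam lab l := Or.inl hl
  have hr0 := S.r_ne hl t
  have hf0 := S.f_ne hL
  have l1 := (finPlace 1).lim_add ((finPlace 1).lim_const t) (S.rho_one l l hL hL)
  have l2 := (finPlace (-1)).lim_add ((finPlace (-1)).lim_const t) (S.rho_neg l l hL hL)
  rw [if_pos rfl] at l1
  rw [add_zero] at l2
  have l1' := asym_zero_iff.mpr l1
  have l2' := asym_zero_iff.mpr l2
  have hseed := sol_double_seed (T := opN u α β γ) p_ne (weight_ne α β) (hW_opN u α β γ)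
    (S.sol l hL) hf0 hr0 (S.D_r hl t)
  rw [opN_double] at hseed
  have hone : ∀ i j, Fam lab i → Fam lab j → (finPlace 1).Asym (ρ i j) 0 (if i = j then ν i else 0) :=
    fun i j hi hj => asym_zero_iff.mpr (S.rho_one i j hi hj)
  have hneg : ∀ i j, Fam lab i → Fam lab j → (finPlace (-1)).Asym (ρ i j) 0 0 :=
    fun i j hi hj => asym_zero_iff.mpr (S.rho_neg i j hi hj)
  refine ⟨⟨S.sum, ?_, S.asym_u_double hl t, ?_, ?_, ?_, ?_, ?_, ?_, ?_, ?_, ?_, ?_, ?_⟩, ?_⟩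
  · intro c hc
    refine (S.reg_u c hc).add ?_
    rcases hc with rfl | rfl
    · exact (reg_logDeriv_iff l1' h2).mpr rfl
    · exact (reg_logDeriv_iff l2' h1).mpr rfl
  · intro i hi
    have hi := hi.of_update_triangle hl
    by_cases e : i = l
    · subst e
      rw [S.confF_self hl]
      exact hseed.const_mul t
    · rw [S.confF_eq C hl hi e]
      exact (S.transfers_double hl h1 h2 (Lam_ne_of_ne e) _ (S.f_ne hi) (S.sol i hi)).2.1
  · intro i hi
    have hi := hi.of_update_triangle hl
    obtain ⟨v, hv, h⟩ := S.lim_one i hi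
    obtain ⟨w, hw, hfl⟩ := S.lim_one l hL
    by_cases e : i = l
    · subst e
      rw [S.confF_self hl]
      exact ⟨_, mul_ne_zero h1 (div_ne_zero hv h2), asym_zero_iff.mp
        ((((asym_zero_iff.mpr h).div l1' h2).const_mul t).congr (by ring) rfl)⟩
    · refine ⟨v, hv, ?_⟩
      have := (asym_zero_iff.mpr h).sub ((((asym_zero_iff.mpr hfl).mul
        (hone l i hL hi)).div l1' h2).congr (by ring : (0 : ℤ) + 0 - 0 = 0) rfl)
      rw [if_neg (Ne.symm e)] at this
      exact asym_zero_iff.mp (this.congr rfl (by ring))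
  · intro i hi
    have hi := hi.of_update_triangle hl
    obtain ⟨hv, h⟩ := S.lim_neg i hi
    obtain ⟨w, hfl⟩ := S.lim_neg l hL
    refine ⟨hv, ?_⟩
    have := (asym_zero_iff.mpr h).sub ((((asym_zero_iff.mpr hfl).mul
        (hneg l i hL hi)).div l2' h1).congr (by ring : (0 : ℤ) + 0 - 0 = 0) rfl)
    exact asym_zero_iff.mp (this.congr rfl (by ring))
  · intro i hi
    obtain ⟨e, hi⟩ := circle_of_update (by simp) hi
    obtain ⟨hlc, h⟩ := S.asym_f i hi
    rw [S.confF_eq C hl (Or.inl hi) e]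
    obtain ⟨e1, e2, e3⟩ := S.gmap_asym (t := t) hl (Lam_ne_of_ne e) (S.sol i (Or.inl hi)) hlc h
    push_cast at e1 e2 e3
    rw [sub_add_cancel] at e1 e2 e3
    exact ⟨mul_ne_zero (div_ne_zero e1 e2) hlc, e3.congr rfl (mul_comm _ _)⟩
  · intro i hi c hc
    obtain ⟨e, hi⟩ := circle_of_update (by simp) hi
    rw [S.confF_eq C hl (Or.inl hi) e]
    exact (S.transfers_double hl h1 h2 (Lam_ne_of_ne e)).not_lExact (S.f_ne (Or.inl hi))
      (S.sol i (Or.inl hi)) (S.not_lExact i hi c hc)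
  · intro i j hi hj
    exact S.D_confRho hl (hi.of_update_triangle hl) (hj.of_update_triangle hl) t
  · intro i j hi hj
    have hi := hi.of_update_triangle hl
    have hj := hj.of_update_triangle hl
    have := (hneg i j hi hj).sub ((((hneg l i hL hi).mul (hneg l j hL hj)).div l2' h1).congr
      (by ring : (0 : ℤ) + 0 - 0 = 0) rfl)
    exact asym_zero_iff.mp (this.congr rfl (by ring))
  · intro i j hi hj
    have hi := hi.of_update_triangle hl
    have hj := hj.of_update_triangle hl
    have := (hone i j hi hj).sub ((((hone l i hL hi).mul (hone l j hL hj)).div l1' h2).congr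
      (by ring : (0 : ℤ) + 0 - 0 = 0) rfl)
    refine asym_zero_iff.mp (this.congr rfl ?_)
    by_cases e1 : i = l <;> by_cases e2 : j = l
    · subst e1; subst e2; simp; field_simp; ring
    · subst e1; simp [Ne.symm e2]
    · subst e2; simp [e1, Ne.symm e1]
    · simp [e1, Ne.symm e1, Ne.symm e2]
  · intro i hi
    have hi := hi.of_update_triangle hl
    split_ifs with e
    · exact div_ne_zero (mul_ne_zero h1 (S.nu_ne l hL)) h2
    · exact S.nu_ne i hi
  · intro j hj
    by_cases hjl : j = l
    · subst hjl
      rw [Function.update_self]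
      obtain ⟨w, hw, hfl⟩ := S.lim_one l hL
      obtain ⟨w', hfl'⟩ := S.lim_neg l hL
      refine ⟨_, div_ne_zero hf0 hr0, hseed, iff_true_intro ?_, iff_true_intro ?_, ?_,
        fun _ => S.not_exact_seed hl (Or.inl rfl) h2 l1⟩
      · exact reg_of_asym ((asym_zero_iff.mpr hfl).div l1' h2) (by omega)
      · exact reg_of_asym ((asym_zero_iff.mpr hfl').div l2' h1) (by omega)
      · obtain ⟨v, hv, hr, -⟩ := S.rho_asym hl t
        obtain ⟨hlc, hf⟩ := S.asym_f l hl
        refine ⟨_, div_ne_zero hlc hv, (hf.div hr hv).congr ?_ rfl⟩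
        have : (α : ℤ) + β = N + 2 * γ := by exact_mod_cast S.sum
        linear_combination -this
    · rw [Function.update_of_ne hjl]
      have := (S.diag j hj).transfer (S.transfers_double hl h1 h2 (Lam_ne_of_ne' hj hjl))
      rwa [sub_zero, sub_zero] at this
  · intro lam h
    by_cases e : lam = Lam N l
    · exact ⟨l, e⟩
    · rw [← opN_double] at h
      exact S.ric lam (ric_of_ric_double p_ne (weight_ne α β) (hW_opN u α β γ) (S.sol l hL) hf0 hr0
        (S.D_r hl t) e h)
  · intro i j hi hj
    exact S.comm_conf C hl (hi.of_update_triangle hl) (hj.of_update_triangle hl) t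

theorem weight_bump {α' β' : ℕ} {c : ℝ}
    (h : (c = 1 ∧ α' = α + 2 ∧ β' = β) ∨ (c = -1 ∧ α' = α ∧ β' = β + 2)) :
    weight α' β' = weight α β * (x - const c) ^ 2 := by
  rcases h with ⟨rfl, rfl, rfl⟩ | ⟨rfl, rfl, rfl⟩
  · rw [const_one]; unfold weight; ring
  · rw [const_neg, const_one]; unfold weight; ring

theorem opN_gauge_bump {α' β' : ℕ} {c : ℝ}
    (h : (c = 1 ∧ α' = α + 2 ∧ β' = β) ∨ (c = -1 ∧ α' = α ∧ β' = β + 2)) (u : RF) (γ : ℕ) :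
    (opN u α β γ).gauge (x - const c) =
      opN (u - const (expo c α β + 1) / (x - const c)) α' β' (γ + 1) := by
  rcases h with ⟨rfl, rfl, rfl⟩ | ⟨rfl, rfl, rfl⟩
  · rw [const_one, expo_one]; exact opN_gauge_one u α β' γ
  · rw [const_neg, const_one, sub_neg_eq_add, expo_neg_one]; exact opN_gauge_neg_one u α' β γ

theorem State.lim_rho (S : State N lab α β γ u δ f ρ ν lc vm) {i j : ℕ} (hi : Fam lab i)
    (hj : Fam lab j) (hij : i ≠ j) {c : ℝ} (hc : c = 1 ∨ c = -1) : (finPlace c).Lim (ρ i j) 0 := by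
  rcases hc with rfl | rfl
  · have := S.rho_one i j hi hj
    rwa [if_neg hij] at this
  · exact S.rho_neg i j hi hj

/-- The confluent step with a degenerate parameter, at the end point `c` where `r` vanishes. -/
theorem State.confluent_edge (S : State N lab α β γ u δ f ρ ν lc vm) (C : Comm N lab α β f ρ)
    {l : ℕ} (hl : lab l = .circle) {t c : ℝ} {a : ℝ} (ha : a ≠ 0)
    (hr : (finPlace c).Lim (const t + ρ l l) 0) (hr' : (finPlace (-c)).Lim (const t + ρ l l) a)
    {α' β' : ℕ} {lb : Label} (hlb : (c = 1 ∧ lb = .plus) ∨ (c = -1 ∧ lb = .minus))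
    (h : (c = 1 ∧ α' = α + 2 ∧ β' = β) ∨ (c = -1 ∧ α' = α ∧ β' = β + 2)) :
    ∃ vm', State N (Function.update lab l lb) α' β' (γ + 1)
      (u + D (const t + ρ l l) / (const t + ρ l l) - const (expo c α β + 1) / (x - const c))
      (δ + (2 * l + N + 1) - (expo c α β + 1))
      (fun i => confF f ρ l t i / (x - const c)) (confRho ρ l t) ν
      (fun i => ((i : ℝ) - l) / (i + l + N + 1) * lc i) vm' ∧
    Comm N (Function.update lab l lb) α' β' (fun i => confF f ρ l t i / (x - const c))
      (confRho ρ l t) := by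
  have hc : c = 1 ∨ c = -1 := by rcases h with h | h; exacts [Or.inl h.1, Or.inr h.1]
  have hc' : -c = 1 ∨ -c = -1 := by rcases hc with rfl | rfl <;> simp
  have hcc : -c - c ≠ 0 := by rcases hc with rfl | rfl <;> norm_num
  have hexp : expo c α' β' = expo c α β + 2 := by
    rcases h with ⟨rfl, rfl, rfl⟩ | ⟨rfl, rfl, rfl⟩ <;> simp only [expo_one, expo_neg_one]
  have hboth : ∀ P : ℝ → Prop, P c → P (-c) → P 1 ∧ P (-1) := by
    rcases hc with rfl | rfl
    · exact fun P h1 h2 => ⟨h1, h2⟩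
    · intro P h1 h2; rw [neg_neg] at h2; exact ⟨h2, h1⟩
  have hb : lb ≠ .circle ∧ lb ≠ .triangle := by rcases hlb with ⟨-, rfl⟩ | ⟨-, rfl⟩ <;> simp
  have hL : Fam lab l := Or.inl hl
  have hr0 := S.r_ne hl t
  have hf0 := S.f_ne hL
  have hm0 := x_sub_const_ne c
  have hra := asym_zero_iff.mpr hr'
  have hm' : (finPlace (-c)).Asym (x - const c) 0 (-c - c) := asym_x_sub'
  have hWb := weight_bump h
  have hp := p_ne
  have hW0 := weight_ne α β
  set u1 := u + D (const t + ρ l l) / (const t + ρ l l) with hu1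
  -- the order of `r` at `c`
  have hr1 : ∃ b, b ≠ 0 ∧ (finPlace c).Asym (const t + ρ l l) (expo c α β + 1) b := by
    obtain ⟨b, hb, hfb⟩ := S.lim_f hL hc
    obtain ⟨w', hw', hW⟩ := asym_weight hc α β
    have hDr := ((asym_zero_iff.mpr hfb).pow 2).mul hW
    rw [← S.D_r hl t] at hDr
    refine ⟨_, ?_, (asym_primitive hDr (by omega) (fun _ => hr)).congr (by ring) rfl⟩
    refine div_ne_zero (mul_ne_zero (pow_ne_zero _ hb) hw') ?_
    push_cast
    positivity
  have hregu : ∀ e : ℝ, e = 1 ∨ e = -1 → Reg e (u1 - const (expo c α β + 1) / (x - const c)) := by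
    have : Reg 1 (u1 - const (expo c α β + 1) / (x - const c)) ∧
        Reg (-1) (u1 - const (expo c α β + 1) / (x - const c)) := by
      apply hboth (fun e => Reg e (u1 - const (expo c α β + 1) / (x - const c)))
      · obtain ⟨b, hb, h1⟩ := hr1
        have h2 : (finPlace c).Asym ((const t + ρ l l) / (x - const c) ^ (expo c α β + 1)) 0 b :=
          (h1.div ((asym_x_sub c).pow (expo c α β + 1)) (by simp)).congr (by push_cast; ring)
            (by simp)
        have h3 := (reg_logDeriv_iff h2 hb).mpr rfl
        rw [logDeriv_div hr0 (pow_ne_zero _ hm0), logDeriv_pow hm0, D_sub, D_x, D_const,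
          sub_zero] at h3
        convert (S.reg_u c hc).add h3 using 1
        rw [hu1, const_add, const_natCast, const_one]
        push_cast
        ring
      · have h3 := (reg_logDeriv_iff hra ha).mpr rfl
        exact ((S.reg_u _ hc').add h3).sub
          (reg_of_asym (((finPlace (-c)).asym_const _).div hm' hcc) (by omega))
    rintro e (rfl | rfl)
    exacts [this.1, this.2]
  have hop : (opN u1 α β γ).gauge (x - const c) =
      opN (u1 - const (expo c α β + 1) / (x - const c)) α' β' (γ + 1) := opN_gauge_bump h u1 γ
  -- the transformation at a generic eigenvalue
  have hT : ∀ {j : ℤ}, Lam N j ≠ Lam N l → Transfers (opN u α β γ)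
      (opN (u1 - const (expo c α β + 1) / (x - const c)) α' β' (γ + 1)) (weight α β) (weight α' β')
      (Lam N j) 1 (fun y => gmap (opN u α β γ) (weight α β) (f l) (const t + ρ l l)
        (Lam N l - Lam N j) y / (x - const c)) := by
    intro j hne y y0 hy
    obtain ⟨g1, g2, g, hg⟩ := sol_double (T := opN u α β γ) p_ne (weight_ne α β) (hW_opN u α β γ)
      (S.sol l hL) (S.f_ne hL) (S.r_ne hl t) (S.D_r hl t) hy y0 hne
    have q1 := S.transfers_pole hl hc hr hne y0 hy
    have q2 := S.transfers_reg hl hc' ha hr' hne y0 hy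
    have q3 : ∀ m, Deg y m → Deg (gmap (opN u α β γ) (weight α β) (f l) (const t + ρ l l)
        (Lam N l - Lam N j) y / (x - const c)) (m - 1) := by
      rintro m ⟨v, hv, hm⟩
      obtain ⟨e1, e2, e3⟩ := S.gmap_asym (t := t) hl hne hy hv hm
      have e4 := asym_inf_x_add (-c)
      rw [const_neg, ← sub_eq_add_neg] at e4
      exact ⟨_, div_ne_zero (mul_ne_zero hv (div_ne_zero e1 e2)) one_ne_zero,
        e3.div e4 one_ne_zero⟩
    rw [opN_double, ← hu1] at g1
    set G := gmap (opN u α β γ) (weight α β) (f l) (const t + ρ l l) (Lam N l - Lam N j) y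
    have z0 : G / (x - const c) ≠ 0 := div_ne_zero g2 hm0
    have hz : Sol (opN (u1 - const (expo c α β + 1) / (x - const c)) α' β' (γ + 1)) (Lam N j)
        (G / (x - const c)) := by
      rw [← hop, sol_gauge hm0, mul_div_cancel₀ _ hm0]; exact g1
    obtain ⟨r1, r2⟩ := hboth (fun e => (Reg e (G / (x - const c)) ↔ Reg e y)) (by
      constructor
      · intro h1
        by_contra hn
        obtain ⟨v, hv, h2⟩ := q1.2 hn
        exact not_reg_of_asym (h2.div (asym_x_sub c) one_ne_zero) (by simpa using hv) (by omega) h1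
      · intro h1
        obtain ⟨v, hv⟩ := q1.1 h1
        by_contra hn
        obtain ⟨-, w, hw, h2⟩ := pole_of_not_reg hc (hregu c hc) hz z0 hn
        rw [hexp] at h2
        have h3 := ((asym_zero_iff.mpr hv).div (asym_x_sub c) one_ne_zero).shift
          (k := expo c α β + 1) (by omega)
        have h4 := h3.congr (show 0 - 1 - (finPlace c).eps * ((expo c α β : ℤ) + 1) =
          -((expo c α β + 2 : ℕ) : ℤ) from by
            change 0 - 1 - 1 * ((expo c α β : ℤ) + 1) = _; push_cast; ring) rfl
        exact hw (h2.unique h4)) (by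
      rw [← q2]
      constructor
      · intro h1
        have := h1.mul ⟨_, asym_zero_iff.mp hm'⟩
        rwa [div_mul_cancel₀ _ hm0] at this
      · rintro ⟨v, hv⟩
        exact reg_of_asym ((asym_zero_iff.mpr hv).div hm' hcc) (by omega))
    refine ⟨z0, hz, r1, r2, q3, 1, g, ?_⟩
    rw [const_one, one_mul, hg, hWb]
    congr 2
    change G ^ 2 * ((x ^ 2 - 1) * weight α β) =
      (G / (x - const c)) ^ 2 * ((x ^ 2 - 1) * (weight α β * (x - const c) ^ 2))
    field_simp
  have hsol : ∀ i, i ≠ l → Fam lab i → confF f ρ l t i / (x - const c) ≠ 0 ∧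
      Sol (opN (u1 - const (expo c α β + 1) / (x - const c)) α' β' (γ + 1)) (Lam N i)
        (confF f ρ l t i / (x - const c)) ∧ ∀ e : ℝ, e = 1 ∨ e = -1 →
        ∃ v, v ≠ 0 ∧ (finPlace e).Lim (confF f ρ l t i / (x - const c)) v := by
    intro i hil hi
    obtain ⟨z0, hz, r1, r2, -⟩ := hT (Lam_ne_of_ne hil) _ (S.f_ne hi) (S.sol i hi)
    rw [S.confF_eq C hl hi hil]
    refine ⟨z0, hz, fun e he => unit_of_reg he (hregu e he) hz z0 ?_⟩
    obtain ⟨v, hv, h1⟩ := S.lim_f hi he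
    rcases he with rfl | rfl
    · exact r1.mpr ⟨v, h1⟩
    · exact r2.mpr ⟨v, h1⟩
  have hlimρ : ∀ i j, i ≠ l → j ≠ l → Fam lab i → Fam lab j → ∀ e : ℝ, (e = 1 ∨ e = -1) → ∀ v,
      (finPlace e).Lim (ρ i j) v → (finPlace e).Lim (confRho ρ l t i j) v := by
    intro i j hil hjl hi hj
    have key : ∀ e : ℝ, (e = 1 ∨ e = -1) → (finPlace e).Lim (ρ l i * ρ l j / (const t + ρ l l)) 0 := by
      have : (finPlace 1).Lim (ρ l i * ρ l j / (const t + ρ l l)) 0 ∧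
          (finPlace (-1)).Lim (ρ l i * ρ l j / (const t + ρ l l)) 0 := by
        apply hboth (fun e => (finPlace e).Lim (ρ l i * ρ l j / (const t + ρ l l)) 0)
        · obtain ⟨b, hb, h1⟩ := hr1
          obtain ⟨w', hw', hW⟩ := asym_weight hc α β
          have h2 : ∀ k, k ≠ l → Fam lab k → ∃ v, (finPlace c).Asym (ρ l k) (expo c α β + 1) v := by
            intro k hkl hk
            obtain ⟨v1, -, hv1⟩ := S.lim_f hL hc
            obtain ⟨v2, -, hv2⟩ := S.lim_f hk hc
            have hD := ((asym_zero_iff.mpr hv1).mul (asym_zero_iff.mpr hv2)).mul hW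
            rw [← S.D_rho l k hL hk] at hD
            exact ⟨_, (asym_primitive hD (by omega)
              (fun _ => S.lim_rho hL hk (Ne.symm hkl) hc)).congr (by ring) rfl⟩
          obtain ⟨v1, g1⟩ := h2 i hil hi
          obtain ⟨v2, g2⟩ := h2 j hjl hj
          have h3 := ((g1.mul g2).div h1 hb).shift (k := expo c α β + 1) (by omega)
          exact asym_zero_iff.mp (h3.congr (by
            change _ - 1 * ((expo c α β : ℤ) + 1) = 0; ring) rfl)
        · have h1 := asym_zero_iff.mpr (S.lim_rho hL hi (Ne.symm hil) hc')
          have h2 := asym_zero_iff.mpr (S.lim_rho hL hj (Ne.symm hjl) hc')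
          exact asym_zero_iff.mp (((h1.mul h2).div hra ha).congr (by ring) (by ring))
      rintro e (rfl | rfl)
      exacts [this.1, this.2]
    intro e he v hv
    have := (asym_zero_iff.mpr hv).sub (asym_zero_iff.mpr (key e he))
    exact asym_zero_iff.mp (this.congr rfl (sub_zero v))
  have hvm : ∀ i, ∃ v, Fam (Function.update lab l lb) i → v ≠ 0 ∧
      (finPlace (-1)).Lim (confF f ρ l t i / (x - const c)) v := by
    intro i
    by_cases hi : Fam (Function.update lab l lb) i
    · obtain ⟨hil, hi⟩ := hi.of_update hb
      obtain ⟨v, hv⟩ := (hsol i hil hi).2.2 (-1) (Or.inr rfl)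
      exact ⟨v, fun _ => hv⟩
    · exact ⟨0, fun h => absurd h hi⟩
  choose vm' hvm' using hvm
  refine ⟨vm', ⟨?_, hregu, ?_, ?_, ?_, hvm', ?_, ?_, ?_, ?_, ?_, ?_, ?_, ?_⟩, ?_⟩
  · have := S.sum
    rcases h with ⟨-, rfl, rfl⟩ | ⟨-, rfl, rfl⟩ <;> omega
  · have e4 := asym_inf_x_add (-c)
    rw [const_neg, ← sub_eq_add_neg] at e4
    exact ((S.asym_u_double hl t).sub ((infPlace.asym_const _).div e4 one_ne_zero)).congr rfl
      (by push_cast; ring)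
  · intro i hi
    obtain ⟨hil, hi⟩ := hi.of_update hb
    exact (hsol i hil hi).2.1
  · intro i hi
    obtain ⟨hil, hi⟩ := hi.of_update hb
    exact (hsol i hil hi).2.2 1 (Or.inl rfl)
  · intro i hi
    obtain ⟨hil, hi⟩ := circle_of_update hb.1 hi
    obtain ⟨hlc, h⟩ := S.asym_f i hi
    rw [S.confF_eq C hl (Or.inl hi) hil]
    obtain ⟨e1, e2, e3⟩ := S.gmap_asym (t := t) hl (Lam_ne_of_ne hil) (S.sol i (Or.inl hi)) hlc h
    push_cast at e1 e2 e3
    rw [sub_add_cancel] at e1 e2 e3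
    have e4 := asym_inf_x_add (-c)
    rw [const_neg, ← sub_eq_add_neg] at e4
    exact ⟨mul_ne_zero (div_ne_zero e1 e2) hlc,
      (e3.div e4 one_ne_zero).congr (by push_cast; ring) (by ring)⟩
  · intro i hi e he
    obtain ⟨hil, hi⟩ := circle_of_update hb.1 hi
    rw [S.confF_eq C hl (Or.inl hi) hil]
    exact (hT (Lam_ne_of_ne hil)).not_lExact (S.f_ne (Or.inl hi))
      (S.sol i (Or.inl hi)) (S.not_lExact i hi e he)
  · intro i j hi hj
    rw [S.D_confRho hl (hi.of_update hb).2 (hj.of_update hb).2 t, hWb]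
    field_simp
  · intro i j hi hj
    obtain ⟨hil, hi⟩ := hi.of_update hb
    obtain ⟨hjl, hj⟩ := hj.of_update hb
    exact hlimρ i j hil hjl hi hj _ (Or.inr rfl) _ (S.rho_neg i j hi hj)
  · intro i j hi hj
    obtain ⟨hil, hi⟩ := hi.of_update hb
    obtain ⟨hjl, hj⟩ := hj.of_update hb
    exact hlimρ i j hil hjl hi hj _ (Or.inl rfl) _ (S.rho_one i j hi hj)
  · intro i hi
    exact S.nu_ne i (hi.of_update hb).2
  · intro j hj
    by_cases hjl : j = l
    · subst hjl
      rw [Function.update_self]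
      have hseed := sol_double_seed (T := opN u α β γ) p_ne (weight_ne α β) (hW_opN u α β γ)
        (S.sol l hL) hf0 hr0 (S.D_r hl t)
      rw [opN_double, ← hu1] at hseed
      have z0 : f l / (const t + ρ l l) / (x - const c) ≠ 0 :=
        div_ne_zero (div_ne_zero hf0 hr0) hm0
      have hz : Sol (opN (u1 - const (expo c α β + 1) / (x - const c)) α' β' (γ + 1)) (Lam N l)
          (f l / (const t + ρ l l) / (x - const c)) := by
        rw [← hop, sol_gauge hm0, mul_div_cancel₀ _ hm0]; exact hseed
      have p1 : ¬ Reg c (f l / (const t + ρ l l) / (x - const c)) := by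
        obtain ⟨b, hb, h1⟩ := hr1
        obtain ⟨w, hw, hfl⟩ := S.lim_f hL hc
        exact not_reg_of_asym (((asym_zero_iff.mpr hfl).div h1 hb).div (asym_x_sub c) one_ne_zero)
          (div_ne_zero (div_ne_zero hw hb) one_ne_zero) (by omega)
      have p2 : Reg (-c) (f l / (const t + ρ l l) / (x - const c)) := by
        obtain ⟨w, hw, hfl⟩ := S.lim_f hL hc'
        exact reg_of_asym (((asym_zero_iff.mpr hfl).div hra ha).div hm' hcc) (by omega)
      have p3 : Deg (f l / (const t + ρ l l) / (x - const c))
          (-(l : ℤ) - N - 1 - (γ + 1 : ℕ)) := by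
        obtain ⟨v, hv, hr, -⟩ := S.rho_asym hl t
        obtain ⟨hlc, hf⟩ := S.asym_f l hl
        have e4 := asym_inf_x_add (-c)
        rw [const_neg, ← sub_eq_add_neg] at e4
        refine ⟨_, div_ne_zero (div_ne_zero hlc hv) one_ne_zero,
          ((hf.div hr hv).div e4 one_ne_zero).congr ?_ rfl⟩
        have : (α : ℤ) + β = N + 2 * γ := by exact_mod_cast S.sum
        push_cast
        linear_combination -this
      have p4 : ¬ Exact (1 / ((f l / (const t + ρ l l) / (x - const c)) ^ 2 *
          ((x ^ 2 - 1) * weight α' β'))) := by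
        have := S.not_exact_seed hl hc' ha hr'
        convert this using 3
        rw [hWb]
        field_simp
      rcases hlb with ⟨rfl, rfl⟩ | ⟨rfl, rfl⟩
      · exact ⟨_, z0, hz, iff_false_intro p1, iff_true_intro p2, p3, fun _ => p4⟩
      · rw [neg_neg] at p2
        exact ⟨_, z0, hz, iff_true_intro p2, iff_false_intro p1, p3, fun _ => p4⟩
    · rw [Function.update_of_ne hjl]
      have := (S.diag j hj).transfer (hT (Lam_ne_of_ne' hj hjl))
      convert this using 1 <;> push_cast <;> ring
  · intro lam h
    by_cases e : lam = Lam N l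
    · exact ⟨l, e⟩
    · obtain ⟨v, hv⟩ := h
      rw [← hop, mem_Ric_gauge hm0, hu1, ← opN_double] at hv
      exact S.ric lam (ric_of_ric_double p_ne (weight_ne α β) (hW_opN u α β γ) (S.sol l hL) hf0 hr0
        (S.D_r hl t) e ⟨_, hv⟩)
  · intro i j hi hj
    rw [S.comm_conf C hl (hi.of_update hb).2 (hj.of_update hb).2 t, hWb, D_quot _ _ hm0,
      D_quot _ _ hm0]
    field_simp
    ring

end

end
end ExcJacobi

namespace ExcJacobi
noncomputable section

open Place

/-! ### Classical Jacobi operators -/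

/-- The Jacobi operator with the exponents `0, -e` at `c` and `0, -e'` at `-c`, where `c = ±1`,
shifted by a constant. -/
def opJ (c e e' k : ℝ) : Diff2 where
  p := x ^ 2 - 1
  q := const (e + 1) * (x + const c) + const (e' + 1) * (x - const c)
  r := const k

theorem opJ_neg (c e e' k : ℝ) : opJ (-c) e' e k = opJ c e e' k := by
  unfold opJ
  simp only [const_neg, sub_neg_eq_add]
  congr 1
  ring

theorem opN_eq_opJ (a b : ℕ) : opN 0 a b 0 = opJ 1 a b 0 := by
  unfold opN opJ
  rw [q_eq, D_zero, const_one]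
  congr 1
  simp

theorem sq_const {c : ℝ} (hc : c = 1 ∨ c = -1) : const c ^ 2 = 1 := by
  rcases hc with rfl | rfl <;> simp [const_neg, const_one]

theorem p_eq' {c : ℝ} (hc : c = 1 ∨ c = -1) :
    x ^ 2 - 1 = (x - const c) * (x + const c) := by
  rw [← sq_const hc]; ring

theorem D_x_sub (c : ℝ) : D (x - const c) = 1 := by rw [D_sub, D_x, D_const, sub_zero]

theorem opJ_gauge {c : ℝ} (hc : c = 1 ∨ c = -1) (i : ℕ) (e' k : ℝ) :
    (opJ c i e' k).gauge ((x - const c) ^ i)⁻¹ = opJ c (-i) e' (k - i * (e' + 1)) := by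
  have h0 := x_sub_const_ne c
  have hl : D ((x - const c) ^ i)⁻¹ / ((x - const c) ^ i)⁻¹ = -(const i / (x - const c)) := by
    rw [logDeriv_inv (pow_ne_zero _ h0), logDeriv_pow h0, D_x_sub, const_natCast]; ring
  have hm : ((x - const c) ^ i)⁻¹ ≠ 0 := inv_ne_zero (pow_ne_zero _ h0)
  have hl2 : D (D ((x - const c) ^ i)⁻¹) / ((x - const c) ^ i)⁻¹ =
      const i * (const i + 1) / (x - const c) ^ 2 := by
    have e1 : D ((x - const c) ^ i)⁻¹ = -(const i / (x - const c)) * ((x - const c) ^ i)⁻¹ := by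
      rw [← hl, div_mul_cancel₀ _ hm]
    rw [e1, D_mul, e1, D_neg, D_quot _ _ h0, D_x_sub, D_const]
    field_simp
    ring
  apply Diff2.ext'
  · rfl
  · change const (i + 1) * (x + const c) + const (e' + 1) * (x - const c) + 2 * (x ^ 2 - 1) *
      (D ((x - const c) ^ i)⁻¹ / ((x - const c) ^ i)⁻¹) =
      const (-i + 1) * (x + const c) + const (e' + 1) * (x - const c)
    rw [hl, p_eq' hc]
    simp only [const_add, const_neg]
    field_simp
    ring
  · change const k + (const (i + 1) * (x + const c) + const (e' + 1) * (x - const c)) *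
      (D ((x - const c) ^ i)⁻¹ / ((x - const c) ^ i)⁻¹) + (x ^ 2 - 1) *
      (D (D ((x - const c) ^ i)⁻¹) / ((x - const c) ^ i)⁻¹) = const (k - i * (e' + 1))
    rw [hl2, hl, p_eq' hc]
    simp only [const_add, const_sub, const_mul, const_one]
    field_simp
    ring

/-! #### Existence of polynomial eigenfunctions -/

theorem opJ_apply_pow {c : ℝ} (hc : c = 1 ∨ c = -1) (e e' k : ℝ) (s : ℕ) :
    (opJ c e e' k).apply ((x - const c) ^ s) =
      const (s * (s + e + e' + 1) + k) * (x - const c) ^ s +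
      const (2 * c * s * (s + e)) * (x - const c) ^ (s - 1) := by
  have h0 := x_sub_const_ne c
  change (x ^ 2 - 1) * D (D ((x - const c) ^ s)) + (const (e + 1) * (x + const c) +
    const (e' + 1) * (x - const c)) * D ((x - const c) ^ s) + const k * (x - const c) ^ s = _
  rw [p_eq' hc]
  have hx : x + const c = (x - const c) + 2 * const c := by ring
  rw [hx]
  generalize hz : x - const c = z at *
  have hDz : D z = 1 := by rw [← hz]; exact D_x_sub c
  rcases s with _ | _ | s
  · rw [pow_zero, D_one, D_zero]; simp [const_zero]
  · rw [zero_add, pow_one, hDz, D_one]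
    simp only [const_add, const_mul, const_two, const_one, Nat.cast_one, Nat.sub_self, pow_zero]
    ring
  · have e1 : D (z ^ (s + 1 + 1)) = const (s + 2) * z ^ (s + 1) := by
      rw [D_pow, hDz, const_add, const_natCast, const_two, Nat.add_sub_cancel]; push_cast; ring
    have e2 : D (z ^ (s + 1)) = const (s + 1) * z ^ s := by
      rw [D_pow, hDz, const_add, const_natCast, const_one, Nat.add_sub_cancel]; push_cast; ring
    rw [e1, D_const_mul, e2]
    push_cast
    simp only [const_add, const_mul, const_natCast, const_two, const_one]
    ring

theorem Diff2.apply_add (T : Diff2) (y z : RF) : T.apply (y + z) = T.apply y + T.apply z := by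
  simp only [Diff2.apply, D_add]; ring

theorem Diff2.apply_const_mul (T : Diff2) (k : ℝ) (y : RF) :
    T.apply (const k * y) = const k * T.apply y := by
  simp only [Diff2.apply, D_const_mul]; ring

/-- Away from resonances the Jacobi operator maps the polynomials of degree less than `n` onto
themselves, after subtraction of the eigenvalue. -/
theorem opJ_surj {c : ℝ} (hc : c = 1 ∨ c = -1) (e e' k lam : ℝ) (s : ℕ)
    (h : ∀ r ≤ s, (r : ℝ) * (r + e + e' + 1) + k ≠ lam) :
    ∃ Q : ℝ[X], Q.natDegree ≤ s ∧
      (opJ c e e' k).apply (ofPoly Q) - const lam * ofPoly Q = (x - const c) ^ s := by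
  induction s with
  | zero =>
    refine ⟨C ((k - lam)⁻¹), by simp, ?_⟩
    have h1 := h 0 le_rfl
    have h2 : k - lam ≠ 0 := by
      intro h3; apply h1; simp; linarith
    have h3 := opJ_apply_pow hc e e' k 0
    simp only [pow_zero, Nat.cast_zero, zero_mul, zero_add, mul_zero, const_zero, mul_one,
      add_zero] at h3
    rw [ofPoly_C, ← mul_one (const (k - lam)⁻¹), Diff2.apply_const_mul, h3, mul_one, ← const_mul,
      ← const_mul, ← const_sub, pow_zero, ← const_one]
    congr 1
    field_simp
  | succ s ih =>
    obtain ⟨Q, hQ, e1⟩ := ih fun r hr => h r (by omega)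
    have h1 := h (s + 1) le_rfl
    set mu : ℝ := ((s + 1 : ℕ) : ℝ) * ((s + 1 : ℕ) + e + e' + 1) + k with hmu
    have h2 : mu - lam ≠ 0 := sub_ne_zero.mpr h1
    set d : ℝ := 2 * c * (s + 1 : ℕ) * ((s + 1 : ℕ) + e)
    refine ⟨C ((mu - lam)⁻¹) * (X - C c) ^ (s + 1) + C (-(mu - lam)⁻¹ * d) * Q, ?_, ?_⟩
    · refine (natDegree_add_le _ _).trans (max_le ?_ ?_)
      · refine (natDegree_C_mul_le _ _).trans ?_
        rw [natDegree_pow, natDegree_X_sub_C, mul_one]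
      · exact ((natDegree_C_mul_le _ _).trans hQ).trans (by omega)
    · have h3 := opJ_apply_pow hc e e' k (s + 1)
      rw [ofPoly_add, ofPoly_mul, ofPoly_mul, ofPoly_C, ofPoly_C, ofPoly_pow, ofPoly_sub, ofPoly_C,
        ofPoly_X, Diff2.apply_add, Diff2.apply_const_mul, Diff2.apply_const_mul, h3,
        Nat.add_sub_cancel]
      have h4 : const (mu - lam)⁻¹ * (const mu - const lam) = 1 := by
        rw [← const_sub, ← const_mul, inv_mul_cancel₀ h2, const_one]
      rw [const_mul (-(mu - lam)⁻¹), const_neg]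
      linear_combination -(const (mu - lam)⁻¹ * const d) * e1 + (x - const c) ^ (s + 1) * h4

/-- Polynomial eigenfunctions of a Jacobi operator. -/
theorem opJ_exists {c : ℝ} (hc : c = 1 ∨ c = -1) (e e' k : ℝ) (n : ℕ)
    (h : ∀ s : ℕ, s < n → (s : ℝ) + n + e + e' + 1 ≠ 0) :
    ∃ P : ℝ[X], P.Monic ∧ P.natDegree = n ∧
      Sol (opJ c e e' k) (n * (n + e + e' + 1) + k) (ofPoly P) := by
  set lam : ℝ := n * (n + e + e' + 1) + k with hlam
  have hres : ∀ s : ℕ, s < n → (s : ℝ) * (s + e + e' + 1) + k ≠ lam := by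
    intro s hs h1
    have h2 : ((s : ℝ) - n) * (s + n + e + e' + 1) = 0 := by rw [hlam] at h1; linear_combination h1
    rcases mul_eq_zero.mp h2 with h3 | h3
    · have : (s : ℝ) < n := by exact_mod_cast hs
      linarith
    · exact h s hs h3
  have h3 := opJ_apply_pow hc e e' k n
  rcases n with _ | n
  · refine ⟨1, monic_one, natDegree_one, ?_⟩
    rw [pow_zero] at h3
    change (opJ c e e' k).apply (ofPoly 1) = const lam * ofPoly 1
    rw [ofPoly_one, h3, hlam]
    simp [const_zero]
  · obtain ⟨Q, hQ, e1⟩ := opJ_surj hc e e' k lam n fun r hr => hres r (by omega)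
    set d : ℝ := 2 * c * (n + 1 : ℕ) * ((n + 1 : ℕ) + e)
    have hm : ((X - C c) ^ (n + 1)).Monic := (monic_X_sub_C c).pow _
    have hd : ((X - C c) ^ (n + 1)).natDegree = n + 1 := by
      rw [natDegree_pow, natDegree_X_sub_C, mul_one]
    have hlt : (C (-d) * Q).degree < ((X - C c) ^ (n + 1)).degree := by
      rw [degree_eq_natDegree hm.ne_zero, hd]
      refine degree_le_natDegree.trans_lt ?_
      exact_mod_cast ((natDegree_C_mul_le _ _).trans hQ).trans_lt (Nat.lt_succ_self n)
    refine ⟨(X - C c) ^ (n + 1) + C (-d) * Q, hm.add_of_left hlt, ?_, ?_⟩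
    · rw [natDegree_eq_of_degree_eq (degree_add_eq_left_of_degree_lt hlt), hd]
    · change (opJ c e e' k).apply _ = const lam * _
      rw [ofPoly_add, ofPoly_mul, ofPoly_C, ofPoly_pow, ofPoly_sub, ofPoly_C, ofPoly_X,
        Diff2.apply_add, Diff2.apply_const_mul, h3, const_neg, Nat.add_sub_cancel]
      linear_combination -const d * e1

end
end ExcJacobi

namespace ExcJacobi
noncomputable section

open Place

/-! #### Solutions of the Riccati equation -/

theorem asym_opJ_q (c e e' k : ℝ) :
    (finPlace c).Asym (opJ c e e' k).q 0 (2 * c * (e + 1)) := by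
  have h1 : (finPlace c).Asym (x - const c) 0 0 :=
    ((asym_x_sub c).shift (k := 1) one_pos).congr (by change (1 : ℤ) - 1 * 1 = 0; ring) rfl
  have h2 : (finPlace c).Asym (x + const c) 0 (2 * c) := by
    have := asym_x_sub' (c := c) (c' := -c)
    rw [const_neg, sub_neg_eq_add] at this
    exact this.congr rfl (by ring)
  exact ((h2.const_mul (e + 1)).add (h1.const_mul (e' + 1))).congr rfl (by ring)

theorem reg_of_asym_neg_one {c : ℝ} {f : RF} (h : (finPlace c).Asym f (-1) 0) : Reg c f := by
  by_cases hf : f = 0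
  · rw [hf, ← const_zero]; exact reg_const c 0
  · obtain ⟨m, v, hv, hm⟩ := exists_asym (P := finPlace c) hf
    rcases lt_trichotomy m (-1) with h1 | h1 | h1
    · exfalso
      have h2 := h.shift (k := -1 - m) (by omega)
      have h3 : (finPlace c).Asym f m 0 :=
        h2.congr (by change (-1 : ℤ) - 1 * (-1 - m) = m; ring) rfl
      exact hv (hm.unique h3)
    · subst h1; exact absurd (hm.unique h) hv
    · exact reg_of_asym hm (by omega)

theorem residue_of_ric {c : ℝ} (hc : c = 1 ∨ c = -1) {e e' k lam : ℝ} {w : RF}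
    (hw : w ∈ Ric (opJ c e e' k) lam) : Reg c w ∨ (finPlace c).Asym w (-1) (-e) := by
  by_cases hf : w = 0
  · left; rw [hf, ← const_zero]; exact reg_const c 0
  obtain ⟨m, v, hv, hm⟩ := exists_asym (P := finPlace c) hf
  have hc0 : 2 * c ≠ 0 := by rcases hc with rfl | rfl <;> norm_num
  have hq := asym_opJ_q c e e' k
  have hp := asym_p hc
  have hr : (finPlace c).Asym (const lam - const k) 0 (lam - k) := (asym_const _).sub (asym_const _)
  have heq : (x ^ 2 - 1) * (D w + w ^ 2) + (opJ c e e' k).q * w = const lam - const k := by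
    have : (x ^ 2 - 1) * (D w + w ^ 2) + (opJ c e e' k).q * w + const k = const lam := hw
    linear_combination this
  have key : ∀ {f : RF} {n n' : ℤ} {v : ℝ}, (finPlace c).Asym f n v → n' < n →
      (finPlace c).Asym f n' 0 := by
    intro f n n' v h hn
    exact (h.shift (k := n - n') (by omega)).congr (by change n - 1 * (n - n') = n'; ring) rfl
  rcases lt_trichotomy m (-1) with h1 | h1 | h1
  · exfalso
    have e1 := hp.mul ((key hm.D (show m + m < m - 1 by omega)).add (hm.mul hm))
    have e2 := key (hq.mul hm) (show 1 + (m + m) < 0 + m by omega)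
    have e3 := (e1.add e2)
    rw [← sq, heq] at e3
    have e4 := (key hr (show 1 + (m + m) < 0 by omega)).unique e3
    apply mul_ne_zero hc0 (mul_ne_zero hv hv)
    linear_combination -e4
  · right
    subst h1
    have e1 := hp.mul (hm.D.add ((hm.mul hm).congr (show (-1 : ℤ) + -1 = -1 - 1 by ring) rfl))
    have e2 := (hq.mul hm).congr (show (0 : ℤ) + -1 = 1 + (-1 - 1) by ring) rfl
    have e3 := e1.add e2
    rw [← sq, heq] at e3
    have e4 := (key hr (show (1 : ℤ) + (-1 - 1) < 0 by omega)).unique e3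
    have e5 : 2 * c * v * (v + e) = 0 := by push_cast at e4; linear_combination -e4
    have e6 : v + e = 0 := by
      rcases mul_eq_zero.mp e5 with h | h
      · exact absurd h (mul_ne_zero hc0 hv)
      · exact h
    exact hm.congr rfl (by linarith)
  · exact Or.inl (reg_of_asym hm (by omega))

theorem ric_gauge_fin {c : ℝ} (hc : c = 1 ∨ c = -1) {e : ℕ} {e' k lam : ℝ} {w : RF}
    (hw : w ∈ Ric (opJ c e e' k) lam) : ∃ (i : ℕ) (e₁ k' : ℝ), (i = 0 ∨ i = e) ∧
      (Reg c w → i = 0) ∧ Reg c (w + const i / (x - const c)) ∧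
      w + const i / (x - const c) ∈ Ric (opJ c e₁ e' k') lam := by
  by_cases h : Reg c w
  · have h0 : w + const ((0 : ℕ) : ℝ) / (x - const c) = w := by simp [const_zero]
    exact ⟨0, e, k, Or.inl rfl, fun _ => rfl, by rwa [h0], by rwa [h0]⟩
  · refine ⟨e, -e, k - e * (e' + 1), Or.inr rfl, fun h' => absurd h' h, ?_, ?_⟩
    · have h1 := (residue_of_ric hc hw).resolve_left h
      have h2 := (asym_const (P := finPlace c) (e : ℝ)).div (asym_x_sub c) one_ne_zero
      exact reg_of_asym_neg_one ((h1.add h2).congr rfl (by ring))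
    · have h0 := x_sub_const_ne c
      have hm : ((x - const c) ^ e)⁻¹ ≠ 0 := inv_ne_zero (pow_ne_zero _ h0)
      rw [← opJ_gauge hc, mem_Ric_gauge hm, logDeriv_inv (pow_ne_zero _ h0), logDeriv_pow h0,
        D_x_sub, const_natCast]
      convert hw using 1
      ring

theorem asym_inf_ofPoly {P : ℝ[X]} (hP : P ≠ 0) :
    infPlace.Asym (ofPoly P) P.natDegree P.leadingCoeff := by
  have h := asym_inf_self (ofPoly_ne_zero hP)
  have h1 : (ofPoly P).num = P := RatFunc.num_algebraMap P
  have h2 : (ofPoly P).intDegree = P.natDegree := RatFunc.intDegree_polynomial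
  rwa [h1, h2] at h

theorem logDeriv_of_ric {c : ℝ} (hc : c = 1 ∨ c = -1) {e e' k lam : ℝ} {v : RF}
    (hv : v ∈ Ric (opJ c e e' k) lam) (h1 : Reg c v) (h2 : Reg (-c) v) :
    ∃ Q : ℝ[X], Q.eval c ≠ 0 ∧ Q.eval (-c) ≠ 0 ∧ v = D (ofPoly Q) / ofPoly Q := by
  set n := v.num with hn
  set Q := v.denom with hQ
  have hQ0 : Q ≠ 0 := RatFunc.denom_ne_zero v
  have hQ0' := ofPoly_ne_zero hQ0
  have hcop : IsCoprime n Q := RatFunc.isCoprime_num_denom v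
  have hr1 : Q.eval c ≠ 0 := reg_iff.mp h1
  have hr2 : Q.eval (-c) ≠ 0 := reg_iff.mp h2
  have hvq : v = ofPoly n / ofPoly Q := (num_div_denom' v).symm
  have hcopp : IsCoprime Q (X ^ 2 - 1) := by
    have e1 : (X ^ 2 - 1 : ℝ[X]) = (X - C c) * (X - C (-c)) := by
      rcases hc with rfl | rfl <;> simp <;> ring
    have e2 : ∀ s : ℝ, Q.eval s ≠ 0 → IsCoprime Q (X - C s) := by
      intro s hs
      rw [isCoprime_comm, (irreducible_X_sub_C s).coprime_iff_not_dvd, dvd_iff_isRoot]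
      exact hs
    rw [e1]
    exact (e2 c hr1).mul_right (e2 _ hr2)
  have hdvd : Q ∣ n - derivative Q := by
    have hq : (opJ c e e' k).q = ofPoly (C (e + 1) * (X + C c) + C (e' + 1) * (X - C c)) := by
      simp only [opJ, ofPoly_add, ofPoly_sub, ofPoly_mul, ofPoly_C, ofPoly_X]
    have h3 : (x ^ 2 - 1) * (D v + v ^ 2) + (opJ c e e' k).q * v + const k = const lam := hv
    rw [hvq, D_div _ _ hQ0, hq] at h3
    have h4 : ofPoly ((X ^ 2 - 1) * (derivative n * Q - n * derivative Q + n ^ 2) +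
        (C (e + 1) * (X + C c) + C (e' + 1) * (X - C c)) * n * Q + C k * Q ^ 2) =
        ofPoly (C lam * Q ^ 2) := by
      simp only [ofPoly_add, ofPoly_sub, ofPoly_mul, ofPoly_C, ofPoly_X, ofPoly_pow,
        ofPoly_one] at h3 ⊢
      field_simp at h3
      linear_combination h3
    have h5 := ofPoly_injective h4
    have h6 : (X ^ 2 - 1) * (n * (n - derivative Q)) = Q * (C lam * Q - C k * Q -
        (C (e + 1) * (X + C c) + C (e' + 1) * (X - C c)) * n - (X ^ 2 - 1) * derivative n) := by
      linear_combination h5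
    have h7 : Q ∣ (X ^ 2 - 1) * (n * (n - derivative Q)) := ⟨_, h6⟩
    exact hcop.symm.dvd_of_dvd_mul_left (hcopp.dvd_of_dvd_mul_left h7)
  obtain ⟨R, hR⟩ := hdvd
  refine ⟨Q, hr1, hr2, ?_⟩
  have hvR : v = D (ofPoly Q) / ofPoly Q + ofPoly R := by
    have e1 : n = derivative Q + Q * R := by linear_combination hR
    rw [hvq, e1, D_ofPoly, ofPoly_add, ofPoly_mul]
    field_simp
  suffices hR0 : R = 0 by rw [hvR, hR0, ofPoly_zero, add_zero]
  by_contra hR0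
  have hl : R.leadingCoeff ≠ 0 := leadingCoeff_ne_zero.mpr hR0
  obtain ⟨d, hd⟩ : ∃ d : ℤ, d = R.natDegree := ⟨_, rfl⟩
  have hd0 : 0 ≤ d := by omega
  have key : ∀ {f : RF} {n n' : ℤ} {v : ℝ}, infPlace.Asym f n v → n < n' →
      infPlace.Asym f n' 0 := by
    intro f n n' v h hn
    exact (h.shift (k := n' - n) (by omega)).congr (by change n - (-1) * (n' - n) = n'; ring) rfl
  have hva : infPlace.Asym v d R.leadingCoeff := by
    rw [hvR, hd]
    exact ((key ((asym_inf_ofPoly hQ0).logDeriv (leadingCoeff_ne_zero.mpr hQ0))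
      (show (-1 : ℤ) < R.natDegree by omega)).add (asym_inf_ofPoly hR0)).congr rfl (by ring)
  have hq : infPlace.Asym (opJ c e e' k).q 1 (e + 1 + (e' + 1)) := by
    have h4 := asym_inf_x_add (-c)
    rw [const_neg, ← sub_eq_add_neg] at h4
    exact (((asym_inf_x_add c).const_mul (e + 1)).add (h4.const_mul (e' + 1))).congr rfl (by ring)
  have e1 := asym_inf_p.mul ((key hva.D (show d - 1 < d + d by omega)).add (hva.mul hva))
  have e2 := key (hq.mul hva) (show 1 + d < 2 + (d + d) by omega)
  have e3 := e1.add e2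
  have heq : (x ^ 2 - 1) * (D v + v ^ 2) + (opJ c e e' k).q * v = const lam - const k := by
    have : (x ^ 2 - 1) * (D v + v ^ 2) + (opJ c e e' k).q * v + const k = const lam := hv
    linear_combination this
  rw [← sq, heq] at e3
  have e4 := (key ((asym_const lam).sub (asym_const k)) (show 0 < 2 + (d + d) by omega)).unique e3
  apply mul_ne_zero hl hl
  linear_combination -e4

/-- The quasi-rational eigenfunctions of a classical operator. -/
theorem ric_classical {a b : ℕ} {lam : ℝ} {w : RF} (hw : w ∈ Ric (opN 0 a b 0) lam) :
    ∃ (Q : ℝ[X]) (i j : ℕ), Q.eval 1 ≠ 0 ∧ Q.eval (-1) ≠ 0 ∧ (i = 0 ∨ i = a) ∧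
      (j = 0 ∨ j = b) ∧ (Reg 1 w → i = 0) ∧ (Reg (-1) w → j = 0) ∧
      w = D (ofPoly Q / ((x - 1) ^ i * (x + 1) ^ j)) / (ofPoly Q / ((x - 1) ^ i * (x + 1) ^ j)) := by
  rw [opN_eq_opJ] at hw
  obtain ⟨i, e₁, k₁, hi, hi', hr1, h1⟩ := ric_gauge_fin (Or.inl rfl) hw
  rw [← opJ_neg] at h1
  obtain ⟨j, e₂, k₂, hj, hj', hr2, h2⟩ := ric_gauge_fin (Or.inr rfl) h1
  have hc1 : Reg (-1) (const (i : ℝ) / (x - const 1)) :=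
    reg_of_asym ((asym_const _).div (asym_x_sub' (c := -1) (c' := 1)) (by norm_num)) (by omega)
  have hc2 : Reg 1 (const (j : ℝ) / (x - const (-1))) :=
    reg_of_asym ((asym_const _).div (asym_x_sub' (c := 1) (c' := -1)) (by norm_num)) (by omega)
  obtain ⟨Q, q1, q2, hQ⟩ := logDeriv_of_ric (Or.inr rfl) h2 hr2 (by rw [neg_neg]; exact hr1.add hc2)
  rw [neg_neg] at q2
  refine ⟨Q, i, j, q2, q1, hi, hj, hi', fun h => hj' (h.add hc1), ?_⟩
  have m1 := pow_ne_zero i x_sub_one_ne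
  have m2 := pow_ne_zero j x_add_one_ne
  rw [logDeriv_div (ofPoly_ne_zero (ne_zero_of_eval q1)) (mul_ne_zero m1 m2), logDeriv_mul m1 m2,
    logDeriv_pow x_sub_one_ne, logDeriv_pow x_add_one_ne, ← hQ, D_add, D_sub, D_x, D_one]
  simp only [const_natCast, const_neg, const_one, sub_neg_eq_add]
  ring

end
end ExcJacobi

namespace ExcJacobi
noncomputable section

open Place

/-! #### Solutions of the classical equation -/

theorem opN_eq_opJ' {c : ℝ} (hc : c = 1 ∨ c = -1) (a b : ℕ) :
    opN 0 a b 0 = opJ c (expo c a b) (expo (-c) a b) 0 := by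
  rcases hc with rfl | rfl
  · rw [expo_one, expo_neg_one, opN_eq_opJ]
  · rw [neg_neg, expo_one, expo_neg_one, opJ_neg, opN_eq_opJ]

theorem asym_fin_ofPoly (c : ℝ) {P : ℝ[X]} (hP : P ≠ 0) :
    ∃ v, v ≠ 0 ∧ (finPlace c).Asym (ofPoly P) (P.rootMultiplicity c) v := by
  obtain ⟨Q, hQ, hn⟩ := exists_eq_pow_rootMultiplicity_mul_and_not_dvd P hP c
  rw [dvd_iff_isRoot, IsRoot] at hn
  refine ⟨_, hn, ?_⟩
  have h := ((asym_x_sub c).pow (P.rootMultiplicity c)).mul (asym_zero_iff.mpr (lim_ofPoly c Q))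
  rw [← ofPoly_X, ← ofPoly_C, ← ofPoly_sub, ← ofPoly_pow, ← ofPoly_mul, ← hQ] at h
  exact h.congr (by ring) (by ring)

theorem rootMultiplicity_le_natDegree (P : ℝ[X]) (c : ℝ) :
    P.rootMultiplicity c ≤ P.natDegree := by
  classical
  rw [← count_roots]
  exact (Multiset.count_le_card _ _).trans (card_roots' P)

theorem classical_exponent {a b : ℕ} {lam : ℝ} {y : RF} {m : ℤ} {v : ℝ}
    (hy : Sol (opN 0 a b 0) lam y) (hv : v ≠ 0) (h : infPlace.Asym y m v) :
    lam = Lam (a + b) m := by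
  have hu : infPlace.Asym (0 : RF) (-1) 0 := asym_zero _
  rw [exponent_inf hu hy hv h, Lam]
  push_cast
  ring

theorem asym_inf_quot {P : ℝ[X]} (hP : P ≠ 0) (i j : ℕ) :
    infPlace.Asym (ofPoly P / ((x - 1) ^ i * (x + 1) ^ j)) (P.natDegree - i - j)
      P.leadingCoeff := by
  have h1 := asym_inf_x_add (-1)
  have h2 := asym_inf_x_add 1
  rw [const_neg, const_one, ← sub_eq_add_neg] at h1
  rw [const_one] at h2
  refine ((asym_inf_ofPoly hP).div ((h1.pow i).mul (h2.pow j)) (by simp)).congr (by ring) (by simp)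

theorem fin_quot {c : ℝ} (hc : c = 1 ∨ c = -1) {P : ℝ[X]} (hP : P ≠ 0) (i j : ℕ) :
    ∃ v, v ≠ 0 ∧ (finPlace c).Asym (ofPoly P / ((x - 1) ^ i * (x + 1) ^ j))
      (P.rootMultiplicity c - expo c i j) v := by
  obtain ⟨v, hv, h⟩ := asym_fin_ofPoly c hP
  have e1 : x - const 1 = x - 1 := by rw [const_one]
  have e2 : x - const (-1) = x + 1 := by rw [const_neg, const_one, sub_neg_eq_add]
  rcases hc with rfl | rfl
  · have h1 := asym_x_sub 1
    have h2 := asym_x_sub' (c := 1) (c' := -1)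
    rw [e1] at h1
    rw [e2] at h2
    refine ⟨_, ?_, (h.div ((h1.pow i).mul (h2.pow j)) (by norm_num)).congr
      (by rw [expo_one]; ring) rfl⟩
    exact div_ne_zero hv (by norm_num)
  · have h1 := asym_x_sub (-1)
    have h2 := asym_x_sub' (c := -1) (c' := 1)
    rw [e2] at h1
    rw [e1] at h2
    refine ⟨_, ?_, (h.div ((h2.pow i).mul (h1.pow j)) (by norm_num)).congr
      (by rw [expo_neg_one]; ring) rfl⟩
    exact div_ne_zero hv (by norm_num)

theorem reg_zero (c : ℝ) : Reg c 0 := by rw [← const_zero]; exact reg_const c 0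

theorem reg_quot_iff {c : ℝ} (hc : c = 1 ∨ c = -1) {a b : ℕ} {lam : ℝ} {P : ℝ[X]} (hP : P ≠ 0)
    {i j : ℕ} (hy : Sol (opN 0 a b 0) lam (ofPoly P / ((x - 1) ^ i * (x + 1) ^ j)))
    (h : expo c i j = 0 ∨ expo c i j = expo c a b ∧ P.natDegree < expo c a b) :
    Reg c (ofPoly P / ((x - 1) ^ i * (x + 1) ^ j)) ↔ expo c i j = 0 := by
  obtain ⟨v, hv, hm⟩ := fin_quot hc hP i j
  have hr := rootMultiplicity_le_natDegree P c
  rcases h with h | ⟨h, hlt⟩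
  · simp only [h, iff_true]
    exact reg_of_asym hm (by omega)
  · refine iff_of_false (not_reg_of_asym hm hv ?_) (by omega)
    rcases exponent_fin hc (reg_zero c) hy hv hm with h1 | h1 <;> omega

theorem hasSol_quot {a b : ℕ} {lam : ℝ} {P : ℝ[X]} (hP : P ≠ 0) {i j : ℕ}
    (hy : Sol (opN 0 a b 0) lam (ofPoly P / ((x - 1) ^ i * (x + 1) ^ j)))
    (hi : i = 0 ∨ i = a ∧ P.natDegree < a) (hj : j = 0 ∨ j = b ∧ P.natDegree < b)
    {r₁ r₂ uniq : Prop} {m : ℤ} (hm : m = P.natDegree - i - j) (h1 : i = 0 ↔ r₁) (h2 : j = 0 ↔ r₂)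
    (hu : uniq → ¬ Exact (1 / ((ofPoly P / ((x - 1) ^ i * (x + 1) ^ j)) ^ 2 *
      ((x ^ 2 - 1) * weight a b)))) :
    HasSol (opN 0 a b 0) (weight a b) lam r₁ r₂ m uniq := by
  refine ⟨_, ?_, hy, ?_, ?_, ?_, hu⟩
  · exact (asym_inf_quot hP i j).ne_zero (leadingCoeff_ne_zero.mpr hP)
  · rw [← h1, reg_quot_iff (Or.inl rfl) hP hy (by rw [expo_one, expo_one]; exact hi), expo_one]
  · rw [← h2, reg_quot_iff (Or.inr rfl) hP hy (by rw [expo_neg_one, expo_neg_one]; exact hj),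
      expo_neg_one]
  · exact ⟨_, leadingCoeff_ne_zero.mpr hP, hm ▸ asym_inf_quot hP i j⟩

theorem exists_sol_three (a b n : ℕ) (h : ∀ s : ℕ, s < n → (s : ℝ) + n - a + b + 1 ≠ 0) :
    ∃ P : ℝ[X], P ≠ 0 ∧ P.natDegree = n ∧
      Sol (opN 0 a b 0) (Lam (a + b) (n - a)) (ofPoly P / ((x - 1) ^ a * (x + 1) ^ 0)) := by
  obtain ⟨P, hP, hn, hs⟩ := opJ_exists (c := 1) (Or.inl rfl) (-(a : ℝ)) b (0 - a * (b + 1)) n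
    (by simpa only [sub_eq_add_neg] using h)
  refine ⟨P, hP.ne_zero, hn, ?_⟩
  rw [← opJ_gauge (Or.inl rfl), sol_gauge (inv_ne_zero (pow_ne_zero _ (x_sub_const_ne 1)))] at hs
  rw [opN_eq_opJ]
  convert hs using 1
  · unfold Lam; push_cast; ring
  · rw [const_one, pow_zero, mul_one]; field_simp

theorem exists_sol_four (a b n : ℕ) (h : ∀ s : ℕ, s < n → (s : ℝ) + n - b + a + 1 ≠ 0) :
    ∃ P : ℝ[X], P ≠ 0 ∧ P.natDegree = n ∧
      Sol (opN 0 a b 0) (Lam (a + b) (n - b)) (ofPoly P / ((x - 1) ^ 0 * (x + 1) ^ b)) := by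
  obtain ⟨P, hP, hn, hs⟩ := opJ_exists (c := -1) (Or.inr rfl) (-(b : ℝ)) a (0 - b * (a + 1)) n
    (by simpa only [sub_eq_add_neg] using h)
  refine ⟨P, hP.ne_zero, hn, ?_⟩
  rw [← opJ_gauge (Or.inr rfl), sol_gauge (inv_ne_zero (pow_ne_zero _ (x_sub_const_ne (-1))))] at hs
  rw [opN_eq_opJ, ← opJ_neg]
  convert hs using 1
  · unfold Lam; push_cast; ring
  · rw [const_neg, const_one, pow_zero, one_mul, sub_neg_eq_add]; field_simp

theorem exists_sol_two (a b n : ℕ) (h : ∀ s : ℕ, s < n → (s : ℝ) + n - a - b + 1 ≠ 0) :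
    ∃ P : ℝ[X], P ≠ 0 ∧ P.natDegree = n ∧
      Sol (opN 0 a b 0) (Lam (a + b) (n - a - b)) (ofPoly P / ((x - 1) ^ a * (x + 1) ^ b)) := by
  obtain ⟨P, hP, hn, hs⟩ := opJ_exists (c := -1) (Or.inr rfl) (-(b : ℝ)) (-(a : ℝ))
    (0 - a * (b + 1) - b * (-a + 1)) n (by
      intro s hs h1; apply h s hs; linear_combination h1)
  refine ⟨P, hP.ne_zero, hn, ?_⟩
  rw [← opJ_gauge (Or.inr rfl), sol_gauge (inv_ne_zero (pow_ne_zero _ (x_sub_const_ne (-1)))),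
    opJ_neg, ← opJ_gauge (Or.inl rfl),
    sol_gauge (inv_ne_zero (pow_ne_zero _ (x_sub_const_ne 1)))] at hs
  rw [opN_eq_opJ]
  convert hs using 1
  · unfold Lam; push_cast; ring
  · rw [const_neg, const_one, sub_neg_eq_add]; field_simp

theorem classical_of_sol {a b : ℕ} {lam : ℝ} {z : RF} (hz : Sol (opN 0 a b 0) lam z)
    (z0 : z ≠ 0) : ∃ (m : ℤ), Deg z m ∧ (Reg 1 z → -(b : ℤ) ≤ m) ∧ (Reg (-1) z → -(a : ℤ) ≤ m) := by
  obtain ⟨Q, i, j, q1, q2, hi, hj, hi', hj', h⟩ := ric_classical (mem_Ric_of_sol z0 hz)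
  have hQ := ne_zero_of_eval q1
  have hl := leadingCoeff_ne_zero.mpr hQ
  have hm := asym_inf_quot hQ i j
  obtain ⟨k, hk, e⟩ := eq_const_mul_of_logDeriv z0 (hm.ne_zero hl) h
  have key : ∀ c : ℝ, c = 1 ∨ c = -1 → Reg c z → Reg c (D z / z) := by
    intro c hc hr
    obtain ⟨v, hv, hl⟩ := unit_of_reg hc (reg_zero c) hz z0 hr
    exact (reg_logDeriv_iff (asym_zero_iff.mpr hl) hv).mpr rfl
  refine ⟨_, ⟨_, mul_ne_zero hk hl, e ▸ hm.const_mul k⟩, fun hr => ?_, fun hr => ?_⟩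
  · have := hi' (key 1 (Or.inl rfl) hr); omega
  · have := hj' (key (-1) (Or.inr rfl) hr); omega

theorem exists_reg_of_exact {c : ℝ} (hc : c = 1 ∨ c = -1) {a b : ℕ} {lam : ℝ} {y : RF}
    (hy : Sol (opN 0 a b 0) lam y) (y0 : y ≠ 0)
    (he : Exact (1 / (y ^ 2 * ((x ^ 2 - 1) * weight a b)))) :
    ∃ z, z ≠ 0 ∧ Sol (opN 0 a b 0) lam z ∧ Reg c z := by
  obtain ⟨h, hh⟩ := he
  by_cases hr : Reg c y
  · exact ⟨y, y0, hy, hr⟩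
  have hz := sol_second hy y0 p_ne (weight_ne a b) (hW_opN 0 a b 0) hh
  by_cases hz0 : y * h = 0
  · exfalso
    rw [mul_eq_zero, or_iff_right y0] at hz0
    rw [hz0, D_zero] at hh
    exact (one_div_ne_zero (mul_ne_zero (pow_ne_zero 2 y0) (mul_ne_zero p_ne (weight_ne a b))))
      hh.symm
  by_cases hzr : Reg c (y * h)
  · exact ⟨_, hz0, hz, hzr⟩
  obtain ⟨_, v, hv, h1⟩ := pole_of_not_reg hc (reg_zero c) hy y0 hr
  obtain ⟨_, w, hw, h2⟩ := pole_of_not_reg hc (reg_zero c) hz hz0 hzr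
  have hs : Sol (opN 0 a b 0) lam (y * h + const (-(w / v)) * y) := hz.add (hy.const_mul _)
  have h3 := (h2.add (h1.const_mul (-(w / v)))).congr rfl
    (show w + -(w / v) * v = 0 by field_simp; ring)
  have hs0 : y * h + const (-(w / v)) * y ≠ 0 := by
    intro e
    have : h = const (w / v) := by
      have e1 : y * (h - const (w / v)) = 0 := by rw [const_neg] at e; linear_combination e
      exact sub_eq_zero.mp ((mul_eq_zero.mp e1).resolve_left y0)
    rw [this, D_const] at hh
    exact (one_div_ne_zero (mul_ne_zero (pow_ne_zero 2 y0) (mul_ne_zero p_ne (weight_ne a b))))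
      hh.symm
  refine ⟨_, hs0, hs, ?_⟩
  by_contra hn
  obtain ⟨_, u, hu, h4⟩ := pole_of_not_reg hc (reg_zero c) hs hs0 hn
  exact hu (h4.unique h3)

/-! #### Absence of a second solution near the end points -/

theorem degree_C_mul_le (r : ℝ) (P : ℝ[X]) : (C r * P).degree ≤ P.degree := by
  rw [← smul_eq_C_mul]; exact degree_smul_le _ _

theorem exists_principal {c : ℝ} {g : RF} (hg : Reg c g) (e : ℕ) :
    ∃ Q : ℝ[X], Q.degree < e ∧ Reg c ((g - ofPoly Q) / (x - const c) ^ e) := by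
  induction e with
  | zero => exact ⟨0, by simp, by simp [ofPoly_zero, hg]⟩
  | succ e ih =>
    obtain ⟨Q, hQ, v, hv⟩ := ih
    refine ⟨Q + C v * (X - C c) ^ e, ?_, ?_⟩
    · refine (degree_add_le _ _).trans_lt (max_lt (hQ.trans (by exact_mod_cast Nat.lt_succ_self e)) ?_)
      refine (degree_C_mul_le _ _).trans_lt ?_
      rw [degree_pow, degree_X_sub_C, nsmul_eq_mul, mul_one]
      exact_mod_cast Nat.lt_succ_self e
    · have h1 := (((asym_zero_iff.mpr hv).sub (asym_const v)).div (asym_x_sub c) one_ne_zero)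
      have h2 := reg_of_asym_neg_one (h1.congr rfl (by ring))
      have h0 := x_sub_const_ne c
      convert h2 using 1
      rw [ofPoly_add, ofPoly_mul, ofPoly_pow, ofPoly_sub, ofPoly_C, ofPoly_C, ofPoly_X]
      field_simp
      ring

theorem eq_zero_of_reg_quot {c : ℝ} {R : ℝ[X]} {e : ℕ} (hd : R.degree < e)
    (h : Reg c (ofPoly R / (x - const c) ^ e)) : R = 0 := by
  by_contra hR
  obtain ⟨v, hv, hm⟩ := asym_fin_ofPoly c hR
  have h1 := hm.div ((asym_x_sub c).pow e) (by simp)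
  have := rootMultiplicity_le_natDegree R c
  have h2 := (natDegree_lt_iff_degree_lt hR).mpr hd
  exact not_reg_of_asym h1 (by simpa using hv) (by omega) h

theorem opJ_apply_ofPoly {c : ℝ} (e e' k : ℝ) (Q : ℝ[X]) {n : ℕ} (hQ : Q.degree < n) :
    ∃ R : ℝ[X], R.degree < n ∧ (opJ c e e' k).apply (ofPoly Q) = ofPoly R := by
  refine ⟨(X ^ 2 - 1) * derivative (derivative Q) +
    (C (e + 1) * (X + C c) + C (e' + 1) * (X - C c)) * derivative Q + C k * Q, ?_, ?_⟩
  · by_cases h0 : Q = 0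
    · simp [h0]
    refine lt_of_le_of_lt ?_ hQ
    have hd : ∀ Q : ℝ[X], (derivative Q).degree + 1 ≤ Q.degree ∨ derivative Q = 0 := by
      intro Q
      by_cases h : derivative Q = 0
      · exact Or.inr h
      · left
        have h1 : Q ≠ 0 := by rintro rfl; simp at h
        have h2 : Q.natDegree ≠ 0 := by
          intro h2; rw [natDegree_eq_zero] at h2; obtain ⟨r, rfl⟩ := h2; simp at h
        rw [degree_eq_natDegree h, degree_eq_natDegree h1]
        exact_mod_cast natDegree_derivative_lt h2
    have hX : (X ^ 2 - 1 : ℝ[X]).degree ≤ 2 := by compute_degree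
    have hX1 : (C (e + 1) * (X + C c) + C (e' + 1) * (X - C c) : ℝ[X]).degree ≤ 1 := by
      compute_degree
    refine (degree_add_le _ _).trans (max_le ((degree_add_le _ _).trans (max_le ?_ ?_))
      (degree_C_mul_le _ _))
    · rcases hd (derivative Q) with h | h
      · rcases hd Q with h' | h'
        · rw [degree_mul]
          calc _ ≤ 2 + (derivative (derivative Q)).degree := by gcongr
            _ = ((derivative (derivative Q)).degree + 1) + 1 := by
              rw [add_comm, add_assoc]; rfl
            _ ≤ (derivative Q).degree + 1 := by gcongr
            _ ≤ _ := h'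
        · simp [h']
      · simp [h]
    · rcases hd Q with h' | h'
      · rw [degree_mul]
        calc _ ≤ 1 + (derivative Q).degree := by gcongr
          _ = (derivative Q).degree + 1 := add_comm _ _
          _ ≤ _ := h'
      · simp [h']
  · simp only [opJ, Diff2.apply, ofPoly_add, ofPoly_sub, ofPoly_mul, ofPoly_C, ofPoly_X, ofPoly_pow,
      ofPoly_one, D_ofPoly]

theorem asym_fin_mono {c : ℝ} {f : RF} {n n' : ℤ} {v : ℝ} (h : (finPlace c).Asym f n v)
    (hn : n' < n) : (finPlace c).Asym f n' 0 :=
  (h.shift (k := n - n') (by omega)).congr (by change n - 1 * (n - n') = n'; ring) rfl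

theorem opN_apply_mul {u f h : RF} {a b γ : ℕ} {lam : ℝ} (hf : Sol (opN u a b γ) lam f)
    (f0 : f ≠ 0) : (opN u a b γ).apply (f * h) - const lam * (f * h) =
    D (f ^ 2 * ((x ^ 2 - 1) * weight a b) * D h) / (f * weight a b) := by
  have h1 : (opN u a b γ).p * D (D f) + (opN u a b γ).q * D f + (opN u a b γ).r * f =
    const lam * f := hf
  have h2 := hW_opN u a b γ
  have h3 : (opN u a b γ).p = x ^ 2 - 1 := rfl
  have h4 := weight_ne a b
  rw [h3] at h1 h2
  rw [eq_div_iff (mul_ne_zero f0 h4), D_mul, D_mul, h2, sq, D_mul]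
  simp only [Diff2.apply, D_mul, D_add, h3]
  linear_combination (f * weight a b * h) * h1

theorem not_lExact_classical {c : ℝ} (hc : c = 1 ∨ c = -1) {a b n : ℕ} {f : RF}
    (hf : Sol (opN 0 a b 0) (Lam (a + b) n) f) (hr : Reg c f) (f0 : f ≠ 0) :
    ¬ LExact c (1 / (f ^ 2 * ((x ^ 2 - 1) * weight a b))) := by
  rintro ⟨h, v, hv⟩
  set e := expo c a b with he
  set T := opN 0 a b 0 with hT
  obtain ⟨v₁, hv₁, hf1⟩ := unit_of_reg hc (reg_zero c) hf f0 hr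
  obtain ⟨v₂, hv₂, hpW⟩ := asym_pW hc a b
  obtain ⟨v₃, hv₃, hW⟩ := asym_weight hc a b
  have hfa := asym_zero_iff.mpr hf1
  have hva := asym_zero_iff.mpr hv
  have hfpw := (hfa.pow 2).mul hpW
  have hfpw0 : v₁ ^ 2 * v₂ ≠ 0 := mul_ne_zero (pow_ne_zero 2 hv₁) hv₂
  set g := 1 / (f ^ 2 * ((x ^ 2 - 1) * weight a b)) with hg
  have hga : (finPlace c).Asym g (-(e + 1)) (1 / (v₁ ^ 2 * v₂)) := by
    have h1 := (asym_const (P := finPlace c) 1).div hfpw hfpw0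
    rw [const_one] at h1
    exact h1.congr (by push_cast; ring) rfl
  have hDh : (finPlace c).Asym (D h) (-(e + 1)) (1 / (v₁ ^ 2 * v₂)) := by
    have h1 := hga.sub (asym_fin_mono hva (show -((e : ℤ) + 1) < 0 by omega))
    rw [sub_sub_cancel] at h1
    exact h1.congr rfl (by ring)
  have hne : 1 / (v₁ ^ 2 * v₂) ≠ 0 := one_div_ne_zero hfpw0
  have h0 : h ≠ 0 := by
    rintro rfl
    rw [D_zero] at hDh
    exact hne (hDh.unique (asym_zero _))
  obtain ⟨m, w, hw, hm⟩ := exists_asym (P := finPlace c) h0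
  have hme : m = -(e : ℤ) ∧ m ≠ 0 := by
    by_cases hm0 : m = 0
    · exfalso
      subst hm0
      have h1 := hm.D.congr rfl (show ((0 : ℤ) : ℝ) * w = 0 by simp)
      rcases Nat.eq_zero_or_pos e with h2 | h2
      · exact hne (hDh.unique (h1.congr (by rw [h2]; rfl) rfl))
      · exact hne (hDh.unique (asym_fin_mono h1 (by omega)))
    · refine ⟨?_, hm0⟩
      have := hm.D.order_unique (mul_ne_zero (by exact_mod_cast hm0) hw) hDh hne
      omega
  obtain ⟨rfl, he0⟩ := hme
  have hz := hfa.mul hm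
  have hx := (asym_x_sub c).pow e
  have hzx : Reg c (f * h * (x - const c) ^ e) := reg_of_asym (hz.mul hx) (by omega)
  obtain ⟨Q, hQd, hQ⟩ := exists_principal hzx e
  have hxe := pow_ne_zero e (x_sub_const_ne c)
  have hQ' : Reg c (f * h - ((x - const c) ^ e)⁻¹ * ofPoly Q) := by
    convert hQ using 1
    field_simp
  have hQ0 : Q ≠ 0 := by
    rintro rfl
    rw [ofPoly_zero, mul_zero, sub_zero] at hQ'
    exact not_reg_of_asym hz (mul_ne_zero hv₁ hw) (by omega) hQ'
  have hTr : ∀ {y : RF}, Reg c y → Reg c (T.apply y - const (Lam (a + b) n) * y) := by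
    intro y hy
    have e1 : Reg c T.p := reg_of_asym (asym_p hc) (by omega)
    have e2 : Reg c T.q := reg_of_asym (asym_q hc a b) (by omega)
    have e3 : Reg c T.r := by
      rw [hT, opN_eq_opJ]; exact reg_const c 0
    exact (((e1.mul hy.D.D).add (e2.mul hy.D)).add (e3.mul hy)).sub ((reg_const _ _).mul hy)
  have hz1 : Reg c (T.apply (f * h) - const (Lam (a + b) n) * (f * h)) := by
    rw [hT, opN_apply_mul hf f0]
    have e1 : f ^ 2 * ((x ^ 2 - 1) * weight a b) * D h =
        const 1 - f ^ 2 * ((x ^ 2 - 1) * weight a b) * (g - D h) := by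
      have : f ^ 2 * ((x ^ 2 - 1) * weight a b) * g = 1 := by
        rw [hg, mul_one_div_cancel]
        exact mul_ne_zero (pow_ne_zero 2 f0) (mul_ne_zero p_ne (weight_ne a b))
      rw [const_one]
      linear_combination this
    rw [e1, D_sub, D_const, zero_sub]
    have e2 := (hfpw.mul hva).D.neg
    exact reg_of_asym (e2.div (hfa.mul hW) (mul_ne_zero hv₁ hv₃)) (by push_cast; omega)
  have hk := opJ_gauge hc e (expo (-c) a b) 0
  obtain ⟨R₀, hR₀, hR₁⟩ := opJ_apply_ofPoly (c := c) (-(e : ℝ)) (expo (-c) a b : ℝ)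
    (0 - e * ((expo (-c) a b : ℝ) + 1)) Q hQd
  have hm0 : ((x - const c) ^ e)⁻¹ ≠ 0 := inv_ne_zero hxe
  rw [← hk, Diff2.gauge_apply _ _ _ hm0, inv_inv, he, ← opN_eq_opJ' hc, ← he, ← hT] at hR₁
  have hreg : Reg c (ofPoly (R₀ - C (Lam (a + b) n) * Q) / (x - const c) ^ e) := by
    have := hz1.sub (hTr hQ')
    convert this using 1
    rw [ofPoly_sub, ofPoly_mul, ofPoly_C, ← hR₁]
    have e1 : T.apply (f * h) = T.apply (f * h - ((x - const c) ^ e)⁻¹ * ofPoly Q) +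
        T.apply (((x - const c) ^ e)⁻¹ * ofPoly Q) := by
      rw [← Diff2.apply_add, sub_add_cancel]
    rw [e1]
    field_simp
    ring
  have hR := eq_zero_of_reg_quot ((degree_sub_le _ _).trans_lt
    (max_lt hR₀ ((degree_C_mul_le _ _).trans_lt hQd))) hreg
  have hsol : Sol T (Lam (a + b) n) (((x - const c) ^ e)⁻¹ * ofPoly Q) := by
    change T.apply _ = _
    have e1 : ofPoly R₀ = const (Lam (a + b) n) * ofPoly Q := by
      rw [sub_eq_zero.mp hR, ofPoly_mul, ofPoly_C]
    rw [e1] at hR₁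
    field_simp at hR₁ ⊢
    exact hR₁
  have hx1 := asym_inf_x_add (-c)
  rw [const_neg, ← sub_eq_add_neg] at hx1
  have hinf := ((hx1.pow e).inv (by simp)).mul (asym_inf_ofPoly hQ0)
  have h5 := classical_exponent hsol (mul_ne_zero (inv_ne_zero (by simp))
    (leadingCoeff_ne_zero.mpr hQ0)) hinf
  rw [Lam_eq_iff] at h5
  have h6 := (natDegree_lt_iff_degree_lt hQ0).mpr hQd
  have h7 : e ≤ a + b := by
    rcases hc with h | h
    · rw [he, h, expo_one]; omega
    · rw [he, h, expo_neg_one]; omega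
  push_cast at h5
  omega

end
end ExcJacobi

namespace ExcJacobi
noncomputable section

open Place

/-! ### The classical Jacobi polynomials -/

theorem choose_succ_cast (n k : ℕ) (h : k ≤ n) :
    (n.choose (k + 1) : ℝ) * (k + 1) = n.choose k * (n - k) := by
  have := Nat.choose_succ_right_eq n k
  rw [← Nat.cast_sub h]
  exact_mod_cast this

/-- Coefficients of the Jacobi polynomials. -/
def jacCoeff (n a b k : ℕ) : ℝ := ((n + a).choose (n - k) : ℝ) * ((n + b).choose k : ℝ)

theorem jacCoeff_succ {n a b k : ℕ} (h : k < n) :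
    jacCoeff n a b (k + 1) * ((k + 1) * (k + 1 + a)) =
      jacCoeff n a b k * ((n - k) * (n - k + b)) := by
  obtain ⟨m, rfl⟩ : ∃ m, n = k + 1 + m := ⟨n - (k + 1), by omega⟩
  have h1 := choose_succ_cast (k + 1 + m + a) m (by omega)
  have h2 := choose_succ_cast (k + 1 + m + b) k (by omega)
  unfold jacCoeff
  rw [show k + 1 + m - (k + 1) = m by omega, show k + 1 + m - k = m + 1 by omega]
  push_cast at h1 h2 ⊢
  linear_combination (-((k + 1 + m + b).choose (k + 1) : ℝ) * (k + 1)) * h1 +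
    (((k + 1 + m + a).choose (m + 1) : ℝ) * (m + 1)) * h2

theorem D_monomial (k m : ℕ) : D ((x - 1) ^ k * (x + 1) ^ m) =
    k * (x - 1) ^ (k - 1) * (x + 1) ^ m + m * (x - 1) ^ k * (x + 1) ^ (m - 1) := by
  rw [D_mul, D_pow, D_pow, D_sub, D_add, D_x, D_one]; ring

theorem jacobi_apply_monomial (a b k m : ℕ) :
    (opN 0 a b 0).apply ((x - 1) ^ k * (x + 1) ^ m) =
    const (k * (k + a)) * (x - 1) ^ (k - 1) * (x + 1) ^ (m + 1) +
    const (2 * k * m + (a + 1) * m + (b + 1) * k) * ((x - 1) ^ k * (x + 1) ^ m) +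
    const (m * (m + b)) * (x - 1) ^ (k + 1) * (x + 1) ^ (m - 1) := by
  rw [opN_eq_opJ]
  change (x ^ 2 - 1) * D (D ((x - 1) ^ k * (x + 1) ^ m)) + (const ((a : ℝ) + 1) * (x + const 1) +
    const ((b : ℝ) + 1) * (x - const 1)) * D ((x - 1) ^ k * (x + 1) ^ m) +
    const 0 * ((x - 1) ^ k * (x + 1) ^ m) = _
  have e' : ∀ (r k m : ℕ), D ((r : RF) * (x - 1) ^ k * (x + 1) ^ m) =
      r * D ((x - 1) ^ k * (x + 1) ^ m) := by
    intro r k m; rw [mul_assoc, D_mul, D_natCast]; ring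
  rw [D_monomial, D_add, e', e', D_monomial, D_monomial, p_eq]
  simp only [const_add, const_mul, const_natCast, const_one, const_zero, const_two]
  generalize x - 1 = A
  generalize x + 1 = B
  rcases k with _ | _ | k <;> rcases m with _ | _ | m <;> push_cast <;>
    (try simp only [zero_add, pow_zero, pow_one]) <;> ring

theorem Diff2.apply_sum {ι : Type*} (T : Diff2) (s : Finset ι) (y : ι → RF) :
    T.apply (∑ i ∈ s, y i) = ∑ i ∈ s, T.apply (y i) := by
  simp only [Diff2.apply, D_sum, Finset.mul_sum, Finset.sum_add_distrib]

theorem ofPoly_jacobiP (n a b : ℕ) : ofPoly (jacobiP n a b) = const ((2 : ℝ)⁻¹ ^ n) *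
    ∑ k ∈ Finset.range (n + 1), const (jacCoeff n a b k) * ((x - 1) ^ k * (x + 1) ^ (n - k)) := by
  unfold jacobiP
  rw [ofPoly_mul, ofPoly_C, ofPoly_sum]
  congr 1
  refine Finset.sum_congr rfl fun k _ => ?_
  rw [ofPoly_mul, ofPoly_mul, ofPoly_C, ofPoly_pow, ofPoly_pow, ofPoly_sub, ofPoly_add, ofPoly_X,
    ofPoly_one, mul_assoc]
  rfl

theorem sol_jacobiP (n a b : ℕ) :
    Sol (opN 0 a b 0) (Lam (a + b) n) (ofPoly (jacobiP n a b)) := by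
  rw [ofPoly_jacobiP]
  apply Sol.const_mul
  change (opN 0 a b 0).apply _ = const _ * _
  rw [Diff2.apply_sum, Finset.mul_sum]
  set c := jacCoeff n a b with hc
  have h1 : ∑ k ∈ Finset.range (n + 1), const (c k * (k * (k + a))) *
        ((x - 1) ^ (k - 1) * (x + 1) ^ (n - k + 1)) =
      ∑ k ∈ Finset.range (n + 1), const (c k * ((n - k) * (n - k + b))) *
        ((x - 1) ^ k * (x + 1) ^ (n - k)) := by
    rw [Finset.sum_range_succ', Finset.sum_range_succ]
    simp only [Nat.cast_zero, zero_mul, mul_zero, const_zero, sub_self, add_zero]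
    refine Finset.sum_congr rfl fun k hk => ?_
    have hk := Finset.mem_range.mp hk
    have := jacCoeff_succ (a := a) (b := b) hk
    rw [← hc] at this
    push_cast
    rw [this, show n - (k + 1) + 1 = n - k by omega]
  have h2 : ∑ k ∈ Finset.range (n + 1), const (c k * ((n - k) * (n - k + b))) *
        ((x - 1) ^ (k + 1) * (x + 1) ^ (n - k - 1)) =
      ∑ k ∈ Finset.range (n + 1), const (c k * (k * (k + a))) *
        ((x - 1) ^ k * (x + 1) ^ (n - k)) := by
    symm
    rw [Finset.sum_range_succ', Finset.sum_range_succ]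
    simp only [Nat.cast_zero, zero_mul, mul_zero, const_zero, sub_self, add_zero]
    refine Finset.sum_congr rfl fun k hk => ?_
    have hk := Finset.mem_range.mp hk
    have := jacCoeff_succ (a := a) (b := b) hk
    rw [← hc] at this
    push_cast
    rw [this, show n - (k + 1) = n - k - 1 by omega]
  have h3 : ∀ k ∈ Finset.range (n + 1),
      (opN 0 a b 0).apply (const (c k) * ((x - 1) ^ k * (x + 1) ^ (n - k))) =
      const (c k * (k * (k + a))) * ((x - 1) ^ (k - 1) * (x + 1) ^ (n - k + 1)) +
      const (c k * (2 * k * (n - k) + (a + 1) * (n - k) + (b + 1) * k)) *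
        ((x - 1) ^ k * (x + 1) ^ (n - k)) +
      const (c k * ((n - k) * (n - k + b))) * ((x - 1) ^ (k + 1) * (x + 1) ^ (n - k - 1)) := by
    intro k hk
    have hk := Finset.mem_range.mp hk
    rw [Diff2.apply_const_mul, jacobi_apply_monomial, Nat.cast_sub (by omega : k ≤ n)]
    simp only [const_mul]
    ring
  rw [Finset.sum_congr rfl h3, Finset.sum_add_distrib, Finset.sum_add_distrib, h1, h2,
    ← Finset.sum_add_distrib, ← Finset.sum_add_distrib]
  refine Finset.sum_congr rfl fun k _ => ?_
  have key : const (c k * ((n - k) * (n - k + b))) +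
      const (c k * (2 * k * (n - k) + (a + 1) * (n - k) + (b + 1) * k)) +
      const (c k * (k * (k + a))) = const (Lam (a + b) n) * const (c k) := by
    rw [← const_mul, ← const_add, ← const_add]
    congr 1
    unfold Lam
    push_cast
    ring
  linear_combination ((x - 1) ^ k * (x + 1) ^ (n - k)) * key

theorem sol_jacobiMonic (n a b : ℕ) :
    Sol (opN 0 a b 0) (Lam (a + b) n) (ofPoly (jacobiMonic n a b)) := by
  rw [jacobiMonic, ofPoly_mul, ofPoly_C]
  exact (sol_jacobiP n a b).const_mul _

theorem natDegree_monomial_le (k m : ℕ) : ((X - 1 : ℝ[X]) ^ k * (X + 1) ^ m).Monic ∧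
    ((X - 1 : ℝ[X]) ^ k * (X + 1) ^ m).natDegree = k + m := by
  have h1 : (X - 1 : ℝ[X]).Monic := by simpa using monic_X_sub_C (1 : ℝ)
  have h2 : (X + 1 : ℝ[X]).Monic := by simpa using monic_X_add_C (1 : ℝ)
  have d1 : (X - 1 : ℝ[X]).natDegree = 1 := by simpa using natDegree_X_sub_C (1 : ℝ)
  have d2 : (X + 1 : ℝ[X]).natDegree = 1 := by simpa using natDegree_X_add_C (1 : ℝ)
  refine ⟨(h1.pow k).mul (h2.pow m), ?_⟩
  rw [(h1.pow k).natDegree_mul (h2.pow m), h1.natDegree_pow, h2.natDegree_pow, d1, d2]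
  ring

theorem jacobiP_natDegree_le (n a b : ℕ) : (jacobiP n a b).natDegree ≤ n := by
  refine (natDegree_C_mul_le _ _).trans (natDegree_sum_le_of_forall_le _ _ fun k hk => ?_)
  have hk := Finset.mem_range.mp hk
  rw [mul_assoc]
  refine (natDegree_C_mul_le _ _).trans ?_
  rw [(natDegree_monomial_le k (n - k)).2]
  omega

theorem jacobiP_coeff (n a b : ℕ) :
    (jacobiP n a b).coeff n = 2⁻¹ ^ n * ((2 * n + a + b).choose n : ℝ) := by
  rw [jacobiP, coeff_C_mul, finsetSum_coeff]
  congr 1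
  have h : ∀ k ∈ Finset.range (n + 1), (C (((n + a).choose (n - k) : ℝ) * ((n + b).choose k : ℝ)) *
      (X - 1) ^ k * (X + 1) ^ (n - k) : ℝ[X]).coeff n =
      (((n + b).choose k * (n + a).choose (n - k) : ℕ) : ℝ) := by
    intro k hk
    have hk := Finset.mem_range.mp hk
    obtain ⟨h1, h2⟩ := natDegree_monomial_le k (n - k)
    have h3 : ((X - 1 : ℝ[X]) ^ k * (X + 1) ^ (n - k)).coeff n = 1 := by
      have := h1.coeff_natDegree
      rwa [h2, show k + (n - k) = n by omega] at this
    rw [mul_assoc, coeff_C_mul, h3]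
    push_cast
    ring
  rw [Finset.sum_congr rfl h, ← Nat.cast_sum]
  congr 1
  rw [show 2 * n + a + b = (n + b) + (n + a) by ring, Nat.add_choose_eq,
    Finset.Nat.sum_antidiagonal_eq_sum_range_succ_mk]

theorem jacobiMonic_coeff (n a b : ℕ) : (jacobiMonic n a b).coeff n = 1 := by
  have h : (ascPochhammer ℝ n).eval ((n : ℝ) + a + b + 1) =
      (n.factorial * (2 * n + a + b).choose n : ℕ) := by
    have := Nat.ascFactorial_eq_factorial_mul_choose (n + a + b) n
    rw [show n + a + b + n = 2 * n + a + b by ring] at this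
    rw [← this, ← ascPochhammer_nat_eq_ascFactorial, ascPochhammer_eval_cast]
    push_cast
    rfl
  have h1 : ((2 * n + a + b).choose n : ℝ) ≠ 0 := by
    exact_mod_cast (Nat.choose_pos (by omega)).ne'
  rw [jacobiMonic, coeff_C_mul, jacobiP_coeff, h]
  push_cast
  have := Nat.factorial_ne_zero n
  field_simp
  rw [← mul_pow]
  norm_num

theorem jacobiMonic_natDegree_le (n a b : ℕ) : (jacobiMonic n a b).natDegree ≤ n :=
  (natDegree_C_mul_le _ _).trans (jacobiP_natDegree_le n a b)

theorem jacobiMonic_natDegree (n a b : ℕ) : (jacobiMonic n a b).natDegree = n :=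
  le_antisymm (jacobiMonic_natDegree_le n a b)
    (le_natDegree_of_ne_zero (by rw [jacobiMonic_coeff]; norm_num))

theorem jacobiMonic_monic (n a b : ℕ) : (jacobiMonic n a b).Monic := by
  rw [Monic, leadingCoeff, jacobiMonic_natDegree, jacobiMonic_coeff]

theorem jacobiMonic_ne_zero (n a b : ℕ) : jacobiMonic n a b ≠ 0 := (jacobiMonic_monic n a b).ne_zero

theorem jacobiMonic_eval_ne {c : ℝ} (hc : c = 1 ∨ c = -1) (n a b : ℕ) :
    (jacobiMonic n a b).eval c ≠ 0 := by
  obtain ⟨v, hv, h⟩ := unit_of_reg hc (reg_zero c) (sol_jacobiMonic n a b)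
    (ofPoly_ne_zero (jacobiMonic_ne_zero n a b)) (reg_ofPoly c _)
  rwa [(finPlace c).lim_unique h (lim_ofPoly c _)] at hv

theorem D_jacobiP (n a b : ℕ) : D (ofPoly (jacobiP (n + 1) a b)) =
    const ((n + a + b + 2) / 2) * ofPoly (jacobiP n (a + 1) (b + 1)) := by
  rw [ofPoly_jacobiP, ofPoly_jacobiP, D_const_mul, D_sum]
  have h : ∀ k ∈ Finset.range (n + 1 + 1), D (const (jacCoeff (n + 1) a b k) *
      ((x - 1) ^ k * (x + 1) ^ (n + 1 - k))) =
      const (jacCoeff (n + 1) a b k * k) * ((x - 1) ^ (k - 1) * (x + 1) ^ (n + 1 - k)) +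
      const (jacCoeff (n + 1) a b k * (n + 1 - k)) * ((x - 1) ^ k * (x + 1) ^ (n - k)) := by
    intro k hk
    have hk := Finset.mem_range.mp hk
    rw [D_const_mul, D_monomial, show n + 1 - k - 1 = n - k by omega, ← const_natCast,
      ← const_natCast, Nat.cast_sub (by omega), const_mul, const_mul]
    push_cast
    ring
  rw [Finset.sum_congr rfl h, Finset.sum_add_distrib, Finset.sum_range_succ' (n := n + 1),
    Finset.sum_range_succ (n := n + 1)]
  push_cast
  simp only [sub_self, mul_zero, const_zero, zero_mul, add_zero]
  rw [← Finset.sum_add_distrib, Finset.mul_sum, Finset.mul_sum, Finset.mul_sum]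
  refine Finset.sum_congr rfl fun k hk => ?_
  have hk := Finset.mem_range.mp hk
  suffices key : const (2⁻¹ ^ (n + 1)) * (const (jacCoeff (n + 1) a b (k + 1) * (k + 1)) +
      const (jacCoeff (n + 1) a b k * (n + 1 - k))) = const ((n + a + b + 2) / 2) *
      (const (2⁻¹ ^ n) * const (jacCoeff n (a + 1) (b + 1) k)) by
    linear_combination ((x - 1) ^ k * (x + 1) ^ (n - k)) * key
  rw [← const_add, ← const_mul, ← const_mul, ← const_mul]
  congr 1
  obtain ⟨m, rfl⟩ : ∃ m, n = k + m := ⟨n - k, by omega⟩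
  have h1 := choose_succ_cast (k + m + 1 + b) k (by omega)
  have h2 := choose_succ_cast (k + m + 1 + a) m (by omega)
  unfold jacCoeff
  rw [show k + m + 1 - (k + 1) = m by omega, show k + m + 1 - k = m + 1 by omega,
    show k + m - k = m by omega, show k + m + (a + 1) = k + m + 1 + a by ring,
    show k + m + (b + 1) = k + m + 1 + b by ring, pow_succ]
  push_cast at h1 h2 ⊢
  linear_combination (2⁻¹ ^ (k + m) * 2⁻¹ * ((k + m + 1 + a).choose m : ℝ)) * h1 +
    (2⁻¹ ^ (k + m) * 2⁻¹ * ((k + m + 1 + b).choose k : ℝ)) * h2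

theorem derivative_jacobiMonic (n a b : ℕ) : derivative (jacobiMonic (n + 1) a b) =
    C (n + 1 : ℝ) * jacobiMonic n (a + 1) (b + 1) := by
  obtain ⟨r, hr⟩ : ∃ r : ℝ, derivative (jacobiMonic (n + 1) a b) =
      C r * jacobiMonic n (a + 1) (b + 1) := by
    have h1 := D_jacobiP n a b
    rw [D_ofPoly, ← ofPoly_C, ← ofPoly_mul] at h1
    have h2 := ofPoly_injective h1
    have h3 : (ascPochhammer ℝ n).eval ((n : ℝ) + (a + 1 : ℕ) + (b + 1 : ℕ) + 1) ≠ 0 :=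
      (ascPochhammer_pos n _ (by positivity)).ne'
    have h4 : ((2 : ℝ) ^ n * (n.factorial : ℝ) /
        (ascPochhammer ℝ n).eval ((n : ℝ) + (a + 1 : ℕ) + (b + 1 : ℕ) + 1)) ≠ 0 :=
      div_ne_zero (mul_ne_zero (by positivity) (by exact_mod_cast n.factorial_ne_zero)) h3
    rw [jacobiMonic, jacobiMonic, derivative_C_mul, h2]
    set s := ((2 : ℝ) ^ n * (n.factorial : ℝ) /
        (ascPochhammer ℝ n).eval ((n : ℝ) + (a + 1 : ℕ) + (b + 1 : ℕ) + 1))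
    generalize (2 : ℝ) ^ (n + 1) * ((n + 1).factorial : ℝ) /
        (ascPochhammer ℝ (n + 1)).eval (((n + 1 : ℕ) : ℝ) + a + b + 1) = r
    refine ⟨r * ((n + a + b + 2) / 2) / s, ?_⟩
    rw [← mul_assoc, ← mul_assoc, ← C_mul, ← C_mul, div_mul_cancel₀ _ h4]
  have h := congrArg (fun P => coeff P n) hr
  simp only [coeff_derivative, coeff_C_mul, jacobiMonic_coeff, mul_one, one_mul] at h
  rw [hr, h]

/-! #### Primitives -/

theorem derivative_primitive (P : ℝ[X]) : derivative (primitive P) = P := by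
  unfold primitive
  rw [derivative_sub, derivative_C, sub_zero, Polynomial.sum_def, derivative_sum]
  conv_rhs => rw [P.as_sum_support]
  refine Finset.sum_congr rfl fun n _ => ?_
  have : (n : ℝ) + 1 ≠ 0 := by positivity
  rw [derivative_C_mul_X_pow, Nat.add_sub_cancel, C_mul_X_pow_eq_monomial]
  congr 1
  push_cast
  field_simp

theorem primitive_eval (P : ℝ[X]) : (primitive P).eval (-1) = 0 := by
  unfold primitive
  rw [eval_sub, eval_C, Polynomial.sum_def, Polynomial.sum_def, eval_finsetSum, sub_eq_zero]
  refine Finset.sum_congr rfl fun n _ => ?_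
  simp

theorem primitive_eval_one {P F : ℝ[X]} (h : derivative F = P) :
    (primitive P).eval 1 = F.eval 1 - F.eval (-1) := by
  have h1 : derivative (primitive P - F) = 0 := by
    rw [derivative_sub, derivative_primitive, h, sub_self]
  have h2 := eq_C_of_derivative_eq_zero h1
  have h3 := congrArg (eval 1) h2
  have h4 := congrArg (eval (-1)) h2
  rw [eval_sub, eval_C] at h3 h4
  rw [primitive_eval] at h4
  linarith

theorem derivative_weight (a b : ℕ) : derivative ((1 - X : ℝ[X]) ^ (a + 1) * (1 + X) ^ (b + 1)) =
    C (b + 1 : ℝ) * ((1 - X) ^ (a + 1) * (1 + X) ^ b) -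
      C (a + 1 : ℝ) * ((1 - X) ^ a * (1 + X) ^ (b + 1)) := by
  rw [derivative_mul, derivative_pow, derivative_pow, Nat.add_sub_cancel, Nat.add_sub_cancel,
    derivative_sub, derivative_add, derivative_X, derivative_one]
  push_cast
  ring

theorem beta_eval (a b : ℕ) : (primitive ((1 - X : ℝ[X]) ^ a * (1 + X) ^ b)).eval 1 =
    2 ^ (a + b + 1) * (a.factorial * b.factorial / (a + b + 1).factorial) := by
  induction a generalizing b with
  | zero =>
    rw [primitive_eval_one (F := C ((b + 1 : ℝ)⁻¹) * (1 + X) ^ (b + 1))]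
    · have : (b : ℝ) + 1 ≠ 0 := by positivity
      have := Nat.factorial_ne_zero b
      rw [show 0 + b + 1 = b + 1 by ring, Nat.factorial_succ]
      simp
      field_simp
      norm_num
    · have : (b : ℝ) + 1 ≠ 0 := by positivity
      rw [derivative_C_mul, derivative_pow, derivative_add, derivative_X, derivative_one,
        Nat.add_sub_cancel, pow_zero, one_mul, zero_add, mul_one, ← mul_assoc, ← C_mul]
      push_cast
      rw [inv_mul_cancel₀ this, C_1, one_mul]
  | succ a ih =>
    have hb : (b : ℝ) + 1 ≠ 0 := by positivity
    have h := ih (b + 1)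
    rw [primitive_eval_one (F := C ((b + 1 : ℝ)⁻¹) * ((1 - X : ℝ[X]) ^ (a + 1) * (1 + X) ^ (b + 1))
      + C ((a + 1) / (b + 1 : ℝ)) * primitive ((1 - X : ℝ[X]) ^ a * (1 + X) ^ (b + 1)))]
    · simp only [eval_add, eval_mul, eval_C, primitive_eval, h]
      rw [Nat.factorial_succ, Nat.factorial_succ, show a + 1 + b + 1 = a + (b + 1) + 1 by ring]
      simp
      field_simp
      rw [Nat.factorial_succ (a + (b + 1)), Nat.factorial_succ a]
      push_cast
      ring
    · rw [derivative_add, derivative_C_mul, derivative_C_mul, derivative_primitive,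
        derivative_weight]
      have e1 : C ((b + 1 : ℝ)⁻¹) * C (b + 1 : ℝ) = 1 := by
        rw [← C_mul, inv_mul_cancel₀ hb, C_1]
      have e2 : C ((a + 1) / (b + 1 : ℝ)) = C ((b + 1 : ℝ)⁻¹) * C (a + 1 : ℝ) := by
        rw [← C_mul]; congr 1; field_simp
      rw [e2]
      linear_combination ((1 - X) ^ (a + 1) * (1 + X) ^ b) * e1

end
end ExcJacobi

namespace ExcJacobi
noncomputable section

open Place

/-! #### Norms -/

theorem weight_eq (a b : ℕ) : weight a b = ofPoly ((1 - X) ^ a * (1 + X) ^ b) := by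
  rw [ofPoly_mul, ofPoly_pow, ofPoly_pow, ofPoly_sub, ofPoly_add, ofPoly_one, ofPoly_X, weight]

/-- The Sturm-Liouville form of the classical equation. -/
theorem sturm_classical {a b : ℕ} {lam : ℝ} {y : RF} (hy : Sol (opN 0 a b 0) lam y) :
    D ((x ^ 2 - 1) * weight a b * D y) = const lam * (weight a b * y) := by
  have h1 : (opN 0 a b 0).p * D (D y) + (opN 0 a b 0).q * D y + (opN 0 a b 0).r * y =
    const lam * y := hy
  have h2 : D ((x ^ 2 - 1) * weight a b) = (opN 0 a b 0).q * weight a b := hW_opN 0 a b 0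
  have h3 : (opN 0 a b 0).r = 0 := by rw [opN_eq_opJ]; exact const_zero
  have h4 : (opN 0 a b 0).p = x ^ 2 - 1 := rfl
  rw [h3, h4] at h1
  rw [D_mul, h2]
  linear_combination weight a b * h1

theorem derivative_jacobi_weight (n a b : ℕ) :
    derivative ((1 - X) ^ (a + 1) * (1 + X) ^ (b + 1) * derivative (jacobiMonic n a b)) =
      -(C (Lam (a + b) n) * ((1 - X) ^ a * (1 + X) ^ b * jacobiMonic n a b)) := by
  apply ofPoly_injective
  rw [← D_ofPoly, ofPoly_mul _ (derivative _), ofPoly_neg, ofPoly_mul (C _), ofPoly_mul _ (jacobiMonic _ _ _), ofPoly_C, ← weight_eq,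
    ← weight_eq, ← D_ofPoly, ← sturm_classical (sol_jacobiMonic n a b), p_mul_weight, neg_mul,
    D_neg, neg_neg]

theorem nuCl_succ (n a b : ℕ) : nuCl ((n + 1 : ℕ) : ℝ) a b * (n + a + b + 2) =
    (n + 1) * nuCl n ((a + 1 : ℕ) : ℝ) ((b + 1 : ℕ) : ℝ) := by
  unfold nuCl
  have e1 : ((1 : ℝ) + (a + 1 : ℕ) + (b + 1 : ℕ) + 2 * n) = 1 + a + b + 2 * (n + 1 : ℕ) := by
    push_cast; ring
  have e2 : (((a + 1 : ℕ) : ℝ) + (b + 1 : ℕ) + n + 1) = (a + b + (n + 1 : ℕ) + 1) + 1 := by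
    push_cast; ring
  have e3 : (((a + 1 : ℕ) : ℝ) + n + 1) = a + (n + 1 : ℕ) + 1 := by push_cast; ring
  have e4 : (((b + 1 : ℕ) : ℝ) + n + 1) = b + (n + 1 : ℕ) + 1 := by push_cast; ring
  have e5 : (((a + 1 : ℕ) : ℝ) + (b + 1 : ℕ) + 2 * n + 1) = a + b + 2 * (n + 1 : ℕ) + 1 := by
    push_cast; ring
  have e6 : (((a + 1 : ℕ) : ℝ) + (b + 1 : ℕ) + 2 * n + 2) = a + b + 2 * (n + 1 : ℕ) + 2 := by
    push_cast; ring
  have e7 : Real.Gamma (((n + 1 : ℕ) : ℝ) + 1) = (n + 1) * Real.Gamma (n + 1) := by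
    rw [Real.Gamma_add_one (by positivity)]; push_cast; ring
  rw [e1, e2, e3, e4, e5, e6, e7, Real.Gamma_add_one (s := (a : ℝ) + b + (n + 1 : ℕ) + 1)
    (by positivity)]
  push_cast
  ring

theorem nuCl_pos (n a b : ℕ) : 0 < nuCl n a b := by
  unfold nuCl
  have h : ∀ r : ℝ, 0 < r → 0 < Real.Gamma r := fun r hr => Real.Gamma_pos_of_pos hr
  have h1 := h (n + 1) (by positivity)
  have h2 := h (a + b + n + 1) (by positivity)
  have h3 := h (a + n + 1) (by positivity)
  have h4 := h (b + n + 1) (by positivity)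
  have h5 := h (a + b + 2 * n + 1) (by positivity)
  have h6 := h (a + b + 2 * n + 2) (by positivity)
  positivity

theorem nuCl_zero (a b : ℕ) : nuCl 0 a b =
    (primitive ((1 - X : ℝ[X]) ^ a * (1 + X) ^ b)).eval 1 := by
  have h : (a : ℝ) + b + 2 * 0 + 2 = ((a + b + 1 : ℕ) : ℝ) + 1 := by push_cast; ring
  have h' : (a : ℝ) + b + 2 * 0 + 1 = ((a + b : ℕ) : ℝ) + 1 := by push_cast; ring
  have h'' : (a : ℝ) + b + 0 + 1 = ((a + b : ℕ) : ℝ) + 1 := by push_cast; ring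
  have e : (1 : ℝ) + a + b + 2 * 0 = ((a + b + 1 : ℕ) : ℝ) := by push_cast; ring
  rw [beta_eval, nuCl, h, h', h'', e, Real.rpow_natCast, Real.Gamma_nat_eq_factorial,
    Real.Gamma_nat_eq_factorial, zero_add, Real.Gamma_one, add_zero, add_zero,
    Real.Gamma_nat_eq_factorial, Real.Gamma_nat_eq_factorial]
  have := Nat.factorial_ne_zero (a + b)
  have := Nat.factorial_ne_zero (a + b + 1)
  field_simp

theorem jacobiMonic_zero (a b : ℕ) : jacobiMonic 0 a b = 1 :=
  (jacobiMonic_monic 0 a b).natDegree_eq_zero.mp (jacobiMonic_natDegree 0 a b)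

theorem rho_eval_one (n a b : ℕ) : (rho n n a b).eval 1 = nuCl n a b := by
  induction n generalizing a b with
  | zero => rw [rho, jacobiMonic_zero, one_mul, one_mul, Nat.cast_zero, nuCl_zero]
  | succ n ih =>
    have hl : Lam (a + b) (n + 1 : ℕ) = (n + 1) * (n + a + b + 2) := by
      unfold Lam; push_cast; ring
    have hn : (n : ℝ) + 1 ≠ 0 := by positivity
    have hn' : (n : ℝ) + a + b + 2 ≠ 0 := by positivity
    have hl0 : Lam (a + b) (n + 1 : ℕ) ≠ 0 := by rw [hl]; exact mul_ne_zero hn hn'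
    set l := Lam (a + b) (n + 1 : ℕ)
    have hs := derivative_jacobi_weight (n + 1) a b
    have hd := derivative_jacobiMonic n a b
    set π := jacobiMonic (n + 1) a b
    set π₁ := jacobiMonic n (a + 1) (b + 1)
    rw [rho, primitive_eval_one (F := C l⁻¹ * (C ((n + 1 : ℝ) ^ 2) * rho n n (a + 1) (b + 1) -
      (1 - X) ^ (a + 1) * (1 + X) ^ (b + 1) * derivative π * π))]
    · have e1 : (rho n n (a + 1) (b + 1)).eval (-1) = 0 := primitive_eval _
      simp only [eval_C, eval_mul, eval_pow, eval_sub, eval_add, eval_one, eval_X, ih, e1]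
      have := nuCl_succ n a b
      rw [hl]
      have h2 : nuCl ((n + 1 : ℕ) : ℝ) a b =
        (n + 1) * nuCl n ((a + 1 : ℕ) : ℝ) ((b + 1 : ℕ) : ℝ) / (n + a + b + 2) := by
        rw [← this]; field_simp
      rw [h2]
      norm_num
      field_simp
    · rw [derivative_C_mul, derivative_sub, derivative_C_mul, rho, derivative_primitive,
        derivative_mul, hs, hd]
      have e1 : C l⁻¹ * C l = 1 := by rw [← C_mul, inv_mul_cancel₀ hl0, C_1]
      rw [C_pow]
      linear_combination ((1 - X) ^ a * (1 + X) ^ b * π * π) * e1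

theorem D_rho_classical (i j a b : ℕ) : D (ofPoly (rho i j a b)) =
    ofPoly (jacobiMonic i a b) * ofPoly (jacobiMonic j a b) * weight a b := by
  rw [D_ofPoly, rho, derivative_primitive, ofPoly_mul, ofPoly_mul, weight_eq]

theorem lim_rho_neg (i j a b : ℕ) : (finPlace (-1)).Lim (ofPoly (rho i j a b)) 0 := by
  have := lim_ofPoly (-1) (rho i j a b)
  rwa [rho, primitive_eval] at this

theorem lim_pW_mul {c : ℝ} (hc : c = 1 ∨ c = -1) {α β : ℕ} {g : RF} (hg : Reg c g) :
    (finPlace c).Lim ((x ^ 2 - 1) * weight α β * g) 0 := by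
  obtain ⟨v, hv⟩ := hg
  obtain ⟨w, -, hw⟩ := asym_pW hc α β
  have h := hw.mul (asym_zero_iff.mpr hv)
  have h1 := h.shift (k := (expo c α β : ℤ) + 1) (by omega)
  exact asym_zero_iff.mp (h1.congr
    (by change (expo c α β + 1 : ℤ) + 0 - 1 * (expo c α β + 1) = 0; ring) rfl)

theorem comm_classical (i j a b : ℕ) :
    const (Lam (a + b) i - Lam (a + b) j) * ofPoly (rho i j a b) =
    (x ^ 2 - 1) * weight a b * (D (ofPoly (jacobiMonic i a b)) * ofPoly (jacobiMonic j a b) -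
      ofPoly (jacobiMonic i a b) * D (ofPoly (jacobiMonic j a b))) := by
  have hi := sturm_classical (sol_jacobiMonic i a b)
  have hj := sturm_classical (sol_jacobiMonic j a b)
  set f := ofPoly (jacobiMonic i a b) with hf
  set g := ofPoly (jacobiMonic j a b) with hg
  have h : D (const (Lam (a + b) i - Lam (a + b) j) * ofPoly (rho i j a b) -
      (x ^ 2 - 1) * weight a b * (D f * g - f * D g)) = 0 := by
    have e : (x ^ 2 - 1) * weight a b * (D f * g - f * D g) =
      (x ^ 2 - 1) * weight a b * D f * g - f * ((x ^ 2 - 1) * weight a b * D g) := by ring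
    rw [D_sub, D_const_mul, D_rho_classical, e, D_sub, D_mul _ g, D_mul f, hi, hj, const_sub,
      ← hf, ← hg]
    ring
  obtain ⟨c, hc⟩ := D_eq_zero h
  have h1 : (finPlace (-1)).Asym (const (Lam (a + b) i - Lam (a + b) j) * ofPoly (rho i j a b)) 0 0 :=
    ((asym_zero_iff.mpr (lim_rho_neg i j a b)).const_mul _).congr rfl (by ring)
  have rf : Reg (-1) f := reg_ofPoly _ _
  have rg : Reg (-1) g := reg_ofPoly _ _
  have h2 := h1.sub (asym_zero_iff.mpr (lim_pW_mul (Or.inr rfl) (α := a) (β := b)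
    ((rf.D.mul rg).sub (rf.mul rg.D))))
  rw [hc] at h2
  have := h2.unique (asym_const c)
  rw [← sub_eq_zero, hc, ← this, sub_zero, const_zero]

theorem lim_rho_one (i j a b : ℕ) :
    (finPlace 1).Lim (ofPoly (rho i j a b)) (if i = j then nuCl i a b else 0) := by
  have h := lim_ofPoly 1 (rho i j a b)
  split_ifs with hij
  · subst hij; rwa [rho_eval_one] at h
  · have hne := sub_ne_zero.mpr (Lam_ne_of_ne (N := a + b) hij)
    have rf : Reg 1 (ofPoly (jacobiMonic i a b)) := reg_ofPoly _ _
    have rg : Reg 1 (ofPoly (jacobiMonic j a b)) := reg_ofPoly _ _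
    have h1 := lim_pW_mul (Or.inl rfl) (α := a) (β := b) ((rf.D.mul rg).sub (rf.mul rg.D))
    rw [← comm_classical] at h1
    have h2 := ((asym_zero_iff.mpr h).const_mul (Lam (a + b) i - Lam (a + b) j)).unique
      (asym_zero_iff.mpr h1)
    rcases mul_eq_zero.mp h2 with h3 | h3
    · exact absurd h3 hne
    · rwa [h3] at h

/-! #### The classical spectral diagram -/

/-- The labels of the classical operator. -/
def lab₀ (a b : ℕ) (j : ℤ) : Label :=
  if 0 ≤ j then .circle else if -(min a b : ℤ) ≤ j then .bullet else if b < a then .plus else .minus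

theorem lab₀_nat (a b i : ℕ) : lab₀ a b i = .circle := if_pos (by omega)

theorem diag_classical {a b : ℕ} {j : ℤ} (hj : -((a + b : ℕ) + 1 : ℤ) ≤ 2 * j) :
    Diag (opN 0 a b 0) (weight a b) (Lam (a + b) j) j (-j - (a + b : ℕ) - 1) (lab₀ a b j) := by
  push_cast at hj ⊢
  have hstar : Lam (a + b) j = Lam (a + b) (-j - a - b - 1) := by
    rw [Lam_eq_iff]; push_cast; omega
  have hjr : -((a : ℝ) + b + 1) ≤ 2 * j := by exact_mod_cast hj
  unfold lab₀
  split_ifs with h1 h2 h3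
  · obtain ⟨n, rfl⟩ := Int.eq_ofNat_of_zero_le h1
    have h0 := jacobiMonic_ne_zero n a b
    have hy := sol_jacobiMonic n a b
    have e : ofPoly (jacobiMonic n a b) =
      ofPoly (jacobiMonic n a b) / ((x - 1) ^ 0 * (x + 1) ^ 0) := by simp
    rw [e] at hy
    refine hasSol_quot h0 hy (Or.inl rfl) (Or.inl rfl) ?_ (by simp) (by simp) ?_
    · rw [jacobiMonic_natDegree]; simp
    · rintro - ⟨h, hh⟩
      rw [← e] at hh
      refine not_lExact_classical (Or.inl rfl) (sol_jacobiMonic n a b) (reg_ofPoly 1 _)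
        (ofPoly_ne_zero h0) ⟨h, ?_⟩
      rw [hh, sub_self]
      exact reg_zero 1
  · have h2' : -(a : ℤ) ≤ j ∧ -(b : ℤ) ≤ j := by omega
    have r2 : -(a : ℝ) ≤ j ∧ -(b : ℝ) ≤ j := ⟨by exact_mod_cast h2'.1, by exact_mod_cast h2'.2⟩
    refine ⟨?_, ?_, ?_⟩
    · obtain ⟨n, hn⟩ := Int.eq_ofNat_of_zero_le (show 0 ≤ a + j by omega)
      have hnr : (n : ℝ) = a + j := by exact_mod_cast hn.symm
      obtain ⟨P, hP, hd, hs⟩ := exists_sol_three a b n (by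
        intro s _
        have : (0 : ℝ) ≤ s := s.cast_nonneg
        rw [hnr]; linarith)
      rw [show (n - a : ℤ) = j by omega] at hs
      exact hasSol_quot hP hs (Or.inr ⟨rfl, by omega⟩) (Or.inl rfl) (by omega)
        (by simp; omega) (by simp) (fun h => h.elim)
    · obtain ⟨n, hn⟩ := Int.eq_ofNat_of_zero_le (show 0 ≤ b + j by omega)
      have hnr : (n : ℝ) = b + j := by exact_mod_cast hn.symm
      obtain ⟨P, hP, hd, hs⟩ := exists_sol_four a b n (by
        intro s _
        have : (0 : ℝ) ≤ s := s.cast_nonneg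
        rw [hnr]; linarith)
      rw [show (n - b : ℤ) = j by omega] at hs
      exact hasSol_quot hP hs (Or.inl rfl) (Or.inr ⟨rfl, by omega⟩) (by omega)
        (by simp) (by simp; omega) (fun h => h.elim)
    · obtain ⟨n, hn⟩ := Int.eq_ofNat_of_zero_le (show 0 ≤ -j - 1 by omega)
      have hnr : (n : ℝ) = -j - 1 := by exact_mod_cast hn.symm
      obtain ⟨P, hP, hd, hs⟩ := exists_sol_two a b n (by
        intro s hs
        have : (s : ℝ) + 1 ≤ n := by exact_mod_cast hs
        rw [hnr] at this ⊢; linarith)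
      rw [show (n - a - b : ℤ) = -j - a - b - 1 by omega, ← hstar] at hs
      exact hasSol_quot hP hs (Or.inr ⟨rfl, by omega⟩) (Or.inr ⟨rfl, by omega⟩) (by omega)
        (by simp; omega) (by simp; omega) (fun h => h.elim)
  · have h2' : j < -(b : ℤ) := by omega
    obtain ⟨n, hn⟩ := Int.eq_ofNat_of_zero_le (show 0 ≤ -j - b - 1 by omega)
    have hnr : (n : ℝ) = -j - b - 1 := by exact_mod_cast hn.symm
    obtain ⟨P, hP, hd, hs⟩ := exists_sol_three a b n (by
      intro s hs
      have : (s : ℝ) + 1 ≤ n := by exact_mod_cast hs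
      rw [hnr] at this ⊢; linarith)
    rw [show (n - a : ℤ) = -j - a - b - 1 by omega, ← hstar] at hs
    refine hasSol_quot hP hs (Or.inr ⟨rfl, by omega⟩) (Or.inl rfl) (by omega) (by simp; omega)
      (by simp) ?_
    rintro - he
    obtain ⟨z, z0, hz, hr⟩ := exists_reg_of_exact (Or.inl rfl) hs
      ((asym_inf_quot hP a 0).ne_zero (leadingCoeff_ne_zero.mpr hP)) he
    obtain ⟨m, ⟨v, hv, hm⟩, hb, -⟩ := classical_of_sol hz z0
    have h5 := classical_exponent hz hv hm
    rw [Lam_eq_iff] at h5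
    have := hb hr
    push_cast at h5
    omega
  · have h2' : j < -(a : ℤ) := by omega
    obtain ⟨n, hn⟩ := Int.eq_ofNat_of_zero_le (show 0 ≤ -j - a - 1 by omega)
    have hnr : (n : ℝ) = -j - a - 1 := by exact_mod_cast hn.symm
    obtain ⟨P, hP, hd, hs⟩ := exists_sol_four a b n (by
      intro s hs
      have : (s : ℝ) + 1 ≤ n := by exact_mod_cast hs
      rw [hnr] at this ⊢; linarith)
    rw [show (n - b : ℤ) = -j - a - b - 1 by omega, ← hstar] at hs
    refine hasSol_quot hP hs (Or.inl rfl) (Or.inr ⟨rfl, by omega⟩) (by omega) (by simp)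
      (by simp; omega) ?_
    rintro - he
    obtain ⟨z, z0, hz, hr⟩ := exists_reg_of_exact (Or.inr rfl) hs
      ((asym_inf_quot hP 0 b).ne_zero (leadingCoeff_ne_zero.mpr hP)) he
    obtain ⟨m, ⟨v, hv, hm⟩, -, hb⟩ := classical_of_sol hz z0
    have h5 := classical_exponent hz hv hm
    rw [Lam_eq_iff] at h5
    have := hb hr
    push_cast at h5
    omega

theorem state_classical (a b : ℕ) : State (a + b) (lab₀ a b) a b 0 0 0
    (fun i => ofPoly (jacobiMonic i a b)) (fun i j => ofPoly (rho i j a b))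
    (fun i => nuCl i a b) (fun _ => 1) (fun i => (jacobiMonic i a b).eval (-1)) where
  sum := by ring
  reg_u c _ := reg_zero c
  asym_u := (asym_zero _).congr rfl (by simp)
  sol i _ := sol_jacobiMonic i a b
  lim_one i _ := ⟨_, jacobiMonic_eval_ne (Or.inl rfl) i a b, lim_ofPoly 1 _⟩
  lim_neg i _ := ⟨jacobiMonic_eval_ne (Or.inr rfl) i a b, lim_ofPoly (-1) _⟩
  asym_f i _ := ⟨one_ne_zero, (asym_inf_ofPoly (jacobiMonic_ne_zero i a b)).congr
    (by rw [jacobiMonic_natDegree]; simp) (jacobiMonic_monic i a b)⟩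
  not_lExact i _ c hc := not_lExact_classical hc (sol_jacobiMonic i a b) (reg_ofPoly c _)
    (ofPoly_ne_zero (jacobiMonic_ne_zero i a b))
  D_rho i j _ _ := D_rho_classical i j a b
  rho_neg i j _ _ := lim_rho_neg i j a b
  rho_one i j _ _ := lim_rho_one i j a b
  nu_ne i _ := (nuCl_pos i a b).ne'
  diag j hj := by simpa using diag_classical hj
  ric lam := by
    rintro ⟨w, hw⟩
    obtain ⟨Q, i, j, q1, -, -, -, -, -, rfl⟩ := ric_classical hw
    have hQ := ne_zero_of_eval q1
    have hm := asym_inf_quot hQ i j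
    have hl := leadingCoeff_ne_zero.mpr hQ
    exact ⟨_, classical_exponent (sol_of_mem_Ric (hm.ne_zero hl) hw) hl hm⟩

theorem comm_state_classical (a b : ℕ) : Comm (a + b) (lab₀ a b) a b
    (fun i => ofPoly (jacobiMonic i a b)) (fun i j => ofPoly (rho i j a b)) :=
  fun i j _ _ => comm_classical i j a b

end
end ExcJacobi

namespace ExcJacobi
noncomputable section

open Place

/-! ### Determinants -/

section

variable {A : Type*} [CommRing A] {m n : Type*} [Fintype m] [Fintype n] [DecidableEq m]
  [DecidableEq n]

/-- The Schur complement, without inverses. -/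
theorem det_fromBlocks_of_mul (R : Matrix m m A) (c : Matrix m n A) (r : Matrix n m A)
    (E : Matrix n n A) (w : Matrix m n A) (h : R * w = c) :
    (Matrix.fromBlocks R c r E).det = R.det * (E - r * w).det := by
  have h1 : Matrix.fromBlocks R c r E * Matrix.fromBlocks 1 (-w) 0 1 =
      Matrix.fromBlocks R 0 r (E - r * w) := by
    rw [Matrix.fromBlocks_multiply]
    simp only [mul_one, add_zero, Matrix.mul_neg, h, Matrix.mul_one, Matrix.mul_zero]
    congr 1
    · rw [neg_add_cancel]
    · rw [neg_add_eq_sub]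
  have h2 := congrArg Matrix.det h1
  rwa [Matrix.det_mul, Matrix.det_fromBlocks_zero₂₁, Matrix.det_fromBlocks_zero₁₂, Matrix.det_one,
    Matrix.det_one, mul_one, mul_one] at h2

theorem det_option_of_mul (M : Matrix (Option m) (Option m) A) (w : m → A)
    (h : ∀ i, ∑ j, M (some i) (some j) * w j = M (some i) none) :
    M.det = (Matrix.of fun i j => M (some i) (some j)).det *
      (M none none - ∑ j, M none (some j) * w j) := by
  have h1 := det_fromBlocks_of_mul (Matrix.of fun i j => M (some i) (some j))
    (Matrix.of fun i (_ : PUnit.{1}) => M (some i) none) (Matrix.of fun (_ : PUnit.{1}) j => M none (some j))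
    (Matrix.of fun (_ _ : PUnit.{1}) => M none none) (Matrix.of fun i _ => w i)
    (by ext i j; simp [Matrix.mul_apply, h])
  rw [← Matrix.det_reindex_self (Equiv.optionEquivSumPUnit.{0} m)]
  convert h1 using 2
  · ext (i | i) (j | j) <;> rfl
  · rw [Matrix.det_unique]; simp [Matrix.mul_apply]

theorem det_triangular {k : ℕ} (h : A) (B C : ℕ → Fin k → A) (c : ℕ → ℕ → A)
    (hC : ∀ i j, C i j = h * B i j + ∑ s ∈ Finset.range i, c i s * B s j) :
    (Matrix.of fun i j : Fin k => C i j).det = h ^ k * (Matrix.of fun i j : Fin k => B i j).det := by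
  let l : ℕ → ℕ → A := fun i s => if s < i then c i s else if s = i then h else 0
  have h1 : (Matrix.of fun i j : Fin k => C i j) =
      (Matrix.of fun i j : Fin k => l i j) * Matrix.of fun i j : Fin k => B i j := by
    ext i j
    rw [Matrix.mul_apply]
    simp only [Matrix.of_apply]
    rw [Fin.sum_univ_eq_sum_range (fun s => l i s * B s j), hC,
      ← Finset.sum_subset (Finset.range_subset_range.mpr (show (i : ℕ) + 1 ≤ k from i.2)),
      Finset.sum_range_succ, add_comm]
    · congr 1
      · refine Finset.sum_congr rfl fun s hs => ?_
        simp [l, Finset.mem_range.mp hs]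
      · simp [l]
    · intro s _ hs
      rw [Finset.mem_range, not_lt] at hs
      simp only [l]
      rw [if_neg (by omega), if_neg (by omega), zero_mul]
  rw [h1, Matrix.det_mul, Matrix.det_of_isLowerTriangular]
  · simp [l]
  · intro i j hij
    have hij : (i : ℕ) < j := hij
    simp only [Matrix.of_apply, l]
    rw [if_neg (by omega), if_neg (by omega)]

end

/-! ### Wronskians -/

section

variable {ι : Type*}

theorem lower_D {B : ℕ → ι → RF} {e : ℕ → RF}
    (hB : ∀ s k, D (B s k) = B (s + 1) k + e s * B 0 k) {i : ℕ} {h : RF} {A : ι → RF} {c : ℕ → RF}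
    (hA : ∀ k, A k = h * B i k + ∑ s ∈ Finset.range i, c s * B s k) :
    ∃ c' : ℕ → RF, ∀ k, D (A k) = h * B (i + 1) k + ∑ s ∈ Finset.range (i + 1), c' s * B s k := by
  refine ⟨fun s => (if s = 0 then h * e i + ∑ r ∈ Finset.range i, c r * e r else c (s - 1)) +
    (if s = i then D h else D (c s)), fun k => ?_⟩
  simp only [add_mul, Finset.sum_add_distrib]
  rw [Finset.sum_range_succ', Finset.sum_range_succ (fun s => (if s = i then D h else D (c s)) * B s k)]
  simp only [if_true, Nat.add_sub_cancel, Nat.add_one_ne_zero, if_false]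
  have h1 : ∑ s ∈ Finset.range i, (if s = i then D h else D (c s)) * B s k =
      ∑ s ∈ Finset.range i, D (c s) * B s k :=
    Finset.sum_congr rfl fun s hs => by rw [if_neg (Finset.mem_range.mp hs).ne]
  rw [h1, hA, D_add, D_mul, hB, D_sum]
  simp only [D_mul, hB, mul_add, add_mul, Finset.sum_add_distrib, Finset.sum_mul, ← mul_assoc]
  ring

theorem exists_lower {B : ℕ → ι → RF} {e : ℕ → RF}
    (hB : ∀ s k, D (B s k) = B (s + 1) k + e s * B 0 k) (h : RF) :
    ∃ c : ℕ → ℕ → RF, ∀ i k, D^[i] (h * B 0 k) =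
      h * B i k + ∑ s ∈ Finset.range i, c i s * B s k := by
  have : ∀ i, ∃ c : ℕ → RF, ∀ k, D^[i] (h * B 0 k) =
      h * B i k + ∑ s ∈ Finset.range i, c s * B s k := by
    intro i
    induction i with
    | zero => exact ⟨0, fun k => by simp⟩
    | succ i ih =>
      obtain ⟨c, hc⟩ := ih
      obtain ⟨c', hc'⟩ := lower_D hB hc
      exact ⟨c', fun k => by rw [Function.iterate_succ_apply', hc']⟩
  choose c hc using this
  exact ⟨c, hc⟩

theorem D_iterate (s : ℕ) (y : RF) : D (D^[s] y) = D^[s + 1] y + 0 * D^[0] y := by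
  rw [Function.iterate_succ_apply', zero_mul, add_zero]

theorem wr_mul {n : ℕ} (h : RF) (f : Fin n → RF) : wr (fun j => h * f j) = h ^ n * wr f := by
  obtain ⟨c, hc⟩ := exists_lower (B := fun s (y : RF) => D^[s] y) (e := 0) D_iterate h
  exact det_triangular h (fun s j => D^[s] (f j)) _ c fun i j => hc i (f j)

theorem D_iterate_const_mul (c : ℝ) (s : ℕ) (y : RF) : D^[s] (const c * y) = const c * D^[s] y := by
  induction s with
  | zero => rfl
  | succ s ih => rw [Function.iterate_succ_apply', Function.iterate_succ_apply', ih, D_const_mul]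

theorem wr_const_mul {n : ℕ} (c : Fin n → ℝ) (f : Fin n → RF) :
    wr (fun j => const (c j) * f j) = const (∏ j, c j) * wr f := by
  have h : const (∏ j, c j) = ∏ j, const (c j) := map_prod (RatFunc.C : ℝ →+* RatFunc ℝ) c _
  unfold wr
  rw [h, ← Matrix.det_mul_row]
  congr 1
  ext i j
  simp only [Matrix.of_apply, D_iterate_const_mul]

theorem wr_succ {n : ℕ} (f : Fin (n + 1) → RF) (h0 : f 0 ≠ 0) :
    wr f = f 0 * wr (fun j : Fin n => dar (D (f 0) / f 0) (f j.succ)) := by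
  set w := D (f 0) / f 0 with hw
  have key : ∀ i, ∃ c : ℕ → RF, ∀ y, D^[i] (dar w y) =
      1 * D^[i + 1] y + ∑ s ∈ Finset.range (i + 1), c s * D^[s] y := by
    intro i
    induction i with
    | zero => exact ⟨fun _ => -w, fun y => by simp [dar]; ring⟩
    | succ i ih =>
      obtain ⟨c, hc⟩ := ih
      obtain ⟨c', hc'⟩ := lower_D (B := fun s (y : RF) => D^[s] y) (e := 0) D_iterate hc
      exact ⟨c', fun y => by rw [Function.iterate_succ_apply', hc']⟩
  choose c hc using key
  have h1 := det_triangular (k := n + 1) 1 (fun s j => D^[s] (f j))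
    (fun i j => if i = 0 then f j else D^[i - 1] (dar w (f j))) (fun i s => c (i - 1) s) (by
      intro i j
      rcases i with _ | i
      · simp
      · simp only [Nat.add_one_ne_zero, if_false, Nat.add_sub_cancel, hc])
  rw [one_pow, one_mul] at h1
  have hd : dar w (f 0) = 0 := by
    rw [dar, hw, div_mul_cancel₀ _ h0, sub_self]
  unfold wr
  rw [← h1, Matrix.det_succ_column_zero, Fin.sum_univ_succ]
  have hz : ∀ i : ℕ, D^[i] (0 : RF) = 0 := by
    intro i
    induction i with
    | zero => rfl
    | succ i ih => rw [Function.iterate_succ_apply', ih, D_zero]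
  simp [hd, hz]
  left
  rfl

end

end
end ExcJacobi

namespace ExcJacobi
noncomputable section

open Place

/-! ### Bordered determinants -/

/-- The matrix `t_ℓ δ_{ℓm} + ρ_{ℓm}`. -/
def gram (a b : ℕ) (t : ℕ → ℝ) (S : Finset ℕ) : Matrix S S RF :=
  Matrix.of fun i j => (if i = j then const (t i) else 0) + ofPoly (rho i j a b)

/-- `f` and `ρ` are, up to the gauge factor `G`, obtained from the classical functions by
elimination of the rows and columns in `S`. -/
structure Elim (a b : ℕ) (t : ℕ → ℝ) (S : Finset ℕ) (G : RF) (f : ℕ → RF) (ρ : ℕ → ℕ → RF) :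
    Prop where
  symm : ∀ i j, ρ i j = ρ j i
  exists_coeff : ∃ v : ℕ → ℕ → RF,
    (∀ i, G * f i = ofPoly (jacobiMonic i a b) - ∑ m ∈ S, ofPoly (jacobiMonic m a b) * v m i) ∧
    (∀ i j, ρ i j = ofPoly (rho i j a b) - ∑ m ∈ S, ofPoly (rho i m a b) * v m j) ∧
    ∀ l ∈ S, ∀ i, ∑ m ∈ S, ((if l = m then const (t l) else 0) + ofPoly (rho l m a b)) * v m i =
      ofPoly (rho l i a b)

theorem rho_comm (i j a b : ℕ) : rho i j a b = rho j i a b := by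
  unfold rho; rw [mul_comm (jacobiMonic i a b)]

variable {a b : ℕ} {t : ℕ → ℝ} {S : Finset ℕ} {G : RF} {f : ℕ → RF} {ρ : ℕ → ℕ → RF}

theorem Elim.empty (a b : ℕ) (t : ℕ → ℝ) : Elim a b t ∅ 1 (fun i => ofPoly (jacobiMonic i a b))
    (fun i j => ofPoly (rho i j a b)) :=
  ⟨fun i j => by rw [rho_comm], 0, by simp, by simp, by simp⟩

theorem Elim.gauge (h : Elim a b t S G f ρ) {g : RF} (hg : g ≠ 0) :
    Elim a b t S (G * g) (fun i => f i / g) ρ := by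
  obtain ⟨hs, v, h1, h2, h3⟩ := h
  refine ⟨hs, v, fun i => ?_, h2, h3⟩
  rw [← h1]
  field_simp

theorem Elim.confluent (h : Elim a b t S G f ρ) {l : ℕ} (hl : l ∉ S)
    (hr : const (t l) + ρ l l ≠ 0) :
    Elim a b t (insert l S) G (confF f ρ l (t l)) (confRho ρ l (t l)) := by
  obtain ⟨hs, v, h1, h2, h3⟩ := h
  refine ⟨fun i j => by unfold confRho; rw [hs i j]; ring, ?_⟩
  set r := const (t l) + ρ l l with hrd
  have hv : ∀ (w : ℕ → RF) i, ∑ m ∈ insert l S,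
      w m * (if m = l then ρ l i / r else v m i - v m l * (ρ l i / r)) =
      w l * (ρ l i / r) + (∑ m ∈ S, w m * v m i - (∑ m ∈ S, w m * v m l) * (ρ l i / r)) := by
    intro w i
    rw [Finset.sum_insert hl, if_pos rfl, Finset.sum_mul, ← Finset.sum_sub_distrib]
    congr 1
    refine Finset.sum_congr rfl fun m hm => ?_
    rw [if_neg (ne_of_mem_of_not_mem hm hl)]
    ring
  refine ⟨fun m i => if m = l then ρ l i / r else v m i - v m l * (ρ l i / r), ?_, ?_, ?_⟩
  · intro i
    rw [hv (fun m => ofPoly (jacobiMonic m a b))]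
    have e1 := h1 i
    have e2 := h1 l
    unfold confF
    rw [← hrd]
    linear_combination e1 - ρ l i / r * e2
  · intro i j
    rw [hv (fun m => ofPoly (rho i m a b))]
    have e1 := h2 i j
    have e2 := h2 i l
    unfold confRho
    rw [← hrd, hs l i]
    linear_combination e1 - ρ l j / r * e2
  · intro l' hl' i
    rw [hv (fun m => (if l' = m then const (t l') else 0) + ofPoly (rho l' m a b))]
    rcases Finset.mem_insert.mp hl' with rfl | hl'
    · have e0 : ∀ i, ∑ m ∈ S, ((if l' = m then const (t l') else 0) + ofPoly (rho l' m a b)) * v m i =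
          ofPoly (rho l' i a b) - ρ l' i := by
        intro i
        rw [h2, sub_sub_cancel]
        exact Finset.sum_congr rfl fun m hm => by
          rw [if_neg (ne_of_mem_of_not_mem hm hl).symm, zero_add]
      rw [e0, e0, if_pos rfl]
      have e1 : ρ l' i = ρ l' i / r * r := by field_simp
      rw [hrd] at e1
      linear_combination -e1
    · rw [h3 l' hl', h3 l' hl', if_neg (ne_of_mem_of_not_mem hl' hl)]
      ring

theorem Elim.gram_mul (h : Elim a b t S G f ρ) : ∃ v : ℕ → ℕ → RF,
    (∀ i, G * f i = ofPoly (jacobiMonic i a b) - ∑ m : S, ofPoly (jacobiMonic m a b) * v m i) ∧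
    (∀ i j, ρ i j = ofPoly (rho i j a b) - ∑ m : S, ofPoly (rho i m a b) * v m j) ∧
    ∀ (l : S) i, ∑ m : S, gram a b t S l m * v m i = ofPoly (rho l i a b) := by
  obtain ⟨-, v, h1, h2, h3⟩ := h
  refine ⟨v, fun i => ?_, fun i j => ?_, fun l i => ?_⟩
  · rw [h1, Finset.sum_coe_sort S (fun m => ofPoly (jacobiMonic m a b) * v m i)]
  · rw [h2, Finset.sum_coe_sort S (fun m => ofPoly (rho i m a b) * v m j)]
  · rw [← h3 l l.2 i, ← Finset.sum_coe_sort S]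
    simp only [gram, Matrix.of_apply, Subtype.ext_iff]

theorem gram_apply (i j : S) : gram a b t S i j =
    (if (i : ℕ) = j then const (t i) else 0) + ofPoly (rho i j a b) := by
  simp only [gram, Matrix.of_apply, Subtype.ext_iff]

theorem Elim.det_insert (h : Elim a b t S G f ρ) {l : ℕ} (hl : l ∉ S) :
    (gram a b t (insert l S)).det = (gram a b t S).det * (const (t l) + ρ l l) := by
  obtain ⟨v, h1, h2, h3⟩ := h.gram_mul
  let n : Option S → ℕ := fun i => i.elim l Subtype.val
  let M : Matrix (Option S) (Option S) RF :=
    Matrix.of fun i j => (if n i = n j then const (t (n i)) else 0) + ofPoly (rho (n i) (n j) a b)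
  have hM : Matrix.reindex (Finset.subtypeInsertEquivOption hl) (Finset.subtypeInsertEquivOption hl)
      (gram a b t (insert l S)) = M := by
    ext (_ | i) (_ | j) <;> rw [Matrix.reindex_apply, Matrix.submatrix_apply, gram_apply] <;> rfl
  have hS : (Matrix.of fun i j => M (some i) (some j)) = gram a b t S := by
    ext i j; rw [gram_apply]; rfl
  have hne : ∀ m : S, ¬ (l = (m : ℕ)) := fun m e => hl (e ▸ m.2)
  rw [← Matrix.det_reindex_self (Finset.subtypeInsertEquivOption hl), hM,
    det_option_of_mul M (fun m : S => v m l), hS]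
  · congr 1
    simp only [M, n, Matrix.of_apply, Option.elim, if_true, hne, if_false, zero_add]
    rw [h2, add_sub_assoc]
  · intro i
    have e := h3 i l
    rw [← hS] at e
    rw [show M (some i) none = ofPoly (rho i l a b) from ?_]
    · exact e
    · have h0 : ¬ ((i : ℕ) = l) := fun e => hne i e.symm
      simp only [M, n, Matrix.of_apply, Option.elim, h0, if_false, zero_add]

theorem Elim.det_bordered (h : Elim a b t S G f ρ) (n : ℕ) (M : Matrix (Option S) (Option S) RF)
    (h00 : M none none = ofPoly (jacobiMonic n a b))
    (h01 : ∀ j : S, M none (some j) = ofPoly (jacobiMonic j a b))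
    (h10 : ∀ i : S, M (some i) none = ofPoly (rho i n a b))
    (h11 : ∀ i j : S, M (some i) (some j) = gram a b t S i j) :
    M.det = (gram a b t S).det * (G * f n) := by
  obtain ⟨v, h1, -, h3⟩ := h.gram_mul
  rw [det_option_of_mul M (fun m : S => v m n)]
  · congr 1
    · congr 1; ext i j; exact h11 i j
    · rw [h1, h00]; simp only [h01]
  · intro i; rw [h10, ← h3]; simp only [h11]

/-- Wronskians of eigenfunctions are polynomials up to the gauge factor. -/
theorem Elim.exists_poly (h : Elim a b t S G f ρ) (hdet : (gram a b t S).det ≠ 0) {n : ℕ}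
    (k : Fin n → ℕ) : ∃ P : ℝ[X],
    (gram a b t S).det * wr (fun j => G * f (k j)) = ofPoly P := by
  obtain ⟨v, h1, -, h3⟩ := h.gram_mul
  set R := gram a b t S with hR
  have hu : IsUnit R.det := hdet.isUnit
  let s : S → RF := R⁻¹.mulVec fun l => ofPoly (jacobiMonic l a b) * weight a b
  have hDv : ∀ (m : S) i, D (v m i) = G * f i * s m := by
    intro m i
    have e1 : R.mulVec (fun m : S => D (v m i)) =
        fun l : S => ofPoly (jacobiMonic l a b) * weight a b * (G * f i) := by
      ext l
      have e2 := congrArg D (h3 l i)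
      rw [D_sum, D_rho_classical] at e2
      have e3 : ∀ m : S, D (R l m * v m i) =
          ofPoly (jacobiMonic l a b) * ofPoly (jacobiMonic m a b) * weight a b * v m i +
          R l m * D (v m i) := by
        intro m
        rw [D_mul, hR, gram_apply, D_add, D_rho_classical]
        have : D (if (l : ℕ) = m then const (t l) else 0) = 0 := by
          split_ifs
          · exact D_const _
          · exact D_zero
        rw [this, zero_add]
      simp only [e3, Finset.sum_add_distrib] at e2
      have e4 : ∑ m : S, ofPoly (jacobiMonic l a b) * ofPoly (jacobiMonic m a b) * weight a b * v m i =
          ofPoly (jacobiMonic l a b) * weight a b * ∑ m : S, ofPoly (jacobiMonic m a b) * v m i := by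
        rw [Finset.mul_sum]; exact Finset.sum_congr rfl fun m _ => by ring
      rw [e4] at e2
      simp only [Matrix.mulVec, dotProduct]
      rw [h1]
      linear_combination e2
    have e5 := congrArg (fun w => (R⁻¹.mulVec w) m) e1
    simp only [Matrix.mulVec_mulVec, Matrix.nonsing_inv_mul _ hu, Matrix.one_mulVec] at e5
    rw [e5]
    simp only [s, Matrix.mulVec, dotProduct, Finset.mul_sum]
    exact Finset.sum_congr rfl fun l _ => by ring
  let B : ℕ → ℕ → RF := fun i k => ofPoly (derivative^[i] (jacobiMonic k a b)) -
    ∑ m : S, ofPoly (derivative^[i] (jacobiMonic m a b)) * v m k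
  have hB0 : ∀ k, B 0 k = G * f k := fun k => (h1 k).symm
  have hB : ∀ i k, D (B i k) = B (i + 1) k +
      (-∑ m : S, ofPoly (derivative^[i] (jacobiMonic m a b)) * s m) * B 0 k := by
    intro i k
    rw [hB0]
    simp only [B, D_sub, D_sum, D_mul, D_ofPoly, hDv, Finset.sum_add_distrib,
      Function.iterate_succ_apply', neg_mul, Finset.sum_mul]
    have : ∀ m : S, ofPoly (derivative^[i] (jacobiMonic m a b)) * (G * f k * s m) =
      ofPoly (derivative^[i] (jacobiMonic m a b)) * s m * (G * f k) := fun m => by ring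
    simp only [this]
    ring
  obtain ⟨c, hc⟩ := exists_lower hB 1
  have h4 := det_triangular (k := n) 1 (fun i j => B i (k j))
    (fun i j => D^[i] (G * f (k j))) c (fun i j => by rw [← hc, hB0, one_mul])
  rw [one_pow, one_mul] at h4
  have h5 : wr (fun j => G * f (k j)) = (Matrix.of fun i j : Fin n => B i (k j)).det := h4
  have h6 := det_fromBlocks_of_mul R (Matrix.of fun (l : S) (j : Fin n) => ofPoly (rho l (k j) a b))
    (Matrix.of fun (i : Fin n) (m : S) => ofPoly (derivative^[i] (jacobiMonic m a b)))
    (Matrix.of fun (i j : Fin n) => ofPoly (derivative^[i] (jacobiMonic (k j) a b)))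
    (Matrix.of fun (m : S) (j : Fin n) => v m (k j)) (by
      ext l j; rw [Matrix.mul_apply]; exact h3 l (k j))
  have h7 : (Matrix.of fun i j : Fin n => B i (k j)) =
      (Matrix.of fun (i j : Fin n) => ofPoly (derivative^[i] (jacobiMonic (k j) a b))) -
      (Matrix.of fun (i : Fin n) (m : S) => ofPoly (derivative^[i] (jacobiMonic m a b))) *
      (Matrix.of fun (m : S) (j : Fin n) => v m (k j)) := by
    ext i j; simp [Matrix.mul_apply, B]
  rw [h5, h7, ← h6]
  refine ⟨(Matrix.fromBlocks
    (Matrix.of fun i j : S => (if (i : ℕ) = j then C (t i) else 0) + rho i j a b)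
    (Matrix.of fun (l : S) (j : Fin n) => rho l (k j) a b)
    (Matrix.of fun (i : Fin n) (m : S) => derivative^[i] (jacobiMonic m a b))
    (Matrix.of fun (i j : Fin n) => derivative^[i] (jacobiMonic (k j) a b))).det, ?_⟩
  unfold ofPoly
  rw [RingHom.map_det]
  congr 1
  ext (i | i) (j | j)
  · simp only [Matrix.fromBlocks_apply₁₁, RingHom.mapMatrix_apply, Matrix.map_apply, Matrix.of_apply,
      hR, gram_apply, map_add]
    congr 1
    split_ifs
    · exact (ofPoly_C _).symm
    · exact (map_zero _).symm
  all_goals rfl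

end
end ExcJacobi

namespace ExcJacobi
noncomputable section

open Place

/-! ### Chains of transformations -/

/-- Change of the labels at the indices in `A`. -/
def mark (A : Finset ℕ) (lb : Label) (lab : ℤ → Label) (j : ℤ) : Label :=
  if ∃ l ∈ A, (l : ℤ) = j then lb else lab j

theorem mark_empty (lb : Label) (lab : ℤ → Label) : mark ∅ lb lab = lab := by
  ext j; simp [mark]

theorem mark_insert (A : Finset ℕ) (l : ℕ) (lb : Label) (lab : ℤ → Label) :
    mark (insert l A) lb lab = Function.update (mark A lb lab) l lb := by
  funext j
  by_cases h : (l : ℤ) = j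
  · subst h; rw [Function.update_self, mark, if_pos ⟨l, Finset.mem_insert_self _ _, rfl⟩]
  · rw [Function.update_of_ne (Ne.symm h)]
    unfold mark
    congr 1
    simp [h]

theorem mark_insert' (A : Finset ℕ) (l : ℕ) (lb : Label) (lab : ℤ → Label) :
    mark (insert l A) lb lab = mark A lb (Function.update lab l lb) := by
  funext j
  unfold mark
  by_cases h : (l : ℤ) = j
  · subst h; rw [Function.update_self, if_pos ⟨l, Finset.mem_insert_self _ _, rfl⟩, ite_self]
  · rw [Function.update_of_ne (Ne.symm h)]
    congr 1
    simp [h]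

theorem mark_nat (A : Finset ℕ) (lb : Label) (lab : ℤ → Label) (i : ℕ) :
    mark A lb lab i = if i ∈ A then lb else lab i := by
  unfold mark
  congr 1
  simp

/-- The link between the transformed functions and the determinants. -/
structure Link (a b : ℕ) (t : ℕ → ℝ) (S : Finset ℕ) (q₃ q₄ : ℕ) (f : ℕ → RF) (ρ : ℕ → ℕ → RF)
    (u : RF) : Prop where
  elim : Elim a b t S ((x - 1) ^ q₄ * (1 + x) ^ q₃) f ρ
  det_ne : (gram a b t S).det ≠ 0
  u_eq : u = D ((gram a b t S).det / weight (q₄ * (q₄ + a)) (q₃ * (q₃ + b))) /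
    ((gram a b t S).det / weight (q₄ * (q₄ + a)) (q₃ * (q₃ + b)))

section

variable {a b : ℕ} {t : ℕ → ℝ} {S : Finset ℕ} {q₃ q₄ : ℕ} {f : ℕ → RF} {ρ : ℕ → ℕ → RF} {u : RF}

theorem Link.empty (a b : ℕ) (t : ℕ → ℝ) : Link a b t ∅ 0 0
    (fun i => ofPoly (jacobiMonic i a b)) (fun i j => ofPoly (rho i j a b)) 0 where
  elim := by simpa using Elim.empty a b t
  det_ne := by simp
  u_eq := by simp [weight, D_one]

theorem Link.confluent (h : Link a b t S q₃ q₄ f ρ u) {l : ℕ} (hl : l ∉ S)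
    (hr : const (t l) + ρ l l ≠ 0) :
    Link a b t (insert l S) q₃ q₄ (confF f ρ l (t l)) (confRho ρ l (t l))
      (u + D (const (t l) + ρ l l) / (const (t l) + ρ l l)) where
  elim := h.elim.confluent hl hr
  det_ne := by rw [h.elim.det_insert hl]; exact mul_ne_zero h.det_ne hr
  u_eq := by
    rw [h.u_eq, h.elim.det_insert hl, ← logDeriv_mul (div_ne_zero h.det_ne (weight_ne _ _)) hr,
      div_mul_eq_mul_div]

theorem logDeriv_weight (m n : ℕ) : D (weight m n) / weight m n = m / (x - 1) + n / (x + 1) := by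
  unfold weight
  rw [logDeriv_mul (pow_ne_zero _ one_sub_x_ne) (pow_ne_zero _ one_add_x_ne),
    logDeriv_pow one_sub_x_ne, logDeriv_pow one_add_x_ne, D_sub, D_add, D_x, D_one, zero_sub, zero_add,
    ← neg_sub x 1, neg_div_neg_eq, add_comm 1 x]
  ring

theorem Link.edge_one (h : Link a b t S q₃ q₄ f ρ u) : Link a b t S q₃ (q₄ + 1)
    (fun i => f i / (x - const 1)) ρ
    (u - const (expo 1 (a + 2 * q₄) (b + 2 * q₃) + 1) / (x - const 1)) where
  elim := by
    have := h.elim.gauge x_sub_one_ne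
    rw [const_one]
    convert this using 1
    ring
  det_ne := h.det_ne
  u_eq := by
    rw [h.u_eq, logDeriv_div h.det_ne (weight_ne _ _), logDeriv_div h.det_ne (weight_ne _ _),
      logDeriv_weight, logDeriv_weight, expo_one, const_one]
    have : const (((a + 2 * q₄ : ℕ) : ℝ) + 1) = a + 2 * q₄ + 1 := by
      rw [const_add, const_natCast, const_one]; push_cast; ring
    rw [this]
    push_cast
    ring

theorem Link.edge_neg_one (h : Link a b t S q₃ q₄ f ρ u) : Link a b t S (q₃ + 1) q₄
    (fun i => f i / (x - const (-1))) ρ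
    (u - const (expo (-1) (a + 2 * q₄) (b + 2 * q₃) + 1) / (x - const (-1))) where
  elim := by
    have := h.elim.gauge one_add_x_ne
    rw [const_neg, const_one, sub_neg_eq_add, add_comm x]
    convert this using 1
    ring
  det_ne := h.det_ne
  u_eq := by
    rw [h.u_eq, logDeriv_div h.det_ne (weight_ne _ _), logDeriv_div h.det_ne (weight_ne _ _),
      logDeriv_weight, logDeriv_weight, expo_neg_one, const_neg, const_one, sub_neg_eq_add]
    have : const (((b + 2 * q₃ : ℕ) : ℝ) + 1) = b + 2 * q₃ + 1 := by
      rw [const_add, const_natCast, const_one]; push_cast; ring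
    rw [this]
    push_cast
    ring

end

/-- The factor of the leading coefficients. -/
def lcFactor (N : ℕ) (A : Finset ℕ) (i : ℕ) : ℝ := ∏ l ∈ A, ((i : ℝ) - l) / (i + l + N + 1)

/-- The result of the steps at the end points. -/
structure EdgeChain (a b : ℕ) (A₃ A₄ : Finset ℕ) (f : ℕ → RF) (ρ : ℕ → ℕ → RF) (u : RF)
    (vm : ℕ → ℝ) : Prop where
  state : State (a + b) (mark A₄ .plus (mark A₃ .minus (lab₀ a b))) (a + 2 * A₄.card)
    (b + 2 * A₃.card) (A₃.card + A₄.card) u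
    (∑ l ∈ A₃, (2 * (l : ℤ) + a + b + 1) + ∑ l ∈ A₄, (2 * (l : ℤ) + a + b + 1) -
      A₃.card * (A₃.card + b) - A₄.card * (A₄.card + a)) f ρ (fun i => nuCl i a b)
    (fun i => lcFactor (a + b) A₃ i * lcFactor (a + b) A₄ i) vm
  comm : Comm (a + b) (mark A₄ .plus (mark A₃ .minus (lab₀ a b))) (a + 2 * A₄.card)
    (b + 2 * A₃.card) f ρ
  link : ∀ t : ℕ → ℝ, (∀ l ∈ A₃, t l = 0) → (∀ l ∈ A₄, t l = -nuCl l a b) →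
    Link a b t (A₃ ∪ A₄) A₃.card A₄.card f ρ u

theorem lcFactor_insert (N : ℕ) {A : Finset ℕ} {l : ℕ} (hl : l ∉ A) (i : ℕ) :
    lcFactor N (insert l A) i = ((i : ℝ) - l) / (i + l + N + 1) * lcFactor N A i := by
  unfold lcFactor; rw [Finset.prod_insert hl]

theorem EdgeChain.insert₃ {a b : ℕ} {A₃ : Finset ℕ} {f : ℕ → RF} {ρ : ℕ → ℕ → RF} {u : RF}
    {vm : ℕ → ℝ} (h : EdgeChain a b A₃ ∅ f ρ u vm) {l : ℕ} (hl : l ∉ A₃) :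
    ∃ f' ρ' u' vm', EdgeChain a b (insert l A₃) ∅ f' ρ' u' vm' := by
  have hlab : mark ∅ .plus (mark A₃ .minus (lab₀ a b)) l = .circle := by
    rw [mark_empty, mark_nat, if_neg hl, lab₀_nat]
  have hr1 := (finPlace 1).lim_add ((finPlace 1).lim_const 0)
    (h.state.rho_one l l (Or.inl hlab) (Or.inl hlab))
  have hr2 := (finPlace (-1)).lim_add ((finPlace (-1)).lim_const 0)
    (h.state.rho_neg l l (Or.inl hlab) (Or.inl hlab))
  rw [if_pos rfl, zero_add] at hr1
  rw [zero_add] at hr2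
  obtain ⟨vm', hs, hc⟩ := h.state.confluent_edge h.comm hlab (t := 0) (c := -1)
    (nuCl_pos l a b).ne' hr2 (by rw [neg_neg]; exact hr1) (Or.inr ⟨rfl, rfl⟩)
    (Or.inr ⟨rfl, rfl, rfl⟩)
  refine ⟨fun i => confF f ρ l 0 i / (x - const (-1)), confRho ρ l 0,
    u + D (const 0 + ρ l l) / (const 0 + ρ l l) -
      const (expo (-1) (a + 2 * (∅ : Finset ℕ).card) (b + 2 * A₃.card) + 1) / (x - const (-1)),
    vm', ?_, ?_, ?_⟩
  rotate_right
  · intro t h3 h4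
    have hL := h.link t (fun l hl => h3 l (Finset.mem_insert_of_mem hl)) h4
    have hl' : l ∉ A₃ ∪ ∅ := by simpa using hl
    have h5 := (hL.confluent hl' (h.state.r_ne hlab (t l))).edge_neg_one
    rw [h3 l (Finset.mem_insert_self _ _)] at h5
    rw [Finset.insert_union, Finset.card_insert_of_notMem hl]
    exact h5
  · rw [mark_empty] at hs ⊢
    rw [mark_insert]
    convert hs using 1
    · rw [Finset.card_insert_of_notMem hl]; ring
    · rw [Finset.card_insert_of_notMem hl]; simp
    · rw [Finset.sum_insert hl, Finset.card_insert_of_notMem hl, expo_neg_one]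
      push_cast
      simp
      ring
    · funext i
      rw [lcFactor_insert _ hl]; ring
  · rw [mark_empty] at hc ⊢
    rw [mark_insert]
    convert hc using 1
    rw [Finset.card_insert_of_notMem hl]; ring

theorem EdgeChain.insert₄ {a b : ℕ} {A₃ A₄ : Finset ℕ} {f : ℕ → RF} {ρ : ℕ → ℕ → RF} {u : RF}
    {vm : ℕ → ℝ} (h : EdgeChain a b A₃ A₄ f ρ u vm) {l : ℕ} (hl3 : l ∉ A₃) (hl : l ∉ A₄) :
    ∃ f' ρ' u' vm', EdgeChain a b A₃ (insert l A₄) f' ρ' u' vm' := by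
  have hlab : mark A₄ .plus (mark A₃ .minus (lab₀ a b)) l = .circle := by
    rw [mark_nat, if_neg hl, mark_nat, if_neg hl3, lab₀_nat]
  have hr1 := (finPlace 1).lim_add ((finPlace 1).lim_const (-nuCl l a b))
    (h.state.rho_one l l (Or.inl hlab) (Or.inl hlab))
  have hr2 := (finPlace (-1)).lim_add ((finPlace (-1)).lim_const (-nuCl l a b))
    (h.state.rho_neg l l (Or.inl hlab) (Or.inl hlab))
  rw [if_pos rfl, neg_add_cancel] at hr1
  rw [add_zero] at hr2
  obtain ⟨vm', hs, hc⟩ := h.state.confluent_edge h.comm hlab (t := -nuCl l a b) (c := 1)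
    (neg_ne_zero.mpr (nuCl_pos l a b).ne') hr1 hr2 (Or.inl ⟨rfl, rfl⟩) (Or.inl ⟨rfl, rfl, rfl⟩)
  refine ⟨fun i => confF f ρ l (-nuCl l a b) i / (x - const 1), confRho ρ l (-nuCl l a b),
    u + D (const (-nuCl l a b) + ρ l l) / (const (-nuCl l a b) + ρ l l) -
      const (expo 1 (a + 2 * A₄.card) (b + 2 * A₃.card) + 1) / (x - const 1), vm', ?_, ?_, ?_⟩
  rotate_right
  · intro t h3 h4
    have hL := h.link t h3 (fun l hl => h4 l (Finset.mem_insert_of_mem hl))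
    have hl' : l ∉ A₃ ∪ A₄ := by simp [hl, hl3]
    have h5 := (hL.confluent hl' (h.state.r_ne hlab (t l))).edge_one
    rw [h4 l (Finset.mem_insert_self _ _)] at h5
    rw [Finset.union_insert, Finset.card_insert_of_notMem hl]
    exact h5
  · rw [mark_insert]
    convert hs using 1
    · rw [Finset.card_insert_of_notMem hl]; ring
    · rw [Finset.card_insert_of_notMem hl]; ring
    · rw [Finset.sum_insert hl, Finset.card_insert_of_notMem hl, expo_one]
      push_cast
      ring
    · funext i
      rw [lcFactor_insert _ hl]; ring
  · rw [mark_insert]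
    convert hc using 1
    rw [Finset.card_insert_of_notMem hl]; ring

theorem exists_edgeChain (a b : ℕ) {A₃ A₄ : Finset ℕ} (h : Disjoint A₃ A₄) :
    ∃ f ρ u vm, EdgeChain a b A₃ A₄ f ρ u vm := by
  induction A₄ using Finset.induction_on with
  | empty =>
    clear h
    induction A₃ using Finset.induction_on with
    | empty =>
      refine ⟨_, _, 0, fun i => (jacobiMonic i a b).eval (-1), ?_, ?_,
        fun t _ _ => Link.empty a b t⟩
      · convert state_classical a b using 1
        · rw [mark_empty, mark_empty]
        · simp
        · simp
        · simp
        · simp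
        · funext i; simp [lcFactor]
      · rw [mark_empty, mark_empty]; exact comm_state_classical a b
    | insert l A hl ih =>
      obtain ⟨f, ρ, u, vm, hc⟩ := ih
      exact hc.insert₃ hl
  | insert l A hl ih =>
    rw [Finset.disjoint_insert_right] at h
    obtain ⟨f, ρ, u, vm, hc⟩ := ih h.2
    exact hc.insert₄ h.1 hl

/-- Successive confluent steps. -/
def confChain (t : ℕ → ℝ) : List ℕ → (ℕ → RF) × (ℕ → ℕ → RF) → (ℕ → RF) × (ℕ → ℕ → RF)
  | [], s => s
  | l :: ls, s => confChain t ls (confF s.1 s.2 l (t l), confRho s.2 l (t l))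

theorem exists_confChain {a b : ℕ} {t : ℕ → ℝ} (ls : List ℕ) (hnd : ls.Nodup) {lab : ℤ → Label}
    {q₃ q₄ γ : ℕ} {u : RF} {δ : ℤ} {f : ℕ → RF} {ρ : ℕ → ℕ → RF} {ν lc vm : ℕ → ℝ} {S : Finset ℕ}
    (hS : State (a + b) lab (a + 2 * q₄) (b + 2 * q₃) γ u δ f ρ ν lc vm)
    (hC : Comm (a + b) lab (a + 2 * q₄) (b + 2 * q₃) f ρ) (hL : Link a b t S q₃ q₄ f ρ u)
    (h : ∀ l ∈ ls, l ∉ S ∧ lab l = .circle ∧ t l ≠ 0 ∧ t l + ν l ≠ 0) :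
    ∃ u', State (a + b) (mark ls.toFinset .triangle lab) (a + 2 * q₄) (b + 2 * q₃) γ u'
      (δ + ∑ l ∈ ls.toFinset, (2 * (l : ℤ) + a + b + 1)) (confChain t ls (f, ρ)).1
      (confChain t ls (f, ρ)).2 (fun i => if i ∈ ls.toFinset then t i * ν i / (t i + ν i) else ν i)
      (fun i => lcFactor (a + b) ls.toFinset i * lc i) vm ∧
      Link a b t (ls.toFinset ∪ S) q₃ q₄ (confChain t ls (f, ρ)).1 (confChain t ls (f, ρ)).2 u' := by
  induction ls generalizing lab u δ f ρ ν lc S with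
  | nil =>
    refine ⟨u, ?_, ?_⟩
    · convert hS using 1
      · rw [List.toFinset_nil, mark_empty]
      · simp
      · rfl
      · rfl
      · funext i; simp
      · funext i; simp [lcFactor]
    · simpa [confChain] using hL
  | cons l ls ih =>
    obtain ⟨hlS, hlab, h1, h2⟩ := h l List.mem_cons_self
    obtain ⟨hs, hc⟩ := hS.confluent hC hlab h1 h2
    have hl := hL.confluent hlS (hS.r_ne hlab (t l))
    obtain ⟨hn1, hn2⟩ := List.nodup_cons.mp hnd
    have hnf : l ∉ ls.toFinset := by simpa using hn1
    obtain ⟨u', hs', hl'⟩ := ih hn2 hs hc hl (by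
      intro m hm
      obtain ⟨a1, a2, a3, a4⟩ := h m (List.mem_cons_of_mem _ hm)
      have hml : m ≠ l := fun e => hn1 (e ▸ hm)
      have hml' : (m : ℤ) ≠ l := by exact_mod_cast hml
      refine ⟨by simp [hml, a1], by rw [Function.update_of_ne hml', a2], a3, ?_⟩
      rwa [if_neg hml])
    refine ⟨u', ?_, ?_⟩
    · convert hs' using 1
      · rw [List.toFinset_cons, mark_insert']
      · rw [List.toFinset_cons, Finset.sum_insert hnf]; push_cast; ring
      · rfl
      · rfl
      · funext i
        rw [List.toFinset_cons]
        by_cases e : i = l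
        · subst e; simp [hn1]
        · simp [e]
      · funext i
        rw [List.toFinset_cons, lcFactor_insert _ hnf]; push_cast; ring
    · rw [List.toFinset_cons, Finset.insert_union, ← Finset.union_insert]
      exact hl'

/-- Successive Darboux steps. -/
def darChain : (n : ℕ) → (Fin n → ℕ) → (ℕ → RF) → ℕ → RF
  | 0, _, f => f
  | n + 1, k, f => darChain n (fun m => k m.succ) fun i => dar (D (f (k 0)) / f (k 0)) (f i)

/-- The values at `-1` after successive Darboux steps. -/
def vmChain (N : ℕ) : (n : ℕ) → (Fin n → ℕ) → ℕ → (ℕ → ℝ) → ℕ → ℝ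
  | 0, _, _, vm => vm
  | n + 1, k, β, vm => vmChain N n (fun m => k m.succ) (β + 1)
      fun i => vm i * (Lam N (k 0) - Lam N i) / (2 * (β + 1))

theorem snoc_succ {n : ℕ} {A : Type*} (p : Fin (n + 1) → A) (q : A) (j : Fin (n + 1)) :
    (Fin.snoc (α := fun _ => A) p q : Fin (n + 2) → A) j.succ =
      (Fin.snoc (α := fun _ => A) (fun m => p m.succ) q : Fin (n + 1) → A) j := by
  refine Fin.lastCases ?_ (fun j => ?_) j
  · rw [Fin.succ_last, Fin.snoc_last, Fin.snoc_last]
  · rw [Fin.succ_castSucc, Fin.snoc_castSucc, Fin.snoc_castSucc]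

theorem wr_snoc_zero (p : Fin 0 → RF) (q : RF) :
    wr (Fin.snoc (α := fun _ => RF) p q : Fin 1 → RF) = q := by
  unfold wr
  rw [Matrix.det_fin_one]
  exact Fin.snoc_last (α := fun _ => RF) q p

theorem comp_snoc {n : ℕ} {A B : Type*} (g : A → B) (p : Fin n → A) (q : A) :
    (fun j => g ((Fin.snoc (α := fun _ => A) p q : Fin (n + 1) → A) j)) =
      (Fin.snoc (α := fun _ => B) (fun j => g (p j)) (g q) : Fin (n + 1) → B) := by
  funext j
  refine Fin.lastCases ?_ (fun j => ?_) j
  · rw [Fin.snoc_last, Fin.snoc_last]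
  · rw [Fin.snoc_castSucc, Fin.snoc_castSucc]

theorem exists_darChain {N : ℕ} (n : ℕ) (k : Fin n → ℕ) (hk : Function.Injective k)
    {lab : ℤ → Label} {α β γ : ℕ} {u : RF} {δ : ℤ} {f : ℕ → RF} {ρ : ℕ → ℕ → RF} {ν lc vm : ℕ → ℝ}
    (hS : State N lab α β γ u δ f ρ ν lc vm) (h : ∀ m, lab (k m) = .circle) :
    ∃ ρ', State N (mark (Finset.univ.image k) .bullet lab) (α + n) (β + n) (γ + n)
      (u + D (wr fun m => f (k m)) / wr fun m => f (k m))
      (δ + ∑ m, (k m : ℤ) - n * γ - n.choose 2) (darChain n k f) ρ'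
      (fun i => (∏ m, (Lam N i - Lam N (k m))) * ν i) (fun i => (∏ m, ((i : ℝ) - k m)) * lc i)
      (vmChain N n k β vm) ∧ (wr fun m => f (k m)) ≠ 0 ∧
      ∀ i, wr (Fin.snoc (α := fun _ => RF) (fun m => f (k m)) (f i) : Fin (n + 1) → RF) =
        (wr fun m => f (k m)) * darChain n k f i := by
  induction n generalizing lab α β γ u δ f ρ ν lc vm with
  | zero =>
    have hw : (wr fun m : Fin 0 => f (k m)) = 1 := by unfold wr; simp
    refine ⟨ρ, ?_, by rw [hw]; exact one_ne_zero, fun i => by rw [hw, one_mul, wr_snoc_zero]; rfl⟩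
    convert hS using 1
    · simp [mark_empty]
    · rw [add_zero]
    · rw [add_zero]
    · rw [add_zero]
    · rw [hw, D_one, zero_div, add_zero]
    · simp
    · rfl
    · funext i; simp
    · funext i; simp
    · rfl
  | succ n ih =>
    have hk0 : Function.Injective fun m : Fin n => k m.succ := fun i j e =>
      Fin.succ_injective _ (hk e)
    have hne : ∀ m : Fin n, k m.succ ≠ k 0 := fun m e => Fin.succ_ne_zero m (hk e)
    have f0 := hS.f_ne (Or.inl (h 0))
    obtain ⟨ρ', hs, hw, hd⟩ := ih (fun m => k m.succ) hk0 (hS.darboux (h 0)) (fun m => by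
      have : (k m.succ : ℤ) ≠ k 0 := by exact_mod_cast hne m
      rw [Function.update_of_ne this, h])
    have hwr := wr_succ (fun m => f (k m)) f0
    refine ⟨ρ', ?_, ?_, ?_⟩
    · convert hs using 1
      · have : Finset.univ.image k = insert (k 0) (Finset.univ.image fun m : Fin n => k m.succ) := by
          ext j; simp [Fin.exists_fin_succ, eq_comm]
        rw [this, mark_insert']
      · ring
      · ring
      · ring
      · rw [hwr, logDeriv_mul f0 hw, add_assoc]
      · rw [Fin.sum_univ_succ, Nat.choose_succ_succ, Nat.choose_one_right]; push_cast; ring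
      · rfl
      · funext i; rw [Fin.prod_univ_succ]; ring
      · funext i; rw [Fin.prod_univ_succ]; ring
      · rfl
    · rw [hwr]; exact mul_ne_zero f0 hw
    · intro i
      have e0 : (Fin.snoc (α := fun _ => RF) (fun m => f (k m)) (f i) : Fin (n + 2) → RF) 0 =
          f (k 0) := by
        rw [← Fin.castSucc_zero, Fin.snoc_castSucc]
      rw [wr_succ _ (by rw [e0]; exact f0), e0]
      simp only [snoc_succ]
      rw [comp_snoc (dar (D (f (k 0)) / f (k 0))), hd, hwr, mul_assoc]
      rfl

end
end ExcJacobi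

namespace ExcJacobi
noncomputable section

open Place

/-! ### Convergence of families of rational functions -/

section

variable {Θ : Type*} {F : Filter Θ}

/-- Convergence of the values at `c`. -/
def ConvAt (F : Filter Θ) (c : ℝ) (g : Θ → RF) (g₀ : RF) : Prop :=
  ∃ (v : Θ → ℝ) (v₀ : ℝ), (∀ᶠ s in F, (finPlace c).Lim (g s) (v s)) ∧ (finPlace c).Lim g₀ v₀ ∧
    Tendsto v F (𝓝 v₀)

/-- Convergence of the derivatives of order at most `n` at `c`. -/
def ConvN (F : Filter Θ) (c : ℝ) : ℕ → (Θ → RF) → RF → Prop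
  | 0, g, g₀ => ConvAt F c g g₀
  | n + 1, g, g₀ => ConvAt F c g g₀ ∧ ConvN F c n (fun s => D (g s)) (D g₀)

/-- Convergence of all derivatives outside of a finite set. -/
def Conv (F : Filter Θ) (g : Θ → RF) (g₀ : RF) : Prop :=
  ∃ E : Finset ℝ, ∀ c, c ∉ E → ∀ n, ConvN F c n g g₀

variable {c : ℝ} {g h : Θ → RF} {g₀ h₀ : RF} {n : ℕ}

theorem ConvAt.add (hg : ConvAt F c g g₀) (hh : ConvAt F c h h₀) :
    ConvAt F c (fun s => g s + h s) (g₀ + h₀) := by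
  obtain ⟨v, v₀, h1, h2, h3⟩ := hg
  obtain ⟨w, w₀, k1, k2, k3⟩ := hh
  exact ⟨_, _, (h1.and k1).mono fun s hs => (finPlace c).lim_add hs.1 hs.2,
    (finPlace c).lim_add h2 k2, h3.add k3⟩

theorem ConvAt.mul (hg : ConvAt F c g g₀) (hh : ConvAt F c h h₀) :
    ConvAt F c (fun s => g s * h s) (g₀ * h₀) := by
  obtain ⟨v, v₀, h1, h2, h3⟩ := hg
  obtain ⟨w, w₀, k1, k2, k3⟩ := hh
  exact ⟨_, _, (h1.and k1).mono fun s hs => (finPlace c).lim_mul hs.1 hs.2,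
    (finPlace c).lim_mul h2 k2, h3.mul k3⟩

theorem ConvAt.inv (hg : ConvAt F c g g₀) (hu : UnitAt g₀ c) :
    ConvAt F c (fun s => (g s)⁻¹) g₀⁻¹ := by
  obtain ⟨v, v₀, h1, h2, h3⟩ := hg
  obtain ⟨w, hw, h4⟩ := unitAt_iff.mp hu
  obtain rfl := (finPlace c).lim_unique h2 h4
  exact ⟨_, _, (h1.and (h3.eventually_ne hw)).mono fun s hs => (finPlace c).lim_inv hs.1 hs.2,
    (finPlace c).lim_inv h2 hw, h3.inv₀ hw⟩

theorem ConvAt.tendsto (hg : ConvAt F c g g₀) :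
    Tendsto (fun s => evalAt c (g s)) F (𝓝 (evalAt c g₀)) := by
  obtain ⟨v, v₀, h1, h2, h3⟩ := hg
  rw [(lim_fin_iff.mp h2).2]
  exact h3.congr' (h1.mono fun s hs => (lim_fin_iff.mp hs).2.symm)

theorem ConvN.of_succ (hg : ConvN F c (n + 1) g g₀) : ConvN F c n g g₀ := by
  induction n generalizing g g₀ with
  | zero => exact hg.1
  | succ n ih => exact ⟨hg.1, ih hg.2⟩

theorem ConvN.congr (hg : ConvN F c n g g₀) (e : ∀ᶠ s in F, g s = h s) : ConvN F c n h g₀ := by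
  have key : ∀ {g h : Θ → RF} {g₀ : RF}, ConvAt F c g g₀ → (∀ᶠ s in F, g s = h s) →
      ConvAt F c h g₀ := fun ⟨v, v₀, h1, h2, h3⟩ e =>
    ⟨v, v₀, (h1.and e).mono fun s hs => hs.2 ▸ hs.1, h2, h3⟩
  induction n generalizing g h g₀ with
  | zero => exact key hg e
  | succ n ih => exact ⟨key hg.1 e, ih hg.2 (e.mono fun s hs => congrArg D hs)⟩

theorem ConvN.add (hg : ConvN F c n g g₀) (hh : ConvN F c n h h₀) :
    ConvN F c n (fun s => g s + h s) (g₀ + h₀) := by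
  induction n generalizing g h g₀ h₀ with
  | zero => exact ConvAt.add hg hh
  | succ n ih =>
    refine ⟨hg.1.add hh.1, ?_⟩
    simp only [D_add]
    exact ih hg.2 hh.2

theorem ConvN.mul (hg : ConvN F c n g g₀) (hh : ConvN F c n h h₀) :
    ConvN F c n (fun s => g s * h s) (g₀ * h₀) := by
  induction n generalizing g h g₀ h₀ with
  | zero => exact ConvAt.mul hg hh
  | succ n ih =>
    refine ⟨hg.1.mul hh.1, ?_⟩
    simp only [D_mul]
    exact (ih hg.2 hh.of_succ).add (ih hg.of_succ hh.2)

theorem ConvN.const {a : Θ → ℝ} {a₀ : ℝ} (ha : Tendsto a F (𝓝 a₀)) (n : ℕ) :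
    ConvN F c n (fun s => const (a s)) (const a₀) := by
  have key : ∀ {a : Θ → ℝ} {a₀ : ℝ}, Tendsto a F (𝓝 a₀) →
      ConvAt F c (fun s => ExcJacobi.const (a s)) (ExcJacobi.const a₀) := fun ha =>
    ⟨_, _, Eventually.of_forall fun s => (finPlace c).lim_const _, (finPlace c).lim_const _, ha⟩
  induction n generalizing a a₀ with
  | zero => exact key ha
  | succ n ih =>
    refine ⟨key ha, ?_⟩
    simp only [D_const]
    have := ih (tendsto_const_nhds (x := (0 : ℝ)))
    simpa only [const_zero] using this

theorem ConvN.neg (hg : ConvN F c n g g₀) : ConvN F c n (fun s => -g s) (-g₀) := by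
  have := (ConvN.const (c := c) (tendsto_const_nhds (x := (-1 : ℝ)) (f := F)) n).mul hg
  simpa only [const_neg, const_one, neg_one_mul] using this

theorem ConvN.inv (hg : ConvN F c n g g₀) (hu : UnitAt g₀ c) :
    ConvN F c n (fun s => (g s)⁻¹) g₀⁻¹ := by
  induction n with
  | zero => exact ConvAt.inv hg hu
  | succ n ih =>
    refine ⟨hg.1.inv hu, ?_⟩
    have e : ∀ y : RF, D y⁻¹ = -(D y * (y⁻¹ * y⁻¹)) := fun y => by
      rw [D_inv]; ring
    simp only [e]
    exact (hg.2.mul ((ih hg.of_succ).mul (ih hg.of_succ))).neg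

theorem ConvN.fixed (hg : Reg c g₀) (n : ℕ) : ConvN F c n (fun _ => g₀) g₀ := by
  have key : ∀ {g : RF}, Reg c g → ConvAt F c (fun _ => g) g := fun ⟨v, hv⟩ =>
    ⟨fun _ => v, v, Eventually.of_forall fun _ => hv, hv, tendsto_const_nhds⟩
  induction n generalizing g₀ with
  | zero => exact key hg
  | succ n ih => exact ⟨key hg, ih hg.D⟩

theorem exists_reg (g : RF) : ∃ E : Finset ℝ, ∀ c, c ∉ E → Reg c g := by
  refine ⟨g.denom.roots.toFinset, fun c hc => reg_iff.mpr fun h => hc ?_⟩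
  rw [Multiset.mem_toFinset, mem_roots (RatFunc.denom_ne_zero g)]
  exact h

theorem exists_unitAt {g : RF} (hg : g ≠ 0) : ∃ E : Finset ℝ, ∀ c, c ∉ E → UnitAt g c := by
  classical
  obtain ⟨E, hE⟩ := exists_reg g
  refine ⟨E ∪ g.num.roots.toFinset, fun c hc => ⟨fun h => hc ?_, reg_iff.mp (hE c ?_)⟩⟩
  · rw [Finset.mem_union, Multiset.mem_toFinset, mem_roots (RatFunc.num_ne_zero hg)]
    exact Or.inr h
  · exact fun h => hc (Finset.mem_union_left _ h)

theorem Conv.add (hg : Conv F g g₀) (hh : Conv F h h₀) :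
    Conv F (fun s => g s + h s) (g₀ + h₀) := by
  classical
  obtain ⟨E, hE⟩ := hg
  obtain ⟨E', hE'⟩ := hh
  exact ⟨E ∪ E', fun c hc n => (hE c (fun h => hc (Finset.mem_union_left _ h)) n).add
    (hE' c (fun h => hc (Finset.mem_union_right _ h)) n)⟩

theorem Conv.mul (hg : Conv F g g₀) (hh : Conv F h h₀) :
    Conv F (fun s => g s * h s) (g₀ * h₀) := by
  classical
  obtain ⟨E, hE⟩ := hg
  obtain ⟨E', hE'⟩ := hh
  exact ⟨E ∪ E', fun c hc n => (hE c (fun h => hc (Finset.mem_union_left _ h)) n).mul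
    (hE' c (fun h => hc (Finset.mem_union_right _ h)) n)⟩

theorem Conv.inv (hg : Conv F g g₀) (h0 : g₀ ≠ 0) : Conv F (fun s => (g s)⁻¹) g₀⁻¹ := by
  classical
  obtain ⟨E, hE⟩ := hg
  obtain ⟨E', hE'⟩ := exists_unitAt h0
  exact ⟨E ∪ E', fun c hc n => (hE c (fun h => hc (Finset.mem_union_left _ h)) n).inv
    (hE' c (fun h => hc (Finset.mem_union_right _ h)))⟩

theorem Conv.div (hg : Conv F g g₀) (hh : Conv F h h₀) (h0 : h₀ ≠ 0) :
    Conv F (fun s => g s / h s) (g₀ / h₀) := by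
  simp only [div_eq_mul_inv]
  exact hg.mul (hh.inv h0)

theorem Conv.neg (hg : Conv F g g₀) : Conv F (fun s => -g s) (-g₀) := by
  obtain ⟨E, hE⟩ := hg
  exact ⟨E, fun c hc n => (hE c hc n).neg⟩

theorem Conv.sub (hg : Conv F g g₀) (hh : Conv F h h₀) :
    Conv F (fun s => g s - h s) (g₀ - h₀) := by
  simp only [sub_eq_add_neg]
  exact hg.add hh.neg

theorem Conv.D (hg : Conv F g g₀) : Conv F (fun s => D (g s)) (D g₀) := by
  obtain ⟨E, hE⟩ := hg
  exact ⟨E, fun c hc n => (hE c hc (n + 1)).2⟩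

theorem Conv.congr (hg : Conv F g g₀) (e : ∀ᶠ s in F, g s = h s) : Conv F h g₀ := by
  obtain ⟨E, hE⟩ := hg
  exact ⟨E, fun c hc n => (hE c hc n).congr e⟩

theorem Conv.const {a : Θ → ℝ} {a₀ : ℝ} (ha : Tendsto a F (𝓝 a₀)) :
    Conv F (fun s => const (a s)) (const a₀) := ⟨∅, fun _ _ n => ConvN.const ha n⟩

theorem Conv.fixed (g : RF) : Conv F (fun _ => g) g := by
  obtain ⟨E, hE⟩ := exists_reg g
  exact ⟨E, fun c hc n => ConvN.fixed (hE c hc) n⟩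

theorem Conv.sum {κ : Type*} (S : Finset κ) {g : Θ → κ → RF} {g₀ : κ → RF}
    (hg : ∀ k, Conv F (fun s => g s k) (g₀ k)) :
    Conv F (fun s => ∑ k ∈ S, g s k) (∑ k ∈ S, g₀ k) := by
  classical
  induction S using Finset.induction_on with
  | empty => simpa using Conv.fixed 0
  | insert k S hk ih => simp only [Finset.sum_insert hk]; exact (hg k).add ih

theorem Conv.prod {κ : Type*} (S : Finset κ) {g : Θ → κ → RF} {g₀ : κ → RF}
    (hg : ∀ k, Conv F (fun s => g s k) (g₀ k)) :
    Conv F (fun s => ∏ k ∈ S, g s k) (∏ k ∈ S, g₀ k) := by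
  classical
  induction S using Finset.induction_on with
  | empty => simpa using Conv.fixed 1
  | insert k S hk ih => simp only [Finset.prod_insert hk]; exact (hg k).mul ih

theorem Conv.iterate_D (hg : Conv F g g₀) (k : ℕ) :
    Conv F (fun s => ExcJacobi.D^[k] (g s)) (ExcJacobi.D^[k] g₀) := by
  induction k generalizing g g₀ with
  | zero => exact hg
  | succ k ih => exact ih hg.D

theorem Conv.wr {m : ℕ} {g : Θ → Fin m → RF} {g₀ : Fin m → RF}
    (hg : ∀ k, Conv F (fun s => g s k) (g₀ k)) : Conv F (fun s => wr (g s)) (wr g₀) := by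
  unfold ExcJacobi.wr
  simp only [Matrix.det_apply', Matrix.of_apply]
  exact Conv.sum _ fun σ => (Conv.fixed _).mul (Conv.prod _ fun i => (hg i).iterate_D _)

theorem Conv.snoc {m : ℕ} {g : Θ → Fin m → RF} {g₀ : Fin m → RF} {q : Θ → RF} {q₀ : RF}
    (hg : ∀ k, Conv F (fun s => g s k) (g₀ k)) (hq : Conv F q q₀) (j : Fin (m + 1)) :
    Conv F (fun s => (Fin.snoc (α := fun _ => RF) (g s) (q s) : Fin (m + 1) → RF) j)
      ((Fin.snoc (α := fun _ => RF) g₀ q₀ : Fin (m + 1) → RF) j) := by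
  refine Fin.lastCases ?_ (fun j => ?_) j
  · simpa only [Fin.snoc_last] using hq
  · simpa only [Fin.snoc_castSucc] using hg j

theorem Conv.tendsto (hg : Conv F g g₀) : ∃ E : Finset ℝ, ∀ c, c ∉ E →
    Tendsto (fun s => evalAt c (g s)) F (𝓝 (evalAt c g₀)) := by
  obtain ⟨E, hE⟩ := hg
  exact ⟨E, fun c hc => (hE c hc 0).tendsto⟩

theorem Conv.one_div_const_add {a : Θ → ℝ} (ha : Tendsto a F (Bornology.cobounded ℝ))
    (hg : Conv F g g₀) : Conv F (fun s => 1 / (ExcJacobi.const (a s) + g s)) 0 := by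
  have h1 := tendsto_inv₀_cobounded.comp ha
  have h2 := (Conv.fixed (F := F) 1).add ((Conv.const h1).mul hg)
  rw [const_zero, zero_mul, add_zero] at h2
  have h3 := (Conv.const h1).div h2 one_ne_zero
  rw [const_zero, zero_div] at h3
  refine h3.congr ?_
  have h4 : ∀ᶠ s in F, a s ≠ 0 := ha.eventually (Bornology.eventually_ne_cobounded 0)
  filter_upwards [h4] with s hs
  have hs' : ExcJacobi.const (a s) ≠ 0 := const_ne_zero hs
  rw [Function.comp_apply, const_inv]
  have e : (1 : RF) + (ExcJacobi.const (a s))⁻¹ * g s =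
      (ExcJacobi.const (a s))⁻¹ * (ExcJacobi.const (a s) + g s) := by
    rw [mul_add, inv_mul_cancel₀ hs']
  rw [e, div_mul_eq_div_div, div_self (inv_ne_zero hs')]

theorem Conv.confChain {t : Θ → ℕ → ℝ} (ls : List ℕ)
    (ht : ∀ l ∈ ls, Tendsto (fun s => t s l) F (Bornology.cobounded ℝ))
    {f : Θ → ℕ → RF} {ρ : Θ → ℕ → ℕ → RF} {f₀ : ℕ → RF} {ρ₀ : ℕ → ℕ → RF}
    (hf : ∀ i, Conv F (fun s => f s i) (f₀ i)) (hρ : ∀ i j, Conv F (fun s => ρ s i j) (ρ₀ i j))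
    (i : ℕ) : Conv F (fun s => (ExcJacobi.confChain (t s) ls (f s, ρ s)).1 i) (f₀ i) := by
  induction ls generalizing f ρ with
  | nil => exact hf i
  | cons l ls ih =>
    have h1 := (hρ l l).one_div_const_add (ht l List.mem_cons_self)
    refine ih (fun m hm => ht m (List.mem_cons_of_mem _ hm)) (fun i => ?_) fun i j => ?_
    · have := (hf i).sub (((hf l).mul (hρ l i)).mul h1)
      rw [mul_zero, sub_zero] at this
      simpa only [mul_one_div, confF] using this
    · have := (hρ i j).sub (((hρ l i).mul (hρ l j)).mul h1)
      rw [mul_zero, sub_zero] at this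
      simpa only [mul_one_div, confRho] using this

end

end
end ExcJacobi

namespace ExcJacobi
noncomputable section

open Place

/-! ### The chain of transformations of the data -/

namespace Data

variable (d : Data)

/-- The labels of the indices `j ≥ j*`. -/
def lab : ℤ → Label :=
  mark d.K .bullet (mark d.L₁ .triangle (mark d.L₄ .plus (mark d.L₃ .minus (lab₀ d.a d.b))))

/-- The seeds of the second stage. -/
def seedIdx (m : Fin d.K.card) : ℕ := d.enum m

/-- The data without deformation parameters. -/
def undeformed : Data := { d with L₁ := ∅ }

/-- The condition that the index sets are pairwise disjoint. -/
structure Disj : Prop where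
  hK : Disjoint d.K (d.L₁ ∪ d.L₃ ∪ d.L₄)
  h13 : Disjoint d.L₁ d.L₃
  h14 : Disjoint d.L₁ d.L₄
  h34 : Disjoint d.L₃ d.L₄

/-- The condition on the deformation parameters. -/
def Valid (t : d.L₁ → ℝ) : Prop := ∀ l : d.L₁, t l ≠ 0 ∧ t l ≠ -d.nu l

/-- The factors of the norms. -/
def nuFactor (t : d.L₁ → ℝ) (i : ℕ) : ℝ :=
  (∏ m, (Lam (d.a + d.b) i - Lam (d.a + d.b) (d.seedIdx m))) *
    if i ∈ d.L₁ then d.tExt t i * nuCl i d.a d.b / (d.tExt t i + nuCl i d.a d.b)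
    else nuCl i d.a d.b

/-- The leading coefficients. -/
def leadCoeff (i : ℕ) : ℝ :=
  (∏ m, ((i : ℝ) - d.seedIdx m)) * (lcFactor (d.a + d.b) d.L₁ i *
    (lcFactor (d.a + d.b) d.L₃ i * lcFactor (d.a + d.b) d.L₄ i))

variable {d}

theorem Disj.undeformed (h : d.Disj) : d.undeformed.Disj where
  hK := h.hK.mono_right (by
    unfold Data.undeformed
    intro l
    simp only [Finset.mem_union, Finset.notMem_empty, false_or]
    tauto)
  h13 := Finset.disjoint_empty_left _
  h14 := Finset.disjoint_empty_left _
  h34 := h.h34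

theorem u_nat (n : ℕ) : d.u n = n := by
  unfold u star
  rw [max_eq_left (by omega), Int.toNat_natCast]

theorem seedIdx_mem (m : Fin d.K.card) : d.seedIdx m ∈ d.K := (d.enum m).2

theorem seedIdx_injective : Function.Injective d.seedIdx := fun _ _ h =>
  d.enum.injective (Subtype.ext h)

theorem image_seedIdx : Finset.univ.image d.seedIdx = d.K := by
  ext k
  simp only [Finset.mem_image, Finset.mem_univ, true_and]
  exact ⟨fun ⟨m, hm⟩ => hm ▸ seedIdx_mem m, fun hk => ⟨d.enum.symm ⟨k, hk⟩, by simp [seedIdx]⟩⟩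

theorem sum_seedIdx {M : Type*} [AddCommMonoid M] (g : ℕ → M) :
    ∑ m, g (d.seedIdx m) = ∑ k ∈ d.K, g k := by
  rw [← Finset.sum_coe_sort d.K]
  exact Equiv.sum_comp d.enum fun k : d.K => g k

theorem prod_seedIdx {M : Type*} [CommMonoid M] (g : ℕ → M) :
    ∏ m, g (d.seedIdx m) = ∏ k ∈ d.K, g k := by
  rw [← Finset.prod_coe_sort d.K]
  exact Equiv.prod_comp d.enum fun k : d.K => g k

theorem tExt_of_mem (t : d.L₁ → ℝ) {l : ℕ} (h : l ∈ d.L₁) : d.tExt t l = t ⟨l, h⟩ := dif_pos h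

theorem Disj.tExt₃ (h : d.Disj) (t : d.L₁ → ℝ) {l : ℕ} (hl : l ∈ d.L₃) : d.tExt t l = 0 := by
  unfold tExt
  rw [dif_neg (fun h' => Finset.disjoint_left.mp h.h13 h' hl),
    if_neg (Finset.disjoint_left.mp h.h34 hl)]

theorem Disj.tExt₄ (h : d.Disj) (t : d.L₁ → ℝ) {l : ℕ} (hl : l ∈ d.L₄) :
    d.tExt t l = -nuCl l d.a d.b := by
  unfold tExt
  rw [dif_neg (fun h' => Finset.disjoint_left.mp h.h14 h' hl), if_pos hl]
  rfl

theorem chiHat_ne {n : ℕ} (hn : n ∉ d.L₃ ∪ d.L₄) : d.chiHat n ≠ 0 := by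
  refine Finset.prod_ne_zero_iff.mpr fun l hl => div_ne_zero ?_ ?_
  · unfold star; push_cast
    have : (0 : ℝ) < n - (-l - d.a - d.b - 1) := by
      have := n.cast_nonneg (α := ℝ); have := l.cast_nonneg (α := ℝ)
      have := d.a.cast_nonneg (α := ℝ); have := d.b.cast_nonneg (α := ℝ)
      linarith
    exact this.ne'
  · exact sub_ne_zero.mpr fun e => hn (Nat.cast_injective e ▸ hl)

theorem chi_ne {n : ℕ} (hn : n ∉ d.K) : d.chi n ≠ 0 :=
  Finset.prod_ne_zero_iff.mpr fun _ hk => div_ne_zero one_ne_zero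
    (sub_ne_zero.mpr fun e => hn (Nat.cast_injective e ▸ hk))

section

variable {f₀ : ℕ → RF} {ρ₀ : ℕ → ℕ → RF} {u₀ : RF} {vm₀ : ℕ → ℝ}

/-- The functions after the first stage. -/
def first (d : Data) (f₀ : ℕ → RF) (ρ₀ : ℕ → ℕ → RF) (t : d.L₁ → ℝ) : ℕ → RF :=
  (confChain (d.tExt t) d.L₁.toList (f₀, ρ₀)).1

theorem exists_first (h : d.Disj) (hE : EdgeChain d.a d.b d.L₃ d.L₄ f₀ ρ₀ u₀ vm₀) {t : d.L₁ → ℝ}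
    (ht : d.Valid t) : ∃ u ρ, State (d.a + d.b)
      (mark d.L₁ .triangle (mark d.L₄ .plus (mark d.L₃ .minus (lab₀ d.a d.b))))
      (d.a + 2 * d.q₄) (d.b + 2 * d.q₃) (d.q₃ + d.q₄) u
      (∑ l ∈ d.L₃, (2 * (l : ℤ) + d.a + d.b + 1) + ∑ l ∈ d.L₄, (2 * (l : ℤ) + d.a + d.b + 1) -
        d.q₃ * (d.q₃ + d.b) - d.q₄ * (d.q₄ + d.a) + ∑ l ∈ d.L₁, (2 * (l : ℤ) + d.a + d.b + 1))
      (d.first f₀ ρ₀ t) ρ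
      (fun i => if i ∈ d.L₁ then
        d.tExt t i * nuCl i d.a d.b / (d.tExt t i + nuCl i d.a d.b) else nuCl i d.a d.b)
      (fun i => lcFactor (d.a + d.b) d.L₁ i *
        (lcFactor (d.a + d.b) d.L₃ i * lcFactor (d.a + d.b) d.L₄ i)) vm₀ ∧
      Link d.a d.b (d.tExt t) d.L d.q₃ d.q₄ (d.first f₀ ρ₀ t) ρ u := by
  obtain ⟨u, hs, hl⟩ := exists_confChain (t := d.tExt t) d.L₁.toList d.L₁.nodup_toList hE.state
    hE.comm (hE.link _ (fun l hl => h.tExt₃ t hl) fun l hl => h.tExt₄ t hl) (by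
      intro l hl
      rw [Finset.mem_toList] at hl
      have h3 := Finset.disjoint_left.mp h.h13 hl
      have h4 := Finset.disjoint_left.mp h.h14 hl
      obtain ⟨h5, h6⟩ := ht ⟨l, hl⟩
      rw [tExt_of_mem t hl]
      refine ⟨by simp [h3, h4], by rw [mark_nat, if_neg h4, mark_nat, if_neg h3, lab₀_nat], h5,
        fun e => h6 (eq_neg_of_add_eq_zero_left e)⟩)
  rw [Finset.toList_toFinset, ← Finset.union_assoc] at hl
  rw [Finset.toList_toFinset] at hs
  exact ⟨u, _, hs, hl⟩

theorem piHat_eq {t : d.L₁ → ℝ} {f : ℕ → RF} {ρ : ℕ → ℕ → RF} {u : RF}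
    (hl : Link d.a d.b (d.tExt t) d.L d.q₃ d.q₄ f ρ u) (i : ℤ) :
    d.piHat t i = const (d.chiHat (d.u (i + d.q₃ + d.q₄))) * f (d.u (i + d.q₃ + d.q₄)) := by
  set n := d.u (i + d.q₃ + d.q₄) with hn
  have h1 := hl.elim.det_bordered n (d.matA t n) rfl (fun _ => rfl) (fun _ => rfl)
    (fun _ _ => rfl)
  have h2 : (d.matR t).det ≠ 0 := hl.det_ne
  have h3 : (x - 1) ^ d.q₄ * (1 + x) ^ d.q₃ ≠ 0 :=
    mul_ne_zero (pow_ne_zero _ x_sub_one_ne) (pow_ne_zero _ one_add_x_ne)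
  have h4 : gram d.a d.b (d.tExt t) d.L = d.matR t := rfl
  unfold piHat
  rw [← hn, h1, h4, mul_div_cancel_left₀ _ h2, mul_div_assoc, mul_div_cancel_left₀ _ h3]

theorem seeds_eq {t : d.L₁ → ℝ} {f : ℕ → RF} {ρ : ℕ → ℕ → RF} {u : RF}
    (hl : Link d.a d.b (d.tExt t) d.L d.q₃ d.q₄ f ρ u) :
    d.seeds t = fun m => const (d.chiHat (d.seedIdx m)) * f (d.seedIdx m) := by
  funext m
  have : ((d.enum m : ℕ) : ℤ) - d.q₃ - d.q₄ + d.q₃ + d.q₄ = (d.seedIdx m : ℕ) := by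
    unfold seedIdx; ring
  unfold seeds
  rw [piHat_eq hl, this, u_nat]

end

/-- Rational functions without poles except possibly at `±1`. -/
def NearPoly (y : RF) : Prop :=
  ∃ (P : ℝ[X]) (m n : ℕ), y * ((x - 1) ^ m * (x + 1) ^ n) = ofPoly P

theorem NearPoly.const_mul {y : RF} (h : NearPoly y) (c : ℝ) : NearPoly (const c * y) := by
  obtain ⟨P, m, n, h⟩ := h
  exact ⟨C c * P, m, n, by rw [ofPoly_mul, ofPoly_C, ← h, mul_assoc]⟩

theorem nearPoly_wr {t : d.L₁ → ℝ} {f : ℕ → RF} {ρ : ℕ → ℕ → RF} {u : RF}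
    (hl : Link d.a d.b (d.tExt t) d.L d.q₃ d.q₄ f ρ u) {m : ℕ} (k : Fin m → ℕ) :
    NearPoly (d.tauHat t * wr fun j => f (k j)) := by
  obtain ⟨P, hP⟩ := hl.elim.exists_poly hl.det_ne k
  rw [wr_mul] at hP
  refine ⟨C ((-1) ^ (d.q₄ * (d.q₄ + d.a))) * P, d.q₄ * (d.q₄ + d.a) + d.q₄ * m,
    d.q₃ * (d.q₃ + d.b) + d.q₃ * m, ?_⟩
  have e1 : weight (d.q₄ * (d.q₄ + d.a)) (d.q₃ * (d.q₃ + d.b)) ≠ 0 := weight_ne _ _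
  have e2 : weight (d.q₄ * (d.q₄ + d.a)) (d.q₃ * (d.q₃ + d.b)) =
      (-1) ^ (d.q₄ * (d.q₄ + d.a)) * ((x - 1) ^ (d.q₄ * (d.q₄ + d.a)) *
        (x + 1) ^ (d.q₃ * (d.q₃ + d.b))) := by
    unfold weight; rw [← mul_assoc, ← mul_pow, add_comm 1 x]; ring
  have e3 : ((-1 : RF) ^ (d.q₄ * (d.q₄ + d.a))) * (-1) ^ (d.q₄ * (d.q₄ + d.a)) = 1 := by
    rw [← mul_pow]; simp
  rw [ofPoly_mul, ofPoly_C, ← hP, const_pow, const_neg, const_one]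
  unfold tauHat
  have h4 : gram d.a d.b (d.tExt t) d.L = d.matR t := rfl
  rw [h4, div_mul_eq_mul_div, div_mul_eq_mul_div, div_eq_iff e1, e2]
  rw [add_comm 1 x]
  generalize (-1 : RF) ^ (d.q₄ * (d.q₄ + d.a)) = s at e3 ⊢
  generalize d.q₄ * (d.q₄ + d.a) = i
  generalize d.q₃ * (d.q₃ + d.b) = j
  generalize (d.matR t).det = R
  generalize (wr fun j => f (k j)) = w
  rw [pow_add, pow_add, pow_mul, pow_mul, mul_pow]
  linear_combination (-(R * w * (x - 1) ^ i * ((x - 1) ^ d.q₄) ^ m * (x + 1) ^ j *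
    ((x + 1) ^ d.q₃) ^ m)) * e3

/-- The result of the two stages. -/
structure Chain (d : Data) (t : d.L₁ → ℝ) (f : ℕ → RF) (ρ : ℕ → ℕ → RF) (vm : ℕ → ℝ) : Prop where
  state : State (d.a + d.b) d.lab d.α d.β (d.p + d.q₃ + d.q₄) (D (d.tau t) / d.tau t) d.degTau
    f ρ (d.nuFactor t) d.leadCoeff vm
  pi_eq : ∀ i, d.pi t i = const (d.chi (d.nIdx i) * d.chiHat (d.nIdx i)) * f (d.nIdx i)
  tau_ne : d.tau t ≠ 0
  near : NearPoly (d.tau t)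
  near_mul : ∀ n, NearPoly (d.tau t * f n)
  wr_ne : wr (d.seeds t) ≠ 0

theorem exists_chain (h : d.Disj) {f₀ : ℕ → RF} {ρ₀ : ℕ → ℕ → RF} {u₀ : RF} {vm₀ : ℕ → ℝ}
    (hE : EdgeChain d.a d.b d.L₃ d.L₄ f₀ ρ₀ u₀ vm₀) {t : d.L₁ → ℝ} (ht : d.Valid t) :
    ∃ ρ, Chain d t (darChain d.K.card d.seedIdx (d.first f₀ ρ₀ t)) ρ
      (vmChain (d.a + d.b) d.K.card d.seedIdx (d.b + 2 * d.q₃) vm₀) := by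
  obtain ⟨u, ρ, hs, hl⟩ := exists_first h hE ht
  have hK : ∀ m, d.seedIdx m ∉ d.L₁ ∧ d.seedIdx m ∉ d.L₃ ∧ d.seedIdx m ∉ d.L₄ := fun m => by
    have := Finset.disjoint_left.mp h.hK (seedIdx_mem m)
    simp only [Finset.mem_union] at this
    tauto
  obtain ⟨ρ', hs', hw, hd⟩ := exists_darChain d.K.card d.seedIdx seedIdx_injective hs (fun m => by
    rw [mark_nat, if_neg (hK m).1, mark_nat, if_neg (hK m).2.2, mark_nat, if_neg (hK m).2.1,
      lab₀_nat])
  have hc : const (∏ m, d.chiHat (d.seedIdx m)) ≠ 0 :=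
    const_ne_zero (Finset.prod_ne_zero_iff.mpr fun m _ => chiHat_ne (by
      have := hK m; simp [this]))
  have hwr : wr (d.seeds t) = const (∏ m, d.chiHat (d.seedIdx m)) *
      wr fun m => d.first f₀ ρ₀ t (d.seedIdx m) := by
    rw [seeds_eq hl, wr_const_mul]
  have hwr_ne : wr (d.seeds t) ≠ 0 := by rw [hwr]; exact mul_ne_zero hc hw
  have hhat : d.tauHat t ≠ 0 := div_ne_zero hl.det_ne (weight_ne _ _)
  refine ⟨ρ', ?_, fun i => ?_, mul_ne_zero hhat hwr_ne, ?_, fun n => ?_, hwr_ne⟩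
  · convert hs' using 1
    · rw [image_seedIdx]; rfl
    · unfold α p; ring
    · unfold β p; ring
    · unfold p; ring
    · have : u = D (d.tauHat t) / d.tauHat t := hl.u_eq
      rw [this]
      unfold tau
      rw [logDeriv_mul hhat hwr_ne, hwr, D_const_mul, mul_div_mul_left _ _ hc]
    · have e1 : ∑ l ∈ d.L, (l : ℤ) = ∑ l ∈ d.L₁, (l : ℤ) + ∑ l ∈ d.L₃, (l : ℤ) +
          ∑ l ∈ d.L₄, (l : ℤ) := by
        unfold L
        rw [Finset.sum_union (Finset.disjoint_union_left.mpr ⟨h.h14, h.h34⟩),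
          Finset.sum_union h.h13]
      have e2 : ∀ A : Finset ℕ, ∑ l ∈ A, (2 * (l : ℤ) + d.a + d.b + 1) =
          2 * ∑ l ∈ A, (l : ℤ) + A.card * (d.a + d.b + 1) := fun A => by
        rw [Finset.mul_sum, ← nsmul_eq_mul, ← Finset.sum_const, ← Finset.sum_add_distrib]
        exact Finset.sum_congr rfl fun l _ => by ring
      rw [e2, e2, e2, sum_seedIdx fun k => (k : ℤ)]
      unfold degTau
      rw [e1]
      unfold p q₁ q₃ q₄
      push_cast
      ring
    · rfl
    · rfl
  · have e : i + d.p + d.q₃ + d.q₄ = i + d.γ := by unfold γ; ring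
    have hsn : (Fin.snoc (α := fun _ => RF) (d.seeds t) (d.piHat t (i + d.p)) :
        Fin (d.K.card + 1) → RF) = fun j =>
        const ((Fin.snoc (α := fun _ => ℝ) (fun m => d.chiHat (d.seedIdx m))
          (d.chiHat (d.nIdx i)) : Fin (d.K.card + 1) → ℝ) j) *
        (Fin.snoc (α := fun _ => RF) (fun m => d.first f₀ ρ₀ t (d.seedIdx m))
          (d.first f₀ ρ₀ t (d.nIdx i)) : Fin (d.K.card + 1) → RF) j := by
      funext j
      rw [piHat_eq hl, seeds_eq hl, e]
      refine Fin.lastCases ?_ (fun j => ?_) j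
      · rw [Fin.snoc_last, Fin.snoc_last, Fin.snoc_last]; rfl
      · rw [Fin.snoc_castSucc, Fin.snoc_castSucc, Fin.snoc_castSucc]
    unfold pi
    rw [hsn, wr_const_mul, hd, hwr, Fin.prod_univ_castSucc]
    simp only [Fin.snoc_castSucc, Fin.snoc_last]
    rw [const_mul, const_mul]
    field_simp
  · have e : d.tau t = const (∏ m, d.chiHat (d.seedIdx m)) *
        (d.tauHat t * wr fun m => d.first f₀ ρ₀ t (d.seedIdx m)) := by
      unfold tau; rw [hwr]; ring
    rw [e]
    exact (nearPoly_wr hl _).const_mul _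
  · have e : d.tau t * darChain d.K.card d.seedIdx (d.first f₀ ρ₀ t) n =
        const (∏ m, d.chiHat (d.seedIdx m)) * (d.tauHat t * wr fun j => d.first f₀ ρ₀ t
          ((Fin.snoc (α := fun _ => ℕ) d.seedIdx n : Fin (d.K.card + 1) → ℕ) j)) := by
      rw [comp_snoc (d.first f₀ ρ₀ t), hd]
      unfold tau
      rw [hwr]; ring
    rw [e]
    exact (nearPoly_wr hl _).const_mul _

theorem undeformed_valid (t : d.undeformed.L₁ → ℝ) : d.undeformed.Valid t := fun l =>
  absurd l.2 (Finset.notMem_empty _)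

/-- The limit of the eigenfunctions when the deformation parameters tend to infinity. -/
theorem conv_pi (h : d.Disj) {f₀ : ℕ → RF} {ρ₀ : ℕ → ℕ → RF} {u₀ : RF} {vm₀ : ℕ → ℝ}
    (hE : EdgeChain d.a d.b d.L₃ d.L₄ f₀ ρ₀ u₀ vm₀) (i : ℤ) :
    Conv (Filter.pi fun _ : d.L₁ => Bornology.cobounded ℝ) (fun t => d.pi t i)
      (d.undeformed.pi (fun _ => 0) i) := by
  have hv : ∀ᶠ t in Filter.pi fun _ : d.L₁ => Bornology.cobounded ℝ, d.Valid t := by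
    refine eventually_all.mpr fun l => ?_
    have := tendsto_eval_pi (fun _ : d.L₁ => Bornology.cobounded ℝ) l
    exact (this.eventually (Bornology.eventually_ne_cobounded 0)).and
      (this.eventually (Bornology.eventually_ne_cobounded _))
  obtain ⟨u', ρ', -, hl'⟩ := exists_first (d := d.undeformed) h.undeformed hE
    (undeformed_valid fun _ => 0)
  have e0 : d.undeformed.first f₀ ρ₀ (fun _ => 0) = f₀ := by
    unfold first Data.undeformed
    rw [Finset.toList_empty]; rfl
  rw [e0] at hl'
  have hpi : ∀ i, Conv (Filter.pi fun _ : d.L₁ => Bornology.cobounded ℝ) (fun t => d.piHat t i)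
      (d.undeformed.piHat (fun _ => 0) i) := by
    intro i
    rw [piHat_eq hl']
    have h1 := (Conv.fixed (F := Filter.pi fun _ : d.L₁ => Bornology.cobounded ℝ)
      (const (d.chiHat (d.u (i + d.q₃ + d.q₄))))).mul
        (Conv.confChain (t := fun t => d.tExt t) d.L₁.toList (fun l hl => by
          rw [Finset.mem_toList] at hl
          simp only [tExt_of_mem _ hl]
          exact tendsto_eval_pi (fun _ : d.L₁ => Bornology.cobounded ℝ) ⟨l, hl⟩)
        (fun i => Conv.fixed (f₀ i)) (fun i j => Conv.fixed (ρ₀ i j)) (d.u (i + d.q₃ + d.q₄)))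
    refine h1.congr (hv.mono fun t ht => ?_)
    obtain ⟨u, ρ, -, hl⟩ := exists_first h hE ht
    rw [piHat_eq hl]
    rfl
  have hs : ∀ m, Conv (Filter.pi fun _ : d.L₁ => Bornology.cobounded ℝ) (fun t => d.seeds t m)
      (d.undeformed.seeds (fun _ => 0) m) := fun m => hpi _
  obtain ⟨ρ'', hch⟩ := exists_chain (d := d.undeformed) h.undeformed hE (undeformed_valid fun _ => 0)
  refine (Conv.fixed _).mul ((Conv.wr (Conv.snoc hs (hpi _))).div (Conv.wr hs) hch.wr_ne)

end Data

end
end ExcJacobi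

namespace ExcJacobi
noncomputable section

open Place

/-! ### Quasi-rational eigenfunctions -/

/-- The Wronskian of two eigenfunctions with the same eigenvalue. -/
theorem abel {T : Diff2} {lam : ℝ} {y z W : RF} (hW : D (T.p * W) = T.q * W)
    (hy : Sol T lam y) (hz : Sol T lam z) :
    ∃ k, T.p * W * (y * D z - D y * z) = const k := by
  refine D_eq_zero ?_
  unfold Sol Diff2.apply at hy hz
  rw [D_mul, hW, D_sub, D_mul, D_mul]
  linear_combination y * W * hz - z * W * hy

theorem eq_const_mul_of_wronskian {y z : RF} (hy : y ≠ 0) (h : y * D z - D y * z = 0) :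
    ∃ c, z = const c * y := by
  obtain ⟨c, hc⟩ := D_eq_zero (f := z / y) (by
    rw [D_quot _ _ hy, div_eq_zero_iff]; left; linear_combination h)
  exact ⟨c, (div_eq_iff hy).mp hc⟩

theorem sol_span {T : Diff2} {lam : ℝ} {y₁ y₂ z W : RF} (hp : T.p ≠ 0) (hW0 : W ≠ 0)
    (hW : D (T.p * W) = T.q * W) (h1 : Sol T lam y₁) (h2 : Sol T lam y₂) (hz : Sol T lam z)
    (h0 : y₁ ≠ 0) (hi : ∀ c, y₂ ≠ const c * y₁) :
    ∃ c d, z = const c * y₁ + const d * y₂ := by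
  obtain ⟨k, hk⟩ := abel hW h1 hz
  obtain ⟨l, hl⟩ := abel hW h1 h2
  have hpW := mul_ne_zero hp hW0
  have l0 : const l ≠ 0 := by
    intro h
    rw [h, mul_eq_zero, or_iff_right hpW] at hl
    obtain ⟨c, hc⟩ := eq_const_mul_of_wronskian h0 hl
    exact hi c hc
  obtain ⟨c, hc⟩ := eq_const_mul_of_wronskian (z := z - const (k / l) * y₂) h0 (by
    rw [D_sub, D_const_mul, ← mul_right_inj' hpW, mul_zero]
    have e : const k = const (k / l) * const l := by rw [const_div, div_mul_cancel₀ _ l0]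
    linear_combination hk + e - const (k / l) * hl)
  exact ⟨c, k / l, by rw [← hc]; ring⟩

theorem reg_const_mul_iff {c k : ℝ} (hk : k ≠ 0) {y : RF} : Reg c (const k * y) ↔ Reg c y := by
  refine ⟨fun h => ?_, fun h => (reg_const c k).mul h⟩
  have := (reg_const c k⁻¹).mul h
  rwa [← mul_assoc, ← const_mul, inv_mul_cancel₀ hk, const_one, one_mul] at this

/-- The type and the degree of the quasi-rational eigenfunctions that correspond to a label. -/
def Occ (m m' : ℤ) : Label → AType → ℤ → Prop
  | .circle, .one, k => k = m
  | .triangle, .one, k => k = m'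
  | .plus, .three, k => k = m'
  | .minus, .four, k => k = m'
  | .bullet, .three, k => k = m
  | .bullet, .four, k => k = m
  | .bullet, .two, k => k = m ∨ k = m'
  | _, _, _ => False

section

variable {N : ℕ} {lab : ℤ → Label} {α β γ : ℕ} {u : RF} {δ : ℤ} {f : ℕ → RF}
  {ρ : ℕ → ℕ → RF} {ν lc vm : ℕ → ℝ}

theorem regularAt_logDeriv {c : ℝ} (hc : c = 1 ∨ c = -1) {lam : ℝ} {y : RF} (hu : Reg c u)
    (hy : Sol (opN u α β γ) lam y) (y0 : y ≠ 0) : RegularAt (D y / y) c ↔ Reg c y := by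
  rw [← reg_iff]
  constructor
  · intro h
    by_contra hn
    obtain ⟨h1, v, hv, h2⟩ := pole_of_not_reg hc hu hy y0 hn
    have := (reg_logDeriv_iff h2 hv).mp h
    omega
  · intro h
    obtain ⟨v, hv, h2⟩ := unit_of_reg hc hu hy y0 h
    exact (reg_logDeriv_iff (asym_zero_iff.mpr h2) hv).mpr rfl

/-- The type of a quasi-rational function. -/
def typeOf (r₁ r₂ : Prop) : AType → Prop
  | .one => r₁ ∧ r₂
  | .two => ¬r₁ ∧ ¬r₂
  | .three => ¬r₁ ∧ r₂
  | .four => r₁ ∧ ¬r₂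

theorem State.hasType_iff (S : State N lab α β γ u δ f ρ ν lc vm) {lam : ℝ} {y : RF}
    (hy : Sol (opN u α β γ) lam y) (y0 : y ≠ 0) (s : AType) :
    HasType (D y / y) s ↔ typeOf (Reg 1 y) (Reg (-1) y) s := by
  have h1 := regularAt_logDeriv (Or.inl rfl) (S.reg_u 1 (Or.inl rfl)) hy y0
  have h2 := regularAt_logDeriv (Or.inr rfl) (S.reg_u (-1) (Or.inr rfl)) hy y0
  cases s <;> simp only [HasType, typeOf, h1, h2]

theorem hasDeg_iff_of_deg {y : RF} {m : ℤ} (h : Deg y m) (μ : ℝ) : HasDeg (D y / y) μ ↔ μ = m := by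
  obtain ⟨v, hv, h⟩ := h
  have h1 := hasDeg_logDeriv h hv
  exact ⟨fun h2 => h2.unique h1, fun h2 => h2 ▸ h1⟩

theorem exists_deg {y : RF} (h : y ≠ 0) : ∃ m, Deg y m := infPlace.exists_asym h

theorem exists_sol_of_ric {lam : ℝ} {y w : RF} (hy : Sol (opN u α β γ) lam y) (y0 : y ≠ 0)
    (hw : w ∈ Ric (opN u α β γ) lam) : ∃ z, z ≠ 0 ∧ Sol (opN u α β γ) lam z ∧ w = D z / z := by
  rcases ric_iff_of_sol hy y0 p_ne (weight_ne α β) (hW_opN u α β γ) w hw with h | ⟨h, h1, h2, h3⟩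
  · exact ⟨y, y0, hy, h⟩
  · exact ⟨y * h, mul_ne_zero y0 h3, sol_second hy y0 p_ne (weight_ne α β) (hW_opN u α β γ) h1, h2⟩

theorem State.of_hasSol (S : State N lab α β γ u δ f ρ ν lc vm) {lam : ℝ} {r₁ r₂ : Prop} {m : ℤ}
    (h : HasSol (opN u α β γ) (weight α β) lam r₁ r₂ m True) :
    ∃ w, Ric (opN u α β γ) lam = {w} ∧ (∀ s, HasType w s ↔ typeOf r₁ r₂ s) ∧
      ∀ μ, HasDeg w μ ↔ μ = m := by
  obtain ⟨y, y0, hy, h1, h2, h3, h4⟩ := h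
  refine ⟨D y / y, ?_, fun s => ?_, hasDeg_iff_of_deg h3⟩
  · refine Set.eq_singleton_iff_unique_mem.mpr ⟨mem_Ric_of_sol y0 hy, fun w hw => ?_⟩
    rcases ric_iff_of_sol hy y0 p_ne (weight_ne α β) (hW_opN u α β γ) w hw with h | ⟨h, h5, -⟩
    · exact h
    · exact absurd ⟨h, h5⟩ (h4 trivial)
  · rw [S.hasType_iff hy y0]
    cases s <;> simp only [typeOf, h1, h2]

theorem exists_occ_of_singleton {T : Diff2} {lam : ℝ} {r₁ r₂ : Prop} {m : ℤ}
    (h : ∃ w, Ric T lam = {w} ∧ (∀ s, HasType w s ↔ typeOf r₁ r₂ s) ∧ ∀ μ, HasDeg w μ ↔ μ = m)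
    (s : AType) (μ : ℝ) : (∃ w ∈ Ric T lam, HasType w s ∧ HasDeg w μ) ↔ typeOf r₁ r₂ s ∧ μ = m := by
  obtain ⟨w, h1, h2, h3⟩ := h
  simp only [h1, Set.mem_singleton_iff, exists_eq_left, h2, h3]

theorem State.bullet (S : State N lab α β γ u δ f ρ ν lc vm) {j : ℤ} (hj : -(N + 1 : ℤ) ≤ 2 * j)
    (hl : lab j = .bullet) : (Ric (opN u α β γ) (Lam N j)).Infinite ∧ ∀ (s : AType) (μ : ℝ),
      (∃ w ∈ Ric (opN u α β γ) (Lam N j), HasType w s ∧ HasDeg w μ) ↔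
        ∃ k : ℤ, μ = k ∧ Occ (j - γ) (-j - N - 1 - γ) .bullet s k := by
  have hd := S.diag j hj
  rw [hl] at hd
  obtain ⟨⟨y₃, n3, s3, a3, b3, d3, -⟩, ⟨y₄, n4, s4, a4, b4, d4, -⟩, ⟨y₂, n2, s2, a2, b2, d2, -⟩⟩ := hd
  rw [iff_false] at a3 b4 a2 b2
  rw [iff_true] at b3 a4
  have hi : ∀ c, y₄ ≠ const c * y₃ := fun c e => b4 (e ▸ (reg_const _ c).mul b3)
  have reg1 : ∀ c d, Reg 1 (const c * y₃ + const d * y₄) ↔ c = 0 := fun c d => by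
    constructor
    · intro h
      by_contra hc
      refine a3 ((reg_const_mul_iff hc).mp ?_)
      have := h.sub ((reg_const 1 d).mul a4)
      rwa [add_sub_cancel_right] at this
    · rintro rfl
      rw [const_zero, zero_mul, zero_add]; exact (reg_const 1 d).mul a4
  have reg2 : ∀ c d, Reg (-1) (const c * y₃ + const d * y₄) ↔ d = 0 := fun c d => by
    constructor
    · intro h
      by_contra hc
      refine b4 ((reg_const_mul_iff hc).mp ?_)
      have := h.sub ((reg_const (-1) c).mul b3)
      rwa [add_sub_cancel_left] at this
    · rintro rfl
      rw [const_zero, zero_mul, add_zero]; exact (reg_const (-1) c).mul b3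
  have hne : ∀ c, y₃ + const c * y₄ ≠ 0 := fun c e => by
    have := reg1 1 c
    rw [const_one, one_mul, e] at this
    exact one_ne_zero (this.mp (reg_zero 1))
  have hsol : ∀ c, Sol (opN u α β γ) (Lam N j) (y₃ + const c * y₄) := fun c => s3.add (s4.const_mul c)
  constructor
  · refine Set.infinite_of_injective_forall_mem
      (f := fun c : ℝ => D (y₃ + const c * y₄) / (y₃ + const c * y₄)) ?_
      fun c => mem_Ric_of_sol (hne c) (hsol c)
    intro c d h
    obtain ⟨k, -, hk⟩ := eq_const_mul_of_logDeriv (hne c) (hne d) h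
    have e : const (1 - k) * y₃ + const (c - k * d) * y₄ = 0 := by
      rw [const_sub, const_sub, const_mul, const_one]; linear_combination hk
    have h1 := (reg1 (1 - k) (c - k * d)).mp (e ▸ reg_zero 1)
    have h2 := (reg2 (1 - k) (c - k * d)).mp (e ▸ reg_zero (-1))
    have : k = 1 := by linarith
    rw [this] at h2
    linarith
  · intro s μ
    constructor
    · rintro ⟨w, hw, ht, hdeg⟩
      obtain ⟨z, z0, hz, rfl⟩ := exists_sol_of_ric s3 n3 hw
      rw [S.hasType_iff hz z0] at ht
      obtain ⟨c, d, rfl⟩ := sol_span p_ne (weight_ne α β) (hW_opN u α β γ) s3 s4 hz n3 hi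
      obtain ⟨m, hm⟩ := exists_deg z0
      rw [hasDeg_iff_of_deg hm] at hdeg
      refine ⟨m, hdeg, ?_⟩
      have hcase := S.deg_cases hz hm
      rw [reg1, reg2] at ht
      have huniq : ∀ {y : RF} {m m' : ℤ}, Deg y m → Deg y m' → m = m' :=
        fun ⟨v, hv, h⟩ ⟨v', hv', h'⟩ => h.order_unique hv h' hv'
      have hmul : ∀ {y : RF} {m : ℤ} {c : ℝ}, c ≠ 0 → Deg y m → Deg (const c * y) m :=
        fun hc ⟨v, hv, h⟩ => ⟨_, mul_ne_zero hc hv, h.const_mul _⟩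
      cases s with
      | one =>
        exfalso
        obtain ⟨rfl, rfl⟩ := ht
        rw [const_zero, zero_mul, zero_mul, add_zero] at z0
        exact z0 rfl
      | two => exact hcase
      | three =>
        obtain ⟨hc, rfl⟩ := ht
        rw [const_zero, zero_mul, add_zero] at hm
        exact huniq hm (hmul hc d3)
      | four =>
        obtain ⟨rfl, hc⟩ := ht
        rw [const_zero, zero_mul, zero_add] at hm
        exact huniq hm (hmul hc d4)
    · rintro ⟨k, rfl, hk⟩
      cases s with
      | one => exact hk.elim
      | two =>
        rcases hk with rfl | rfl
        · obtain ⟨v, hv, hv'⟩ := d3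
          obtain ⟨w, hw, hw'⟩ := d4
          obtain ⟨c, hc0, hc⟩ : ∃ c : ℝ, c ≠ 0 ∧ v + c * w ≠ 0 := by
            by_cases h : v + 1 * w = 0
            · refine ⟨2, two_ne_zero, fun h' => hw ?_⟩
              linarith
            · exact ⟨1, one_ne_zero, h⟩
          refine ⟨_, mem_Ric_of_sol (hne c) (hsol c), ?_, ?_⟩
          · rw [S.hasType_iff (hsol c) (hne c)]
            have h1 := reg1 1 c
            have h2 := reg2 1 c
            rw [const_one, one_mul] at h1 h2
            exact ⟨fun h => one_ne_zero (h1.mp h), fun h => hc0 (h2.mp h)⟩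
          · exact (hasDeg_iff_of_deg ⟨_, hc, hv'.add (hw'.const_mul c)⟩ _).mpr rfl
        · exact ⟨_, mem_Ric_of_sol n2 s2, (S.hasType_iff s2 n2 .two).mpr ⟨a2, b2⟩,
            (hasDeg_iff_of_deg d2 _).mpr rfl⟩
      | three =>
        obtain rfl := hk
        exact ⟨_, mem_Ric_of_sol n3 s3, (S.hasType_iff s3 n3 .three).mpr ⟨a3, b3⟩,
          (hasDeg_iff_of_deg d3 _).mpr rfl⟩
      | four =>
        obtain rfl := hk
        exact ⟨_, mem_Ric_of_sol n4 s4, (S.hasType_iff s4 n4 .four).mpr ⟨a4, b4⟩,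
          (hasDeg_iff_of_deg d4 _).mpr rfl⟩

/-- The types and the degrees of the quasi-rational eigenfunctions. -/
theorem State.occ (S : State N lab α β γ u δ f ρ ν lc vm) {j : ℤ} (hj : -(N + 1 : ℤ) ≤ 2 * j)
    (s : AType) (μ : ℝ) : (∃ w ∈ Ric (opN u α β γ) (Lam N j), HasType w s ∧ HasDeg w μ) ↔
        ∃ k : ℤ, μ = k ∧ Occ (j - γ) (-j - N - 1 - γ) (lab j) s k := by
  by_cases hb : lab j = .bullet
  · rw [hb]; exact (S.bullet hj hb).2 s μ
  have hd := S.diag j hj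
  generalize hlab : lab j = l at hb hd ⊢
  cases l with
  | bullet => exact absurd rfl hb
  | circle =>
    rw [exists_occ_of_singleton (S.of_hasSol hd)]
    cases s <;> simp [typeOf, Occ]
  | triangle =>
    rw [exists_occ_of_singleton (S.of_hasSol hd)]
    cases s <;> simp [typeOf, Occ]
  | plus =>
    rw [exists_occ_of_singleton (S.of_hasSol hd)]
    cases s <;> simp [typeOf, Occ]
  | minus =>
    rw [exists_occ_of_singleton (S.of_hasSol hd)]
    cases s <;> simp [typeOf, Occ]

theorem State.exists_unique (S : State N lab α β γ u δ f ρ ν lc vm) {j : ℤ}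
    (hj : -(N + 1 : ℤ) ≤ 2 * j) (hb : lab j ≠ .bullet) :
    ∃ w, Ric (opN u α β γ) (Lam N j) = {w} := by
  have hd := S.diag j hj
  generalize lab j = l at hb hd
  cases l with
  | bullet => exact absurd rfl hb
  | circle => obtain ⟨w, hw, -⟩ := S.of_hasSol hd; exact ⟨w, hw⟩
  | triangle => obtain ⟨w, hw, -⟩ := S.of_hasSol hd; exact ⟨w, hw⟩
  | plus => obtain ⟨w, hw, -⟩ := S.of_hasSol hd; exact ⟨w, hw⟩
  | minus => obtain ⟨w, hw, -⟩ := S.of_hasSol hd; exact ⟨w, hw⟩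

/-- Every quasi-rational eigenfunction has a degree. -/
theorem State.hasDeg (S : State N lab α β γ u δ f ρ ν lc vm) {j : ℤ} (hj : -(N + 1 : ℤ) ≤ 2 * j)
    {w : RF} (hw : w ∈ Ric (opN u α β γ) (Lam N j)) : ∃ m : ℤ, HasDeg w m := by
  have : ∃ y, y ≠ 0 ∧ Sol (opN u α β γ) (Lam N j) y := by
    have hd := S.diag j hj
    generalize lab j = l at hd
    cases l with
    | bullet => obtain ⟨y, y0, hy, -⟩ := hd.1; exact ⟨y, y0, hy⟩
    | circle => obtain ⟨y, y0, hy, -⟩ := hd; exact ⟨y, y0, hy⟩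
    | triangle => obtain ⟨y, y0, hy, -⟩ := hd; exact ⟨y, y0, hy⟩
    | plus => obtain ⟨y, y0, hy, -⟩ := hd; exact ⟨y, y0, hy⟩
    | minus => obtain ⟨y, y0, hy, -⟩ := hd; exact ⟨y, y0, hy⟩
  obtain ⟨y, y0, hy⟩ := this
  obtain ⟨z, z0, -, rfl⟩ := exists_sol_of_ric hy y0 hw
  obtain ⟨m, hm⟩ := exists_deg z0
  exact ⟨m, (hasDeg_iff_of_deg hm _).mpr rfl⟩

theorem State.exists_upper (S : State N lab α β γ u δ f ρ ν lc vm) {lam : ℝ}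
    (h : (Ric (opN u α β γ) lam).Nonempty) : ∃ j : ℤ, -(N + 1 : ℤ) ≤ 2 * j ∧ lam = Lam N j := by
  obtain ⟨j, rfl⟩ := S.ric lam h
  by_cases hj : -(N + 1 : ℤ) ≤ 2 * j
  · exact ⟨j, hj, rfl⟩
  · exact ⟨-j - N - 1, by omega, (Lam_eq_iff N _ _).mpr (Or.inr (by ring))⟩

end

end
end ExcJacobi

namespace ExcJacobi
noncomputable section

open Place

/-! ### Index sets and spectral diagrams -/

namespace Data

variable {d : Data}

variable (d) in
/-- The condition `j ≥ j*`. -/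
def Up (j : ℤ) : Prop := -((d.a + d.b : ℕ) + 1 : ℤ) ≤ 2 * j

theorem mem_toZ {A : Finset ℕ} {j : ℤ} : j ∈ toZ A ↔ ∃ l ∈ A, (l : ℤ) = j := by
  simp [toZ]

theorem lab_eq (j : ℤ) [Decidable (j ∈ toZ d.K)] [Decidable (j ∈ toZ d.L₁)]
    [Decidable (j ∈ toZ d.L₃)] [Decidable (j ∈ toZ d.L₄)] :
    d.lab j = if j ∈ toZ d.K then .bullet else if j ∈ toZ d.L₁ then .triangle else
      if j ∈ toZ d.L₄ then .plus else if j ∈ toZ d.L₃ then .minus else lab₀ d.a d.b j := by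
  unfold lab mark
  simp only [mem_toZ]

theorem toZ_nonneg {A : Finset ℕ} {j : ℤ} (h : j ∈ toZ A) : 0 ≤ j := by
  obtain ⟨l, -, rfl⟩ := mem_toZ.mp h
  positivity

theorem toZ_disjoint {A B : Finset ℕ} (h : Disjoint A B) {j : ℤ} (h1 : j ∈ toZ A)
    (h2 : j ∈ toZ B) : False := by
  obtain ⟨l, hl, rfl⟩ := mem_toZ.mp h1
  obtain ⟨m, hm, e⟩ := mem_toZ.mp h2
  rw [Int.natCast_inj] at e
  exact Finset.disjoint_left.mp h hl (e ▸ hm)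

theorem toZ_union {A B : Finset ℕ} {j : ℤ} : j ∈ toZ (A ∪ B) ↔ j ∈ toZ A ∨ j ∈ toZ B := by
  simp only [mem_toZ, Finset.mem_union]
  constructor
  · rintro ⟨l, h | h, e⟩
    exacts [Or.inl ⟨l, h, e⟩, Or.inr ⟨l, h, e⟩]
  · rintro (⟨l, h, e⟩ | ⟨l, h, e⟩)
    exacts [⟨l, Or.inl h, e⟩, ⟨l, Or.inr h, e⟩]

theorem lab_iff (h : d.Disj) (j : ℤ) :
    (d.lab j = .circle ↔ 0 ≤ j ∧ j ∉ toZ d.K ∧ j ∉ toZ d.L₁ ∧ j ∉ toZ d.L₃ ∧ j ∉ toZ d.L₄) ∧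
    (d.lab j = .triangle ↔ j ∈ toZ d.L₁) ∧
    (d.lab j = .bullet ↔ j ∈ toZ d.K ∨ -(min d.a d.b : ℤ) ≤ j ∧ j < 0) ∧
    (d.lab j = .plus ↔ j ∈ toZ d.L₄ ∨ j < -(min d.a d.b : ℤ) ∧ d.b < d.a) ∧
    (d.lab j = .minus ↔ j ∈ toZ d.L₃ ∨ j < -(min d.a d.b : ℤ) ∧ d.a ≤ d.b) := by
  classical
  have hK := h.hK
  rw [Finset.disjoint_union_right, Finset.disjoint_union_right] at hK
  have n1 := toZ_nonneg (A := d.K) (j := j)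
  have n2 := toZ_nonneg (A := d.L₁) (j := j)
  have n3 := toZ_nonneg (A := d.L₃) (j := j)
  have n4 := toZ_nonneg (A := d.L₄) (j := j)
  have e1 := toZ_disjoint hK.1.1 (j := j)
  have e2 := toZ_disjoint hK.1.2 (j := j)
  have e3 := toZ_disjoint hK.2 (j := j)
  have e4 := toZ_disjoint h.h13 (j := j)
  have e5 := toZ_disjoint h.h14 (j := j)
  have e6 := toZ_disjoint h.h34 (j := j)
  rw [lab_eq]
  unfold lab₀
  split_ifs <;> simp only [true_iff, false_iff] <;> grind

theorem mem_I₁p (h : d.Disj) {k : ℤ} :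
    k ∈ d.I₁p ↔ ∃ j, d.Up j ∧ d.lab j = .circle ∧ k = j - d.γ := by
  unfold I₁p shift L Up
  simp only [Set.mem_image, Set.mem_ofPred_eq, (lab_iff h _).1, toZ_union]
  refine exists_congr fun j => ?_
  grind

theorem mem_I₁m (h : d.Disj) {k : ℤ} :
    k ∈ d.I₁m ↔ ∃ j, d.Up j ∧ d.lab j = .triangle ∧ k = d.star j - d.γ := by
  unfold I₁m shift starSet Up
  simp only [Set.mem_image, (lab_iff h _).2.1, exists_exists_and_eq_and]
  refine exists_congr fun j => ?_
  have := toZ_nonneg (A := d.L₁) (j := j)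
  grind

theorem lab_bullet (h : d.Disj) {j : ℤ} : d.lab j = .bullet ↔
    j ∈ toZ d.K ∨ -(min d.a d.b : ℤ) ≤ j ∧ j < 0 := (lab_iff h j).2.2.1

theorem cast_α : ((d.α : ℕ) : ℤ) = d.a + d.p + 2 * d.q₄ := by unfold α; push_cast; ring
theorem cast_β : ((d.β : ℕ) : ℤ) = d.b + d.p + 2 * d.q₃ := by unfold β; push_cast; ring

theorem mem_I₂p (h : d.Disj) {k : ℤ} :
    k ∈ d.I₂p ↔ ∃ j, d.Up j ∧ d.lab j = .bullet ∧ k = j - d.γ + d.α + d.β := by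
  unfold I₂p shift cI₂p Up
  rw [cast_α, cast_β]
  unfold γ
  simp only [Set.mem_union, Set.mem_image, Set.mem_Ico, lab_bullet h]
  constructor
  · rintro (⟨i, hi, rfl⟩ | ⟨j, hj, rfl⟩)
    · exact ⟨i - d.a - d.b, by omega, by omega, by ring⟩
    · have := toZ_nonneg hj
      exact ⟨j, by omega, Or.inl hj, by ring⟩
  · rintro ⟨j, h1, h2 | h2, rfl⟩
    · exact Or.inr ⟨j, h2, by ring⟩
    · exact Or.inl ⟨j + d.a + d.b, by omega, by ring⟩

theorem mem_I₂m (h : d.Disj) {k : ℤ} :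
    k ∈ d.I₂m ↔ ∃ j, d.Up j ∧ d.lab j = .bullet ∧ k = d.star j - d.γ + d.α + d.β := by
  unfold I₂m shift cI₂m Up starSet star
  rw [cast_α, cast_β]
  unfold γ
  simp only [Set.mem_union, Set.mem_image, Set.mem_Ico, lab_bullet h, exists_exists_and_eq_and]
  constructor
  · rintro (⟨i, hi, rfl⟩ | ⟨j, hj, rfl⟩)
    · exact ⟨-i - 1, by omega, by omega, by ring⟩
    · have := toZ_nonneg hj
      exact ⟨j, by omega, Or.inl hj, by ring⟩
  · rintro ⟨j, h1, h2 | h2, rfl⟩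
    · exact Or.inr ⟨j, h2, by ring⟩
    · exact Or.inl ⟨-j - 1, by omega, by ring⟩

theorem mem_I₃p (h : d.Disj) {k : ℤ} :
    k ∈ d.I₃p ↔ ∃ j, d.Up j ∧ d.lab j = .bullet ∧ k = j - d.γ + d.α := by
  unfold I₃p shift cI₃p Up
  rw [cast_α]
  unfold γ
  simp only [Set.mem_union, Set.mem_image, Set.mem_Ico, lab_bullet h]
  constructor
  · rintro (⟨i, hi, rfl⟩ | ⟨j, hj, rfl⟩)
    · exact ⟨i - d.a, by omega, by omega, by ring⟩
    · have := toZ_nonneg hj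
      exact ⟨j, by omega, Or.inl hj, by ring⟩
  · rintro ⟨j, h1, h2 | h2, rfl⟩
    · exact Or.inr ⟨j, h2, by ring⟩
    · exact Or.inl ⟨j + d.a, by omega, by ring⟩

theorem mem_I₃m (h : d.Disj) {k : ℤ} :
    k ∈ d.I₃m ↔ ∃ j, d.Up j ∧ d.lab j = .plus ∧ k = d.star j - d.γ + d.α := by
  unfold I₃m shift cI₃m Up starSet star
  rw [cast_α]
  unfold γ
  simp only [Set.mem_union, Set.mem_image, Set.mem_ofPred_eq, (lab_iff h _).2.2.2.1,
    exists_exists_and_eq_and]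
  constructor
  · rintro (⟨i, hi, rfl⟩ | ⟨j, hj, rfl⟩)
    · exact ⟨-i - d.b - 1, by omega, by omega, by ring⟩
    · have := toZ_nonneg hj
      exact ⟨j, by omega, Or.inl hj, by ring⟩
  · rintro ⟨j, h1, h2 | h2, rfl⟩
    · exact Or.inr ⟨j, h2, by ring⟩
    · exact Or.inl ⟨-j - d.b - 1, by omega, by ring⟩

theorem mem_I₄p (h : d.Disj) {k : ℤ} :
    k ∈ d.I₄p ↔ ∃ j, d.Up j ∧ d.lab j = .bullet ∧ k = j - d.γ + d.β := by
  unfold I₄p shift cI₄p Up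
  rw [cast_β]
  unfold γ
  simp only [Set.mem_union, Set.mem_image, Set.mem_Ico, lab_bullet h]
  constructor
  · rintro (⟨i, hi, rfl⟩ | ⟨j, hj, rfl⟩)
    · exact ⟨i - d.b, by omega, by omega, by ring⟩
    · have := toZ_nonneg hj
      exact ⟨j, by omega, Or.inl hj, by ring⟩
  · rintro ⟨j, h1, h2 | h2, rfl⟩
    · exact Or.inr ⟨j, h2, by ring⟩
    · exact Or.inl ⟨j + d.b, by omega, by ring⟩

theorem mem_I₄m (h : d.Disj) {k : ℤ} :
    k ∈ d.I₄m ↔ ∃ j, d.Up j ∧ d.lab j = .minus ∧ k = d.star j - d.γ + d.β := by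
  unfold I₄m shift cI₄m Up starSet star
  rw [cast_β]
  unfold γ
  simp only [Set.mem_union, Set.mem_image, Set.mem_ofPred_eq, (lab_iff h _).2.2.2.2,
    exists_exists_and_eq_and]
  constructor
  · rintro (⟨i, hi, rfl⟩ | ⟨j, hj, rfl⟩)
    · exact ⟨-i - d.a - 1, by omega, by omega, by ring⟩
    · have := toZ_nonneg hj
      exact ⟨j, by omega, Or.inl hj, by ring⟩
  · rintro ⟨j, h1, h2 | h2, rfl⟩
    · exact Or.inr ⟨j, h2, by ring⟩
    · exact Or.inl ⟨-j - d.a - 1, by omega, by ring⟩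

/-- Upper and lower indices are different unless both are at the vertex. -/
theorem disjoint_of_mem {A B : Set ℤ} {l l' : Label} {c : ℤ}
    (hA : ∀ k, k ∈ A ↔ ∃ j, d.Up j ∧ d.lab j = l ∧ k = j - d.γ + c)
    (hB : ∀ k, k ∈ B ↔ ∃ j, d.Up j ∧ d.lab j = l' ∧ k = d.star j - d.γ + c)
    (hl : ∀ j, 2 * j = -((d.a + d.b : ℕ) + 1 : ℤ) → d.lab j = l → d.lab j ≠ l') : Disjoint A B := by
  rw [Set.disjoint_left]
  intro k h1 h2
  obtain ⟨i, hi, hi', rfl⟩ := (hA k).mp h1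
  obtain ⟨j, hj, hj', e⟩ := (hB _).mp h2
  unfold Up at hi hj
  unfold star at e
  obtain rfl : i = j := by push_cast at *; omega
  exact hl i (by push_cast at *; omega) hi' hj'

theorem disjoint_I₁ (h : d.Disj) : Disjoint d.I₁p d.I₁m :=
  disjoint_of_mem (d := d) (l := .circle) (l' := .triangle) (c := 0)
    (by simpa using fun k => mem_I₁p h) (by simpa using fun k => mem_I₁m h) (by simp_all)

theorem disjoint_I₂ (h : d.Disj) : Disjoint d.I₂p d.I₂m :=
  disjoint_of_mem (d := d) (l := .bullet) (l' := .bullet) (c := d.α + d.β)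
    (fun k => by rw [mem_I₂p h]; simp only [add_assoc])
    (fun k => by rw [mem_I₂m h]; simp only [add_assoc])
    fun j hj hl => by
      exfalso
      rw [lab_bullet h] at hl
      rcases hl with hl | hl
      · have := toZ_nonneg hl; omega
      · push_cast at hj; omega

theorem disjoint_I₃ (h : d.Disj) : Disjoint d.I₃p d.I₃m :=
  disjoint_of_mem (d := d) (l := .bullet) (l' := .plus) (c := d.α) (fun _ => mem_I₃p h)
    (fun _ => mem_I₃m h) (by simp_all)

theorem disjoint_I₄ (h : d.Disj) : Disjoint d.I₄p d.I₄m :=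
  disjoint_of_mem (d := d) (l := .bullet) (l' := .minus) (c := d.β) (fun _ => mem_I₄p h)
    (fun _ => mem_I₄m h) (by simp_all)

/-- The eigenvalues in terms of types and degrees. -/
theorem lamOf_sub_degMu (α β : ℝ) (s : AType) (m : ℝ) :
    lamOf α β s (m - degMu α β s) = lamOf α β .one m := by
  cases s <;> simp only [lamOf, degMu] <;> ring

theorem lamOf_eq_Lam (j : ℤ) : lamOf d.α d.β .one (j - d.γ) +
    ((d.p + d.q₃ + d.q₄ : ℕ) : ℝ) * (d.α + d.β + 1 - (d.p + d.q₃ + d.q₄ : ℕ)) =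
      Lam (d.a + d.b) j := by
  simp only [lamOf, Lam, γ, α, β]; push_cast; ring

theorem lamOf_star (j : ℤ) : lamOf d.α d.β .one ((d.star j : ℝ) - d.γ) =
    lamOf d.α d.β .one ((j : ℝ) - d.γ) := by
  simp only [lamOf, γ, α, β, star]; push_cast; ring

theorem mem_spec_upper {A : Set ℤ} {l : Label} {s : AType} {c : ℤ}
    (hc : (c : ℝ) = -degMu d.α d.β s)
    (hA : ∀ k, k ∈ A ↔ ∃ j, d.Up j ∧ d.lab j = l ∧ k = j - d.γ + c) (lam : ℝ) :
    lam ∈ d.spec s A ↔ ∃ j, d.Up j ∧ d.lab j = l ∧ lam = lamOf d.α d.β .one (j - d.γ) := by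
  have e : ∀ j : ℤ, lamOf d.α d.β s ((j - d.γ + c : ℤ) : ℝ) = lamOf d.α d.β .one (j - d.γ) :=
    fun j => by rw [← lamOf_sub_degMu _ _ s]; congr 1; push_cast; rw [hc]; ring
  unfold spec
  simp only [Set.mem_image, hA]
  constructor
  · rintro ⟨k, ⟨j, h1, h2, rfl⟩, rfl⟩
    exact ⟨j, h1, h2, e j⟩
  · rintro ⟨j, h1, h2, rfl⟩
    exact ⟨_, ⟨j, h1, h2, rfl⟩, e j⟩

theorem mem_spec_lower {A : Set ℤ} {l : Label} {s : AType} {c : ℤ}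
    (hc : (c : ℝ) = -degMu d.α d.β s)
    (hA : ∀ k, k ∈ A ↔ ∃ j, d.Up j ∧ d.lab j = l ∧ k = d.star j - d.γ + c) (lam : ℝ) :
    lam ∈ d.spec s A ↔ ∃ j, d.Up j ∧ d.lab j = l ∧ lam = lamOf d.α d.β .one (j - d.γ) := by
  have e : ∀ j : ℤ, lamOf d.α d.β s ((d.star j - d.γ + c : ℤ) : ℝ) =
      lamOf d.α d.β .one (j - d.γ) :=
    fun j => by
      rw [← lamOf_star, ← lamOf_sub_degMu _ _ s]; congr 1; push_cast; rw [hc]; ring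
  unfold spec
  simp only [Set.mem_image, hA]
  constructor
  · rintro ⟨k, ⟨j, h1, h2, rfl⟩, rfl⟩
    exact ⟨j, h1, h2, e j⟩
  · rintro ⟨j, h1, h2, rfl⟩
    exact ⟨_, ⟨j, h1, h2, rfl⟩, e j⟩

theorem mem_spec_two_p (h : d.Disj) (lam : ℝ) : lam ∈ d.spec .two d.I₂p ↔
    ∃ j, d.Up j ∧ d.lab j = .bullet ∧ lam = lamOf d.α d.β .one (j - d.γ) :=
  mem_spec_upper (c := d.α + d.β) (by simp [degMu]; ring)
    (fun k => by rw [mem_I₂p h]; simp only [add_assoc]) lam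

theorem spec_two (h : d.Disj) : d.spec .two d.I₂m = d.spec .two d.I₂p := by
  ext lam
  rw [mem_spec_two_p h]
  exact mem_spec_lower (c := d.α + d.β) (by simp [degMu]; ring)
    (fun k => by rw [mem_I₂m h]; simp only [add_assoc]) lam

theorem spec_three (h : d.Disj) : d.spec .three d.I₃p = d.spec .two d.I₂p := by
  ext lam
  rw [mem_spec_two_p h]
  exact mem_spec_upper (c := d.α) (by simp [degMu]) (fun _ => mem_I₃p h) lam

theorem spec_four (h : d.Disj) : d.spec .four d.I₄p = d.spec .two d.I₂p := by
  ext lam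
  rw [mem_spec_two_p h]
  exact mem_spec_upper (c := d.β) (by simp [degMu]) (fun _ => mem_I₄p h) lam

theorem mem_labelled (h : d.Disj) (lam : ℝ) (l : Label) : lam ∈ d.labelled l ↔
    ∃ j, d.Up j ∧ d.lab j = l ∧ lam = lamOf d.α d.β .one (j - d.γ) := by
  cases l with
  | circle => exact mem_spec_upper (c := 0) (by simp [degMu]) (by simpa using fun k => mem_I₁p h) lam
  | triangle =>
    exact mem_spec_lower (c := 0) (by simp [degMu]) (by simpa using fun k => mem_I₁m h) lam
  | bullet => exact mem_spec_two_p h lam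
  | plus => exact mem_spec_lower (c := d.α) (by simp [degMu]) (fun _ => mem_I₃m h) lam
  | minus => exact mem_spec_lower (c := d.β) (by simp [degMu]) (fun _ => mem_I₄m h) lam

theorem mem_spec_univ (lam : ℝ) : lam ∈ d.spec .one Set.univ ↔
    ∃ j, d.Up j ∧ lam = lamOf d.α d.β .one (j - d.γ) := by
  unfold spec
  simp only [Set.mem_image, Set.mem_univ, true_and]
  constructor
  · rintro ⟨k, rfl⟩
    by_cases hj : d.Up (k + d.γ)
    · exact ⟨k + d.γ, hj, by congr 1; push_cast; ring⟩
    · refine ⟨d.star (k + d.γ), ?_, ?_⟩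
      · unfold Up star at *; omega
      · rw [lamOf_star]; congr 1; push_cast; ring
  · rintro ⟨j, -, rfl⟩
    exact ⟨j - d.γ, by push_cast; rfl⟩

theorem Up.inj {i j : ℤ} (hi : d.Up i) (hj : d.Up j)
    (h : lamOf d.α d.β .one (i - d.γ) = lamOf d.α d.β .one (j - d.γ)) : i = j := by
  have h1 := lamOf_eq_Lam (d := d) i
  rw [h, lamOf_eq_Lam] at h1
  exact (Lam_inj hj hi h1).symm

theorem existsUnique_label (h : d.Disj) {lam : ℝ} (hl : lam ∈ d.spec .one Set.univ) :
    ∃! l : Label, (lam, l) ∈ d.LambdaD := by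
  obtain ⟨j, hj, rfl⟩ := (mem_spec_univ lam).mp hl
  refine ⟨d.lab j, (mem_labelled h _ _).mpr ⟨j, hj, rfl, rfl⟩, fun l hl => ?_⟩
  obtain ⟨i, hi, rfl, e⟩ := (mem_labelled h _ _).mp hl
  rw [Up.inj hi hj e.symm]

end Data

end
end ExcJacobi

namespace ExcJacobi
noncomputable section

open Place

/-! ### The operators of the chain -/

theorem NearPoly.exists_poly {y : RF} (h : Data.NearPoly y) (h1 : Reg 1 y) (h2 : Reg (-1) y) :
    ∃ Q : ℝ[X], y = ofPoly Q := by
  obtain ⟨P, m, n, h⟩ := h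
  have hd := ofPoly_ne_zero (RatFunc.denom_ne_zero y)
  have e : y.num * ((X - 1) ^ m * (X + 1) ^ n) = P * y.denom := by
    apply IsFractionRing.injective ℝ[X] (RatFunc ℝ)
    change ofPoly _ = ofPoly _
    rw [ofPoly_mul, ofPoly_mul, ofPoly_mul P, ← h, ofPoly_pow, ofPoly_pow, ofPoly_sub, ofPoly_add,
      ofPoly_X, ofPoly_one]
    have := num_div_denom' y
    rw [div_eq_iff hd] at this
    rw [this]; ring
  have hc : ∀ c : ℝ, Reg c y → IsCoprime y.denom (X - C c) := fun c hr => by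
    refine ((irreducible_X_sub_C c).coprime_iff_not_dvd.mpr fun h => ?_).symm
    exact reg_iff.mp hr (dvd_iff_isRoot.mp h)
  have c1 := hc 1 h1
  have c2 := hc (-1) h2
  rw [C_1] at c1
  rw [C_neg, C_1, sub_neg_eq_add] at c2
  have h3 : y.denom ∣ (X - 1) ^ m * (X + 1) ^ n :=
    (RatFunc.isCoprime_num_denom y).symm.dvd_of_dvd_mul_left (e ▸ dvd_mul_left _ _)
  have h4 : IsUnit y.denom :=
    (IsCoprime.mul_right (c1.pow_right (n := m)) (c2.pow_right (n := n))).isUnit_of_dvd' dvd_rfl h3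
  have h5 := (RatFunc.monic_denom y).eq_one_of_isUnit h4
  refine ⟨y.num, ?_⟩
  have := num_div_denom' y
  rw [h5, ofPoly_one, div_one] at this
  exact this.symm

namespace Data

variable {d : Data} {t : d.L₁ → ℝ} {f : ℕ → RF} {ρ : ℕ → ℕ → RF} {vm : ℕ → ℝ}

theorem Chain.lim_tau (C : d.Chain t f ρ vm) {c : ℝ} (hc : c = 1 ∨ c = -1) :
    ∃ v, v ≠ 0 ∧ (finPlace c).Lim (d.tau t) v := by
  obtain ⟨m, v, hv, h⟩ := (finPlace c).exists_asym C.tau_ne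
  obtain rfl := (reg_logDeriv_iff h hv).mp (C.state.reg_u c hc)
  exact ⟨v, hv, asym_zero_iff.mp h⟩

theorem Chain.deg_tau (C : d.Chain t f ρ vm) : Deg (d.tau t) d.degTau := by
  obtain ⟨m, v, hv, h⟩ := infPlace.exists_asym C.tau_ne
  have h1 := (h.logDeriv hv).unique C.state.asym_u
  rw [Int.cast_inj] at h1
  exact ⟨v, hv, h1 ▸ h⟩

theorem Chain.exists_tau (C : d.Chain t f ρ vm) : ∃ P : ℝ[X], ofPoly P = d.tau t ∧
    (P.natDegree : ℤ) = d.degTau ∧ P.eval 1 ≠ 0 ∧ P.eval (-1) ≠ 0 := by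
  obtain ⟨v, hv, h1⟩ := C.lim_tau (Or.inl rfl)
  obtain ⟨w, hw, h2⟩ := C.lim_tau (Or.inr rfl)
  obtain ⟨P, hP⟩ := NearPoly.exists_poly C.near ⟨v, h1⟩ ⟨w, h2⟩
  obtain ⟨z, hz, h3⟩ := C.deg_tau
  rw [hP] at h1 h2 h3
  refine ⟨P, hP.symm, ?_, ?_, ?_⟩
  · rw [← intDegree_eq h3 hz]; exact RatFunc.intDegree_polynomial.symm
  · rwa [(finPlace 1).lim_unique (lim_ofPoly 1 P) h1]
  · rwa [(finPlace (-1)).lim_unique (lim_ofPoly (-1) P) h2]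

theorem Chain.ric_eq (C : d.Chain t f ρ vm) (j : ℤ) :
    Ric (Trg (d.tau t) d.α d.β) (lamOf d.α d.β .one (j - d.γ)) =
      Ric (opN (D (d.tau t) / d.tau t) d.α d.β (d.p + d.q₃ + d.q₄)) (Lam (d.a + d.b) j) := by
  ext w
  rw [mem_Ric_Trg C.tau_ne d.α d.β (d.p + d.q₃ + d.q₄), lamOf_eq_Lam]

theorem Chain.exists_up (C : d.Chain t f ρ vm) {lam : ℝ}
    (h : (Ric (Trg (d.tau t) d.α d.β) lam).Nonempty) :
    ∃ j, d.Up j ∧ lam = lamOf d.α d.β .one (j - d.γ) := by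
  obtain ⟨w, hw⟩ := h
  rw [mem_Ric_Trg C.tau_ne d.α d.β (d.p + d.q₃ + d.q₄)] at hw
  obtain ⟨j, hj, e⟩ := C.state.exists_upper ⟨w, hw⟩
  refine ⟨j, hj, ?_⟩
  rw [← lamOf_eq_Lam] at e
  linarith

theorem Chain.occ (C : d.Chain t f ρ vm) {j : ℤ} (hj : d.Up j) (s : AType) (μ : ℝ) :
    (∃ w ∈ Ric (Trg (d.tau t) d.α d.β) (lamOf d.α d.β .one (j - d.γ)), HasType w s ∧ HasDeg w μ) ↔
      ∃ k : ℤ, μ = k ∧ Occ (j - d.γ) (d.star j - d.γ) (d.lab j) s k := by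
  rw [C.ric_eq, C.state.occ hj]
  have e1 : ((d.p + d.q₃ + d.q₄ : ℕ) : ℤ) = d.γ := by unfold γ; push_cast; ring
  have e2 : -j - ((d.a + d.b : ℕ) : ℤ) - 1 = d.star j := by unfold star; push_cast; ring
  rw [e1, e2]

theorem occ_one {m m' k : ℤ} {l : Label} :
    Occ m m' l .one k ↔ l = .circle ∧ k = m ∨ l = .triangle ∧ k = m' := by
  cases l <;> simp [Occ]

theorem occ_two {m m' k : ℤ} {l : Label} :
    Occ m m' l .two k ↔ l = .bullet ∧ k = m ∨ l = .bullet ∧ k = m' := by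
  cases l <;> simp [Occ]

theorem occ_three {m m' k : ℤ} {l : Label} :
    Occ m m' l .three k ↔ l = .bullet ∧ k = m ∨ l = .plus ∧ k = m' := by
  cases l <;> simp [Occ]

theorem occ_four {m m' k : ℤ} {l : Label} :
    Occ m m' l .four k ↔ l = .bullet ∧ k = m ∨ l = .minus ∧ k = m' := by
  cases l <;> simp [Occ]

theorem exists_occ (m m' : ℤ) (l : Label) : ∃ s k, Occ m m' l s k := by
  cases l
  exacts [⟨.one, m, rfl⟩, ⟨.one, m', rfl⟩, ⟨.three, m, rfl⟩, ⟨.three, m', rfl⟩, ⟨.four, m', rfl⟩]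

theorem mem_I (h : d.Disj) (s : AType) (k : ℝ) : k ∈ (fun k : ℤ => (k : ℝ)) '' d.I s ↔
    ∃ j, d.Up j ∧ ∃ m, Occ (j - d.γ) (d.star j - d.γ) (d.lab j) s m ∧
      k = m - degMu d.α d.β s := by
  have key : ∀ {A B : Set ℤ} {l l' : Label} {c : ℤ} (_ : -(c : ℝ) = degMu d.α d.β s)
      (_ : ∀ k, k ∈ A ↔ ∃ j, d.Up j ∧ d.lab j = l ∧ k = j - d.γ + c)
      (_ : ∀ k, k ∈ B ↔ ∃ j, d.Up j ∧ d.lab j = l' ∧ k = d.star j - d.γ + c)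
      (_ : ∀ (m m' k : ℤ) (L : Label), Occ m m' L s k ↔ L = l ∧ k = m ∨ L = l' ∧ k = m'),
      k ∈ (fun k : ℤ => (k : ℝ)) '' (A ∪ B) ↔ ∃ j, d.Up j ∧
        ∃ m, Occ (j - d.γ) (d.star j - d.γ) (d.lab j) s m ∧ k = m - degMu d.α d.β s := by
    intro A B l l' c hc hA hB hO
    simp only [Set.mem_image, Set.mem_union, hA, hB, hO, ← hc]
    constructor
    · rintro ⟨_, ⟨j, h1, h2, rfl⟩ | ⟨j, h1, h2, rfl⟩, rfl⟩
      · exact ⟨j, h1, _, Or.inl ⟨h2, rfl⟩, by push_cast; ring⟩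
      · exact ⟨j, h1, _, Or.inr ⟨h2, rfl⟩, by push_cast; ring⟩
    · rintro ⟨j, h1, m, ⟨h2, rfl⟩ | ⟨h2, rfl⟩, rfl⟩
      · exact ⟨_, Or.inl ⟨j, h1, h2, rfl⟩, by push_cast; ring⟩
      · exact ⟨_, Or.inr ⟨j, h1, h2, rfl⟩, by push_cast; ring⟩
  cases s with
  | one =>
    exact key (c := 0) (by simp [degMu]) (by simpa using fun k => mem_I₁p h)
      (by simpa using fun k => mem_I₁m h) fun _ _ _ _ => occ_one
  | two =>
    exact key (c := d.α + d.β) (by simp [degMu]; ring)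
      (fun k => by rw [mem_I₂p h]; simp only [add_assoc])
      (fun k => by rw [mem_I₂m h]; simp only [add_assoc]) fun _ _ _ _ => occ_two
  | three =>
    exact key (c := d.α) (by simp [degMu]) (fun _ => mem_I₃p h) (fun _ => mem_I₃m h)
      fun _ _ _ _ => occ_three
  | four =>
    exact key (c := d.β) (by simp [degMu]) (fun _ => mem_I₄p h) (fun _ => mem_I₄m h)
      fun _ _ _ _ => occ_four

theorem Chain.indexSet_eq (C : d.Chain t f ρ vm) (h : d.Disj) (s : AType) :
    indexSet (Trg (d.tau t) d.α d.β) d.α d.β s = (fun k : ℤ => (k : ℝ)) '' d.I s := by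
  ext k
  rw [mem_I h]
  constructor
  · rintro ⟨lam, w, m, hw, ht, hm, rfl⟩
    obtain ⟨j, hj, rfl⟩ := C.exists_up ⟨w, hw⟩
    obtain ⟨k, rfl, hk⟩ := (C.occ hj s m).mp ⟨w, hw, ht, hm⟩
    exact ⟨j, hj, k, hk, rfl⟩
  · rintro ⟨j, hj, k, hk, rfl⟩
    obtain ⟨w, hw, ht, hm⟩ := (C.occ hj s k).mpr ⟨k, rfl, hk⟩
    exact ⟨_, w, k, hw, ht, hm, rfl⟩

theorem Chain.qrSpectrum_eq (C : d.Chain t f ρ vm) :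
    qrSpectrum (Trg (d.tau t) d.α d.β) = d.spec .one Set.univ := by
  ext lam
  rw [mem_spec_univ]
  refine ⟨C.exists_up, ?_⟩
  rintro ⟨j, hj, rfl⟩
  obtain ⟨s, k, hk⟩ := exists_occ (j - d.γ) (d.star j - d.γ) (d.lab j)
  obtain ⟨w, hw, -⟩ := (C.occ hj s k).mpr ⟨k, rfl, hk⟩
  exact ⟨w, hw⟩

theorem Chain.occ_of_mem (C : d.Chain t f ρ vm) {j : ℤ} (hj : d.Up j) {w : RF}
    (hw : w ∈ Ric (Trg (d.tau t) d.α d.β) (lamOf d.α d.β .one (j - d.γ))) {s : AType}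
    (hs : HasType w s) : ∃ k : ℤ, Occ (j - d.γ) (d.star j - d.γ) (d.lab j) s k := by
  have hw' := hw
  rw [C.ric_eq] at hw'
  obtain ⟨m, hm⟩ := C.state.hasDeg hj hw'
  obtain ⟨k, -, hk⟩ := (C.occ hj s m).mp ⟨w, hw, hs, hm⟩
  exact ⟨k, hk⟩

theorem α_add_β : (d.α : ℝ) + d.β = d.a + d.b + 2 * (d.γ : ℝ) := by
  simp only [α, β, γ]; push_cast; ring

theorem Chain.hasLabel_iff (C : d.Chain t f ρ vm) (h : d.Disj) {j : ℤ} (hj : d.Up j) (l : Label) :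
    HasLabel (Trg (d.tau t) d.α d.β) d.α d.β (lamOf d.α d.β .one (j - d.γ)) l ↔ d.lab j = l := by
  set R := Ric (Trg (d.tau t) d.α d.β) (lamOf d.α d.β .one (j - d.γ)) with hR
  have hinf : d.lab j = .bullet → R.Infinite := fun hl => by
    rw [hR, C.ric_eq]; exact (C.state.bullet hj hl).1
  have huniq : d.lab j ≠ .bullet → ∃ w, R = {w} := fun hl => by
    rw [hR, C.ric_eq]; exact C.state.exists_unique hj hl
  have hnb : ∀ w, R = {w} → d.lab j ≠ .bullet := fun w hw hl => by
    have := hinf hl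
    rw [hw] at this
    exact this (Set.finite_singleton w)
  have hup : -((d.a : ℝ) + d.b + 1) ≤ 2 * j := by
    unfold Up at hj; exact_mod_cast hj
  have hlow : d.lab j = .triangle → 0 ≤ (j : ℝ) := fun hl => by
    exact_mod_cast toZ_nonneg ((lab_iff h j).2.1.mp hl)
  have hαβ := α_add_β (d := d)
  have hst : (d.star j : ℝ) = -j - d.a - d.b - 1 := by unfold star; push_cast; ring
  have ha := d.a.cast_nonneg (α := ℝ)
  have hb := d.b.cast_nonneg (α := ℝ)
  have get : ∀ w, R = {w} → ∀ s k, Occ (j - d.γ) (d.star j - d.γ) (d.lab j) s k →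
      HasType w s ∧ HasDeg w k := fun w hw s k hk => by
    obtain ⟨w', hw', h1⟩ := (C.occ hj s k).mpr ⟨k, rfl, hk⟩
    rw [← hR, hw] at hw'
    obtain rfl := hw'
    exact h1
  constructor
  · intro hl
    cases l with
    | circle =>
      obtain ⟨w, m, hw, ht, hm, hle⟩ := hl
      obtain ⟨k, rfl, hk⟩ := (C.occ hj .one m).mp ⟨w, hw ▸ rfl, ht, hm⟩
      rcases occ_one.mp hk with ⟨hl, -⟩ | ⟨hl, rfl⟩
      · exact hl
      · have := hlow hl
        push_cast at hle
        rw [hst] at hle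
        linarith
    | triangle =>
      obtain ⟨w, m, hw, ht, hm, hle⟩ := hl
      obtain ⟨k, rfl, hk⟩ := (C.occ hj .one m).mp ⟨w, hw ▸ rfl, ht, hm⟩
      rcases occ_one.mp hk with ⟨hl, rfl⟩ | ⟨hl, -⟩
      · push_cast at hle
        linarith
      · exact hl
    | bullet =>
      by_contra hne
      obtain ⟨w, hw⟩ := huniq hne
      have := hl.1
      rw [← hR, hw] at this
      exact this (Set.finite_singleton w)
    | plus =>
      obtain ⟨w, hw, ht⟩ := hl
      obtain ⟨k, hk⟩ := C.occ_of_mem hj (hw ▸ rfl) ht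
      rcases occ_three.mp hk with ⟨hl, -⟩ | ⟨hl, -⟩
      exacts [absurd hl (hnb w hw), hl]
    | minus =>
      obtain ⟨w, hw, ht⟩ := hl
      obtain ⟨k, hk⟩ := C.occ_of_mem hj (hw ▸ rfl) ht
      rcases occ_four.mp hk with ⟨hl, -⟩ | ⟨hl, -⟩
      exacts [absurd hl (hnb w hw), hl]
  · rintro rfl
    by_cases hl : d.lab j = .bullet
    · rw [hl]
      refine ⟨hinf hl, fun s => ⟨?_, fun hs => ?_⟩⟩
      · rintro ⟨w, hw, ht⟩
        obtain ⟨k, hk⟩ := C.occ_of_mem hj hw ht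
        rintro rfl
        rw [hl] at hk
        exact hk
      · have : ∃ k, Occ (j - d.γ) (d.star j - d.γ) (d.lab j) s k := by
          rw [hl]
          cases s
          exacts [absurd rfl hs, ⟨_, Or.inl rfl⟩, ⟨_, rfl⟩, ⟨_, rfl⟩]
        obtain ⟨k, hk⟩ := this
        obtain ⟨w, hw, ht, -⟩ := (C.occ hj s k).mpr ⟨k, rfl, hk⟩
        exact ⟨w, hw, ht⟩
    · obtain ⟨w, hw⟩ := huniq hl
      have hg := get w hw
      have hlow := hlow
      generalize d.lab j = L at hl hg hlow
      cases L with
      | bullet => exact absurd rfl hl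
      | circle =>
        obtain ⟨h1, h2⟩ := hg .one _ rfl
        exact ⟨w, _, hw, h1, h2, by push_cast; linarith⟩
      | triangle =>
        obtain ⟨h1, h2⟩ := hg .one _ rfl
        have := hlow rfl
        exact ⟨w, _, hw, h1, h2, by push_cast; rw [hst]; linarith⟩
      | plus => exact ⟨w, hw, (hg .three _ rfl).1⟩
      | minus => exact ⟨w, hw, (hg .four _ rfl).1⟩

theorem HasLabel.nonempty {T : Diff2} {α β lam : ℝ} {l : Label} (h : HasLabel T α β lam l) :
    (Ric T lam).Nonempty := by
  cases l with
  | circle => obtain ⟨w, m, hw, -⟩ := h; rw [hw]; exact Set.singleton_nonempty w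
  | triangle => obtain ⟨w, m, hw, -⟩ := h; rw [hw]; exact Set.singleton_nonempty w
  | bullet => exact h.1.nonempty
  | plus => obtain ⟨w, hw, -⟩ := h; rw [hw]; exact Set.singleton_nonempty w
  | minus => obtain ⟨w, hw, -⟩ := h; rw [hw]; exact Set.singleton_nonempty w

theorem Chain.extDiagram_eq (C : d.Chain t f ρ vm) (h : d.Disj) :
    extDiagram (Trg (d.tau t) d.α d.β) d.α d.β = d.LambdaD := by
  ext ⟨lam, l⟩
  change HasLabel _ _ _ lam l ↔ lam ∈ d.labelled l
  rw [mem_labelled h]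
  constructor
  · intro hl
    obtain ⟨j, hj, rfl⟩ := C.exists_up (HasLabel.nonempty hl)
    exact ⟨j, hj, (C.hasLabel_iff h hj l).mp hl, rfl⟩
  · rintro ⟨j, hj, hl, rfl⟩
    exact (C.hasLabel_iff h hj l).mpr hl

end Data

end
end ExcJacobi

namespace ExcJacobi
noncomputable section

open Place

namespace Data

variable {d : Data} {t : d.L₁ → ℝ} {f : ℕ → RF} {ρ : ℕ → ℕ → RF} {vm : ℕ → ℝ}

/-! ### Eigenfunctions -/

theorem u_star (n : ℕ) : d.u (d.star n) = n := by
  unfold u star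
  rw [max_eq_right (by omega)]
  omega

theorem exists_of_mem_I (h : d.Disj) {i : ℤ} (hi : i ∈ d.I .one) :
    (d.lab (d.nIdx i) = .circle ∧ i = d.nIdx i - d.γ) ∨
      (d.lab (d.nIdx i) = .triangle ∧ i = d.star (d.nIdx i) - d.γ) := by
  rcases hi with hi | hi
  · obtain ⟨j, -, hl, rfl⟩ := (mem_I₁p h).mp hi
    have hj := ((lab_iff h j).1.mp hl).1
    lift j to ℕ using hj
    left
    have : d.nIdx (j - d.γ) = j := by unfold nIdx; rw [sub_add_cancel, u_nat]
    rw [this]; exact ⟨hl, rfl⟩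
  · obtain ⟨j, -, hl, rfl⟩ := (mem_I₁m h).mp hi
    have hj := toZ_nonneg ((lab_iff h j).2.1.mp hl)
    lift j to ℕ using hj
    right
    have : d.nIdx (d.star j - d.γ) = j := by unfold nIdx; rw [sub_add_cancel, u_star]
    rw [this]; exact ⟨hl, rfl⟩

theorem fam_of_mem_I (h : d.Disj) {i : ℤ} (hi : i ∈ d.I .one) : Fam d.lab (d.nIdx i) := by
  rcases exists_of_mem_I h hi with h | h
  exacts [Or.inl h.1, Or.inr h.1]

theorem nIdx_inj (h : d.Disj) {i j : ℤ} (hi : i ∈ d.I .one) (hj : j ∈ d.I .one)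
    (e : d.nIdx i = d.nIdx j) : i = j := by
  have h1 := exists_of_mem_I h hi
  have h2 := exists_of_mem_I h hj
  rw [e] at h1
  rcases h1 with ⟨a, b⟩ | ⟨a, b⟩ <;> rcases h2 with ⟨a', b'⟩ | ⟨a', b'⟩
  · exact b.trans b'.symm
  · rw [a] at a'; cases a'
  · rw [a] at a'; cases a'
  · exact b.trans b'.symm

theorem mem_toZ_nat {A : Finset ℕ} {n : ℕ} : (n : ℤ) ∈ toZ A ↔ n ∈ A := by
  simp [mem_toZ]

theorem notMem_of_fam (h : d.Disj) {n : ℕ} (hn : Fam d.lab n) : n ∉ d.K ∧ n ∉ d.L₃ ∧ n ∉ d.L₄ := by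
  rcases hn with hl | hl
  · have := (lab_iff h n).1.mp hl
    simp only [mem_toZ_nat] at this
    tauto
  · have hl := mem_toZ_nat.mp ((lab_iff h n).2.1.mp hl)
    refine ⟨fun h' => Finset.disjoint_left.mp h.hK h' (by simp [hl]),
      Finset.disjoint_left.mp h.h13 hl, Finset.disjoint_left.mp h.h14 hl⟩

variable (d) in
/-- The normalization factor of the eigenfunctions. -/
def scale (n : ℕ) : ℝ := d.chi n * d.chiHat n

theorem scale_ne (h : d.Disj) {n : ℕ} (hn : Fam d.lab n) : d.scale n ≠ 0 := by
  obtain ⟨h1, h2, h3⟩ := notMem_of_fam h hn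
  exact mul_ne_zero (chi_ne h1) (chiHat_ne (by simp [h2, h3]))

theorem up_nat (n : ℕ) : d.Up n := by unfold Up; omega

theorem Chain.sol (C : d.Chain t f ρ vm) {n : ℕ} (hn : Fam d.lab n) :
    Sol (Trg (d.tau t) d.α d.β) (lamOf d.α d.β .one ((n : ℤ) - d.γ)) (f n) := by
  rw [sol_Trg C.tau_ne d.α d.β (d.p + d.q₃ + d.q₄), lamOf_eq_Lam]
  exact C.state.sol n hn

theorem Chain.deg (C : d.Chain t f ρ vm) (h : d.Disj) {i : ℤ} (hi : i ∈ d.I .one) :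
    Deg (f (d.nIdx i)) i := by
  have hn := fam_of_mem_I h hi
  have hf := C.state.f_ne hn
  obtain ⟨m, hm⟩ := exists_deg hf
  have hs := C.state.sol _ hn
  have ht := (C.state.hasType_iff hs hf .one).mpr
    ⟨(C.state.lim_one _ hn).imp fun _ h => h.2, ⟨_, (C.state.lim_neg _ hn).2⟩⟩
  have hw := mem_Ric_of_sol hf hs
  rw [← C.ric_eq] at hw
  obtain ⟨k, hk, ho⟩ := (C.occ (up_nat _) .one m).mp
    ⟨_, hw, ht, (hasDeg_iff_of_deg hm _).mpr rfl⟩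
  rw [Int.cast_inj] at hk
  subst hk
  rcases exists_of_mem_I h hi with ⟨hl, hi⟩ | ⟨hl, hi⟩ <;> rw [hl] at ho
  · obtain rfl : m = _ := ho
    rw [← hi] at hm; exact hm
  · obtain rfl : m = _ := ho
    rw [← hi] at hm; exact hm

theorem lamOf_of_mem (h : d.Disj) {i : ℤ} (hi : i ∈ d.I .one) :
    lamOf d.α d.β .one i = lamOf d.α d.β .one ((d.nIdx i : ℤ) - d.γ) := by
  rcases exists_of_mem_I h hi with ⟨-, hi⟩ | ⟨-, hi⟩
  · conv_lhs => rw [hi]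
    rw [Int.cast_sub]
  · conv_lhs => rw [hi]
    rw [Int.cast_sub, lamOf_star]

theorem Chain.lim_pi (C : d.Chain t f ρ vm) (h : d.Disj) {i : ℤ} (hi : i ∈ d.I .one) :
    (finPlace (-1)).Lim (d.pi t i) (d.scale (d.nIdx i) * vm (d.nIdx i)) := by
  rw [C.pi_eq]
  exact (finPlace (-1)).lim_mul ((finPlace (-1)).lim_const _)
    (C.state.lim_neg _ (fam_of_mem_I h hi)).2

theorem Chain.eigen (C : d.Chain t f ρ vm) (h : d.Disj) {i : ℤ} (hi : i ∈ d.I .one) :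
    IsQuasiPoly (Trg (d.tau t) d.α d.β) (lamOf d.α d.β .one i) (d.pi t i) ∧
      (d.pi t i).intDegree = i := by
  have hn := fam_of_mem_I h hi
  have hs := scale_ne h hn
  refine ⟨⟨?_, ?_, ?_⟩, ?_⟩
  · rw [lamOf_of_mem h hi, C.pi_eq]
    exact (C.sol hn).const_mul _
  · obtain ⟨v, hv, hl⟩ := C.state.lim_one _ hn
    rw [C.pi_eq]
    exact unitAt_iff.mpr ⟨_, mul_ne_zero hs hv, (finPlace 1).lim_mul ((finPlace 1).lim_const _) hl⟩
  · exact unitAt_iff.mpr ⟨_, mul_ne_zero hs (C.state.lim_neg _ hn).1, C.lim_pi h hi⟩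
  · obtain ⟨v, hv, hl⟩ := C.deg h hi
    rw [C.pi_eq]
    exact intDegree_eq (hl.const_mul _) (mul_ne_zero hs hv)

theorem Chain.of_isQuasiPoly (C : d.Chain t f ρ vm) (h : d.Disj) {lam : ℝ} {y : RF}
    (hy : IsQuasiPoly (Trg (d.tau t) d.α d.β) lam y) :
    y.intDegree ∈ d.I .one ∧ lam = lamOf d.α d.β .one y.intDegree := by
  obtain ⟨hs, h1, h2⟩ := hy
  obtain ⟨v, hv, h1⟩ := unitAt_iff.mp h1
  obtain ⟨w, hw, h2⟩ := unitAt_iff.mp h2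
  have h1 := asym_zero_iff.mpr h1
  have h2 := asym_zero_iff.mpr h2
  have y0 := h1.ne_zero hv
  have hr := mem_Ric_of_sol y0 hs
  have ht : HasType (D y / y) .one :=
    ⟨reg_iff.mp ((reg_logDeriv_iff h1 hv).mpr rfl), reg_iff.mp ((reg_logDeriv_iff h2 hw).mpr rfl)⟩
  have hd := hasDeg_logDeriv (asym_inf_self y0)
    (leadingCoeff_ne_zero.mpr (RatFunc.num_ne_zero y0))
  obtain ⟨j, hj, rfl⟩ := C.exists_up ⟨_, hr⟩
  obtain ⟨k, hk, ho⟩ := (C.occ hj .one _).mp ⟨_, hr, ht, hd⟩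
  rw [Int.cast_inj] at hk
  rw [← hk] at ho
  have hmem := (mem_I h .one (y.intDegree : ℝ)).mpr ⟨j, hj, _, ho, by simp [degMu]⟩
  obtain ⟨i, hi, e⟩ := hmem
  rw [Int.cast_inj.mp e] at hi
  refine ⟨hi, ?_⟩
  rcases occ_one.mp ho with ⟨-, e⟩ | ⟨-, e⟩ <;> rw [e, Int.cast_sub]
  rw [lamOf_star]

theorem Chain.qpIndexSet_eq (C : d.Chain t f ρ vm) (h : d.Disj) :
    qpIndexSet (Trg (d.tau t) d.α d.β) = d.I .one := by
  ext i
  constructor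
  · rintro ⟨lam, y, hy, rfl⟩
    exact (C.of_isQuasiPoly h hy).1
  · intro hi
    exact ⟨_, _, C.eigen h hi⟩

theorem Chain.qpSpectrum_eq (C : d.Chain t f ρ vm) (h : d.Disj) :
    qpSpectrum (Trg (d.tau t) d.α d.β) = d.spec .one (d.I .one) := by
  ext lam
  constructor
  · rintro ⟨y, hy⟩
    obtain ⟨h1, h2⟩ := C.of_isQuasiPoly h hy
    exact ⟨_, h1, h2.symm⟩
  · rintro ⟨i, hi, rfl⟩
    exact ⟨_, (C.eigen h hi).1⟩

theorem Chain.exists_eigenpolynomial (C : d.Chain t f ρ vm) (h : d.Disj) {i : ℤ}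
    (hi : i ∈ d.I .one) : ∃ P : ℝ[X], P ≠ 0 ∧ (P.natDegree : ℤ) = d.degTau + i ∧
      (Tng (d.tau t) d.α d.β).apply (ofPoly P) = const (lamOf d.α d.β .one i) * ofPoly P := by
  have hn := fam_of_mem_I h hi
  obtain ⟨v, hv, h1⟩ := C.state.lim_one _ hn
  obtain ⟨v', hv', h1'⟩ := C.lim_tau (Or.inl rfl)
  obtain ⟨w', hw', h2'⟩ := C.lim_tau (Or.inr rfl)
  obtain ⟨P, hP⟩ := NearPoly.exists_poly (C.near_mul (d.nIdx i))
    ⟨_, (finPlace 1).lim_mul h1' h1⟩ ⟨_, (finPlace (-1)).lim_mul h2' (C.state.lim_neg _ hn).2⟩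
  obtain ⟨z, hz, h3⟩ := C.deg_tau
  obtain ⟨z', hz', h3'⟩ := C.deg h hi
  have h4 := h3.mul h3'
  rw [hP] at h4
  refine ⟨P, ?_, ?_, ?_⟩
  · rintro rfl
    exact h4.ne_zero (mul_ne_zero hz hz') ofPoly_zero
  · rw [← intDegree_eq h4 (mul_ne_zero hz hz')]
    exact RatFunc.intDegree_polynomial.symm
  · have hs := C.sol hn
    unfold Sol Trg at hs
    rw [Diff2.gauge_apply _ _ _ C.tau_ne, hP, ← lamOf_of_mem h hi,
      inv_mul_eq_iff_eq_mul₀ C.tau_ne] at hs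
    rw [hs, ← hP]; ring

theorem Chain.exceptional (C : d.Chain t f ρ vm) (h : d.Disj) :
    IsExceptionalJacobi (Tng (d.tau t) d.α d.β) := by
  refine ⟨rfl, Set.Finite.subset
    (Set.finite_lt_nat (d.degTau - d.γ + (d.K ∪ d.L).sup id + 1).toNat) fun n hn => ?_⟩
  by_contra hlt
  refine hn ?_
  have hlt : d.degTau - d.γ + (d.K ∪ d.L).sup id + 1 ≤ n := by
    have : ¬ n < _ := hlt
    omega
  have hi : (n : ℤ) - d.degTau ∈ d.I .one := by
    refine Or.inl ⟨n - d.degTau + d.γ, ⟨by omega, fun hm => ?_⟩, by ring⟩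
    obtain ⟨l, hl, e⟩ := mem_toZ.mp hm
    have : l ≤ (d.K ∪ d.L).sup id := Finset.le_sup (f := id) hl
    omega
  obtain ⟨P, h1, h2, h3⟩ := C.exists_eigenpolynomial h hi
  exact ⟨P, _, h1, by omega, h3⟩

/-! ### Norms -/

theorem star_sub (n l : ℕ) : (n : ℝ) - (d.star l : ℝ) = n + l + (d.a + d.b : ℕ) + 1 := by
  unfold star; push_cast; ring

theorem kappa₀_eq {n : ℕ} (hn : n ∉ d.K) : d.scale n ^ 2 *
    ∏ m, (Lam (d.a + d.b) n - Lam (d.a + d.b) (d.seedIdx m)) = d.kappa₀ n := by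
  rw [prod_seedIdx fun k => Lam (d.a + d.b) n - Lam (d.a + d.b) k]
  unfold scale kappa₀ chi chiHat
  rw [mul_pow, ← Finset.prod_pow, ← Finset.prod_pow, mul_right_comm, ← Finset.prod_mul_distrib]
  congr 1
  refine Finset.prod_congr rfl fun k hk => ?_
  have : (n : ℝ) - k ≠ 0 := sub_ne_zero.mpr fun e => hn (Nat.cast_injective e ▸ hk)
  rw [Lam_sub, star_sub]
  simp only [Int.cast_natCast]
  field_simp

theorem prod_kappa (t : d.L₁ → ℝ) (n : ℕ) : (∏ l : d.L₁, (1 - if n = (l : ℕ) then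
    d.nu l / (t l + d.nu l) else 0)) =
      if n ∈ d.L₁ then 1 - d.nu n / (d.tExt t n + d.nu n) else 1 := by
  split_ifs with hn
  · rw [Finset.prod_eq_single (⟨n, hn⟩ : d.L₁), if_pos rfl, tExt_of_mem t hn]
    · intro l _ hl
      rw [if_neg fun e => hl (Subtype.ext e.symm), sub_zero]
    · exact fun hh => absurd (Finset.mem_univ _) hh
  · refine Finset.prod_eq_one fun l _ => ?_
    rw [if_neg fun e : n = (l : ℕ) => hn (e ▸ l.2), sub_zero]

theorem norm_eq (h : d.Disj) (ht : d.Valid t) {i : ℤ} (hi : i ∈ d.I .one) :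
    d.norm t i = d.scale (d.nIdx i) ^ 2 * d.nuFactor t (d.nIdx i) := by
  obtain ⟨hK, -⟩ := notMem_of_fam h (fam_of_mem_I h hi)
  unfold norm kappa nuFactor
  rw [prod_kappa, ← mul_assoc, kappa₀_eq hK, mul_comm _ (d.kappa₀ _), mul_assoc]
  congr 1
  split_ifs with hn
  · have := (ht ⟨_, hn⟩).2
    rw [tExt_of_mem t hn]
    have h1 : t ⟨d.nIdx i, hn⟩ + nuCl (d.nIdx i) d.a d.b ≠ 0 := fun e =>
      this (eq_neg_of_add_eq_zero_left e)
    unfold nu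
    field_simp
    ring
  · rw [one_mul]; rfl

theorem norm_of_notMem (t : d.L₁ → ℝ) {i : ℤ} (hi : d.nIdx i ∉ d.L₁) : d.norm t i = d.norm₀ i := by
  unfold norm kappa norm₀
  rw [prod_kappa, if_neg hi, one_mul]

theorem norm_star (ht : d.Valid t) (l : d.L₁) : d.norm t (d.star l - d.γ) =
    d.kappa₀ l * (t l * d.nu l / (t l + d.nu l)) := by
  have h1 : t l + d.nu l ≠ 0 := fun e => (ht l).2 (eq_neg_of_add_eq_zero_left e)
  have hn : d.nIdx (d.star l - d.γ) = l := by unfold nIdx; rw [sub_add_cancel, u_star]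
  unfold norm kappa
  rw [hn, prod_kappa, if_pos l.2, tExt_of_mem t l.2]
  field_simp
  ring

theorem norm₀_star (l : d.L₁) : d.norm₀ (d.star l - d.γ) = d.kappa₀ l * d.nu l := by
  have hn : d.nIdx (d.star l - d.γ) = l := by unfold nIdx; rw [sub_add_cancel, u_star]
  unfold norm₀
  rw [hn]

theorem Chain.isNormFamily (C : d.Chain t f ρ vm) (h : d.Disj) (ht : d.Valid t) :
    IsNormFamily d.α d.β (d.I .one) (d.pi t) (d.norm t) := by
  intro i hi j hj
  set κ : ℝ := if i = j then d.norm t i / nuCl 0 d.α d.β else 0 with hκ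
  have fi := fam_of_mem_I h hi
  have fj := fam_of_mem_I h hj
  have ν0 : nuCl 0 d.α d.β ≠ 0 := by
    have := nuCl_pos 0 d.α d.β
    rw [Nat.cast_zero] at this
    exact this.ne'
  set B := primitive ((1 - X) ^ d.α * (1 + X) ^ d.β) with hB
  set H := const (d.scale (d.nIdx i) * d.scale (d.nIdx j)) * ρ (d.nIdx i) (d.nIdx j) -
    const κ * ofPoly B with hH
  have hD : D H = (d.pi t i * d.pi t j - const κ) * weight d.α d.β := by
    rw [hH, D_sub, D_const_mul, D_const_mul, C.state.D_rho _ _ fi fj, D_ofPoly, hB,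
      derivative_primitive, ← weight_eq, C.pi_eq, C.pi_eq, const_mul]
    unfold scale
    ring
  have l2 : (finPlace (-1)).Lim H 0 := by
    have h1 := asym_zero_iff.mpr (C.state.rho_neg _ _ fi fj)
    have h2 := asym_zero_iff.mpr (lim_ofPoly (-1) B)
    rw [hB, primitive_eval, ← hB] at h2
    have := (h1.const_mul (d.scale (d.nIdx i) * d.scale (d.nIdx j))).sub (h2.const_mul κ)
    rw [mul_zero, mul_zero, sub_zero] at this
    exact asym_zero_iff.mp this
  have l1 : (finPlace 1).Lim H 0 := by
    have h1 := asym_zero_iff.mpr (C.state.rho_one _ _ fi fj)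
    have h2 := asym_zero_iff.mpr (lim_ofPoly 1 B)
    rw [hB, ← nuCl_zero, ← hB] at h2
    have := (h1.const_mul (d.scale (d.nIdx i) * d.scale (d.nIdx j))).sub (h2.const_mul κ)
    refine asym_zero_iff.mp (this.congr rfl ?_)
    by_cases hij : i = j
    · subst hij
      rw [if_pos rfl, hκ, if_pos rfl, div_mul_cancel₀ _ ν0, norm_eq h ht hi]
      ring
    · rw [if_neg fun e => hij (nIdx_inj h hi hj e), hκ, if_neg hij]
      ring
  have reg : ∀ c, c = 1 ∨ c = -1 → (finPlace c).Lim H 0 →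
      RegularAt (H / weight (d.α + 1) (d.β + 1)) c := by
    intro c hc hl
    have hu : ∀ k ∈ d.I .one, Reg c (d.pi t k) := fun k hk => by
      rw [reg_iff]
      rcases hc with rfl | rfl
      exacts [(C.eigen h hk).1.2.1.2, (C.eigen h hk).1.2.2.2]
    obtain ⟨v, hv⟩ := ((hu i hi).mul (hu j hj)).sub (reg_const c κ)
    obtain ⟨w, -, hw⟩ := asym_weight hc d.α d.β
    have h1 := (asym_zero_iff.mpr hv).mul hw
    rw [← hD, zero_add] at h1
    have h2 := asym_primitive h1 (by positivity) fun _ => hl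
    obtain ⟨z, hz, h3⟩ := asym_pW hc d.α d.β
    rw [p_mul_weight] at h3
    have h4 := h2.div h3.neg (neg_ne_zero.mpr hz)
    rw [neg_neg] at h4
    exact reg_iff.mp (reg_of_asym h4 (by omega))
  refine ⟨H / weight (d.α + 1) (d.β + 1), reg 1 (Or.inl rfl) l1, reg (-1) (Or.inr rfl) l2, ?_⟩
  rw [mul_div_cancel₀ _ (weight_ne _ _), hD]

theorem kappa₀_ne (h : d.Disj) {n : ℕ} (hn : Fam d.lab n) : d.kappa₀ n ≠ 0 := by
  obtain ⟨hK, h3, h4⟩ := notMem_of_fam h hn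
  have hpos : ∀ l : ℕ, (n : ℝ) - (d.star l : ℝ) ≠ 0 := fun l => by
    rw [star_sub]; positivity
  refine mul_ne_zero (Finset.prod_ne_zero_iff.mpr fun k hk => div_ne_zero (hpos k) ?_)
    (Finset.prod_ne_zero_iff.mpr fun l hl => pow_ne_zero _ (div_ne_zero (hpos l) ?_))
  · exact sub_ne_zero.mpr fun e => hK (Nat.cast_injective e ▸ hk)
  · refine sub_ne_zero.mpr fun e => ?_
    obtain rfl := Nat.cast_injective (R := ℝ) e
    simp [h3, h4] at hl

theorem star_mem (l : d.L₁) : d.star l - d.γ ∈ d.I₁m :=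
  ⟨d.star l, ⟨l, mem_toZ_nat.mpr l.2, rfl⟩, by ring⟩

theorem exists_of_mem_I₁m {i : ℤ} (hi : i ∈ d.I₁m) : ∃ l : d.L₁, i = d.star l - d.γ := by
  obtain ⟨_, ⟨_, hj, rfl⟩, rfl⟩ := hi
  obtain ⟨l, hl, rfl⟩ := mem_toZ.mp hj
  exact ⟨⟨l, hl⟩, by ring⟩

theorem bijOn_norm (h : d.Disj) :
    Set.BijOn (fun (s : d.Param) (i : d.I₁m) => d.norm s.1 i) Set.univ
      {y | ∀ i : d.I₁m, y i ≠ 0 ∧ y i ≠ d.norm₀ i} := by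
  have hκ : ∀ l : d.L₁, d.kappa₀ l ≠ 0 := fun l =>
    kappa₀_ne h (Or.inr ((lab_iff h _).2.1.mpr (mem_toZ_nat.mpr l.2)))
  have hν : ∀ l : d.L₁, d.nu l ≠ 0 := fun l => (nuCl_pos _ _ _).ne'
  have hs : ∀ (s : d.Param) (l : d.L₁), s.1 l + d.nu l ≠ 0 := fun s l e =>
    (s.2 l).2 (eq_neg_of_add_eq_zero_left e)
  refine ⟨fun s _ i => ?_, fun s _ s' _ e => ?_, fun y hy => ?_⟩
  · obtain ⟨i, hi⟩ := i
    obtain ⟨l, rfl⟩ := exists_of_mem_I₁m hi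
    change d.norm s.1 _ ≠ 0 ∧ d.norm s.1 _ ≠ d.norm₀ _
    rw [norm_star s.2, norm₀_star]
    refine ⟨mul_ne_zero (hκ l) (div_ne_zero (mul_ne_zero (s.2 l).1 (hν l)) (hs s l)), fun e => ?_⟩
    have := mul_left_cancel₀ (hκ l) e
    rw [div_eq_iff (hs s l)] at this
    exact mul_ne_zero (hν l) (hν l) (by linear_combination -this)
  · refine Subtype.ext (funext fun l => ?_)
    have := congrFun e ⟨_, star_mem l⟩
    change d.norm s.1 _ = d.norm s'.1 _ at this
    rw [norm_star s.2, norm_star s'.2] at this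
    have := mul_left_cancel₀ (hκ l) this
    rw [div_eq_div_iff (hs s l) (hs s' l)] at this
    have h2 := mul_ne_zero (hν l) (hν l)
    refine mul_left_cancel₀ h2 ?_
    linear_combination this
  · set z : d.L₁ → ℝ := fun l => y ⟨_, star_mem l⟩ / d.kappa₀ l with hz
    have z0 : ∀ l, z l ≠ 0 := fun l => div_ne_zero (hy ⟨_, star_mem l⟩).1 (hκ l)
    have z1 : ∀ l : d.L₁, d.nu l - z l ≠ 0 := fun l e => by
      refine (hy ⟨_, star_mem l⟩).2 ?_
      rw [norm₀_star, sub_eq_zero.mp e]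
      exact (mul_div_cancel₀ _ (hκ l)).symm
    have hv : d.Valid fun l => z l * d.nu l / (d.nu l - z l) := fun l => by
      refine ⟨div_ne_zero (mul_ne_zero (z0 l) (hν l)) (z1 l), fun e => ?_⟩
      rw [div_eq_iff (z1 l)] at e
      exact mul_ne_zero (hν l) (hν l) (by linear_combination e)
    refine ⟨⟨_, hv⟩, trivial, funext fun ⟨i, hi⟩ => ?_⟩
    obtain ⟨l, rfl⟩ := exists_of_mem_I₁m hi
    change d.norm _ _ = _
    rw [norm_star hv]
    have h1 := z1 l
    have h2 := hν l
    have h3 : z l * d.nu l / (d.nu l - z l) + d.nu l = d.nu l * d.nu l / (d.nu l - z l) := by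
      field_simp; ring
    rw [h3]
    have h4 : z l * d.nu l / (d.nu l - z l) * d.nu l / (d.nu l * d.nu l / (d.nu l - z l)) = z l := by
      field_simp
    rw [h4]
    exact mul_div_cancel₀ _ (hκ l)

/-! ### The monic limit -/

theorem leadCoeff_eq {n : ℕ} (hK : n ∉ d.K) (h3 : n ∉ d.L₃) (h4 : n ∉ d.L₄) (h1 : d.L₁ = ∅)
    (h34 : Disjoint d.L₃ d.L₄) : d.scale n * d.leadCoeff n = 1 := by
  have key : ∀ A : Finset ℕ, n ∉ A → (∏ l ∈ A, ((n : ℝ) - (d.star l : ℝ)) / ((n : ℝ) - l)) *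
      lcFactor (d.a + d.b) A n = 1 := fun A hA => by
    unfold lcFactor
    rw [← Finset.prod_mul_distrib]
    refine Finset.prod_eq_one fun l hl => ?_
    have e1 : (n : ℝ) - l ≠ 0 := sub_ne_zero.mpr fun e => hA (Nat.cast_injective e ▸ hl)
    have e2 : (n : ℝ) + l + (d.a + d.b : ℕ) + 1 ≠ 0 := by positivity
    rw [star_sub]
    field_simp
  have key' : d.chi n * ∏ m, ((n : ℝ) - d.seedIdx m) = 1 := by
    rw [prod_seedIdx fun k => (n : ℝ) - k]
    unfold chi
    rw [← Finset.prod_mul_distrib]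
    refine Finset.prod_eq_one fun l hl => ?_
    have e1 : (n : ℝ) - l ≠ 0 := sub_ne_zero.mpr fun e => hK (Nat.cast_injective e ▸ hl)
    field_simp
  have k3 := key _ h3
  have k4 := key _ h4
  unfold scale leadCoeff chiHat
  rw [Finset.prod_union h34, h1]
  have e : lcFactor (d.a + d.b) ∅ n = 1 := Finset.prod_empty
  rw [e, one_mul]
  rw [mul_mul_mul_comm, key', one_mul, mul_mul_mul_comm, k3, k4, one_mul]

theorem exists_limit (h : d.Disj) {f₀ : ℕ → RF} {ρ₀ : ℕ → ℕ → RF} {u₀ : RF} {vm₀ : ℕ → ℝ}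
    (hE : EdgeChain d.a d.b d.L₃ d.L₄ f₀ ρ₀ u₀ vm₀) {i : ℤ} (hi : i ∈ d.I .one) :
    ∃ g : RF, IsMonic g ∧ g.intDegree = (d.nIdx i : ℤ) - d.γ ∧
      ∃ E : Finset ℝ, ∀ c : ℝ, c ∉ E →
        Tendsto (fun t : d.L₁ → ℝ => evalAt c (d.pi t i))
          (Filter.pi fun _ => Bornology.cobounded ℝ) (𝓝 (evalAt c g)) := by
  obtain ⟨ρ', C⟩ := exists_chain (d := d.undeformed) h.undeformed hE (undeformed_valid fun _ => 0)
  obtain ⟨hK, h3, h4⟩ := notMem_of_fam h (fam_of_mem_I h hi)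
  have hl : d.undeformed.lab (d.nIdx i) = .circle := by
    refine (lab_iff h.undeformed _).1.mpr ⟨by positivity, ?_, ?_, ?_, ?_⟩ <;> rw [mem_toZ_nat]
    exacts [hK, Finset.notMem_empty _, h3, h4]
  obtain ⟨-, ha⟩ := C.state.asym_f _ hl
  have ha' := ha.const_mul (d.undeformed.scale (d.nIdx i))
  rw [leadCoeff_eq (d := d.undeformed) hK h3 h4 rfl h.h34] at ha'
  have hp : infPlace.Asym (d.undeformed.pi (fun _ => 0) i) (d.nIdx i -
      (d.undeformed.p + d.undeformed.q₃ + d.undeformed.q₄ : ℕ)) 1 := by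
    rw [C.pi_eq]; exact ha'
  refine ⟨_, isMonic_of_asym hp, ?_, (conv_pi h hE i).tendsto⟩
  rw [intDegree_eq hp one_ne_zero]
  unfold γ
  push_cast
  rfl

end Data

end
end ExcJacobi

open ExcJacobi in
theorem mainTheorem12 (d : ExcJacobi.Data)
    (hK : Disjoint d.K (d.L₁ ∪ d.L₃ ∪ d.L₄))
    (h13 : Disjoint d.L₁ d.L₃) (h14 : Disjoint d.L₁ d.L₄) (h34 : Disjoint d.L₃ d.L₄) :
    -- polynomials of the stated degree that do not vanish at `±1`
    (∀ t : d.Param, ∃ P : Polynomial ℝ, ofPoly P = d.tau t.1 ∧ (P.natDegree : ℤ) = d.degTau ∧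
      P.eval 1 ≠ 0 ∧ P.eval (-1) ≠ 0) ∧
    -- isospectral deformation, eigenfunctions, norms
    IsIsospectralDeformation (fun t : d.Param => d.tau t.1) d.α d.β (d.I .one) d.I₁m
      (fun t i => d.pi t.1 i) (fun t i => d.norm t.1 i) d.norm₀ ∧
    -- index sets
    (∀ (t : d.Param) (s : AType),
      indexSet (Trg (d.tau t.1) d.α d.β) d.α d.β s = (fun k : ℤ => (k : ℝ)) '' d.I s) ∧
    Disjoint d.I₁p d.I₁m ∧ Disjoint d.I₂p d.I₂m ∧ Disjoint d.I₃p d.I₃m ∧ Disjoint d.I₄p d.I₄m ∧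
    -- extended spectral diagram
    d.spec .two d.I₂m = d.spec .two d.I₂p ∧ d.spec .three d.I₃p = d.spec .two d.I₂p ∧
    d.spec .four d.I₄p = d.spec .two d.I₂p ∧
    (∀ t : d.Param, extDiagram (Trg (d.tau t.1) d.α d.β) d.α d.β = d.LambdaD) ∧
    (∀ t : d.Param, qrSpectrum (Trg (d.tau t.1) d.α d.β) = d.spec .one Set.univ) ∧
    (∀ lam ∈ d.spec .one Set.univ, ∃! l : Label, (lam, l) ∈ d.LambdaD) ∧
    -- asymptotically monic normalization
    (∀ i ∈ d.I .one, ∃ f : ExcJacobi.RF, IsMonic f ∧ f.intDegree = (d.nIdx i : ℤ) - d.γ ∧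
      ∃ E : Finset ℝ, ∀ c : ℝ, c ∉ E →
        Filter.Tendsto (fun t : d.L₁ → ℝ => evalAt c (d.pi t i))
          (Filter.pi fun _ => Bornology.cobounded ℝ) (nhds (evalAt c f))) := by
  have h : d.Disj := ⟨hK, h13, h14, h34⟩
  obtain ⟨f₀, ρ₀, u₀, vm₀, hE⟩ := exists_edgeChain d.a d.b h34
  have hC := fun t : d.Param => Data.exists_chain h hE t.2
  choose ρ C using hC
  refine ⟨fun t => (C t).exists_tau, ?_, fun t s => (C t).indexSet_eq h s, Data.disjoint_I₁ h,
    Data.disjoint_I₂ h, Data.disjoint_I₃ h, Data.disjoint_I₄ h, Data.spec_two h,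
    Data.spec_three h, Data.spec_four h, fun t => (C t).extDiagram_eq h,
    fun t => (C t).qrSpectrum_eq, fun lam hl => Data.existsUnique_label h hl,
    fun i hi => Data.exists_limit h hE hi⟩
  exact {
    exceptional := fun t => (C t).exceptional h
    isospectral := fun t t' => by rw [(C t).qpSpectrum_eq h, (C t').qpSpectrum_eq h]
    index := fun t => (C t).qpIndexSet_eq h
    eigen := fun t i hi => (C t).eigen h hi
    normalization := fun i hi t t' => by
      rw [(lim_fin_iff.mp ((C t).lim_pi h hi)).2, (lim_fin_iff.mp ((C t').lim_pi h hi)).2]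
    norm := fun t => (C t).isNormFamily h t.2
    support_subset := Set.subset_union_right
    support_finite := by
      have : (Data.toZ d.L₁).Finite := d.L₁.finite_toSet.image _
      exact (this.image _).image _
    constant := fun i hi t t' => by
      have hn : d.nIdx i ∉ d.L₁ := fun hn => by
        rcases Data.exists_of_mem_I h hi.1 with ⟨hl, -⟩ | ⟨-, e⟩
        · exact ((Data.lab_iff h _).1.mp hl).2.2.1 (Data.mem_toZ_nat.mpr hn)
        · exact hi.2 (e ▸ Data.star_mem ⟨_, hn⟩)
      rw [Data.norm_of_notMem _ hn, Data.norm_of_notMem _ hn]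
    bijective := Data.bijOn_norm h }
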